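/- **Conventions.** A *$\mathbb Z$-graded supermanifold* (of finite or countable dimension) is a regular Hausdorff, second countable topological space $|M|$ equipped with a sheaf $\mathcal F_M=(\mathcal F_M^k)_{k\in\mathbb Z}$ of $\mathbb Z$-graded, graded-commutative $\mathbb R$-algebras, locally isomorphic to the following model. One is given a finite or countable family of graded coordinates, with degrees in $\mathbb Z$ subject to no bound; the underlying space is an open subset of $\mathbb R^{I_0}$ (with the product topology), where $I_0$ indexes the coordinates of degree $0$; the functions of degree $k$ are the formal power series of total degree $k$ in the coordinates of nonzero degree (those of even degree commute, those of odd degree anticommute), with coefficients that are smooth functions of the coordinates of degree $0$, such that locally the whole series involves only finitely many coordinates. Morphisms are continuous maps of the underlying spaces together with pull-backs of functions that are compatible with restrictions and are homomorphisms of graded algebras; products are those of the category of graded supermanifolds. A *$Q$-manifold* is a $\mathbb Z$-graded supermanifold with a homological vector field, i.e. a degree $1$ derivation $Q$ of $\mathcal F_M$ with $Q^2=0$; a *$Q$-map* is a morphism whose pull-back commutes with the homological vector fields. On a product of $Q$-manifolds one takes the homological vector field for which both projections are $Q$-maps. Let $X$ be a smooth manifold (Hausdorff and second countable), and let $(T[1]X,\mathrm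 d_X)$ be the $Q$-manifold whose functions are the differential forms on $X$, graded by form degree, with $Q$ the de Rham differential. A *gauge pre-PDE* over $T[1]X$ is a $Q$-manifold $(E,Q)$ with a $Q$-map $\pi\colon E\to T[1]X$ that is locally trivial as a bundle of $\mathbb Z$-graded supermanifolds (but not necessarily as a bundle of $Q$-manifolds): $X$ is covered by open sets $U$ such that $\pi^{-1}(U)$ is, over $T[1]U$, a product $T[1]U\times F_U$ with some graded supermanifold $F_U$. A *contractible $Q$-manifold* is a $Q$-manifold isomorphic to $(T[1]V,\mathrm d_V)$ for a $\mathbb Z$-graded vector space $V$ of finite or countable dimension (with no bound on its grading), that is, one with global coordinates $(w^\alpha,v^\alpha)$, $\deg v^\alpha=\deg w^\alpha+1$, such that $Qw^\alpha=v^\alpha$. A gauge pre-PDE $(E,Q)$ is an *equivalent reduction* of a gauge pre-PDE $(E',Q')$ over the same $T[1]X$ if there is a $Q$-map $p\colon E'\to E$ over $T[1]X$ (i.e. $\pi\circ p=\pi'$) such that * for some contractible $Q$-manifold $T[1]V$, every point of $E$ has an open neighbourhood $U$ over which $E'$ is the product $U\times T[1]V$ as a $Q$-manifold, with $p$ as the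 projection to $U$; * $p$ has a global $Q$-section, i.e. there is a $Q$-map $i\colon E\to E'$ with $p\circ i=\mathrm{id}_E$. Two gauge pre-PDEs over $T[1]X$ are *equivalent* if they are related by the equivalence relation generated by the relation "is an equivalent reduction of". **Proposition.** Let $(E_1,Q_1)$ and $(E_2,Q_2)$ be gauge pre-PDEs over $T[1]X$. Then they are equivalent if and only if there exists a gauge pre-PDE $(E,Q)$ over $T[1]X$ such that both $(E_1,Q_1)$ and $(E_2,Q_2)$ are equivalent reductions of $(E,Q)$. -/

import Mathlib

open TopologicalSpace CategoryTheory
open scoped Manifold ContDiff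

/-- A topological space with a sheaf of `ℤ`-graded commutative real algebras (Koszul sign rule).
`sec U k` is the space of sections of degree `k` over `U`; the degree of a product is passed
through an equation `i + j = k`. The sheaf axioms are imposed in each degree. -/
structure GradedSpace where
  carrier : Type
  [top : TopologicalSpace carrier]
  sec : Opens carrier → ℤ → Type
  [addCommGroup : ∀ U k, AddCommGroup (sec U k)]
  [module : ∀ U k, Module ℝ (sec U k)]
  one : ∀ U, sec U 0
  mul : ∀ {U : Opens carrier} {i j k : ℤ}, i + j = k → sec U i →ₗ[ℝ] sec U j →ₗ[ℝ] sec U k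
  one_mul : ∀ {U : Opens carrier} {k : ℤ} (a : sec U k), mul (zero_add k) (one U) a = a
  mul_assoc : ∀ {U : Opens carrier} {i j k ij jk l : ℤ} (hij : i + j = ij) (hjk : j + k = jk)
    (h₁ : ij + k = l) (h₂ : i + jk = l) (a : sec U i) (b : sec U j) (c : sec U k),
    mul h₁ (mul hij a b) c = mul h₂ a (mul hjk b c)
  mul_comm : ∀ {U : Opens carrier} {i j k : ℤ} (h : i + j = k) (h' : j + i = k)
    (a : sec U i) (b : sec U j), mul h a b = (i * j).negOnePow • mul h' b a
  res : ∀ {U V : Opens carrier}, V ≤ U → ∀ {k : ℤ}, sec U k →ₗ[ℝ] sec V k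
  res_self : ∀ {U : Opens carrier} {k : ℤ} (h : U ≤ U) (a : sec U k), res h a = a
  res_res : ∀ {U V W : Opens carrier} {k : ℤ} (h : V ≤ U) (h' : W ≤ V) (a : sec U k),
    res h' (res h a) = res (h'.trans h) a
  res_one : ∀ {U V : Opens carrier} (h : V ≤ U), res h (one U) = one V
  res_mul : ∀ {U V : Opens carrier} (h : V ≤ U) {i j k : ℤ} (hk : i + j = k)
    (a : sec U i) (b : sec U j), res h (mul hk a b) = mul hk (res h a) (res h b)
  locality : ∀ {U : Opens carrier} {I : Type} (V : I → Opens carrier) (hV : ∀ i, V i ≤ U),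
    U ≤ iSup V → ∀ {k : ℤ} (a b : sec U k), (∀ i, res (hV i) a = res (hV i) b) → a = b
  gluing : ∀ {U : Opens carrier} {I : Type} (V : I → Opens carrier) (hV : ∀ i, V i ≤ U),
    U ≤ iSup V → ∀ {k : ℤ} (s : ∀ i, sec (V i) k),
    (∀ i j, res (inf_le_left : V i ⊓ V j ≤ V i) (s i) =
      res (inf_le_right : V i ⊓ V j ≤ V j) (s j)) →
    ∃ a : sec U k, ∀ i, res (hV i) a = s i

namespace GradedSpace

attribute [instance] GradedSpace.top GradedSpace.addCommGroup GradedSpace.module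

instance : CoeSort GradedSpace Type := ⟨GradedSpace.carrier⟩

/-- A degree preserving morphism: a continuous map of the underlying spaces together with the
pull-back of sections. The pull-back is recorded as a map from sections over `U` to sections over
every open `V` that is mapped into `U`. -/
structure Hom (M N : GradedSpace) where
  base : C(M, N)
  pull : ∀ {U : Opens N} {V : Opens M}, V ≤ Opens.comap base U →
    ∀ {k : ℤ}, N.sec U k →ₗ[ℝ] M.sec V k
  pull_one : ∀ {U : Opens N} {V : Opens M} (h : V ≤ Opens.comap base U),
    pull h (N.one U) = M.one V
  pull_mul : ∀ {U : Opens N} {V : Opens M} (h : V ≤ Opens.comap base U) {i j k : ℤ}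
    (hk : i + j = k) (a : N.sec U i) (b : N.sec U j),
    pull h (N.mul hk a b) = M.mul hk (pull h a) (pull h b)
  res_pull : ∀ {U : Opens N} {V V' : Opens M} (h : V ≤ Opens.comap base U) (h' : V' ≤ V) {k : ℤ}
    (a : N.sec U k), M.res h' (pull h a) = pull (h'.trans h) a
  pull_res : ∀ {U U' : Opens N} {V : Opens M} (h : V ≤ Opens.comap base U) (h' : U ≤ U') {k : ℤ}
    (a : N.sec U' k),
    pull h (N.res h' a) = pull (h.trans fun _ hx => h' hx : V ≤ Opens.comap base U') a

theorem Hom.ext_pull {M N : GradedSpace} {f g : Hom M N} (hb : f.base = g.base)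
    (hp : ∀ (U : Opens N) (V : Opens M) (hf : V ≤ Opens.comap f.base U)
      (hg : V ≤ Opens.comap g.base U) (k : ℤ) (a : N.sec U k), f.pull hf a = g.pull hg a) :
    f = g := by
  obtain ⟨fb, fp, _, _, _, _⟩ := f
  obtain ⟨gb, gp, _, _, _, _⟩ := g
  obtain rfl : fb = gb := hb
  have : @fp = @gp := by
    funext U V h k
    exact LinearMap.ext fun a => hp U V h h k a
  subst this
  rfl

instance : Category GradedSpace where
  Hom := Hom
  id M :=
    { base := ContinuousMap.id M
      pull := fun h => M.res h
      pull_one := fun h => M.res_one h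
      pull_mul := fun h _ _ _ hk a b => M.res_mul h hk a b
      res_pull := fun h h' _ a => M.res_res h h' a
      pull_res := fun h h' _ a => M.res_res h' h a }
  comp {M N P} f g :=
    { base := g.base.comp f.base
      pull := fun {U _} h _ =>
        (f.pull (U := Opens.comap g.base U) h).comp (g.pull (le_refl (Opens.comap g.base U)))
      pull_one := fun {U V} h => by
        exact (congrArg _ (g.pull_one _)).trans (f.pull_one (U := Opens.comap g.base U) h)
      pull_mul := fun {U V} h i j k hk a b => by
        exact (congrArg _ (g.pull_mul _ hk a b)).trans
          (f.pull_mul (U := Opens.comap g.base U) h hk _ _)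
      res_pull := fun {U V V'} h h' k a => by
        exact f.res_pull (U := Opens.comap g.base U) h h' _
      pull_res := fun {U U' V} h h' k a => by
        have hle : Opens.comap g.base U ≤ Opens.comap g.base U' := fun _ hx => h' hx
        exact (congrArg _ ((g.pull_res _ h' a).trans (g.res_pull (le_refl _) hle a).symm)).trans
          (f.pull_res (U := Opens.comap g.base U) h hle _) }
  id_comp {M N} f := Hom.ext_pull rfl fun U V hf hg k a => by
    exact f.res_pull (le_refl (Opens.comap f.base U)) hg a
  comp_id {M N} f := Hom.ext_pull rfl fun U V hf hg k a => by
    exact f.pull_res (U := U) hg (le_refl U) a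
  assoc f g h := Hom.ext_pull rfl fun U V hf hg k a => rfl

/-- An open subset of an open subspace, seen in the ambient space. -/
def openImage {Y : Type} [TopologicalSpace Y] (U : Opens Y) (W : Opens U) : Opens Y :=
  ⟨Subtype.val '' (W : Set U), U.isOpen.isOpenMap_subtype_val _ W.isOpen⟩

theorem openImage_mono {Y : Type} [TopologicalSpace Y] (U : Opens Y) {W W' : Opens U}
    (h : W ≤ W') : openImage U W ≤ openImage U W' :=
  Set.image_mono h

/-- The open subspace of a graded space. -/
def restrict (M : GradedSpace) (U : Opens M) : GradedSpace where
  carrier := U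
  sec W k := M.sec (openImage U W) k
  one W := M.one (openImage U W)
  mul h := M.mul h
  one_mul a := M.one_mul a
  mul_assoc := M.mul_assoc
  mul_comm := M.mul_comm
  res h := M.res (openImage_mono U h)
  res_self _ a := M.res_self _ a
  res_res _ _ a := M.res_res _ _ a
  res_one _ := M.res_one _
  res_mul _ _ _ _ hk a b := M.res_mul _ hk a b
  locality {W I} V hV hW k a b hab := by
    refine M.locality (fun i => openImage U (V i)) (fun i => openImage_mono U (hV i)) ?_ a b hab
    rintro _ ⟨x, hx, rfl⟩
    obtain ⟨i, hi⟩ := Opens.mem_iSup.1 (hW hx)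
    exact Opens.mem_iSup.2 ⟨i, x, hi, rfl⟩
  gluing {W I} V hV hW k s hs := by
    refine M.gluing (fun i => openImage U (V i)) (fun i => openImage_mono U (hV i)) ?_ s ?_
    · rintro _ ⟨x, hx, rfl⟩
      obtain ⟨i, hi⟩ := Opens.mem_iSup.1 (hW hx)
      exact Opens.mem_iSup.2 ⟨i, x, hi, rfl⟩
    · intro i j
      have hle : openImage U (V i) ⊓ openImage U (V j) ≤ openImage U (V i ⊓ V j) := by
        rintro _ ⟨⟨x, hx, rfl⟩, ⟨y, hy, hxy⟩⟩
        obtain rfl : y = x := Subtype.ext hxy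
        exact ⟨y, ⟨hx, hy⟩, rfl⟩
      have := congrArg (M.res hle) (hs i j)
      simpa only [M.res_res] using this

/-- The restriction of a morphism `f : M ⟶ N` over an open subset of `N`. -/
def restrictHom {M N : GradedSpace} (f : M ⟶ N) (U : Opens N) :
    M.restrict (Opens.comap f.base U) ⟶ N.restrict U :=
  have aux : ∀ {W : Opens U} {V : Opens (Opens.comap f.base U)},
      V ≤ Opens.comap (⟨U.1.restrictPreimage f.base,
        f.base.continuous.restrictPreimage⟩ : C(Opens.comap f.base U, U)) W →
      openImage (Opens.comap f.base U) V ≤ Opens.comap f.base (openImage U W) := by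
    rintro W V h _ ⟨x, hx, rfl⟩
    exact ⟨_, h hx, rfl⟩
  { base := ⟨U.1.restrictPreimage f.base, f.base.continuous.restrictPreimage⟩
    pull := fun h => f.pull (aux h)
    pull_one := fun h => f.pull_one (aux h)
    pull_mul := fun h _ _ _ hk a b => f.pull_mul (aux h) hk a b
    res_pull := fun h h' _ a => f.res_pull (aux h) (openImage_mono _ h') a
    pull_res := fun h h' _ a => f.pull_res (aux h) (openImage_mono _ h') a }

end GradedSpace

/-- A countable family of graded coordinates. The linear order is only used to write monomials in
the odd coordinates in a standard form. -/
structure GradedCoords where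
  ι : Type
  [linearOrder : LinearOrder ι]
  [countable : Countable ι]
  deg : ι → ℤ

namespace GradedCoords

attribute [instance] GradedCoords.linearOrder GradedCoords.countable

variable (C : GradedCoords)

/-- The space in which the degree zero coordinates take their values. -/
abbrev Body : Type := {i : C.ι // C.deg i = 0} → ℝ

/-- The exponents of monomials in the coordinates of nonzero degree. -/
def Admissible (α : C.ι →₀ ℕ) : Prop :=
  ∀ i, (C.deg i = 0 → α i = 0) ∧ (Odd (C.deg i) → α i ≤ 1)

/-- The degree of a monomial. -/
noncomputable def totalDeg (α : C.ι →₀ ℕ) : ℤ := α.sum fun i a => (a : ℤ) * C.deg i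

/-- The number of transpositions of odd coordinates needed to order `ξ^α ξ^β`. -/
noncomputable def crossings (α β : C.ι →₀ ℕ) : ℕ :=
  α.sum fun i a => β.sum fun j b =>
    if j < i ∧ Odd (C.deg i) ∧ Odd (C.deg j) then a * b else 0

open Classical in
/-- The product of the formal series `∑ f_α ξ^α` and `∑ g_β ξ^β`. -/
noncomputable def mulSeries {Y : Type} (f g : (C.ι →₀ ℕ) → Y → ℝ) : (C.ι →₀ ℕ) → Y → ℝ :=
  fun γ y => if C.Admissible γ then
    ∑ p ∈ Finset.HasAntidiagonal.antidiagonal γ, (-1 : ℝ) ^ C.crossings p.1 p.2 * (f p.1 y * g p.2 y) else 0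

/-- `∑ f_α ξ^α` is a function of degree `k` over the open set `U`: only monomials of degree `k`
occur, and locally there are finitely many coordinates such that only monomials in these occur and
such that all coefficients are smooth functions of these. -/
def IsFunction (U : Opens C.Body) (k : ℤ) (f : (C.ι →₀ ℕ) → U → ℝ) : Prop :=
  (∀ α, f α ≠ 0 → C.Admissible α ∧ C.totalDeg α = k) ∧
  ∀ x : U, ∃ (J : Finset {i : C.ι // C.deg i = 0}) (K : Finset C.ι), ∃ V ∈ nhds x,
    (∀ α : C.ι →₀ ℕ, ¬ α.support ⊆ K → ∀ y ∈ V, f α y = 0) ∧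
    ∀ α : C.ι →₀ ℕ, ∃ g : (J → ℝ) → ℝ, ContDiff ℝ ∞ g ∧
      ∀ y ∈ V, f α y = g fun j => y.1 j

variable {C}

theorem totalDeg_add (α β : C.ι →₀ ℕ) :
    C.totalDeg (α + β) = C.totalDeg α + C.totalDeg β := by
  unfold totalDeg
  rw [Finsupp.sum_add_index'] <;> intros <;> simp [add_mul]

theorem crossings_add_left (α α' β : C.ι →₀ ℕ) :
    C.crossings (α + α') β = C.crossings α β + C.crossings α' β := by
  unfold crossings
  rw [Finsupp.sum_add_index']
  · intro i; simp [Finsupp.sum]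
  · intro i a b
    rw [← Finsupp.sum_add]
    refine Finsupp.sum_congr fun j _ => ?_
    split_ifs <;> simp [add_mul]

theorem crossings_add_right (α β β' : C.ι →₀ ℕ) :
    C.crossings α (β + β') = C.crossings α β + C.crossings α β' := by
  unfold crossings
  rw [← Finsupp.sum_add]
  refine Finsupp.sum_congr fun i _ => ?_
  rw [Finsupp.sum_add_index']
  · intro j; simp
  · intro j a b
    split_ifs <;> simp [mul_add]

theorem Admissible.left {α β : C.ι →₀ ℕ} (h : C.Admissible (α + β)) : C.Admissible α := fun i =>
  ⟨fun hi => by have := (h i).1 hi; simp at this; exact this.1,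
   fun hi => by have := (h i).2 hi; simp at this; omega⟩

theorem Admissible.right {α β : C.ι →₀ ℕ} (h : C.Admissible (α + β)) : C.Admissible β :=
  Admissible.left (add_comm α β ▸ h)

/-- Reordering two monomials. -/
theorem neg_one_pow_crossings_swap {α β : C.ι →₀ ℕ} (h : C.Admissible (α + β)) :
    (-1 : ℝ) ^ C.crossings α β =
      (C.totalDeg α * C.totalDeg β).negOnePow • (-1 : ℝ) ^ C.crossings β α := by
  have key : ((C.crossings α β + C.crossings β α : ℕ) : ZMod 2) =
      ((C.totalDeg α * C.totalDeg β : ℤ) : ZMod 2) := by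
    have hpar : ∀ i, ((C.deg i : ℤ) : ZMod 2) = if Odd (C.deg i) then 1 else 0 := by
      intro i
      split_ifs with hi
      · obtain ⟨m, hm⟩ := hi
        rw [hm]; push_cast
        rw [show (2 : ZMod 2) = 0 from rfl]; simp
      · rw [Int.not_odd_iff_even] at hi
        exact (ZMod.intCast_eq_zero_iff_even).2 hi
    unfold crossings totalDeg Finsupp.sum
    push_cast
    rw [Finset.sum_mul_sum, Finset.sum_comm (s := β.support), ← Finset.sum_add_distrib]
    refine Finset.sum_congr rfl fun i _ => ?_
    rw [← Finset.sum_add_distrib]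
    refine Finset.sum_congr rfl fun j _ => ?_
    rw [hpar, hpar]
    by_cases hi : Odd (C.deg i) <;> by_cases hj : Odd (C.deg j) <;> simp only [hi, hj, and_true,
      and_false, if_true, if_false, mul_zero, zero_mul, add_zero, mul_one]
    rcases lt_trichotomy i j with hij | rfl | hij
    · simp [hij, hij.not_gt, mul_comm]
    · have := (h i).2 hi
      simp only [Finsupp.coe_add, Pi.add_apply] at this
      simp only [lt_irrefl, if_false, add_zero]
      rcases Nat.eq_zero_or_pos (α i) with h0 | h0
      · simp [h0]
      · have : β i = 0 := by omega
        simp [this]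
    · simp [hij, hij.not_gt]
  rcases Nat.even_or_odd (C.crossings α β) with h1 | h1 <;>
  rcases Nat.even_or_odd (C.crossings β α) with h2 | h2 <;>
  rcases Int.even_or_odd (C.totalDeg α * C.totalDeg β) with h3 | h3 <;>
  first
  | have hs := Int.negOnePow_even _ h3
  | have hs := Int.negOnePow_odd _ h3
  all_goals
  simp only [h1.neg_one_pow, h2.neg_one_pow, hs,
    one_smul, Units.neg_smul] <;> first
  | (simp; done)
  | (exfalso
     have h4 := key
     rw [← Int.cast_natCast, ZMod.intCast_eq_intCast_iff_dvd_sub] at h4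
     push_cast at h4
     obtain ⟨a, ha⟩ := h1
     obtain ⟨b, hb⟩ := h2
     obtain ⟨c, hc⟩ := h3
     rw [ha, hb, hc] at h4
     push_cast at h4
     omega)

theorem smooth_mono {J J' : Finset {i : C.ι // C.deg i = 0}} (h : J ⊆ J') {U : Opens C.Body}
    {V : Set U} {φ : U → ℝ}
    (H : ∃ g : (J → ℝ) → ℝ, ContDiff ℝ ∞ g ∧ ∀ y ∈ V, φ y = g fun j => y.1 j) :
    ∃ g : (J' → ℝ) → ℝ, ContDiff ℝ ∞ g ∧ ∀ y ∈ V, φ y = g fun j => y.1 j := by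
  obtain ⟨g, hg, hφ⟩ := H
  refine ⟨fun z => g fun j => z ⟨j.1, h j.2⟩, ?_, fun y hy => hφ y hy⟩
  exact hg.comp (contDiff_pi.2 fun j => contDiff_apply ℝ ℝ (⟨j.1, h j.2⟩ : J'))

theorem IsFunction.add {U : Opens C.Body} {k : ℤ} {f g : (C.ι →₀ ℕ) → U → ℝ}
    (hf : C.IsFunction U k f) (hg : C.IsFunction U k g) : C.IsFunction U k (f + g) := by
  classical
  refine ⟨fun α hα => ?_, fun x => ?_⟩
  · by_cases h : f α = 0
    · exact hg.1 α fun h' => hα (by simp [h, h'])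
    · exact hf.1 α h
  · obtain ⟨J, K, V, hV, h1, h2⟩ := hf.2 x
    obtain ⟨J', K', V', hV', h1', h2'⟩ := hg.2 x
    refine ⟨J ∪ J', K ∪ K', V ∩ V', Filter.inter_mem hV hV', ?_, ?_⟩
    · intro α hα y hy
      have := h1 α (fun h => hα (h.trans Finset.subset_union_left)) y hy.1
      have := h1' α (fun h => hα (h.trans Finset.subset_union_right)) y hy.2
      simp [*]
    · intro α
      obtain ⟨a, ha, ha'⟩ := smooth_mono (J' := J ∪ J') Finset.subset_union_left (h2 α)
      obtain ⟨b, hb, hb'⟩ := smooth_mono (J' := J ∪ J') Finset.subset_union_right (h2' α)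
      exact ⟨fun z => a z + b z, ha.add hb, fun y hy => by simp [ha' y hy.1, hb' y hy.2]⟩

theorem IsFunction.smul {U : Opens C.Body} {k : ℤ} {f : (C.ι →₀ ℕ) → U → ℝ}
    (c : ℝ) (hf : C.IsFunction U k f) : C.IsFunction U k (c • f) := by
  refine ⟨fun α hα => hf.1 α fun h => hα (by simp [h]), fun x => ?_⟩
  obtain ⟨J, K, V, hV, h1, h2⟩ := hf.2 x
  refine ⟨J, K, V, hV, fun α hα y hy => by simp [h1 α hα y hy], fun α => ?_⟩
  obtain ⟨a, ha, ha'⟩ := h2 α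
  exact ⟨fun z => c * a z, contDiff_const.mul ha, fun y hy => by simp [ha' y hy]⟩

theorem IsFunction.zero (U : Opens C.Body) (k : ℤ) : C.IsFunction U k 0 :=
  ⟨fun _ hα => absurd rfl hα, fun _ => ⟨∅, ∅, Set.univ, Filter.univ_mem, fun _ _ _ _ => rfl,
    fun _ => ⟨fun _ => 0, contDiff_const, fun _ _ => rfl⟩⟩⟩

theorem IsFunction.mul {U : Opens C.Body} {i j k : ℤ} {f g : (C.ι →₀ ℕ) → U → ℝ}
    (hk : i + j = k) (hf : C.IsFunction U i f) (hg : C.IsFunction U j g) :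
    C.IsFunction U k (C.mulSeries f g) := by
  classical
  refine ⟨fun γ hγ => ?_, fun x => ?_⟩
  · obtain ⟨y, hy⟩ := Function.ne_iff.1 hγ
    by_cases had : C.Admissible γ
    · refine ⟨had, ?_⟩
      simp only [mulSeries, had, if_true] at hy
      obtain ⟨p, hp, hne⟩ := Finset.exists_ne_zero_of_sum_ne_zero hy
      rw [Finset.HasAntidiagonal.mem_antidiagonal] at hp
      have h1 : f p.1 ≠ 0 := fun h => hne (by simp [h])
      have h2 : g p.2 ≠ 0 := fun h => hne (by simp [h])
      rw [← hp, totalDeg_add, (hf.1 _ h1).2, (hg.1 _ h2).2, hk]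
    · simp [mulSeries, had] at hy
  · obtain ⟨J, K, V, hV, h1, h2⟩ := hf.2 x
    obtain ⟨J', K', V', hV', h1', h2'⟩ := hg.2 x
    refine ⟨J ∪ J', K ∪ K', V ∩ V', Filter.inter_mem hV hV', ?_, ?_⟩
    · intro γ hγ y hy
      simp only [mulSeries]
      split_ifs with had
      · refine Finset.sum_eq_zero fun p hp => ?_
        rw [Finset.HasAntidiagonal.mem_antidiagonal] at hp
        by_cases hs : p.1.support ⊆ K
        · have hs' : ¬ p.2.support ⊆ K' := fun hs' =>
            hγ (hp ▸ Finsupp.support_add.trans (Finset.union_subset_union hs hs'))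
          simp [h1' p.2 hs' y hy.2]
        · simp [h1 p.1 hs y hy.1]
      · rfl
    · intro γ
      choose a ha ha' using fun α => smooth_mono (J' := J ∪ J') Finset.subset_union_left (h2 α)
      choose b hb hb' using fun α => smooth_mono (J' := J ∪ J') Finset.subset_union_right (h2' α)
      by_cases had : C.Admissible γ
      · refine ⟨fun z => ∑ p ∈ Finset.HasAntidiagonal.antidiagonal γ,
          (-1 : ℝ) ^ C.crossings p.1 p.2 * (a p.1 z * b p.2 z),
          ContDiff.sum fun p _ => contDiff_const.mul ((ha _).mul (hb _)), fun y hy => ?_⟩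
        simp only [mulSeries, had, if_true]
        exact Finset.sum_congr rfl fun p _ => by rw [ha' _ y hy.1, hb' _ y hy.2]
      · exact ⟨fun _ => 0, contDiff_const, fun y _ => by simp [mulSeries, had]⟩

theorem mulSeries_assoc {Y : Type} (f g h : (C.ι →₀ ℕ) → Y → ℝ) :
    C.mulSeries (C.mulSeries f g) h = C.mulSeries f (C.mulSeries g h) := by
  classical
  funext γ y
  by_cases had : C.Admissible γ
  · have h1 : ∀ p ∈ Finset.HasAntidiagonal.antidiagonal γ, C.Admissible p.1 ∧ C.Admissible p.2 := fun p hp => by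
      rw [Finset.HasAntidiagonal.mem_antidiagonal] at hp
      exact ⟨Admissible.left (hp ▸ had), Admissible.right (hp ▸ had)⟩
    have e1 : C.mulSeries (C.mulSeries f g) h γ y = ∑ p ∈ Finset.HasAntidiagonal.antidiagonal γ,
        ∑ q ∈ Finset.HasAntidiagonal.antidiagonal p.1, (-1 : ℝ) ^ (C.crossings q.1 q.2 + C.crossings q.1 p.2
          + C.crossings q.2 p.2) * (f q.1 y * g q.2 y * h p.2 y) := by
      simp only [mulSeries, had, if_true]
      refine Finset.sum_congr rfl fun p hp => ?_
      simp only [(h1 p hp).1, if_true, Finset.sum_mul, Finset.mul_sum]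
      refine Finset.sum_congr rfl fun q hq => ?_
      rw [Finset.HasAntidiagonal.mem_antidiagonal] at hq
      rw [← hq, crossings_add_left]
      ring
    have e2 : C.mulSeries f (C.mulSeries g h) γ y = ∑ p ∈ Finset.HasAntidiagonal.antidiagonal γ,
        ∑ q ∈ Finset.HasAntidiagonal.antidiagonal p.2, (-1 : ℝ) ^ (C.crossings p.1 q.1 + C.crossings p.1 q.2
          + C.crossings q.1 q.2) * (f p.1 y * g q.1 y * h q.2 y) := by
      simp only [mulSeries, had, if_true]
      refine Finset.sum_congr rfl fun p hp => ?_
      simp only [(h1 p hp).2, if_true, Finset.mul_sum]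
      refine Finset.sum_congr rfl fun q hq => ?_
      rw [Finset.HasAntidiagonal.mem_antidiagonal] at hq
      rw [← hq, crossings_add_right]
      ring
    rw [e1, e2, Finset.sum_sigma', Finset.sum_sigma']
    refine Finset.sum_nbij' (fun ⟨⟨_i, j⟩, ⟨k, l⟩⟩ ↦ ⟨(k, l + j), (l, j)⟩)
      (fun ⟨⟨i, _j⟩, ⟨k, l⟩⟩ ↦ ⟨(i + k, l), (i, k)⟩) ?_ ?_ ?_ ?_ ?_ <;>
      rintro ⟨⟨a, b⟩, ⟨c, d⟩⟩ hm <;>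
      simp only [Finset.mem_sigma, Finset.HasAntidiagonal.mem_antidiagonal] at hm ⊢ <;>
      obtain ⟨rfl, rfl⟩ := hm <;> simp [add_assoc]
  · simp [mulSeries, had]

/-- The constant function `1`. -/
noncomputable def oneSeries (Y : Type) : (C.ι →₀ ℕ) → Y → ℝ := fun α _ => if α = 0 then 1 else 0

theorem IsFunction.one (U : Opens C.Body) : C.IsFunction U 0 (oneSeries U) := by
  refine ⟨fun α hα => ?_, fun _ => ⟨∅, ∅, Set.univ, Filter.univ_mem, ?_, ?_⟩⟩
  · obtain rfl : α = 0 := by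
      by_contra h
      exact hα (by funext y; simp [oneSeries, h])
    exact ⟨fun i => by simp, by simp [totalDeg]⟩
  · intro α hα _ _
    have : α ≠ 0 := by rintro rfl; simp at hα
    simp [oneSeries, this]
  · exact fun α => ⟨fun _ => if α = 0 then 1 else 0, contDiff_const, fun _ _ => rfl⟩

theorem one_mulSeries {U : Opens C.Body} {k : ℤ} {f : (C.ι →₀ ℕ) → U → ℝ}
    (hf : C.IsFunction U k f) : C.mulSeries (oneSeries U) f = f := by
  classical
  funext γ y
  by_cases had : C.Admissible γ
  · simp only [mulSeries, had, if_true]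
    rw [Finset.sum_eq_single_of_mem (0, γ) (by simp)]
    · simp [oneSeries, crossings]
    · rintro ⟨a, b⟩ hp hne
      rw [Finset.HasAntidiagonal.mem_antidiagonal] at hp
      have : a ≠ 0 := by
        rintro rfl
        simp at hp
        exact hne (by simp [hp])
      simp [oneSeries, this]
  · have : f γ = 0 := by
      by_contra h
      exact had (hf.1 γ h).1
    simp [mulSeries, had, this]

theorem mulSeries_comm {U : Opens C.Body} {i j : ℤ} {f g : (C.ι →₀ ℕ) → U → ℝ}
    (hf : C.IsFunction U i f) (hg : C.IsFunction U j g) :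
    C.mulSeries f g = (i * j).negOnePow • C.mulSeries g f := by
  classical
  funext γ y
  simp only [Pi.smul_apply, mulSeries]
  split_ifs with had
  · have hswap : ∑ p ∈ Finset.HasAntidiagonal.antidiagonal γ,
        (-1 : ℝ) ^ C.crossings p.1 p.2 * (g p.1 y * f p.2 y) =
        ∑ p ∈ Finset.HasAntidiagonal.antidiagonal γ,
          (-1 : ℝ) ^ C.crossings p.2 p.1 * (g p.2 y * f p.1 y) :=
      Finset.sum_equiv (Equiv.prodComm _ _) (by simp [add_comm]) (by simp)
    rw [hswap, Finset.smul_sum]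
    refine Finset.sum_congr rfl fun p hp => ?_
    rw [Finset.HasAntidiagonal.mem_antidiagonal] at hp
    by_cases h1 : f p.1 = 0
    · simp [h1]
    by_cases h2 : g p.2 = 0
    · simp [h2]
    rw [neg_one_pow_crossings_swap (hp ▸ had), (hf.1 _ h1).2, (hg.1 _ h2).2, smul_mul_assoc,
      mul_comm (f p.1 y)]
  · simp

variable (C)

/-- The functions of degree `k` over `U`. -/
noncomputable def functions (U : Opens C.Body) (k : ℤ) :
    Submodule ℝ ((C.ι →₀ ℕ) → U → ℝ) where
  carrier := {f | C.IsFunction U k f}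
  add_mem' := IsFunction.add
  zero_mem' := IsFunction.zero U k
  smul_mem' := fun c _ hf => hf.smul c

theorem IsFunction.comp_inclusion {C : GradedCoords} {U V : Opens C.Body} (h : V ≤ U) {k : ℤ}
    {f : (C.ι →₀ ℕ) → U → ℝ} (hf : C.IsFunction U k f) :
    C.IsFunction V k fun α y => f α ⟨y.1, h y.2⟩ := by
  refine ⟨fun α hα => hf.1 α fun h0 => hα ?_, fun x => ?_⟩
  · funext y; simp [h0]
  · obtain ⟨J, K, W, hW, h1, h2⟩ := hf.2 ⟨x.1, h x.2⟩
    have hc : Continuous fun y : V => (⟨y.1, h y.2⟩ : U) := by fun_prop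
    refine ⟨J, K, _, hc.continuousAt.preimage_mem_nhds hW, fun α hα y hy => h1 α hα _ hy,
      fun α => ?_⟩
    obtain ⟨g, hg, hg'⟩ := h2 α
    exact ⟨g, hg, fun y hy => hg' _ hy⟩

theorem IsFunction.of_local {C : GradedCoords} {U : Opens C.Body} {I : Type}
    {V : I → Opens C.Body} (hV : ∀ i, V i ≤ U) (hU : U ≤ iSup V) {k : ℤ}
    {f : (C.ι →₀ ℕ) → U → ℝ}
    (hf : ∀ i, C.IsFunction (V i) k fun α y => f α ⟨y.1, hV i y.2⟩) : C.IsFunction U k f := by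
  refine ⟨fun α hα => ?_, fun x => ?_⟩
  · obtain ⟨y, hy⟩ := Function.ne_iff.1 hα
    obtain ⟨i, hi⟩ := Opens.mem_iSup.1 (hU y.2)
    exact (hf i).1 α fun h0 => hy (congrFun h0 ⟨y.1, hi⟩)
  · obtain ⟨i, hi⟩ := Opens.mem_iSup.1 (hU x.2)
    obtain ⟨J, K, W, hW, h1, h2⟩ := (hf i).2 ⟨x.1, hi⟩
    have hemb : Topology.IsOpenEmbedding fun y : V i => (⟨y.1, hV i y.2⟩ : U) :=
      Opens.isOpenEmbedding_of_le (hV i)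
    refine ⟨J, K, (fun y : V i => (⟨y.1, hV i y.2⟩ : U)) '' W,
      hemb.isOpenMap.image_mem_nhds hW, ?_, fun α => ?_⟩
    · rintro α hα _ ⟨y, hy, rfl⟩
      exact h1 α hα y hy
    · obtain ⟨g, hg, hg'⟩ := h2 α
      refine ⟨g, hg, ?_⟩
      rintro _ ⟨y, hy, rfl⟩
      exact hg' y hy

/-- The graded space with global coordinates `C`: the underlying space is the space of values of
the degree zero coordinates, the functions are formal power series in the other coordinates. -/
noncomputable def toGradedSpace : GradedSpace where
  carrier := C.Body
  sec U k := C.functions U k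
  one U := ⟨oneSeries U, IsFunction.one U⟩
  mul {U i j k} h := LinearMap.mk₂ ℝ
    (fun f g => (⟨C.mulSeries f.1 g.1, IsFunction.mul h f.2 g.2⟩ : C.functions U k))
    (fun f f' g => Subtype.ext <| by
      funext γ y
      change C.mulSeries (f.1 + f'.1) g.1 γ y = C.mulSeries f.1 g.1 γ y + C.mulSeries f'.1 g.1 γ y
      simp only [mulSeries]
      split_ifs <;> simp [add_mul, mul_add, Finset.sum_add_distrib])
    (fun c f g => Subtype.ext <| by
      funext γ y
      change C.mulSeries (c • f.1) g.1 γ y = c * C.mulSeries f.1 g.1 γ y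
      simp only [mulSeries]
      split_ifs
      · rw [Finset.mul_sum]
        exact Finset.sum_congr rfl fun p _ => by simp; ring
      · simp)
    (fun f g g' => Subtype.ext <| by
      funext γ y
      change C.mulSeries f.1 (g.1 + g'.1) γ y = C.mulSeries f.1 g.1 γ y + C.mulSeries f.1 g'.1 γ y
      simp only [mulSeries]
      split_ifs <;> simp [mul_add, Finset.sum_add_distrib])
    (fun c f g => Subtype.ext <| by
      funext γ y
      change C.mulSeries f.1 (c • g.1) γ y = c * C.mulSeries f.1 g.1 γ y
      simp only [mulSeries]
      split_ifs
      · rw [Finset.mul_sum]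
        exact Finset.sum_congr rfl fun p _ => by simp; ring
      · simp)
  one_mul a := Subtype.ext (one_mulSeries a.2)
  mul_assoc _ _ _ _ a b c := Subtype.ext (mulSeries_assoc a.1 b.1 c.1)
  mul_comm _ _ a b := Subtype.ext (mulSeries_comm a.2 b.2)
  res {U V} h {k} :=
    { toFun := fun f => ⟨fun α y => f.1 α ⟨y.1, h y.2⟩, f.2.comp_inclusion h⟩
      map_add' := fun _ _ => rfl
      map_smul' := fun _ _ => rfl }
  res_self _ _ := rfl
  res_res _ _ _ := rfl
  res_one _ := rfl
  res_mul _ _ _ _ _ _ _ := rfl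
  locality {U I} V hV hU k a b hab := Subtype.ext <| by
    funext α y
    obtain ⟨i, hi⟩ := Opens.mem_iSup.1 (hU y.2)
    exact congrFun (congrFun (congrArg Subtype.val (hab i)) α) ⟨y.1, hi⟩
  gluing {U I} V hV hU k s hs := by
    choose i hi using fun y : U => Opens.mem_iSup.1 (hU y.2)
    have key : ∀ (j : I) (α : C.ι →₀ ℕ) (y : V j),
        (s (i ⟨y.1, hV j y.2⟩)).1 α ⟨y.1, hi ⟨y.1, hV j y.2⟩⟩ = (s j).1 α y := fun j α y =>
      congrFun (congrFun (congrArg Subtype.val (hs (i ⟨y.1, hV j y.2⟩) j)) α)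
        ⟨y.1, hi ⟨y.1, hV j y.2⟩, y.2⟩
    refine ⟨⟨fun α y => (s (i y)).1 α ⟨y.1, hi y⟩, IsFunction.of_local hV hU fun j => ?_⟩,
      fun j => Subtype.ext (funext fun α => funext fun y => key j α y)⟩
    have : (fun α (y : V j) => (s (i ⟨y.1, hV j y.2⟩)).1 α ⟨y.1, hi ⟨y.1, hV j y.2⟩⟩) = (s j).1 :=
      funext fun α => funext fun y => key j α y
    exact this ▸ (s j).2

/-- The series of the coordinate `i`. -/
noncomputable def coordSeries (i : C.ι) (U : Opens C.Body) : (C.ι →₀ ℕ) → U → ℝ := fun α y =>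
  if h : C.deg i = 0 then (if α = 0 then y.1 ⟨i, h⟩ else 0)
  else if α = Finsupp.single i 1 then 1 else 0

theorem coordSeries_isFunction (i : C.ι) (U : Opens C.Body) :
    C.IsFunction U (C.deg i) (C.coordSeries i U) := by
  classical
  refine ⟨fun α hα => ?_, fun x => ?_⟩
  · by_cases h : C.deg i = 0
    · obtain rfl : α = 0 := by
        by_contra h'
        exact hα (by funext y; simp [coordSeries, h, h'])
      exact ⟨fun i => by simp, by simp [totalDeg, h]⟩
    · obtain rfl : α = Finsupp.single i 1 := by
        by_contra h'
        exact hα (by funext y; simp [coordSeries, h, h'])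
      refine ⟨fun j => ⟨fun hj => ?_, fun _ => ?_⟩, by simp [totalDeg]⟩
      · have : i ≠ j := by rintro rfl; exact h hj
        simp [this]
      · rw [Finsupp.single_apply]; split_ifs <;> simp
  · by_cases h : C.deg i = 0
    · refine ⟨{⟨i, h⟩}, ∅, Set.univ, Filter.univ_mem, fun α hα y _ => ?_, fun α => ?_⟩
      · have : α ≠ 0 := by rintro rfl; simp at hα
        simp [coordSeries, h, this]
      · refine ⟨fun z => if α = 0 then z ⟨⟨i, h⟩, by simp⟩ else 0, ?_, fun y _ => by
          simp [coordSeries, h]⟩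
        split_ifs
        · exact contDiff_apply ℝ ℝ _
        · exact contDiff_const
    · refine ⟨∅, {i}, Set.univ, Filter.univ_mem, fun α hα y _ => ?_, fun α => ?_⟩
      · have : α ≠ Finsupp.single i 1 := by
          rintro rfl
          exact hα Finsupp.support_single_subset
        simp [coordSeries, h, this]
      · exact ⟨fun _ => if α = Finsupp.single i 1 then 1 else 0, contDiff_const, fun y _ => by
          simp [coordSeries, h]⟩

/-- The coordinate `i` as a function over `U`. -/
noncomputable def coord (i : C.ι) (U : Opens C.toGradedSpace) : C.toGradedSpace.sec U (C.deg i) :=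
  (⟨C.coordSeries i U, C.coordSeries_isFunction i U⟩ : C.functions U (C.deg i))

end GradedCoords

namespace DiffForm

/-- The model space. -/
abbrev E (n : ℕ) : Type := EuclideanSpace ℝ (Fin n)

section Fibre

variable (n : ℕ)

/-- The exterior algebra of the cotangent space of an `n`-dimensional manifold at a point. (In
Mathlib all tangent spaces of the manifold are the model space `E n`; the
identification is given by the preferred chart at the point.) -/
abbrev Fibre : Type := ExteriorAlgebra ℝ (E n →L[ℝ] ℝ)

instance : Module.Finite ℝ (Fibre n) :=
  Module.Finite.of_basis
    (Module.finBasis ℝ (E n →L[ℝ] ℝ)).ExteriorAlgebra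

/-- A norm on the finite dimensional space `Fibre n`; derivatives do not depend on the choice. -/
noncomputable abbrev fibreNorm : NormedAddCommGroup (Fibre n) :=
  NormedAddCommGroup.induced (Fibre n) _ (Module.finBasis ℝ (Fibre n)).equivFun
    (Module.finBasis ℝ (Fibre n)).equivFun.injective

attribute [local instance] fibreNorm

noncomputable abbrev fibreNormedSpace : NormedSpace ℝ (Fibre n) :=
  NormedSpace.induced ℝ (Fibre n) _ (Module.finBasis ℝ (Fibre n)).equivFun

attribute [local instance] fibreNormedSpace

variable {n}

/-- The pull-back of exterior forms along a linear map. -/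
noncomputable def pullFibre (L : E n →L[ℝ] E n) :
    Fibre n →ₐ[ℝ] Fibre n :=
  ExteriorAlgebra.map
    { toFun := fun ξ => ξ.comp L
      map_add' := fun _ _ => rfl
      map_smul' := fun _ _ => rfl }

/-- The part of degree `k`. -/
noncomputable def degreePart (n : ℕ) : ℤ → Submodule ℝ (Fibre n)
  | Int.ofNat m => ⋀[ℝ]^m (E n →L[ℝ] ℝ)
  | Int.negSucc _ => ⊥

/-- The exterior derivative `∑ i, dx^i ∧ ∂_i F` in Euclidean space. -/
noncomputable def flatD (F : E n → Fibre n) (z : E n) :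
    Fibre n :=
  ∑ i : Fin n, ExteriorAlgebra.ι ℝ (EuclideanSpace.proj i : E n →L[ℝ] ℝ) *
    fderiv ℝ F z (EuclideanSpace.single i 1)

end Fibre

section Manifold

variable {n : ℕ} {X : Type} [TopologicalSpace X] [ChartedSpace (E n) X]

/-- The differential of the preferred chart at `x`, at the point `x`. -/
noncomputable def chartDiff (x : X) : E n →L[ℝ] E n :=
  mfderiv (𝓡 n) 𝓘(ℝ, E n) (extChartAt (𝓡 n) x) x

/-- The differential of the inverse of the preferred chart at `x`, at the point `z`. -/
noncomputable def chartSymmDiff (x : X) (z : E n) : E n →L[ℝ] E n :=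
  mfderiv 𝓘(ℝ, E n) (𝓡 n) (extChartAt (𝓡 n) x).symm z

variable (n) in
/-- The differential of a function, as a form. -/
noncomputable def differential (f : X → ℝ) (x : X) : Fibre n :=
  ExteriorAlgebra.ι ℝ (mfderiv (𝓡 n) 𝓘(ℝ, ℝ) f x : E n →L[ℝ] ℝ)

/-- A form in the coordinates of the preferred chart at `x`. -/
noncomputable def inChart (η : X → Fibre n) (x : X) (z : E n) : Fibre n :=
  pullFibre (chartSymmDiff x z) (η ((extChartAt (𝓡 n) x).symm z))

/-- The exterior derivative of a form on a manifold, computed in the chart at `x`. -/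
noncomputable def d (η : X → Fibre n) (x : X) : Fibre n :=
  pullFibre (chartDiff x) (flatD (inChart η x) (extChartAt (𝓡 n) x x))

variable (n) in
/-- The algebra generated by the functions `f` and the forms `df`, where `f` is smooth on `V`. -/
noncomputable def generated (V : Set X) : Subalgebra ℝ (X → Fibre n) :=
  Algebra.adjoin ℝ {φ | ∃ f : X → ℝ, ContMDiffOn (𝓡 n) 𝓘(ℝ, ℝ) ∞ f V ∧
    (φ = (fun x => algebraMap ℝ (Fibre n) (f x)) ∨ φ = differential n f)}

end Manifold

section Lemmas

attribute [local instance] fibreNorm fibreNormedSpace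

variable {n : ℕ}

@[simp] theorem pullFibre_ι (L : E n →L[ℝ] E n) (ξ : E n →L[ℝ] ℝ) :
    pullFibre L (ExteriorAlgebra.ι ℝ ξ) = ExteriorAlgebra.ι ℝ (ξ.comp L) :=
  ExteriorAlgebra.map_apply_ι _ _

theorem ι_mul_eq (ξ : E n →L[ℝ] ℝ) (a : Fibre n) :
    ExteriorAlgebra.ι ℝ ξ * a = CliffordAlgebra.involute a * ExteriorAlgebra.ι ℝ ξ := by
  induction a using ExteriorAlgebra.induction with
  | algebraMap r => simp [Algebra.commutes]
  | ι η =>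
    rw [show CliffordAlgebra.involute (ExteriorAlgebra.ι ℝ η) = -ExteriorAlgebra.ι ℝ η from
      CliffordAlgebra.involute_ι η, neg_mul, eq_neg_iff_add_eq_zero]
    exact ExteriorAlgebra.ι_add_mul_swap ξ η
  | mul a b ha hb => rw [map_mul, ← mul_assoc, ha, mul_assoc, hb, mul_assoc]
  | add a b ha hb => rw [map_add, mul_add, add_mul, ha, hb]

theorem pullFibre_involute (L : E n →L[ℝ] E n) (a : Fibre n) :
    pullFibre L (CliffordAlgebra.involute a) = CliffordAlgebra.involute (pullFibre L a) := by
  induction a using ExteriorAlgebra.induction with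
  | algebraMap r => simp
  | ι η =>
    rw [show CliffordAlgebra.involute (ExteriorAlgebra.ι ℝ η) = -ExteriorAlgebra.ι ℝ η from
      CliffordAlgebra.involute_ι η, map_neg, pullFibre_ι,
      show CliffordAlgebra.involute (ExteriorAlgebra.ι ℝ (η.comp L)) =
        -ExteriorAlgebra.ι ℝ (η.comp L) from CliffordAlgebra.involute_ι _]
  | mul a b ha hb => simp only [map_mul, ha, hb]
  | add a b ha hb => simp only [map_add, ha, hb]

theorem involute_of_mem {m : ℕ} {a : Fibre n} (ha : a ∈ ⋀[ℝ]^m (E n →L[ℝ] ℝ)) :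
    CliffordAlgebra.involute a = (-1 : ℝ) ^ m • a := by
  induction ha using Submodule.pow_induction_on_left' with
  | algebraMap r => simp
  | add x y i hx hy ihx ihy => rw [map_add, ihx, ihy, smul_add]
  | mem_mul v hv i x hx ih =>
    obtain ⟨ξ, rfl⟩ := hv
    rw [map_mul, ih, show CliffordAlgebra.involute (ExteriorAlgebra.ι ℝ ξ) =
      -ExteriorAlgebra.ι ℝ ξ from CliffordAlgebra.involute_ι ξ, pow_succ]
    simp

theorem mul_comm_of_mem {p q : ℕ} {a b : Fibre n} (ha : a ∈ ⋀[ℝ]^p (E n →L[ℝ] ℝ))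
    (hb : b ∈ ⋀[ℝ]^q (E n →L[ℝ] ℝ)) : a * b = (-1 : ℝ) ^ (p * q) • (b * a) := by
  induction ha using Submodule.pow_induction_on_left' with
  | algebraMap r => simp [Algebra.commutes]
  | add x y i hx hy ihx ihy => rw [add_mul, mul_add, ihx, ihy, smul_add]
  | mem_mul v hv i x hx ih =>
    obtain ⟨ξ, rfl⟩ := hv
    rw [mul_assoc, ih, mul_smul_comm, ← mul_assoc, ι_mul_eq, involute_of_mem hb, smul_mul_assoc,
      smul_mul_assoc, smul_smul, mul_assoc, Nat.succ_mul, pow_add]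

/-- The product as a continuous bilinear map. -/
noncomputable def mulL : Fibre n →L[ℝ] Fibre n →L[ℝ] Fibre n :=
  LinearMap.toContinuousLinearMap
    ((LinearMap.toContinuousLinearMap (E := Fibre n) (F' := Fibre n)).toLinearMap ∘ₗ
      LinearMap.mul ℝ (Fibre n))

theorem mulL_apply (a b : Fibre n) : mulL a b = a * b := rfl

theorem differentiableAt_mul {F G : E n → Fibre n} {z : E n} (hF : DifferentiableAt ℝ F z)
    (hG : DifferentiableAt ℝ G z) : DifferentiableAt ℝ (fun w => F w * G w) z ∧
      ∀ v, fderiv ℝ (fun w => F w * G w) z v = fderiv ℝ F z v * G z + F z * fderiv ℝ G z v := by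
  have h : HasFDerivAt (fun w => F w * G w) _ z :=
    mulL.hasFDerivAt_of_bilinear hF.hasFDerivAt hG.hasFDerivAt
  refine ⟨h.differentiableAt, fun v => ?_⟩
  rw [h.fderiv, add_comm]
  rfl

theorem fderiv_linear (ℓ : Fibre n →ₗ[ℝ] Fibre n) {F : E n → Fibre n} {z : E n}
    (hF : DifferentiableAt ℝ F z) : DifferentiableAt ℝ (fun w => ℓ (F w)) z ∧
      ∀ v, fderiv ℝ (fun w => ℓ (F w)) z v = ℓ (fderiv ℝ F z v) := by
  have h := (ℓ.toContinuousLinearMap.hasFDerivAt (x := F z)).comp z hF.hasFDerivAt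
  exact ⟨h.differentiableAt, fun v => congrArg (fun L => L v) h.fderiv⟩

theorem flatD_mul {F G : E n → Fibre n} {z : E n} (hF : DifferentiableAt ℝ F z)
    (hG : DifferentiableAt ℝ G z) : flatD (fun w => F w * G w) z =
      flatD F z * G z + CliffordAlgebra.involute (F z) * flatD G z := by
  simp only [flatD, (differentiableAt_mul hF hG).2, mul_add, Finset.sum_add_distrib,
    Finset.sum_mul, Finset.mul_sum, ← mul_assoc, ι_mul_eq _ (F z)]

theorem flatD_involute {F : E n → Fibre n} {z : E n} (hF : DifferentiableAt ℝ F z) :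
    flatD (fun w => CliffordAlgebra.involute (F w)) z = -CliffordAlgebra.involute (flatD F z) := by
  simp only [flatD, map_sum, map_mul, ← Finset.sum_neg_distrib]
  refine Finset.sum_congr rfl fun i _ => ?_
  rw [show CliffordAlgebra.involute (ExteriorAlgebra.ι ℝ
      (EuclideanSpace.proj i : E n →L[ℝ] ℝ)) = -ExteriorAlgebra.ι ℝ _ from
      CliffordAlgebra.involute_ι _, neg_mul, neg_neg]
  exact congrArg _ ((fderiv_linear (CliffordAlgebra.involute).toLinearMap hF).2 _)

theorem sum_proj (L : E n →L[ℝ] ℝ) :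
    ∑ i : Fin n, L (EuclideanSpace.single i 1) • (EuclideanSpace.proj i : E n →L[ℝ] ℝ) = L := by
  ext v
  conv_rhs => rw [← (EuclideanSpace.basisFun (Fin n) ℝ).sum_repr v]
  simp [mul_comm]

theorem flatD_algebraMap {f : E n → ℝ} {z : E n} (hf : DifferentiableAt ℝ f z) :
    DifferentiableAt ℝ (fun w => algebraMap ℝ (Fibre n) (f w)) z ∧
    flatD (fun w => algebraMap ℝ (Fibre n) (f w)) z = ExteriorAlgebra.ι ℝ (fderiv ℝ f z) := by
  have h := ((Algebra.linearMap ℝ (Fibre n)).toContinuousLinearMap.hasFDerivAt (x := f z)).comp z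
    hf.hasFDerivAt
  refine ⟨h.differentiableAt, ?_⟩
  have h2 : ∀ v, fderiv ℝ (fun w => algebraMap ℝ (Fibre n) (f w)) z v =
      algebraMap ℝ (Fibre n) (fderiv ℝ f z v) := fun v => congrArg (fun L => L v) h.fderiv
  simp only [flatD, h2]
  conv_rhs => rw [← sum_proj (fderiv ℝ f z), map_sum]
  exact Finset.sum_congr rfl fun i _ => by
    rw [map_smul, ← Algebra.commutes, Algebra.smul_def]

theorem flatD_ι_fderiv {f : E n → ℝ} {z : E n} (hf : ContDiffAt ℝ ∞ f z) :
    DifferentiableAt ℝ (fun w => (ExteriorAlgebra.ι ℝ (fderiv ℝ f w) : Fibre n)) z ∧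
    flatD (fun w => ExteriorAlgebra.ι ℝ (fderiv ℝ f w)) z = 0 := by
  have hd : DifferentiableAt ℝ (fderiv ℝ f) z :=
    (hf.fderiv_right (m := 1) (by norm_cast)).differentiableAt (by simp)
  have h := ((ExteriorAlgebra.ι ℝ (M := E n →L[ℝ] ℝ)).toContinuousLinearMap.hasFDerivAt
    (x := fderiv ℝ f z)).comp z hd.hasFDerivAt
  refine ⟨h.differentiableAt, ?_⟩
  have h2 : ∀ v, fderiv ℝ (fun w => (ExteriorAlgebra.ι ℝ (fderiv ℝ f w) : Fibre n)) z v =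
      ExteriorAlgebra.ι ℝ (fderiv ℝ (fderiv ℝ f) z v) :=
    fun v => congrArg (fun L => L v) h.fderiv
  have hsym : IsSymmSndFDerivAt ℝ f z := hf.isSymmSndFDerivAt (by simp; norm_cast)
  have key : flatD (fun w => (ExteriorAlgebra.ι ℝ (fderiv ℝ f w) : Fibre n)) z =
      ∑ i : Fin n, ∑ j : Fin n, (fderiv ℝ (fderiv ℝ f) z (EuclideanSpace.single i 1)
        (EuclideanSpace.single j 1)) •
        (ExteriorAlgebra.ι ℝ (EuclideanSpace.proj i : E n →L[ℝ] ℝ) *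
          ExteriorAlgebra.ι ℝ (EuclideanSpace.proj j : E n →L[ℝ] ℝ)) := by
    simp only [flatD, h2]
    refine Finset.sum_congr rfl fun i _ => ?_
    conv_lhs => rw [← sum_proj (fderiv ℝ (fderiv ℝ f) z _), map_sum, Finset.mul_sum]
    exact Finset.sum_congr rfl fun j _ => by rw [map_smul, mul_smul_comm]
  have hanti : ∀ a : Fibre n, a = -a → a = 0 := fun a ha => by
    have h2 : (2 : ℝ) • a = 0 := by rw [two_smul]; nth_rewrite 2 [ha]; simp
    simpa using h2
  apply hanti
  conv_lhs => rw [key, Finset.sum_comm]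
  rw [key, ← Finset.sum_neg_distrib]
  refine Finset.sum_congr rfl fun i _ => ?_
  rw [← Finset.sum_neg_distrib]
  refine Finset.sum_congr rfl fun j _ => ?_
  rw [hsym.eq, ← smul_neg]
  congr 1
  rw [eq_neg_iff_add_eq_zero]
  exact ExteriorAlgebra.ι_add_mul_swap _ _

variable {X : Type} [TopologicalSpace X] [ChartedSpace (E n) X]

theorem inChart_congr {η η' : X → Fibre n} {x : X} (h : η =ᶠ[nhds x] η') :
    inChart η x =ᶠ[nhds (extChartAt (𝓡 n) x x)] inChart η' x := by
  have hc := continuousAt_extChartAt_symm (I := 𝓡 n) x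
  have : (extChartAt (𝓡 n) x).symm (extChartAt (𝓡 n) x x) = x := extChartAt_to_inv x
  rw [ContinuousAt, this] at hc
  filter_upwards [hc.eventually h] with z hz
  simp only [inChart, hz]

theorem d_congr {η η' : X → Fibre n} {x : X} (h : η =ᶠ[nhds x] η') : d η x = d η' x := by
  simp only [d, flatD, (inChart_congr h).fderiv_eq]

/-- Differentiability of a form in the chart at `x`, at the point `x`. -/
def DiffAt (η : X → Fibre n) (x : X) : Prop :=
  DifferentiableAt ℝ (inChart η x) (extChartAt (𝓡 n) x x)

theorem DiffAt.congr {η η' : X → Fibre n} {x : X} (h : η =ᶠ[nhds x] η') (H : DiffAt η x) :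
    DiffAt η' x :=
  DifferentiableAt.congr_of_eventuallyEq H (inChart_congr h).symm

theorem d_add {a b : X → Fibre n} {x : X} (ha : DiffAt a x) (hb : DiffAt b x) :
    DiffAt (a + b) x ∧ d (a + b) x = d a x + d b x := by
  have h : inChart (a + b) x = inChart a x + inChart b x := by
    funext z; simp [inChart]
  refine ⟨?_, ?_⟩
  · rw [DiffAt, h]; exact DifferentiableAt.add ha hb
  · have h2 : flatD (inChart a x + inChart b x) (extChartAt (𝓡 n) x x) =
        flatD (inChart a x) (extChartAt (𝓡 n) x x) +
          flatD (inChart b x) (extChartAt (𝓡 n) x x) := by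
      simp only [flatD, fderiv_add ha hb, _root_.add_apply, mul_add,
        Finset.sum_add_distrib]
    rw [d, h, h2, map_add]
    rfl

theorem d_involute {a : X → Fibre n} {x : X} (ha : DiffAt a x) :
    DiffAt (fun y => CliffordAlgebra.involute (a y)) x ∧
      d (fun y => CliffordAlgebra.involute (a y)) x = -CliffordAlgebra.involute (d a x) := by
  have h : inChart (fun y => CliffordAlgebra.involute (a y)) x =
      fun z => CliffordAlgebra.involute (inChart a x z) := by
    funext z; simp only [inChart, pullFibre_involute]
  refine ⟨?_, ?_⟩
  · rw [DiffAt, h]; exact (fderiv_linear (CliffordAlgebra.involute).toLinearMap ha).1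
  · rw [d, h, flatD_involute ha, map_neg, pullFibre_involute]
    rfl

theorem involute_mem_generated {V : Set X} {η : X → Fibre n} (h : η ∈ generated n V) :
    (fun y => CliffordAlgebra.involute (η y)) ∈ generated n V := by
  induction h using Algebra.adjoin_induction with
  | mem φ hφ =>
    obtain ⟨f, hf, rfl | rfl⟩ := hφ
    · refine Algebra.subset_adjoin ⟨f, hf, Or.inl ?_⟩
      funext y; simp
    · have : (fun y => CliffordAlgebra.involute (differential n f y)) = -differential n f := by
        funext y; exact CliffordAlgebra.involute_ι _
      rw [this]
      exact neg_mem (Algebra.subset_adjoin ⟨f, hf, Or.inr rfl⟩)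
  | algebraMap r =>
    convert (generated n V).algebraMap_mem r using 1
    funext y; simp
  | add a b _ _ ha hb => convert add_mem ha hb using 1; funext y; simp
  | mul a b _ _ ha hb => convert mul_mem ha hb using 1; funext y; simp

variable [IsManifold (𝓡 n) ∞ X]

theorem pull_pull (x : X) (a : Fibre n) :
    pullFibre (chartDiff x)
      (pullFibre (chartSymmDiff x (extChartAt (𝓡 n) x x)) a)
      = a := by
  have h := mfderivWithin_extChartAt_symm_comp_mfderiv_extChartAt' (I := 𝓡 n)
    (mem_extChartAt_source (I := 𝓡 n) x)
  rw [ModelWithCorners.range_eq_univ, mfderivWithin_univ] at h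
  have h' : (chartSymmDiff x (extChartAt (𝓡 n) x x)).comp (chartDiff x) =
      ContinuousLinearMap.id ℝ (E n) := h
  induction a using ExteriorAlgebra.induction with
  | algebraMap r => simp
  | ι ξ =>
    rw [pullFibre_ι, pullFibre_ι, ContinuousLinearMap.comp_assoc]
    exact congrArg (fun L => ExteriorAlgebra.ι ℝ (ξ.comp L)) h'
  | mul a b ha hb => rw [map_mul, map_mul, ha, hb]
  | add a b ha hb => rw [map_add, map_add, ha, hb]

theorem pull_inChart (η : X → Fibre n) (x : X) :
    pullFibre (chartDiff x)
      (inChart η x (extChartAt (𝓡 n) x x)) = η x := by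
  rw [inChart, pull_pull, extChartAt_to_inv]

theorem d_mul {a b : X → Fibre n} {x : X} (ha : DiffAt a x) (hb : DiffAt b x) :
    DiffAt (a * b) x ∧ d (a * b) x = d a x * b x + CliffordAlgebra.involute (a x) * d b x := by
  have h : inChart (a * b) x = fun z => inChart a x z * inChart b x z := by
    funext z; simp [inChart]
  refine ⟨?_, ?_⟩
  · rw [DiffAt, h]; exact (differentiableAt_mul ha hb).1
  · rw [d, h, flatD_mul ha hb, map_add, map_mul, map_mul, pull_inChart, pullFibre_involute,
      pull_inChart]
    rfl

theorem contDiffAt_chart {V : Set X} (hV : IsOpen V) {f : X → ℝ}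
    (hf : ContMDiffOn (𝓡 n) 𝓘(ℝ, ℝ) ∞ f V) {x : X} (hx : x ∈ V) :
    ContDiffAt ℝ ∞ (f ∘ (extChartAt (𝓡 n) x).symm) (extChartAt (𝓡 n) x x) := by
  have h := (contMDiffAt_iff_of_mem_source (I := 𝓡 n) (I' := 𝓘(ℝ, ℝ)) (x' := x) (x := x)
    (y := f x) (mem_chart_source _ x) (by simp)).1 (hf.contMDiffAt (hV.mem_nhds hx))
  have h2 := h.2
  simp only [ModelWithCorners.range_eq_univ, contDiffWithinAt_univ] at h2
  exact h2

theorem mfderiv_symm {V : Set X} (hV : IsOpen V) {f : X → ℝ}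
    (hf : ContMDiffOn (𝓡 n) 𝓘(ℝ, ℝ) ∞ f V) {x : X} {z : E n}
    (hz : z ∈ (extChartAt (𝓡 n) x).target) (hzV : (extChartAt (𝓡 n) x).symm z ∈ V) :
    pullFibre (chartSymmDiff x z) (differential n f ((extChartAt (𝓡 n) x).symm z)) =
      ExteriorAlgebra.ι ℝ (fderiv ℝ (f ∘ (extChartAt (𝓡 n) x).symm) z) := by
  have h1 : MDifferentiableAt (𝓡 n) 𝓘(ℝ, ℝ) f ((extChartAt (𝓡 n) x).symm z) :=
    (hf.contMDiffAt (hV.mem_nhds hzV)).mdifferentiableAt (by simp)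
  have h2 : MDifferentiableAt 𝓘(ℝ, E n) (𝓡 n) (extChartAt (𝓡 n) x).symm z := by
    have := mdifferentiableWithinAt_extChartAt_symm (I := 𝓡 n) hz
    rwa [ModelWithCorners.range_eq_univ, mdifferentiableWithinAt_univ] at this
  have h3 := mfderiv_comp z h1 h2
  rw [mfderiv_eq_fderiv] at h3
  exact (pullFibre_ι _ _).trans (congrArg (ExteriorAlgebra.ι ℝ (M := E n →L[ℝ] ℝ)) h3.symm)

theorem fderiv_comp_chart {V : Set X} (hV : IsOpen V) {f : X → ℝ}
    (hf : ContMDiffOn (𝓡 n) 𝓘(ℝ, ℝ) ∞ f V) {x : X} (hx : x ∈ V) :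
    pullFibre (chartDiff x)
      (ExteriorAlgebra.ι ℝ (fderiv ℝ (f ∘ (extChartAt (𝓡 n) x).symm) (extChartAt (𝓡 n) x x))) =
      differential n f x := by
  have h := mfderiv_symm hV hf (mem_extChartAt_target (I := 𝓡 n) x)
    (by rwa [extChartAt_to_inv])
  rw [← h, pull_pull, extChartAt_to_inv]

theorem d_function {V : Set X} (hV : IsOpen V) {f : X → ℝ}
    (hf : ContMDiffOn (𝓡 n) 𝓘(ℝ, ℝ) ∞ f V) {x : X} (hx : x ∈ V) :
    DiffAt (fun y => algebraMap ℝ (Fibre n) (f y)) x ∧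
    d (fun y => algebraMap ℝ (Fibre n) (f y)) x =
      differential n f x := by
  have h : inChart (fun y => algebraMap ℝ (Fibre n) (f y)) x =
      fun z => algebraMap ℝ (Fibre n) ((f ∘ (extChartAt (𝓡 n) x).symm) z) := by
    funext z; simp [inChart]
  have hd := flatD_algebraMap ((contDiffAt_chart hV hf hx).differentiableAt (by simp))
  refine ⟨?_, ?_⟩
  · rw [DiffAt, h]; exact hd.1
  · rw [d, h, hd.2, fderiv_comp_chart hV hf hx]

theorem d_differential {V : Set X} (hV : IsOpen V) {f : X → ℝ}
    (hf : ContMDiffOn (𝓡 n) 𝓘(ℝ, ℝ) ∞ f V) {x : X} (hx : x ∈ V) :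
    DiffAt (differential n f) x ∧
    d (differential n f) x = 0 := by
  have h : inChart (differential n f) x
      =ᶠ[nhds (extChartAt (𝓡 n) x x)] fun z => (ExteriorAlgebra.ι ℝ
        (fderiv ℝ (f ∘ (extChartAt (𝓡 n) x).symm) z) : Fibre n) := by
    have hc := continuousAt_extChartAt_symm (I := 𝓡 n) x
    rw [ContinuousAt, extChartAt_to_inv] at hc
    filter_upwards [hc.eventually (hV.mem_nhds hx),
      extChartAt_target_mem_nhds (I := 𝓡 n) x] with z hz1 hz2
    exact mfderiv_symm hV hf hz2 hz1
  have hd := flatD_ι_fderiv (contDiffAt_chart hV hf hx)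
  refine ⟨hd.1.congr_of_eventuallyEq h, ?_⟩
  have h2 : flatD (inChart (differential n f) x) (extChartAt (𝓡 n) x x) = 0 := by
    rw [← hd.2]
    simp only [flatD, h.fderiv_eq]
  rw [d, h2, map_zero]

theorem exists_d {V : Set X} (hV : IsOpen V) {η : X → Fibre n} (h : η ∈ generated n V) :
    (∀ x ∈ V, DiffAt η x) ∧ ∃ η' ∈ generated n V, ∀ x ∈ V, DiffAt η' x ∧ d η x = η' x ∧
      d η' x = 0 := by
  have hzero : ∀ x : X, DiffAt (0 : X → Fibre n) x ∧ d (0 : X → Fibre n) x = 0 := by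
    intro x
    have h0 : inChart (0 : X → Fibre n) x = 0 := by funext z; simp [inChart]
    refine ⟨?_, ?_⟩
    · rw [DiffAt, h0]; exact differentiableAt_const 0
    · have : flatD (0 : E n → Fibre n) (extChartAt (𝓡 n) x x) = 0 := by simp [flatD]
      rw [d, h0, this, map_zero]
  induction h using Algebra.adjoin_induction with
  | mem φ hφ =>
    obtain ⟨f, hf, rfl | rfl⟩ := hφ
    · exact ⟨fun x hx => (d_function hV hf hx).1, _, Algebra.subset_adjoin ⟨f, hf, Or.inr rfl⟩,
        fun x hx => ⟨(d_differential hV hf hx).1, (d_function hV hf hx).2,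
          (d_differential hV hf hx).2⟩⟩
    · exact ⟨fun x hx => (d_differential hV hf hx).1, 0, zero_mem _,
        fun x hx => ⟨(hzero x).1, (d_differential hV hf hx).2, (hzero x).2⟩⟩
  | algebraMap r =>
    have hf : ContMDiffOn (𝓡 n) 𝓘(ℝ, ℝ) ∞ (fun _ : X => r) V := contMDiffOn_const
    refine ⟨fun x hx => (d_function hV hf hx).1, 0, zero_mem _,
        fun x hx => ⟨(hzero x).1, ?_, (hzero x).2⟩⟩
    have := (d_function hV hf hx).2
    have h0 : differential n (fun _ : X => r) x = 0 :=
      (congrArg (ExteriorAlgebra.ι ℝ (M := E n →L[ℝ] ℝ)) mfderiv_const).trans (map_zero _)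
    exact this.trans h0
  | add a b _ _ ha hb =>
    obtain ⟨ha, a', ha'm, ha'⟩ := ha
    obtain ⟨hb, b', hb'm, hb'⟩ := hb
    refine ⟨fun x hx => (d_add (ha x hx) (hb x hx)).1, a' + b', add_mem ha'm hb'm,
      fun x hx => ⟨(d_add (ha' x hx).1 (hb' x hx).1).1, ?_, ?_⟩⟩
    · rw [(d_add (ha x hx) (hb x hx)).2, (ha' x hx).2.1, (hb' x hx).2.1]; rfl
    · rw [(d_add (ha' x hx).1 (hb' x hx).1).2, (ha' x hx).2.2, (hb' x hx).2.2, add_zero]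
  | mul a b ham hbm ha hb =>
    obtain ⟨ha, a', ha'm, ha'⟩ := ha
    obtain ⟨hb, b', hb'm, hb'⟩ := hb
    refine ⟨fun x hx => (d_mul (ha x hx) (hb x hx)).1,
      a' * b + (fun y => CliffordAlgebra.involute (a y)) * b',
      add_mem (mul_mem ha'm hbm) (mul_mem (involute_mem_generated ham) hb'm), fun x hx => ?_⟩
    have h1 := d_mul (ha' x hx).1 (hb x hx)
    have h2 := d_mul (d_involute (ha x hx)).1 (hb' x hx).1
    refine ⟨(d_add h1.1 h2.1).1, ?_, ?_⟩
    · rw [(d_mul (ha x hx) (hb x hx)).2, (ha' x hx).2.1, (hb' x hx).2.1]; rfl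
    · rw [(d_add h1.1 h2.1).2, h1.2, h2.2, (ha' x hx).2.2, (hb' x hx).2.2,
        (d_involute (ha x hx)).2, (ha' x hx).2.1, (hb' x hx).2.1]
      simp


end Lemmas

end DiffForm

/-- A graded space with a homological vector field: a derivation `Q` of degree `1` of the structure
sheaf with `Q² = 0`. -/
structure QSpace extends GradedSpace where
  Q : ∀ {U : Opens carrier} {k l : ℤ}, k + 1 = l → sec U k →ₗ[ℝ] sec U l
  Q_mul : ∀ {U : Opens carrier} {i j k i' j' k' : ℤ} (hi : i + 1 = i') (hj : j + 1 = j')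
    (hk : k + 1 = k') (h : i + j = k) (h₁ : i' + j = k') (h₂ : i + j' = k')
    (a : sec U i) (b : sec U j),
    Q hk (mul h a b) = mul h₁ (Q hi a) b + i.negOnePow • mul h₂ a (Q hj b)
  Q_Q : ∀ {U : Opens carrier} {k l m : ℤ} (hl : k + 1 = l) (hm : l + 1 = m) (a : sec U k),
    Q hm (Q hl a) = 0
  Q_res : ∀ {U V : Opens carrier} (h : V ≤ U) {k l : ℤ} (hl : k + 1 = l) (a : sec U k),
    Q hl (res h a) = res h (Q hl a)

namespace DiffForm

attribute [local instance] fibreNorm fibreNormedSpace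

section Sections

variable {n : ℕ} {X : Type} [TopologicalSpace X]

open Classical in
/-- Extension by zero. -/
noncomputable def extendZero {U : Opens X} (η : U → Fibre n) (x : X) : Fibre n :=
  if h : x ∈ U then η ⟨x, h⟩ else 0

theorem extendZero_eventuallyEq {U V : Opens X} (hV : V ≤ U) {η : U → Fibre n}
    {θ : X → Fibre n} (h : ∀ y : V, η ⟨y.1, hV y.2⟩ = θ y) {x : X} (hx : x ∈ V) :
    extendZero η =ᶠ[nhds x] θ := by
  filter_upwards [V.isOpen.mem_nhds hx] with y hy
  rw [extendZero, dif_pos (hV hy)]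
  exact h ⟨y, hy⟩

theorem extendZero_apply {U : Opens X} (η : U → Fibre n) (x : U) : extendZero η x = η x :=
  dif_pos x.2

theorem extendZero_mem {U : Opens X} {k : ℤ} {η : U → Fibre n} (h : ∀ x, η x ∈ degreePart n k)
    (x : X) : extendZero η x ∈ degreePart n k := by
  unfold extendZero
  split_ifs with hx
  · exact h _
  · exact zero_mem _

variable [ChartedSpace (E n) X]

/-- Smooth differential forms of degree `k` over `U`: locally, they are sums of products
`f dg₁ ∧ ⋯ ∧ dgₖ`. -/
def IsForm (U : Opens X) (k : ℤ) (η : U → Fibre n) : Prop :=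
  (∀ x, η x ∈ degreePart n k) ∧
  ∀ x : U, ∃ V : Opens X, x.1 ∈ V ∧ ∃ hV : V ≤ U, ∃ θ ∈ generated n (V : Set X),
    ∀ y : V, η ⟨y.1, hV y.2⟩ = θ y

/-- The exterior derivative of a form over `U`. -/
noncomputable def dOn {U : Opens X} (η : U → Fibre n) (x : U) : Fibre n := d (extendZero η) x

theorem generated_mono {V W : Set X} (h : V ⊆ W) : generated n W ≤ generated n V :=
  Algebra.adjoin_mono fun _ ⟨f, hf, hφ⟩ => ⟨f, hf.mono h, hφ⟩

theorem dOn_inclusion {U V : Opens X} (hV : V ≤ U) (η : U → Fibre n) (x : V) :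
    dOn (fun y : V => η ⟨y.1, hV y.2⟩) x = dOn η ⟨x.1, hV x.2⟩ := by
  refine d_congr ?_
  refine extendZero_eventuallyEq le_rfl (fun y => ?_) x.2
  exact (extendZero_apply η ⟨y.1, hV y.2⟩).symm

theorem one_mem_degreePart : (1 : Fibre n) ∈ degreePart n 0 :=
  SetLike.GradedOne.one_mem (A := fun i : ℕ => ⋀[ℝ]^i (E n →L[ℝ] ℝ))

theorem degreePart_nat (m : ℕ) : degreePart n (m : ℤ) = ⋀[ℝ]^m (E n →L[ℝ] ℝ) := rfl

theorem eq_zero_or_nat {k : ℤ} {a : Fibre n} (ha : a ∈ degreePart n k) :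
    a = 0 ∨ ∃ m : ℕ, k = m ∧ a ∈ ⋀[ℝ]^m (E n →L[ℝ] ℝ) := by
  rcases k with m | m
  · exact Or.inr ⟨m, rfl, ha⟩
  · exact Or.inl ((Submodule.mem_bot ℝ).1 ha)

theorem mul_mem_degreePart {i j k : ℤ} (hk : i + j = k) {a b : Fibre n}
    (ha : a ∈ degreePart n i) (hb : b ∈ degreePart n j) : a * b ∈ degreePart n k := by
  rcases eq_zero_or_nat ha with rfl | ⟨p, rfl, ha⟩
  · simp
  rcases eq_zero_or_nat hb with rfl | ⟨q, rfl, hb⟩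
  · simp
  obtain rfl : k = ((p + q : ℕ) : ℤ) := by rw [← hk]; push_cast; rfl
  exact SetLike.GradedMul.mul_mem (A := fun i : ℕ => ⋀[ℝ]^i (E n →L[ℝ] ℝ)) ha hb

theorem negOnePow_smul (p : ℕ) (a : Fibre n) : ((p : ℤ).negOnePow) • a = (-1 : ℝ) ^ p • a := by
  rcases Nat.even_or_odd p with h | h
  · rw [Int.negOnePow_even _ (by exact_mod_cast h), h.neg_one_pow, one_smul, one_smul]
  · rw [Int.negOnePow_odd _ (by exact_mod_cast h), h.neg_one_pow, Units.neg_smul, one_smul,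
      neg_smul, one_smul]

theorem mul_comm_degreePart {i j : ℤ} {a b : Fibre n}
    (ha : a ∈ degreePart n i) (hb : b ∈ degreePart n j) :
    a * b = (i * j).negOnePow • (b * a) := by
  rcases eq_zero_or_nat ha with rfl | ⟨p, rfl, ha⟩
  · simp
  rcases eq_zero_or_nat hb with rfl | ⟨q, rfl, hb⟩
  · simp
  rw [mul_comm_of_mem ha hb, ← Nat.cast_mul, negOnePow_smul]

theorem involute_degreePart {i : ℤ} {a : Fibre n} (ha : a ∈ degreePart n i) :
    CliffordAlgebra.involute a = i.negOnePow • a := by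
  rcases eq_zero_or_nat ha with rfl | ⟨p, rfl, ha⟩
  · simp
  rw [involute_of_mem ha, negOnePow_smul]

theorem pullFibre_mem {k : ℤ} (L : E n →L[ℝ] E n) {a : Fibre n} (ha : a ∈ degreePart n k) :
    pullFibre L a ∈ degreePart n k := by
  rcases eq_zero_or_nat ha with rfl | ⟨p, rfl, ha⟩
  · simp
  rw [degreePart_nat]
  change pullFibre L a ∈ LinearMap.range (ExteriorAlgebra.ι ℝ (M := E n →L[ℝ] ℝ)) ^ p
  induction ha using Submodule.pow_induction_on_left' with
  | algebraMap r =>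
    rw [AlgHom.commutes]
    exact (Submodule.mem_one (R := ℝ)).2 ⟨r, rfl⟩
  | add x y i hx hy ihx ihy => rw [map_add]; exact add_mem (ihx hx) (ihy hy)
  | mem_mul v hv i x hx ih =>
    obtain ⟨ξ, rfl⟩ := hv
    rw [map_mul, pullFibre_ι, Nat.succ_eq_add_one, pow_succ']
    exact Submodule.mul_mem_mul ⟨_, rfl⟩ (ih hx)

theorem ι_mem_degreePart (ξ : E n →L[ℝ] ℝ) : ExteriorAlgebra.ι ℝ ξ ∈ degreePart n 1 := by
  change _ ∈ LinearMap.range (ExteriorAlgebra.ι ℝ (M := E n →L[ℝ] ℝ)) ^ 1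
  rw [pow_one]
  exact ⟨ξ, rfl⟩

theorem fderiv_mem {P : Submodule ℝ (Fibre n)} {F : E n → Fibre n} {z : E n}
    (hF : ∀ᶠ w in nhds z, F w ∈ P) (v : E n) : fderiv ℝ F z v ∈ P := by
  by_cases hd : DifferentiableAt ℝ F z
  · by_contra hv
    obtain ⟨f, hfv, hP⟩ := Submodule.exists_le_ker_of_notMem hv
    have h1 := (fderiv_linear ((Algebra.linearMap ℝ (Fibre n)).comp f) hd).2 v
    have h0 : (fun w => ((Algebra.linearMap ℝ (Fibre n)).comp f) (F w)) =ᶠ[nhds z] fun _ => 0 := by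
      filter_upwards [hF] with w hw
      have : f (F w) = 0 := hP hw
      simp [this]
    rw [h0.fderiv_eq, fderiv_fun_const] at h1
    refine hfv ((ExteriorAlgebra.algebraMap_inj (E n →L[ℝ] ℝ) _ _).1 ?_)
    rw [map_zero]
    exact h1.symm
  · rw [fderiv_zero_of_not_differentiableAt hd]
    exact P.zero_mem

theorem d_mem {k l : ℤ} (hl : k + 1 = l) {η : X → Fibre n} (h : ∀ x, η x ∈ degreePart n k)
    (x : X) : d η x ∈ degreePart n l := by
  refine pullFibre_mem _ (sum_mem fun i _ => ?_)
  refine mul_mem_degreePart (by rw [← hl, add_comm]) (ι_mem_degreePart _) (fderiv_mem ?_ _)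
  exact Filter.Eventually.of_forall fun w => pullFibre_mem _ (h _)

theorem IsForm.add {U : Opens X} {k : ℤ} {η θ : U → Fibre n} (hη : IsForm U k η)
    (hθ : IsForm U k θ) : IsForm U k (η + θ) := by
  refine ⟨fun x => add_mem (hη.1 x) (hθ.1 x), fun x => ?_⟩
  obtain ⟨V, hxV, hV, a, ha, ha'⟩ := hη.2 x
  obtain ⟨W, hxW, hW, b, hb, hb'⟩ := hθ.2 x
  refine ⟨V ⊓ W, ⟨hxV, hxW⟩, inf_le_left.trans hV, a + b,
    add_mem (generated_mono Set.inter_subset_left ha)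
      (generated_mono Set.inter_subset_right hb), fun y => ?_⟩
  exact congrArg₂ (· + ·) (ha' ⟨y.1, y.2.1⟩) (hb' ⟨y.1, y.2.2⟩)

theorem IsForm.mul {U : Opens X} {i j k : ℤ} (hk : i + j = k) {η θ : U → Fibre n}
    (hη : IsForm U i η) (hθ : IsForm U j θ) : IsForm U k (η * θ) := by
  refine ⟨fun x => mul_mem_degreePart hk (hη.1 x) (hθ.1 x), fun x => ?_⟩
  obtain ⟨V, hxV, hV, a, ha, ha'⟩ := hη.2 x
  obtain ⟨W, hxW, hW, b, hb, hb'⟩ := hθ.2 x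
  refine ⟨V ⊓ W, ⟨hxV, hxW⟩, inf_le_left.trans hV, a * b,
    mul_mem (generated_mono Set.inter_subset_left ha)
      (generated_mono Set.inter_subset_right hb), fun y => ?_⟩
  exact congrArg₂ (· * ·) (ha' ⟨y.1, y.2.1⟩) (hb' ⟨y.1, y.2.2⟩)

theorem IsForm.smul {U : Opens X} {k : ℤ} (c : ℝ) {η : U → Fibre n} (hη : IsForm U k η) :
    IsForm U k (c • η) := by
  refine ⟨fun x => Submodule.smul_mem _ c (hη.1 x), fun x => ?_⟩
  obtain ⟨V, hxV, hV, a, ha, ha'⟩ := hη.2 x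
  exact ⟨V, hxV, hV, c • a, Subalgebra.smul_mem _ ha c, fun y => congrArg (c • ·) (ha' y)⟩

theorem IsForm.zero (U : Opens X) (k : ℤ) : IsForm U k (0 : U → Fibre n) :=
  ⟨fun _ => zero_mem _, fun x => ⟨U, x.2, le_rfl, 0, zero_mem _, fun _ => rfl⟩⟩

theorem IsForm.one (U : Opens X) : IsForm U 0 (1 : U → Fibre n) :=
  ⟨fun _ => one_mem_degreePart, fun x => ⟨U, x.2, le_rfl, 1, one_mem _, fun _ => rfl⟩⟩

theorem IsForm.comp_inclusion {U V : Opens X} (h : V ≤ U) {k : ℤ} {η : U → Fibre n}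
    (hη : IsForm U k η) : IsForm V k fun y => η ⟨y.1, h y.2⟩ := by
  refine ⟨fun x => hη.1 _, fun x => ?_⟩
  obtain ⟨W, hxW, hW, a, ha, ha'⟩ := hη.2 ⟨x.1, h x.2⟩
  exact ⟨W ⊓ V, ⟨hxW, x.2⟩, inf_le_right, a, generated_mono Set.inter_subset_left ha,
    fun y => ha' ⟨y.1, y.2.1⟩⟩

theorem IsForm.of_local {U : Opens X} {I : Type} {V : I → Opens X} (hV : ∀ i, V i ≤ U)
    (hU : U ≤ iSup V) {k : ℤ} {η : U → Fibre n}
    (h : ∀ i, IsForm (V i) k fun y => η ⟨y.1, hV i y.2⟩) : IsForm U k η := by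
  refine ⟨fun x => ?_, fun x => ?_⟩ <;> obtain ⟨i, hi⟩ := Opens.mem_iSup.1 (hU x.2)
  · exact (h i).1 ⟨x.1, hi⟩
  · obtain ⟨W, hxW, hW, a, ha, ha'⟩ := (h i).2 ⟨x.1, hi⟩
    exact ⟨W, hxW, hW.trans (hV i), a, ha, ha'⟩

/-- The differential forms of degree `k` over `U`. -/
noncomputable def forms (U : Opens X) (k : ℤ) : Submodule ℝ (U → Fibre n) where
  carrier := {η | IsForm U k η}
  add_mem' := IsForm.add
  zero_mem' := IsForm.zero U k
  smul_mem' := fun c _ h => h.smul c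

variable [IsManifold (𝓡 n) ∞ X]

theorem IsForm.d_spec {U : Opens X} {k : ℤ} {η : U → Fibre n} (hη : IsForm U k η) (x : U) :
    DiffAt (extendZero η) x ∧ ∃ V : Opens X, x.1 ∈ V ∧ ∃ hV : V ≤ U,
      ∃ θ ∈ generated n (V : Set X), ∀ y : V, dOn η ⟨y.1, hV y.2⟩ = θ y ∧ DiffAt θ y ∧
        d θ y = 0 := by
  obtain ⟨V, hxV, hV, a, ha, ha'⟩ := hη.2 x
  obtain ⟨h1, a', ha'm, h2⟩ := exists_d V.isOpen ha
  have he : ∀ y : V, extendZero η =ᶠ[nhds y.1] a := fun y => extendZero_eventuallyEq hV ha' y.2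
  refine ⟨(h1 x hxV).congr (he ⟨x, hxV⟩).symm, V, hxV, hV, a', ha'm, fun y =>
    ⟨?_, (h2 y y.2).1, (h2 y y.2).2.2⟩⟩
  rw [dOn, d_congr (he y), (h2 y y.2).2.1]

theorem IsForm.dOn {U : Opens X} {k l : ℤ} (hl : k + 1 = l) {η : U → Fibre n}
    (hη : IsForm U k η) : IsForm U l (dOn η) := by
  refine ⟨fun x => d_mem hl (extendZero_mem hη.1) x, fun x => ?_⟩
  obtain ⟨_, V, hxV, hV, a, ha, ha'⟩ := hη.d_spec x
  exact ⟨V, hxV, hV, a, ha, fun y => (ha' y).1⟩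

theorem dOn_dOn {U : Opens X} {k : ℤ} {η : U → Fibre n} (hη : IsForm U k η) (x : U) :
    DiffForm.dOn (DiffForm.dOn η) x = 0 := by
  obtain ⟨_, V, hxV, hV, a, ha, ha'⟩ := hη.d_spec x
  rw [DiffForm.dOn, d_congr (extendZero_eventuallyEq hV (fun y => (ha' y).1) hxV)]
  exact (ha' ⟨x, hxV⟩).2.2

theorem dOn_mul {U : Opens X} {i j : ℤ} {η θ : U → Fibre n}
    (hη : IsForm U i η) (hθ : IsForm U j θ) (x : U) :
    DiffForm.dOn (η * θ) x =
      DiffForm.dOn η x * θ x + i.negOnePow • (η x * DiffForm.dOn θ x) := by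
  have h : extendZero (η * θ) = extendZero η * extendZero θ := by
    funext y
    by_cases hy : y ∈ U <;> simp [extendZero, hy]
  rw [DiffForm.dOn, h, (d_mul (hη.d_spec x).1 (hθ.d_spec x).1).2, extendZero_apply,
    extendZero_apply, involute_degreePart (hη.1 x), smul_mul_assoc]
  rfl

theorem dOn_add {U : Opens X} {i : ℤ} {η θ : U → Fibre n}
    (hη : IsForm U i η) (hθ : IsForm U i θ) :
    DiffForm.dOn (η + θ) = DiffForm.dOn η + DiffForm.dOn θ := by
  have h : extendZero (η + θ) = extendZero η + extendZero θ := by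
    funext y
    by_cases hy : y ∈ U <;> simp [extendZero, hy]
  funext x
  rw [DiffForm.dOn, h, (d_add (hη.d_spec x).1 (hθ.d_spec x).1).2]
  rfl

theorem dOn_smul {U : Opens X} {i : ℤ} (c : ℝ) {η : U → Fibre n} (hη : IsForm U i η) :
    DiffForm.dOn (c • η) = c • DiffForm.dOn η := by
  funext x
  have hc : IsForm U 0 (c • (1 : U → Fibre n)) := (IsForm.one U).smul c
  have hcc : DiffForm.dOn (c • (1 : U → Fibre n)) x = 0 := by
    have h := d_function (n := n) U.isOpen (f := fun _ : X => c) contMDiffOn_const x.2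
    have h0 : differential n (fun _ : X => c) x.1 = 0 :=
      (congrArg (ExteriorAlgebra.ι ℝ (M := E n →L[ℝ] ℝ)) mfderiv_const).trans (map_zero _)
    have he : extendZero (c • (1 : U → Fibre n)) =ᶠ[nhds x.1]
        fun _ => algebraMap ℝ (Fibre n) c :=
      extendZero_eventuallyEq le_rfl (fun y => by
        rw [Algebra.algebraMap_eq_smul_one]; rfl) x.2
    rw [DiffForm.dOn, d_congr he]
    exact h.2.trans h0
  have hmul : c • η = (c • (1 : U → Fibre n)) * η := by rw [smul_mul_assoc, one_mul]
  rw [hmul, dOn_mul hc hη, hcc]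
  simp

end Sections

end DiffForm

/-- The shifted tangent bundle `T[1]X` of a smooth `n`-dimensional manifold: its functions are the
differential forms on `X`, and its homological vector field is the de Rham differential. -/
noncomputable def shiftedTangent (n : ℕ) (X : Type) [TopologicalSpace X]
    [ChartedSpace (EuclideanSpace ℝ (Fin n)) X] [IsManifold (𝓡 n) ∞ X] : QSpace where
  carrier := X
  sec U k := DiffForm.forms (n := n) U k
  one U := ⟨1, DiffForm.IsForm.one U⟩
  mul {U i j k} h := LinearMap.mk₂ ℝ
    (fun a b => (⟨a.1 * b.1, DiffForm.IsForm.mul h a.2 b.2⟩ : DiffForm.forms (n := n) U k))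
    (fun _ _ _ => Subtype.ext (add_mul _ _ _))
    (fun _ _ _ => Subtype.ext (smul_mul_assoc _ _ _))
    (fun _ _ _ => Subtype.ext (mul_add _ _ _))
    (fun _ _ _ => Subtype.ext (mul_smul_comm _ _ _))
  one_mul a := Subtype.ext (one_mul a.1)
  mul_assoc _ _ _ _ a b c := Subtype.ext (mul_assoc a.1 b.1 c.1)
  mul_comm _ _ a b := Subtype.ext <| funext fun x =>
    DiffForm.mul_comm_degreePart (a.2.1 x) (b.2.1 x)
  res {U V} h {k} :=
    { toFun := fun a => ⟨fun y => a.1 ⟨y.1, h y.2⟩, a.2.comp_inclusion h⟩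
      map_add' := fun _ _ => rfl
      map_smul' := fun _ _ => rfl }
  res_self _ _ := rfl
  res_res _ _ _ := rfl
  res_one _ := rfl
  res_mul _ _ _ _ _ _ _ := rfl
  locality {U I} V hV hU k a b hab := Subtype.ext <| by
    funext y
    obtain ⟨i, hi⟩ := Opens.mem_iSup.1 (hU y.2)
    exact congrFun (congrArg Subtype.val (hab i)) ⟨y.1, hi⟩
  gluing {U I} V hV hU k s hs := by
    choose i hi using fun y : U => Opens.mem_iSup.1 (hU y.2)
    have key : ∀ (j : I) (y : V j),
        (s (i ⟨y.1, hV j y.2⟩)).1 ⟨y.1, hi ⟨y.1, hV j y.2⟩⟩ = (s j).1 y := fun j y =>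
      congrFun (congrArg Subtype.val (hs (i ⟨y.1, hV j y.2⟩) j))
        ⟨y.1, hi ⟨y.1, hV j y.2⟩, y.2⟩
    refine ⟨⟨fun y => (s (i y)).1 ⟨y.1, hi y⟩, DiffForm.IsForm.of_local hV hU fun j => ?_⟩,
      fun j => Subtype.ext (funext fun y => key j y)⟩
    have : (fun y : V j => (s (i ⟨y.1, hV j y.2⟩)).1 ⟨y.1, hi ⟨y.1, hV j y.2⟩⟩) = (s j).1 :=
      funext fun y => key j y
    exact this ▸ (s j).2
  Q {U k l} h :=
    { toFun := fun a => ⟨DiffForm.dOn a.1, a.2.dOn h⟩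
      map_add' := fun a b => Subtype.ext (DiffForm.dOn_add a.2 b.2)
      map_smul' := fun c a => Subtype.ext (DiffForm.dOn_smul c a.2) }
  Q_mul _ _ _ _ _ _ a b := Subtype.ext (funext (DiffForm.dOn_mul a.2 b.2))
  Q_Q _ _ a := Subtype.ext (funext (DiffForm.dOn_dOn a.2))
  Q_res h _ _ _ a := Subtype.ext (funext (DiffForm.dOn_inclusion h a.1))

/-- A `ℤ`-graded supermanifold (of finite or countable dimension): a graded space, with regular
Hausdorff second countable underlying space, that is locally isomorphic to an open piece of a
space with global graded coordinates. -/
def IsGradedManifold (M : GradedSpace) : Prop :=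
  T3Space M ∧ SecondCountableTopology M ∧
  ∀ x : M, ∃ U : Opens M, x ∈ U ∧ ∃ (C : GradedCoords) (W : Opens C.toGradedSpace),
    Nonempty (M.restrict U ≅ C.toGradedSpace.restrict W)

/-- `P`, with the projections `p` and `q`, is the direct product of `A` and `B` in the category of
graded manifolds. -/
def IsGradedProduct {P A B : GradedSpace} (p : P ⟶ A) (q : P ⟶ B) : Prop :=
  ∀ N : GradedSpace, IsGradedManifold N → ∀ (f : N ⟶ A) (g : N ⟶ B),
    ∃! h : N ⟶ P, h ≫ p = f ∧ h ≫ q = g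

/-- A locally trivial graded bundle: every point of the base has a neighbourhood over which the
total space is the product of the base and a graded manifold. -/
def IsGradedBundle {P M : GradedSpace} (p : P ⟶ M) : Prop :=
  ∀ x : M, ∃ U : Opens M, x ∈ U ∧ ∃ F : GradedSpace, IsGradedManifold F ∧
    ∃ q : P.restrict (Opens.comap p.base U) ⟶ F, IsGradedProduct (GradedSpace.restrictHom p U) q

namespace QSpace

/-- An open subspace of a `Q`-space. -/
def restrict (M : QSpace) (U : Opens M.toGradedSpace) : QSpace where
  toGradedSpace := M.toGradedSpace.restrict U
  Q hl := M.Q hl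
  Q_mul := M.Q_mul
  Q_Q := M.Q_Q
  Q_res _ _ _ hl a := M.Q_res _ hl a

/-- A morphism of graded spaces that is compatible with the homological vector fields. -/
def IsQMap {M N : QSpace} (f : M.toGradedSpace ⟶ N.toGradedSpace) : Prop :=
  ∀ {U : Opens N.toGradedSpace} {V : Opens M.toGradedSpace} (h : V ≤ Opens.comap f.base U)
    {k l : ℤ} (hl : k + 1 = l) (a : N.sec U k), M.Q hl (f.pull h a) = f.pull h (N.Q hl a)

end QSpace

/-- The coordinates `w^α` of degree `deg α` and `v^α` of degree `deg α + 1` of the shifted tangent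
bundle `T[1]V`, where `w^α` are linear coordinates on a graded vector space `V`. -/
noncomputable def GradedCoords.shiftedTangent (C : GradedCoords) : GradedCoords where
  ι := C.ι ⊕ₗ C.ι
  countable := inferInstanceAs (Countable (C.ι ⊕ C.ι))
  deg i := Sum.elim C.deg (fun α => C.deg α + 1) (ofLex i)

/-- A contractible `Q`-manifold: it is isomorphic to `T[1]V` with its canonical homological vector
field, i.e. it has global coordinates `w^α`, `v^α` such that `Q w^α = v^α`. -/
def IsContractible (F : QSpace) : Prop :=
  ∃ (C : GradedCoords) (e : F.toGradedSpace ≅ C.shiftedTangent.toGradedSpace),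
    ∀ α : C.ι, F.Q (rfl : C.deg α + 1 = C.deg α + 1)
      (e.hom.pull (le_top : ⊤ ≤ Opens.comap e.hom.base ⊤)
        (C.shiftedTangent.coord (Sum.inlₗ α) ⊤)) =
      e.hom.pull (le_top : ⊤ ≤ Opens.comap e.hom.base ⊤)
        (C.shiftedTangent.coord (Sum.inrₗ α) ⊤)

/-- A `Q`-bundle that is locally trivial as a `Q`-bundle, with fibre `F`: every point of the base
has a neighbourhood over which the total space is the product, as a `Q`-manifold, of the base
and `F`. (The homological vector field of a product is the one for which both projections are
compatible with the homological vector fields.) -/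
def IsLocallyTrivialQBundle {P M : QSpace} (p : P.toGradedSpace ⟶ M.toGradedSpace)
    (F : QSpace) : Prop :=
  QSpace.IsQMap p ∧
  ∀ x : M.toGradedSpace, ∃ U : Opens M.toGradedSpace, x ∈ U ∧
    ∃ q : (P.restrict (Opens.comap p.base U)).toGradedSpace ⟶ F.toGradedSpace,
      QSpace.IsQMap q ∧ IsGradedProduct (GradedSpace.restrictHom p U) q

/-- A gauge pre-PDE over `T[1]X`: a `Q`-manifold with a `Q`-map to `T[1]X` that is locally trivial
as a bundle of graded manifolds (but not necessarily as a `Q`-bundle). -/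
structure GaugePrePDE (n : ℕ) (X : Type) [TopologicalSpace X]
    [ChartedSpace (EuclideanSpace ℝ (Fin n)) X] [IsManifold (𝓡 n) ∞ X] where
  total : QSpace
  isGradedManifold : IsGradedManifold total.toGradedSpace
  proj : total.toGradedSpace ⟶ (shiftedTangent n X).toGradedSpace
  isQMap_proj : QSpace.IsQMap proj
  isGradedBundle_proj : IsGradedBundle proj

/-- `E` is an equivalent reduction of `E'`: there is a projection `p` of `E'` to `E` over `T[1]X`
which is a locally trivial `Q`-bundle with contractible fibre and has a global `Q`-section `s`. -/
def IsEquivalentReduction {n : ℕ} {X : Type} [TopologicalSpace X]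
    [ChartedSpace (EuclideanSpace ℝ (Fin n)) X] [IsManifold (𝓡 n) ∞ X]
    (E E' : GaugePrePDE n X) : Prop :=
  ∃ p : E'.total.toGradedSpace ⟶ E.total.toGradedSpace, p ≫ E.proj = E'.proj ∧
    (∃ F : QSpace, IsContractible F ∧ IsLocallyTrivialQBundle p F) ∧
    ∃ s : E.total.toGradedSpace ⟶ E'.total.toGradedSpace, QSpace.IsQMap s ∧ s ≫ p = 𝟙 _

/-- The equivalence of gauge pre-PDEs: the equivalence relation generated by equivalent
reductions. -/
def GaugePrePDE.Equivalent {n : ℕ} {X : Type} [TopologicalSpace X]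
    [ChartedSpace (EuclideanSpace ℝ (Fin n)) X] [IsManifold (𝓡 n) ∞ X] :
    GaugePrePDE n X → GaugePrePDE n X → Prop :=
  Relation.EqvGen IsEquivalentReduction

namespace GradedSpace

variable {M N P : GradedSpace}

theorem comp_pull (f : M ⟶ N) (g : N ⟶ P) {U : Opens P} {W : Opens N} {V : Opens M}
    (h : V ≤ Opens.comap (f ≫ g).base U) (h₁ : V ≤ Opens.comap f.base W)
    (h₂ : W ≤ Opens.comap g.base U) {k : ℤ} (a : P.sec U k) :
    (f ≫ g).pull h a = f.pull h₁ (g.pull h₂ a) := by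
  have e : g.pull h₂ a = N.res h₂ (g.pull (le_refl (Opens.comap g.base U)) a) :=
    (g.res_pull (le_refl _) h₂ a).symm
  rw [e, f.pull_res h₁ h₂]
  rfl

theorem id_pull {U V : Opens M} (h : V ≤ Opens.comap (𝟙 M : M ⟶ M).base U) {k : ℤ}
    (a : M.sec U k) : (𝟙 M : M ⟶ M).pull h a = M.res h a := rfl

theorem hom_ext {f g : M ⟶ N} (hb : ∀ x, f.base x = g.base x)
    (hp : ∀ (U : Opens N) (V : Opens M) (hf : V ≤ Opens.comap f.base U)
      (hg : V ≤ Opens.comap g.base U) (k : ℤ) (a : N.sec U k), f.pull hf a = g.pull hg a) :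
    f = g :=
  Hom.ext_pull (ContinuousMap.ext hb) hp

theorem pull_congr {f g : M ⟶ N} (h : f = g) {U : Opens N} {V : Opens M}
    (hf : V ≤ Opens.comap f.base U) (hg : V ≤ Opens.comap g.base U) {k : ℤ} (a : N.sec U k) :
    f.pull hf a = g.pull hg a := by
  subst h; rfl

theorem openImage_le {Y : Type} [TopologicalSpace Y] (U : Opens Y) (W : Opens U) :
    openImage U W ≤ U := by
  rintro _ ⟨x, -, rfl⟩
  exact x.2

theorem mem_openImage {Y : Type} [TopologicalSpace Y] {U : Opens Y} {W : Opens U} {x : U} :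
    x.1 ∈ openImage U W ↔ x ∈ W :=
  ⟨fun ⟨y, hy, h⟩ => (Subtype.ext h : y = x) ▸ hy, fun h => ⟨x, h, rfl⟩⟩

/-- The inclusion of an open subspace. -/
def incl (M : GradedSpace) (U : Opens M) : M.restrict U ⟶ M :=
  have aux : ∀ {W : Opens M} {V : Opens U},
      V ≤ Opens.comap (⟨Subtype.val, continuous_subtype_val⟩ : C(U, M)) W →
      openImage U V ≤ W := by
    rintro W V h _ ⟨x, hx, rfl⟩
    exact h hx
  { base := ⟨Subtype.val, continuous_subtype_val⟩
    pull := fun h => M.res (aux h)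
    pull_one := fun h => M.res_one (aux h)
    pull_mul := fun h _ _ _ hk a b => M.res_mul (aux h) hk a b
    res_pull := fun h h' _ a => M.res_res (aux h) (openImage_mono U h') a
    pull_res := fun h h' _ a => M.res_res h' (aux h) a }

theorem incl_pull {U : Opens M} {W : Opens M} {V : Opens (M.restrict U)}
    (h : V ≤ Opens.comap (incl M U).base W) (h' : openImage U V ≤ W) {k : ℤ} (a : M.sec W k) :
    (incl M U).pull h a = M.res h' a := rfl

/-- The factorization of a morphism through an open subspace. -/
def lift (f : N ⟶ M) (U : Opens M) (hU : ∀ x, f.base x ∈ U) : N ⟶ M.restrict U :=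
  have aux : ∀ {W : Opens U} {V : Opens N},
      V ≤ Opens.comap (⟨fun x => ⟨f.base x, hU x⟩, by fun_prop⟩ : C(N, U)) W →
      V ≤ Opens.comap f.base (openImage U W) := by
    rintro W V h x hx
    exact ⟨_, h hx, rfl⟩
  { base := ⟨fun x => ⟨f.base x, hU x⟩, by fun_prop⟩
    pull := fun h => f.pull (aux h)
    pull_one := fun h => f.pull_one (aux h)
    pull_mul := fun h _ _ _ hk a b => f.pull_mul (aux h) hk a b
    res_pull := fun h h' _ a => f.res_pull (aux h) h' a
    pull_res := fun h h' _ a => f.pull_res (aux h) (openImage_mono _ h') a }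

@[simp] theorem lift_incl (f : N ⟶ M) (U : Opens M) (hU : ∀ x, f.base x ∈ U) :
    lift f U hU ≫ incl M U = f := by
  refine hom_ext (fun x => rfl) fun W V hf hg k a => ?_
  rw [comp_pull _ _ hf (W := Opens.comap (incl M U).base W) hf le_rfl]
  exact f.pull_res _ _ a

theorem incl_cancel {U : Opens M} {f g : N ⟶ M.restrict U}
    (h : f ≫ incl M U = g ≫ incl M U) : f = g := by
  have hb : ∀ x, f.base x = g.base x := fun x =>
    Subtype.ext (congrArg (fun φ : N ⟶ M => φ.base x) h)
  refine hom_ext hb fun W V hf hg k a => ?_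
  have h1 : W ≤ Opens.comap (incl M U).base (openImage U W) := fun x hx => ⟨x, hx, rfl⟩
  have e : a = (incl M U).pull h1 (k := k) a := (M.res_self _ a).symm
  have hf' : V ≤ Opens.comap (f ≫ incl M U).base (openImage U W) := fun x hx => h1 (hf hx)
  have hg' : V ≤ Opens.comap (g ≫ incl M U).base (openImage U W) := fun x hx => h1 (hg hx)
  exact (congrArg _ e).trans ((comp_pull f (incl M U) hf' hf h1 a).symm.trans
    ((pull_congr h hf' hg' a).trans
      ((comp_pull g (incl M U) hg' hg h1 a).trans (congrArg _ e.symm))))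

theorem restrictHom_incl (f : M ⟶ N) (U : Opens N) :
    restrictHom f U ≫ incl N U = incl M (Opens.comap f.base U) ≫ f := by
  refine hom_ext (fun x => rfl) fun W V hf hg k a => ?_
  have h1 : Opens.comap f.base W ≤ Opens.comap f.base W := le_rfl
  rw [comp_pull _ _ hf (W := Opens.comap (incl N U).base W) hf le_rfl,
    comp_pull _ _ hg (W := Opens.comap f.base W) hg le_rfl]
  refine (f.pull_res _ _ a).trans ?_
  exact (f.res_pull _ _ a).symm

/-- The inclusion of a smaller open subspace into a larger one. -/
def inclLE (M : GradedSpace) {U V : Opens M} (h : U ≤ V) : M.restrict U ⟶ M.restrict V :=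
  lift (incl M U) V fun x => h x.2

@[simp] theorem inclLE_incl {U V : Opens M} (h : U ≤ V) : inclLE M h ≫ incl M V = incl M U :=
  lift_incl _ _ _

/-- Sections that agree locally are equal. -/
theorem sec_ext {U : Opens M} {k : ℤ} {a b : M.sec U k}
    (h : ∀ x ∈ U, ∃ V : Opens M, ∃ hV : V ≤ U, x ∈ V ∧ M.res hV a = M.res hV b) : a = b := by
  choose V hV hx hab using fun x : U => h x.1 x.2
  exact M.locality V hV (fun x hx' => Opens.mem_iSup.2 ⟨⟨x, hx'⟩, hx ⟨x, hx'⟩⟩) a b hab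

theorem sec_bot_ext {U : Opens M} (hU : ∀ x, x ∉ U) {k : ℤ} (a b : M.sec U k) : a = b :=
  sec_ext fun x hx => absurd hx (hU x)

/-- Morphisms that agree locally on the source are equal. -/
theorem hom_ext_local {I : Type} {V : I → Opens M} (hV : ∀ x, ∃ i, x ∈ V i) {f g : M ⟶ N}
    (h : ∀ i, incl M (V i) ≫ f = incl M (V i) ≫ g) : f = g := by
  have hb : ∀ x, f.base x = g.base x := fun x => by
    obtain ⟨i, hi⟩ := hV x
    exact congrArg (fun φ : M.restrict (V i) ⟶ N => φ.base ⟨x, hi⟩) (h i)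
  refine hom_ext hb fun U W hf hg k a => sec_ext fun x hx => ?_
  obtain ⟨i, hi⟩ := hV x
  let W' : Opens (M.restrict (V i)) := Opens.comap (incl M (V i)).base W
  have hW' : openImage (V i) W' ≤ W := by
    rintro _ ⟨y, hy, rfl⟩
    exact hy
  refine ⟨openImage (V i) W', hW', ⟨⟨x, hi⟩, hx, rfl⟩, ?_⟩
  have hf' : W' ≤ Opens.comap (incl M (V i) ≫ f).base U := fun y hy => hf hy
  have hg' : W' ≤ Opens.comap (incl M (V i) ≫ g).base U := fun y hy => hg hy
  have := pull_congr (h i) hf' hg' a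
  rwa [comp_pull _ _ hf' (W := W) le_rfl hf, comp_pull _ _ hg' (W := W) le_rfl hg] at this

section Glue

variable {I : Type} (V : I → Opens M) (hV : ∀ x, ∃ i, x ∈ V i) (f : ∀ i, M.restrict (V i) ⟶ N)

theorem exists_glue_sec {U : Opens M} {k : ℤ} (W : ∀ i, Opens (M.restrict (V i)))
    (hW : ∀ i, openImage (V i) (W i) ≤ U) (hU : ∀ x ∈ U, ∃ i, x ∈ openImage (V i) (W i))
    (s : ∀ i, (M.restrict (V i)).sec (W i) k)
    (hs : ∀ i j (G : Opens M) (hi : G ≤ openImage (V i) (W i)) (hj : G ≤ openImage (V j) (W j)),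
      M.res hi (s i) = M.res hj (s j)) :
    ∃! a : M.sec U k, ∀ i, M.res (hW i) a = s i := by
  have hc : U ≤ iSup fun i => openImage (V i) (W i) := fun x hx => Opens.mem_iSup.2 (hU x hx)
  obtain ⟨a, ha⟩ := M.gluing (fun i => openImage (V i) (W i)) hW hc s fun i j => hs i j _ _ _
  exact ⟨a, ha, fun b hb => M.locality _ hW hc b a fun i => (hb i).trans (ha i).symm⟩

variable {V f}

theorem exists_glue_hom (hV : ∀ x, ∃ i, x ∈ V i)
    (hf : ∀ i j, inclLE M (inf_le_left : V i ⊓ V j ≤ V i) ≫ f i =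
      inclLE M (inf_le_right : V i ⊓ V j ≤ V j) ≫ f j) :
    ∃ g : M ⟶ N, ∀ i, incl M (V i) ≫ g = f i := by
  classical
  have hbase : ∀ i j x (hi : x ∈ V i) (hj : x ∈ V j), (f i).base ⟨x, hi⟩ = (f j).base ⟨x, hj⟩ :=
    fun i j x hi hj =>
      congrArg (fun φ : M.restrict (V i ⊓ V j) ⟶ N => φ.base ⟨x, hi, hj⟩) (hf i j)
  let b : C(M, N) := ContinuousMap.liftCover (fun i => (V i : Set M)) (fun i => (f i).base)
    hbase fun x => (hV x).imp fun i hi => (V i).isOpen.mem_nhds hi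
  have hb : ∀ i (x : V i), b x.1 = (f i).base x := fun i x => ContinuousMap.liftCover_coe _
  let W : ∀ (G : Opens M) i, Opens (M.restrict (V i)) := fun G i =>
    Opens.comap (incl M (V i)).base G
  have hWle : ∀ G i, openImage (V i) (W G i) ≤ G := by
    rintro G i _ ⟨x, hx, rfl⟩
    exact hx
  have hWc : ∀ (G : Opens M), ∀ x ∈ G, ∃ i, x ∈ openImage (V i) (W G i) := fun G x hx => by
    obtain ⟨i, hi⟩ := hV x
    exact ⟨i, ⟨x, hi⟩, hx, rfl⟩
  have hWf : ∀ {U : Opens N} {G : Opens M}, G ≤ Opens.comap b U → ∀ i,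
      W G i ≤ Opens.comap (f i).base U := fun {U G} h i x hx => by
    have := h hx
    exact (congrArg (· ∈ U) (hb i x)).mp this
  have agree : ∀ {U : Opens N} {G : Opens M} (h : G ≤ Opens.comap b U) {k : ℤ} (a : N.sec U k)
      (i j) (G' : Opens M) (hi : G' ≤ openImage (V i) (W G i))
      (hj : G' ≤ openImage (V j) (W G j)),
      M.res hi ((f i).pull (hWf h i) a) = M.res hj ((f j).pull (hWf h j) a) := by
    intro U G h k a i j G' hi hj
    let G'' : Opens (M.restrict (V i ⊓ V j)) := Opens.comap (incl M _).base G'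
    have e : G' ≤ openImage (V i ⊓ V j) G'' := fun x hx =>
      ⟨⟨x, openImage_le _ _ (hi hx), openImage_le _ _ (hj hx)⟩, hx, rfl⟩
    have hi' : G'' ≤ Opens.comap (inclLE M (inf_le_left : V i ⊓ V j ≤ V i)).base (W G i) :=
      fun x hx => hWle G i (hi hx)
    have hj' : G'' ≤ Opens.comap (inclLE M (inf_le_right : V i ⊓ V j ≤ V j)).base (W G j) :=
      fun x hx => hWle G i (hi hx)
    have key := pull_congr (hf i j) (U := U) (V := G'')
      (fun x hx => hWf h i (hi' hx)) (fun x hx => hWf h j (hj' hx)) a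
    have key1 := (comp_pull _ (f i) (fun x hx => hWf h i (hi' hx)) hi' (hWf h i) a).symm.trans
      (key.trans (comp_pull _ (f j) (fun x hx => hWf h j (hj' hx)) hj' (hWf h j) a))
    have key2 := congrArg (M.res e) key1
    refine Eq.trans ?_ (key2.trans ?_)
    · exact (M.res_res _ _ _).symm
    · exact M.res_res _ _ _
  have ex : ∀ {U : Opens N} {G : Opens M} (h : G ≤ Opens.comap b U) {k : ℤ} (a : N.sec U k),
      ∃! s : M.sec G k, ∀ i, M.res (hWle G i) s = (f i).pull (hWf h i) a :=
    fun {U G} h {k} a => exists_glue_sec V (W G) (hWle G) (hWc G)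
      (fun i => (f i).pull (hWf h i) a) (agree h a)
  choose p hp hpu using @ex
  have hp' : ∀ {U : Opens N} {G : Opens M} (h : G ≤ Opens.comap b U) {k : ℤ} (a : N.sec U k)
      (s : M.sec G k), (∀ i, M.res (hWle G i) s = (f i).pull (hWf h i) a) → p h a = s :=
    fun {U G} h {k} a s hs => (hpu h a s hs).symm
  let g : Hom M N :=
    { base := b
      pull := fun {U G} h {k} =>
        { toFun := p h
          map_add' := fun x y => hp' h _ _ fun i => by rw [map_add, map_add, hp, hp]; rfl
          map_smul' := fun c x => hp' h _ _ fun i => by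
            rw [map_smul, map_smul, hp, RingHom.id_apply]; rfl }
      pull_one := fun {U G} h => hp' h _ _ fun i => by rw [M.res_one, (f i).pull_one]; rfl
      pull_mul := fun {U G} h i j k hk a c => hp' h _ _ fun i => by
        rw [M.res_mul, (f i).pull_mul]
        simp only [LinearMap.coe_mk, AddHom.coe_mk, hp]
        rfl
      res_pull := fun {U G G'} h h' k a => (hp' (h'.trans h) _ _ fun i => by
        have hWW : W G' i ≤ W G i := fun x hx => h' hx
        rw [M.res_res]
        have := congrArg (M.res (openImage_mono (V i) hWW)) (hp h a i)
        rw [M.res_res] at this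
        refine this.trans ?_
        exact (f i).res_pull (hWf h i) hWW a).symm
      pull_res := fun {U U' G} h h' k a => hp' h _ _ fun i => by
        refine (hp _ a i).trans ?_
        exact ((f i).pull_res (hWf h i) h' a).symm }
  refine ⟨g, fun i => hom_ext (fun x => hb i x) fun U G h h' k a => ?_⟩
  have h1 : openImage (V i) G ≤ Opens.comap b U := by
    rintro _ ⟨x, hx, rfl⟩
    exact h hx
  have h2 : G ≤ Opens.comap (incl M (V i)).base (openImage (V i) G) := fun x hx => ⟨x, hx, rfl⟩
  have h3 : G ≤ W (openImage (V i) G) i := h2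
  rw [comp_pull (incl M (V i)) (g : M ⟶ N) h h2 h1]
  have h4 : openImage (V i) G ≤ openImage (V i) (W (openImage (V i) G) i) := openImage_mono _ h3
  have := congrArg (M.res h4) (hp h1 a i)
  rw [M.res_res] at this
  refine Eq.trans ?_ (this.trans ((f i).res_pull _ h3 a))
  exact incl_pull _ _ _

end Glue

/-- A morphism that is a homeomorphism of the underlying spaces and bijective on sections is an
isomorphism. -/
noncomputable def isoOfBijective (f : M ⟶ N) (h : M ≃ₜ N) (hb : ∀ x, f.base x = h x)
    (hf : ∀ (U : Opens N) (k : ℤ), Function.Bijective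
      (f.pull (le_refl (Opens.comap f.base U)) (k := k))) : M ≅ N := by
  have hsymm : ∀ {U : Opens M} {V : Opens N},
      V ≤ Opens.comap (⟨h.symm, h.symm.continuous⟩ : C(N, M)) U → Opens.comap f.base V ≤ U := by
    intro U V hV x hx
    have := hV hx
    change h.symm (f.base x) ∈ U at this
    rwa [hb, h.symm_apply_apply] at this
  let e : ∀ (V : Opens N) (k : ℤ), N.sec V k ≃ₗ[ℝ] M.sec (Opens.comap f.base V) k := fun V k =>
    LinearEquiv.ofBijective _ (hf V k)
  have he : ∀ V k a, e V k a = f.pull (le_refl (Opens.comap f.base V)) a := fun V k a => rfl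
  have key : ∀ {V : Opens N} {k : ℤ} {a : M.sec (Opens.comap f.base V) k} {b : N.sec V k},
      f.pull (le_refl (Opens.comap f.base V)) b = a → (e V k).symm a = b := fun h => by
    rw [LinearEquiv.symm_apply_eq]; exact h.symm
  have keys : ∀ {V : Opens N} {k : ℤ} (a : M.sec (Opens.comap f.base V) k),
      f.pull (le_refl (Opens.comap f.base V)) ((e V k).symm a) = a := fun a =>
    (e _ _).apply_symm_apply a
  let g : Hom N M :=
    { base := ⟨h.symm, h.symm.continuous⟩
      pull := fun {U V} hV k => (e V k).symm.toLinearMap.comp (M.res (hsymm hV))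
      pull_one := fun {U V} hV => key (by rw [f.pull_one, M.res_one])
      pull_mul := fun {U V} hV i j k hk a b => key (by
        rw [f.pull_mul, M.res_mul]
        exact congrArg₂ (fun x y => M.mul hk x y) (keys _) (keys _))
      res_pull := fun {U V V'} hV h' k a => (key (by
        rw [f.pull_res _ h']
        have h2 : Opens.comap f.base V' ≤ Opens.comap f.base V := fun x hx => h' hx
        rw [← f.res_pull (le_refl (Opens.comap f.base V)) h2]
        refine (congrArg (M.res h2) (keys _)).trans ?_
        exact M.res_res _ _ _)).symm
      pull_res := fun {U U' V} hV h' k a => key (by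
        refine (keys _).trans ?_
        exact (M.res_res _ _ _).symm) }
  exact
    { hom := f
      inv := g
      hom_inv_id := by
        refine hom_ext (fun x => ?_) fun U V h1 h2 k a => ?_
        · change h.symm (f.base x) = x
          rw [hb, h.symm_apply_apply]
        · rw [comp_pull f (g : N ⟶ M) h1 (W := Opens.comap g.base U) h1 le_rfl, id_pull]
          have h3 : V ≤ Opens.comap f.base (Opens.comap g.base U) := h1
          rw [← f.res_pull (le_refl _) h3]
          refine (congrArg (M.res h3) (keys _)).trans ?_
          exact M.res_res _ _ _
      inv_hom_id := by
        refine hom_ext (fun x => ?_) fun U V h1 h2 k a => ?_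
        · change f.base (h.symm x) = x
          rw [hb, h.apply_symm_apply]
        · have h4 : V ≤ Opens.comap g.base (Opens.comap f.base U) := h1
          rw [comp_pull (g : N ⟶ M) f h1 (W := Opens.comap f.base U) h4 le_rfl, id_pull]
          refine key ?_
          exact (f.pull_res _ h2 a).trans (f.res_pull _ _ a).symm }

end GradedSpace

theorem contDiff_nat_intervalIntegral {E : Type} [NormedAddCommGroup E] [NormedSpace ℝ E]
    [FiniteDimensional ℝ E] (n : ℕ) : ∀ {F : Type} [NormedAddCommGroup F] [NormedSpace ℝ F] [CompleteSpace F]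
    {h : ℝ × E → F} (_ : ContDiff ℝ ∞ h), ContDiff ℝ n (fun p => ∫ t in (0:ℝ)..1, h (t, p)) := by
  induction n with
  | zero =>
    intro F _ _ _ h hh
    refine contDiff_zero.2 ?_
    exact intervalIntegral.continuous_parametric_intervalIntegral_of_continuous' (f := fun p t => h (t, p)) (by
      have := hh.continuous; fun_prop) 0 1
  | succ n ih =>
    intro F _ _ _ h hh
    rw [show ((n + 1 : ℕ) : WithTop ℕ∞) = (n : WithTop ℕ∞) + 1 by norm_cast, contDiff_succ_iff_hasFDerivAt]
    let h' : ℝ × E → (E →L[ℝ] F) := fun q => (fderiv ℝ h q).comp (ContinuousLinearMap.inr ℝ ℝ E)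
    have hh' : ContDiff ℝ ∞ h' :=
      (hh.fderiv_right (m := ∞) (by simp)).clm_comp contDiff_const
    refine ⟨_, ih hh', fun p => ?_⟩
    have hc' : Continuous h' := hh'.continuous
    obtain ⟨B, hB⟩ := ((isCompact_Icc (a := (0:ℝ)) (b := 1)).prod (isCompact_closedBall p 1)).exists_bound_of_continuousOn hc'.continuousOn
    have hc := hh.continuous
    refine intervalIntegral.hasFDerivAt_integral_of_dominated_of_fderiv_le (F := fun p t => h (t, p)) (F' := fun p t => h' (t, p))
      (bound := fun _ => B) (Metric.ball_mem_nhds p one_pos) ?_ ?_ ?_ ?_ ?_ ?_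
    · exact Filter.Eventually.of_forall fun q => (by fun_prop : Continuous fun t => h (t, q)).aestronglyMeasurable
    · exact (by fun_prop : Continuous fun t => h (t, p)).intervalIntegrable _ _
    · exact (by fun_prop : Continuous fun t => h' (t, p)).aestronglyMeasurable
    · refine Filter.Eventually.of_forall fun t ht q hq => hB (t, q) ⟨?_, Metric.ball_subset_closedBall hq⟩
      rw [Set.uIoc_of_le zero_le_one] at ht
      exact ⟨ht.1.le, ht.2⟩
    · exact intervalIntegrable_const
    · refine Filter.Eventually.of_forall fun t ht q hq => ?_
      have h1 : HasFDerivAt h (fderiv ℝ h (t, q)) (t, q) := (hh.differentiable (by simp) _).hasFDerivAt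
      exact h1.comp q (hasFDerivAt_prodMk_right t q)

theorem hadamard {J : Type} [Fintype J] {g : (J → ℝ) → ℝ} (hg : ContDiff ℝ ∞ g) (b : J → ℝ) :
    ∃ u : J → (J → ℝ) → ℝ, (∀ j, ContDiff ℝ ∞ (u j)) ∧
      ∀ x, g x = g b + ∑ j, (x j - b j) * u j x := by
  classical
  have hd : ContDiff ℝ ∞ (fderiv ℝ g) := hg.fderiv_right (m := ∞) (by simp)
  have hk : ∀ j, ContDiff ℝ ∞ (fun q : ℝ × (J → ℝ) =>
      fderiv ℝ g (b + q.1 • (q.2 - b)) (Pi.single j 1)) := fun j =>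
    (hd.comp (contDiff_const.add (contDiff_fst.smul (contDiff_snd.sub contDiff_const)))).clm_apply
      contDiff_const
  refine ⟨fun j x => ∫ t in (0:ℝ)..1, fderiv ℝ g (b + t • (x - b)) (Pi.single j 1),
    fun j => contDiff_infty.2 fun n => contDiff_nat_intervalIntegral n (hk j), fun x => ?_⟩
  have h1 : ∀ t : ℝ, HasDerivAt (fun t : ℝ => g (b + t • (x - b))) (∑ j, (x j - b j) *
      fderiv ℝ g (b + t • (x - b)) (Pi.single j 1)) t := fun t => by
    have h2 : HasDerivAt (fun t : ℝ => b + t • (x - b)) (x - b) t := by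
      simpa using ((hasDerivAt_id t).smul_const (x - b)).const_add b
    have h3 := ((hg.differentiable (by simp) (b + t • (x - b))).hasFDerivAt).comp_hasDerivAt t h2
    refine h3.congr_deriv ?_
    generalize fderiv ℝ g (b + t • (x - b)) = L
    conv_lhs => rw [← Finset.univ_sum_single (x - b), map_sum]
    refine Finset.sum_congr rfl fun j _ => ?_
    rw [← smul_eq_mul, ← Pi.sub_apply, ← map_smul, ← Pi.single_smul, smul_eq_mul, mul_one]
  have hc : ∀ j, Continuous fun t : ℝ => fderiv ℝ g (b + t • (x - b)) (Pi.single j 1) := fun j =>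
    (hk j).continuous.comp (by fun_prop : Continuous fun t : ℝ => (t, x))
  have h4 := intervalIntegral.integral_eq_sub_of_hasDerivAt (a := 0) (b := 1) (fun t _ => h1 t)
    ((continuous_finsetSum _ fun j _ => continuous_const.mul (hc j)).intervalIntegrable _ _)
  rw [intervalIntegral.integral_finsetSum (f := fun j t => (x j - b j) * fderiv ℝ g (b + t • (x - b)) (Pi.single j 1))
    fun j _ => (continuous_const.mul (hc j)).intervalIntegrable _ _] at h4
  simp only [intervalIntegral.integral_const_mul] at h4
  rw [h4]; simp

namespace GradedCoords

variable {C : GradedCoords}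

/-- The product of functions on a coordinate space. -/
noncomputable def mulF {U : Opens C.Body} {i j k : ℤ} (h : i + j = k) (a : C.functions U i)
    (b : C.functions U j) : C.functions U k :=
  ⟨C.mulSeries a.1 b.1, IsFunction.mul h a.2 b.2⟩

/-- The restriction of functions on a coordinate space. -/
noncomputable def resF {U V : Opens C.Body} (h : V ≤ U) {k : ℤ} (f : C.functions U k) :
    C.functions V k :=
  ⟨fun α y => f.1 α ⟨y.1, h y.2⟩, f.2.comp_inclusion h⟩

/-- All coordinates in the monomial `α` are at least `i`, and `ξ^i ξ^α` is a monomial. -/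
def Above (C : GradedCoords) (i : C.ι) (α : C.ι →₀ ℕ) : Prop :=
  (∀ j ∈ α.support, i ≤ j) ∧ C.Admissible (α + Finsupp.single i 1)

theorem crossings_single_of_above {i : C.ι} {α : C.ι →₀ ℕ} (h : ∀ j ∈ α.support, i ≤ j) :
    C.crossings (Finsupp.single i 1) α = 0 := by
  unfold crossings
  rw [Finsupp.sum_single_index (by simp [Finsupp.sum])]
  refine Finset.sum_eq_zero fun j hj => ?_
  exact if_neg fun hji => (h j hj).not_gt hji.1

theorem coordSeries_of_deg_eq_zero {i : C.ι} (hi : C.deg i = 0) {U : Opens C.Body}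
    (α : C.ι →₀ ℕ) (y : U) : C.coordSeries i U α y = if α = 0 then y.1 ⟨i, hi⟩ else 0 := by
  simp [coordSeries, hi]

theorem coordSeries_of_deg_ne_zero {i : C.ι} (hi : C.deg i ≠ 0) {U : Opens C.Body}
    (α : C.ι →₀ ℕ) (y : U) :
    C.coordSeries i U α y = if α = Finsupp.single i 1 then 1 else 0 := by
  simp [coordSeries, hi]

/-- Multiplication by a series without coordinates of nonzero degree. -/
theorem mulSeries_of_concentrated {Y : Type} {f g : (C.ι →₀ ℕ) → Y → ℝ}
    (hf : ∀ α, α ≠ 0 → f α = 0) (hg : ∀ α, ¬ C.Admissible α → g α = 0) (γ : C.ι →₀ ℕ) (y : Y) :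
    C.mulSeries f g γ y = f 0 y * g γ y := by
  classical
  by_cases had : C.Admissible γ
  · simp only [mulSeries, had, if_true]
    rw [Finset.sum_eq_single_of_mem (0, γ) (by simp)]
    · simp [crossings]
    · rintro ⟨a, b⟩ hp hne
      rw [Finset.HasAntidiagonal.mem_antidiagonal] at hp
      have : a ≠ 0 := by
        rintro rfl
        simp at hp
        exact hne (by simp [hp])
      simp [hf a this]
  · simp [mulSeries, had, hg γ had]

theorem mulSeries_coord {i : C.ι} (hi : C.deg i ≠ 0) {U : Opens C.Body}
    {f : (C.ι →₀ ℕ) → U → ℝ} (hf : ∀ α, f α ≠ 0 → C.Above i α) (γ : C.ι →₀ ℕ) (y : U) :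
    C.mulSeries (C.coordSeries i U) f γ y = if γ i = 0 then 0 else f (γ - Finsupp.single i 1) y := by
  classical
  have hsub : ∀ {γ : C.ι →₀ ℕ}, γ i ≠ 0 → Finsupp.single i 1 + (γ - Finsupp.single i 1) = γ := by
    intro γ h
    rw [add_comm]
    exact tsub_add_cancel_of_le (Finsupp.single_le_iff.2 (Nat.one_le_iff_ne_zero.2 h))
  by_cases had : C.Admissible γ
  · simp only [mulSeries, had, if_true]
    split_ifs with h0
    · refine Finset.sum_eq_zero ?_
      rintro ⟨a, b⟩ hp
      rw [Finset.HasAntidiagonal.mem_antidiagonal] at hp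
      have : a ≠ Finsupp.single i 1 := by
        rintro rfl
        rw [← hp] at h0
        simp at h0
      simp [coordSeries_of_deg_ne_zero hi, this]
    · rw [Finset.sum_eq_single_of_mem (Finsupp.single i 1, γ - Finsupp.single i 1)
        (by simp [hsub h0])]
      · by_cases hz : f (γ - Finsupp.single i 1) = 0
        · simp [hz]
        · simp [coordSeries_of_deg_ne_zero hi, crossings_single_of_above (hf _ hz).1]
      · rintro ⟨a, b⟩ hp hne
        rw [Finset.HasAntidiagonal.mem_antidiagonal] at hp
        have : a ≠ Finsupp.single i 1 := by
          rintro rfl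
          refine hne (Prod.ext rfl ?_)
          simp only at hp ⊢
          rw [← hp, add_tsub_cancel_left]
        simp [coordSeries_of_deg_ne_zero hi, this]
  · simp only [mulSeries, had, if_false]
    split_ifs with h0
    · rfl
    · by_contra hz
      have h1 : f (γ - Finsupp.single i 1) ≠ 0 := fun h => hz (by simp [h])
      have := (hf _ h1).2
      rw [add_comm, hsub h0] at this
      exact had this

open Classical in
/-- The coordinate `i`, shifted so that it vanishes at `b`. -/
noncomputable def gen (C : GradedCoords) (b : C.Body) (i : C.ι) (U : Opens C.Body) :
    C.functions U (C.deg i) :=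
  ⟨C.coordSeries i U, C.coordSeries_isFunction i U⟩ -
    ⟨if h : C.deg i = 0 then b ⟨i, h⟩ • oneSeries U else 0, by
      split_ifs with h
      · rw [h]; exact (IsFunction.one U).smul _
      · exact IsFunction.zero U _⟩

theorem gen_of_deg_ne_zero {b : C.Body} {i : C.ι} (hi : C.deg i ≠ 0) (U : Opens C.Body) :
    (C.gen b i U).1 = C.coordSeries i U := by
  simp [gen, hi]

theorem gen_of_deg_eq_zero {b : C.Body} {i : C.ι} (hi : C.deg i = 0) (U : Opens C.Body)
    (α : C.ι →₀ ℕ) (y : U) :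
    (C.gen b i U).1 α y = if α = 0 then y.1 ⟨i, hi⟩ - b ⟨i, hi⟩ else 0 := by
  have : (C.gen b i U).1 = C.coordSeries i U - b ⟨i, hi⟩ • oneSeries U := by
    simp [gen, hi]
  rw [this]
  by_cases h : α = 0 <;> simp [coordSeries_of_deg_eq_zero hi, oneSeries, h]

theorem not_admissible_eq_zero {U : Opens C.Body} {k : ℤ} {f : (C.ι →₀ ℕ) → U → ℝ}
    (hf : C.IsFunction U k f) (α : C.ι →₀ ℕ) (h : ¬ C.Admissible α) : f α = 0 := by
  by_contra h'
  exact h (hf.1 α h').1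

/-- Functions of the coordinates of degree zero. -/
theorem isFunction_body {U : Opens C.Body} (J : Finset {i : C.ι // C.deg i = 0})
    {g : (J → ℝ) → ℝ} (hg : ContDiff ℝ ∞ g) :
    C.IsFunction U 0 fun α y => if α = 0 then g fun j => y.1 j else 0 := by
  refine ⟨fun α hα => ?_, fun _ => ⟨J, ∅, Set.univ, Filter.univ_mem, fun α hα y _ => ?_,
    fun α => ⟨fun z => if α = 0 then g z else 0, ?_, fun y _ => rfl⟩⟩⟩
  · obtain rfl : α = 0 := by
      by_contra h
      exact hα (by funext y; simp [h])
    exact ⟨fun i => by simp, by simp [totalDeg]⟩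
  · have : α ≠ 0 := by rintro rfl; simp at hα
    simp [this]
  · split_ifs
    · exact hg
    · exact contDiff_const

theorem totalDeg_single (i : C.ι) : C.totalDeg (Finsupp.single i 1) = C.deg i := by
  simp [totalDeg]

theorem above_of_min {i : C.ι} {γ : C.ι →₀ ℕ} (hγ : C.Admissible γ) (hi : γ i ≠ 0)
    (h : ∀ j ∈ γ.support, i ≤ j) : C.Above i (γ - Finsupp.single i 1) := by
  refine ⟨fun j hj => h j (Finsupp.support_tsub hj), ?_⟩
  rw [tsub_add_cancel_of_le (Finsupp.single_le_iff.2 (Nat.one_le_iff_ne_zero.2 hi))]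
  exact hγ

open Classical in
/-- The part of `f` that is divisible by `ξ^i` but by no earlier coordinate, divided by `ξ^i`. -/
noncomputable def quotSeries (C : GradedCoords) (i : C.ι) {Y : Type}
    (f : (C.ι →₀ ℕ) → Y → ℝ) : (C.ι →₀ ℕ) → Y → ℝ :=
  fun α y => if C.Above i α then f (α + Finsupp.single i 1) y else 0

theorem quotSeries_isFunction (i : C.ι) {U : Opens C.Body} {l k : ℤ} (h : C.deg i + l = k)
    {f : (C.ι →₀ ℕ) → U → ℝ} (hf : C.IsFunction U k f) : C.IsFunction U l (C.quotSeries i f) := by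
  classical
  refine ⟨fun α hα => ?_, fun x => ?_⟩
  · have ha : C.Above i α := by
      by_contra h'
      exact hα (by funext y; simp [quotSeries, h'])
    have hne : f (α + Finsupp.single i 1) ≠ 0 := fun h' => hα (by
      funext y; simp [quotSeries, h'])
    have := (hf.1 _ hne).2
    rw [totalDeg_add, totalDeg_single] at this
    exact ⟨ha.2.left, by omega⟩
  · obtain ⟨J, K, V, hV, h1, h2⟩ := hf.2 x
    refine ⟨J, K, V, hV, fun α hα y hy => ?_, fun α => ?_⟩
    · simp only [quotSeries]
      split_ifs
      · refine h1 _ (fun h' => hα (fun j hj => h' ?_)) y hy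
        rw [Finsupp.mem_support_iff] at hj ⊢
        simp only [Finsupp.coe_add, Pi.add_apply]
        omega
      · rfl
    · by_cases ha : C.Above i α
      · obtain ⟨g, hg, hg'⟩ := h2 (α + Finsupp.single i 1)
        exact ⟨g, hg, fun y hy => by simp [quotSeries, ha, hg' y hy]⟩
      · exact ⟨fun _ => 0, contDiff_const, fun y _ => by simp [quotSeries, ha]⟩

theorem quotSeries_above {i : C.ι} {Y : Type} {f : (C.ι →₀ ℕ) → Y → ℝ} (α : C.ι →₀ ℕ)
    (h : C.quotSeries i f α ≠ 0) : C.Above i α := by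
  by_contra h'
  exact h (by funext y; simp [quotSeries, h'])

theorem sum_quotSeries {U : Opens C.Body} {f : (C.ι →₀ ℕ) → U → ℝ} {K : Finset C.ι}
    (hK : ∀ i ∈ K, C.deg i ≠ 0) {γ : C.ι →₀ ℕ} {y : U} (hγ : C.Admissible γ) (h0 : γ ≠ 0)
    (hf : ¬ γ.support ⊆ K → f γ y = 0) :
    ∑ i ∈ K, C.mulSeries (C.coordSeries i U) (C.quotSeries i f) γ y = f γ y := by
  classical
  have hne : γ.support.Nonempty := Finsupp.support_nonempty_iff.2 h0
  set m := γ.support.min' hne with hm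
  have hmm : m ∈ γ.support := Finset.min'_mem _ _
  have hmle : ∀ j ∈ γ.support, m ≤ j := fun j hj => Finset.min'_le _ _ hj
  have hval : ∀ i ∈ K, C.mulSeries (C.coordSeries i U) (C.quotSeries i f) γ y =
      if i = m then f γ y else 0 := by
    intro i hi
    rw [mulSeries_coord (hK i hi) quotSeries_above]
    split_ifs with h1 h2 h2
    · subst h2
      exact absurd h1 (Finsupp.mem_support_iff.1 hmm)
    · rfl
    · subst h2
      rw [quotSeries, if_pos (above_of_min hγ h1 hmle),
        tsub_add_cancel_of_le (Finsupp.single_le_iff.2 (Nat.one_le_iff_ne_zero.2 h1))]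
    · rw [quotSeries, if_neg]
      intro ha
      refine h2 (le_antisymm (ha.1 m ?_) (hmle i (Finsupp.mem_support_iff.2 h1)))
      rw [Finsupp.mem_support_iff, Finsupp.coe_tsub, Pi.sub_apply, Finsupp.single_eq_of_ne' h2]
      exact Finsupp.mem_support_iff.1 hmm
  rw [Finset.sum_congr rfl hval, Finset.sum_ite_eq']
  split_ifs with h1
  · rfl
  · exact (hf fun h' => h1 (h' hmm)).symm

/-- Near `b` a function is a constant plus a combination of the shifted coordinates. -/
theorem exists_decomposition {U : Opens C.Body} {k : ℤ} (f : C.functions U k) {b : C.Body}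
    (hb : b ∈ U) : ∃ (V : Opens C.Body) (hV : V ≤ U) (_ : b ∈ V) (c : C.functions V k)
      (S : Finset C.ι) (h : ∀ i, C.functions V (k - C.deg i)),
      (∃ r : ℝ, c.1 = r • oneSeries V) ∧
      (∀ i, C.deg i ≠ 0 → ∀ α, (h i).1 α ≠ 0 → C.Above i α) ∧
      resF hV f = c + ∑ i ∈ S, mulF (add_sub_cancel (C.deg i) k) (C.gen b i V) (h i) := by
  classical
  obtain ⟨J, K, V₀, hV₀, h1, h2⟩ := f.2.2 ⟨b, hb⟩
  obtain ⟨V₁, hV₁, hVo, hbV⟩ := mem_nhds_iff.1 hV₀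
  let V : Opens C.Body := ⟨Subtype.val '' V₁, U.isOpen.isOpenMap_subtype_val _ hVo⟩
  have hVU : V ≤ U := by
    rintro _ ⟨y, hy, rfl⟩
    exact y.2
  have hmem : ∀ y : V, (⟨y.1, hVU y.2⟩ : U) ∈ V₀ := by
    rintro ⟨_, y, hy, rfl⟩
    exact hV₁ hy
  obtain ⟨g, hg, hg'⟩ := h2 0
  obtain ⟨u, hu, hgu⟩ := hadamard hg fun j => b j
  have hK : ∀ i ∈ K.filter (fun i => C.deg i ≠ 0), C.deg i ≠ 0 := fun i hi =>
    (Finset.mem_filter.1 hi).2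
  let S : Finset C.ι := J.map (Function.Embedding.subtype _) ∪ K.filter fun i => C.deg i ≠ 0
  let u' : ∀ j : {i : C.ι // C.deg i = 0}, (J → ℝ) → ℝ := fun j =>
    if hj : j ∈ J then u ⟨j, hj⟩ else 0
  have hu' : ∀ j, ContDiff ℝ ∞ (u' j) := fun j => by
    by_cases hj : j ∈ J
    · simp only [u', hj, dif_pos]; exact hu _
    · simp only [u', hj, dif_neg, not_false_iff]; exact contDiff_const
  have hf0 : k ≠ 0 → ∀ y, f.1 0 y = 0 := fun hk y => by
    by_contra h
    exact hk ((f.2.1 0 fun h' => h (by simp [h'])).2.symm.trans (by simp [totalDeg]))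
  let hx : C.ι → (C.ι →₀ ℕ) → V → ℝ := fun i α y =>
    if hi : C.deg i = 0 then (if α = 0 ∧ k = 0 then u' ⟨i, hi⟩ (fun j => y.1 j) else 0)
    else C.quotSeries i (resF hVU f).1 α y
  have hxF : ∀ i, C.IsFunction V (k - C.deg i) (hx i) := fun i => by
    by_cases hi : C.deg i = 0
    · by_cases hk : k = 0
      · have := isFunction_body (U := V) J (hu' ⟨i, hi⟩)
        rw [hi, hk, sub_zero]
        convert this using 3
        simp [hx, hi, hk]
      · convert IsFunction.zero V (k - C.deg i) using 1
        funext α y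
        simp [hx, hi, hk]
    · have := quotSeries_isFunction i (add_sub_cancel (C.deg i) k) (resF hVU f).2
      convert this using 3
      simp [hx, hi]
  have hxne : ∀ i, C.deg i ≠ 0 → hx i = C.quotSeries i (resF hVU f).1 := fun i hi => by
    funext α y; simp [hx, hi]
  let c : C.functions V k := ⟨(if k = 0 then g fun j => b j else 0) • oneSeries V, by
    split_ifs with hk
    · rw [hk]; exact (IsFunction.one V).smul _
    · rw [zero_smul]; exact IsFunction.zero V k⟩
  refine ⟨V, hVU, ⟨⟨b, hb⟩, hbV, rfl⟩, c, S, fun i => ⟨hx i, hxF i⟩, ⟨_, rfl⟩, ?_, ?_⟩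
  · intro i hi α hα
    change hx i α ≠ 0 at hα
    rw [hxne i hi] at hα
    exact quotSeries_above α hα
  · refine Subtype.ext ?_
    rw [Submodule.coe_add, Submodule.coe_sum]
    funext γ y
    rw [Pi.add_apply, Pi.add_apply, Finset.sum_apply, Finset.sum_apply]
    have hdisj : Disjoint (J.map (Function.Embedding.subtype _))
        (K.filter fun i => C.deg i ≠ 0) := by
      rw [Finset.disjoint_left]
      intro i hi hi'
      obtain ⟨j, -, rfl⟩ := Finset.mem_map.1 hi
      exact hK _ hi' j.2
    rw [Finset.sum_union hdisj, Finset.sum_map]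
    have hJ : ∀ j ∈ J, (mulF (add_sub_cancel (C.deg j.1) k) (C.gen b j.1 V)
        (⟨hx j.1, hxF j.1⟩ : C.functions V _)).1 γ y =
        if γ = 0 ∧ k = 0 then (y.1 j - b j) * u' j (fun j => y.1 j) else 0 := by
      intro j hj
      change C.mulSeries (C.gen b j.1 V).1 (hx j.1) γ y = _
      rw [mulSeries_of_concentrated (fun α hα => by funext y; simp [gen_of_deg_eq_zero j.2, hα])
        (not_admissible_eq_zero (hxF j.1)), gen_of_deg_eq_zero j.2]
      simp only [hx, j.2, if_true, dif_pos]
      split_ifs <;> simp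
    have hKs : ∀ i ∈ K.filter (fun i => C.deg i ≠ 0), (mulF (add_sub_cancel (C.deg i) k)
        (C.gen b i V) (⟨hx i, hxF i⟩ : C.functions V _)).1 γ y =
        C.mulSeries (C.coordSeries i V) (C.quotSeries i (resF hVU f).1) γ y := by
      intro i hi
      change C.mulSeries (C.gen b i V).1 (hx i) γ y = _
      rw [gen_of_deg_ne_zero (hK i hi), hxne i (hK i hi)]
    refine Eq.trans ?_ (congrArg₂ (fun p q => c.1 γ y + (p + q)) (Finset.sum_congr rfl hJ)
      (Finset.sum_congr rfl hKs)).symm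
    have hc : c.1 γ y = (if k = 0 then g fun j => b j else 0) * oneSeries V γ y := rfl
    rw [hc]
    by_cases hγ : C.Admissible γ
    · by_cases h0 : γ = 0
      · subst h0
        have hz : ∑ i ∈ K.filter (fun i => C.deg i ≠ 0),
            C.mulSeries (C.coordSeries i V) (C.quotSeries i (resF hVU f).1) 0 y = 0 :=
          Finset.sum_eq_zero fun i hi => by
            rw [mulSeries_coord (hK i hi) quotSeries_above]; simp
        rw [hz, add_zero]
        change f.1 0 ⟨y.1, hVU y.2⟩ = _
        by_cases hk : k = 0
        · rw [hg' _ (hmem y), hgu]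
          simp only [hk, oneSeries, if_true, mul_one, and_self]
          congr 1
          rw [← Finset.sum_coe_sort J]
          refine Finset.sum_congr rfl fun j _ => ?_
          simp [u']
        · rw [hf0 hk]
          simp [hk]
      · simp only [h0, false_and, if_false, Finset.sum_const_zero, zero_add]
        rw [sum_quotSeries hK hγ h0]
        · simp [oneSeries, h0]
        · intro hs
          by_cases hs' : γ.support ⊆ K
          · exfalso
            refine hs fun j hj => Finset.mem_filter.2 ⟨hs' hj, fun hj' => ?_⟩
            exact Finsupp.mem_support_iff.1 hj ((hγ j).1 hj')
          · exact h1 γ hs' _ (hmem y)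
    · have h0 : γ ≠ 0 := by
        rintro rfl
        exact hγ fun i => by simp
      rw [show (resF hVU f).1 γ y = 0 by
        rw [not_admissible_eq_zero (resF hVU f).2 γ hγ]; rfl]
      simp [oneSeries, h0, mulSeries, hγ]

/-- An induction principle for functions near `b`: a property that depends on an order `m` holds
if it is local, additive, holds in order `0` and for constants, and if multiplication by a
coordinate vanishing at `b` raises the order. -/
theorem hadamard_induction (b : C.Body)
    {P : ∀ (_ : ℕ) {U : Opens C.Body} {k : ℤ}, C.functions U k → Prop}
    (zero : ∀ {U : Opens C.Body} {k : ℤ} (f : C.functions U k), b ∈ U → P 0 f)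
    (loc : ∀ {m : ℕ} {U V : Opens C.Body} (h : V ≤ U) {k : ℤ} (f : C.functions U k), b ∈ V →
      P m (resF h f) → P m f)
    (add : ∀ {m : ℕ} {U : Opens C.Body} {k : ℤ} (f g : C.functions U k), b ∈ U →
      P m f → P m g → P m (f + g))
    (const : ∀ {m : ℕ} {U : Opens C.Body} {k : ℤ} (f : C.functions U k), b ∈ U →
      ∀ r : ℝ, f.1 = r • oneSeries U → P m f)
    (mul : ∀ {m : ℕ} {U : Opens C.Body} (i : C.ι) {l k : ℤ} (h : C.deg i + l = k)
      (f : C.functions U l), b ∈ U → (C.deg i ≠ 0 → ∀ α, f.1 α ≠ 0 → C.Above i α) →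
      P m f → P (m + 1) (mulF h (C.gen b i U) f)) :
    ∀ (m : ℕ) {U : Opens C.Body} {k : ℤ} (f : C.functions U k), b ∈ U → P m f := by
  classical
  intro m
  induction m with
  | zero => exact fun f hb => zero f hb
  | succ m ih =>
    intro U k f hb
    obtain ⟨V, hV, hbV, c, S, h, ⟨r, hr⟩, hs, hf⟩ := exists_decomposition f hb
    refine loc hV f hbV ?_
    rw [hf]
    refine add _ _ hbV (const c hbV r hr) ?_
    clear hf
    induction S using Finset.induction_on with
    | empty =>
      rw [Finset.sum_empty]
      exact const 0 hbV 0 (by simp)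
    | insert i S hi ihS =>
      rw [Finset.sum_insert hi]
      exact add _ _ hbV (mul i _ (h i) hbV (hs i) (ih (h i) hbV)) ihS

end GradedCoords

namespace GradedSpace

/-- A constant, of degree `k = 0`. -/
def const (M : GradedSpace) {k : ℤ} (h : k = 0) (r : ℝ) (U : Opens M) : M.sec U k := by
  subst h
  exact r • M.one U

theorem pull_const {M N : GradedSpace} (f : M ⟶ N) {U : Opens N} {V : Opens M}
    (hV : V ≤ Opens.comap f.base U) {k : ℤ} (h : k = 0) (r : ℝ) :
    f.pull hV (N.const h r U) = M.const h r V := by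
  subst h
  exact (map_smul (f.pull hV) r _).trans (congrArg (r • ·) (f.pull_one hV))

end GradedSpace

namespace GradedCoords

/-- An open piece of a coordinate space. -/
noncomputable abbrev dom (C : GradedCoords) (W : Opens C.Body) : GradedSpace :=
  C.toGradedSpace.restrict W

/-- A point of a coordinate space, as a family of values of the coordinates of degree zero. -/
abbrev toBody (C : GradedCoords) (b : C.toGradedSpace) : C.Body := b

variable {C D : GradedCoords} {W : Opens D.Body}

/-- The coefficient of a monomial at a point. -/
noncomputable def coeff {V : Opens (D.dom W)} {k : ℤ} (a : (D.dom W).sec V k) (γ : D.ι →₀ ℕ)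
    {y : D.dom W} (hy : y ∈ V) : ℝ :=
  (show D.functions (GradedSpace.openImage W V) k from a).1 γ ⟨y.1, y, hy, rfl⟩

section coeff

variable {V : Opens (D.dom W)} {k : ℤ} {y : D.dom W} (hy : y ∈ V) (γ : D.ι →₀ ℕ)

theorem coeff_add (a b : (D.dom W).sec V k) :
    coeff (a + b) γ hy = coeff a γ hy + coeff b γ hy := rfl

theorem coeff_sub (a b : (D.dom W).sec V k) :
    coeff (a - b) γ hy = coeff a γ hy - coeff b γ hy := rfl

theorem coeff_zero : coeff (0 : (D.dom W).sec V k) γ hy = 0 := rfl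

theorem coeff_res {V' : Opens (D.dom W)} (h : V' ≤ V) (hy' : y ∈ V') (a : (D.dom W).sec V k) :
    coeff ((D.dom W).res h a) γ hy' = coeff a γ hy := rfl

open Classical in
theorem coeff_one : coeff ((D.dom W).one V) γ hy = if γ = 0 then 1 else 0 := rfl

open Classical in
theorem coeff_mul {i j : ℤ} (h : i + j = k) (a : (D.dom W).sec V i) (b : (D.dom W).sec V j) :
    coeff ((D.dom W).mul h a b) γ hy = if D.Admissible γ then
      ∑ p ∈ Finset.HasAntidiagonal.antidiagonal γ,
        (-1 : ℝ) ^ D.crossings p.1 p.2 * (coeff a p.1 hy * coeff b p.2 hy) else 0 := rfl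

theorem coeff_mul_zero {i j : ℤ} (h : i + j = k) (a : (D.dom W).sec V i)
    (b : (D.dom W).sec V j) :
    coeff ((D.dom W).mul h a b) 0 hy = coeff a 0 hy * coeff b 0 hy := by
  rw [coeff_mul, if_pos (show D.Admissible 0 from fun i => by simp)]
  simp [crossings]

theorem coeff_eq_zero {a : (D.dom W).sec V k} (h : ¬ (D.Admissible γ ∧ D.totalDeg γ = k)) :
    coeff a γ hy = 0 := by
  by_contra hne
  refine h ((show D.functions _ k from a).2.1 γ fun h0 => hne ?_)
  exact congrFun h0 _

theorem coeff_zero_of_ne (hk : k ≠ 0) (a : (D.dom W).sec V k) : coeff a 0 hy = 0 :=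
  coeff_eq_zero _ _ fun h => hk (h.2.symm.trans (by simp [totalDeg]))

theorem coeff_ext {a b : (D.dom W).sec V k}
    (h : ∀ (y : D.dom W) (hy : y ∈ V) (γ : D.ι →₀ ℕ), coeff a γ hy = coeff b γ hy) : a = b := by
  refine Subtype.ext ?_
  funext γ y
  obtain ⟨y, y', hy, rfl⟩ := y
  exact h y' hy γ

/-- All coefficients of monomials of length less than `m` vanish at `y`. -/
def Vanish (m : ℕ) (a : (D.dom W).sec V k) : Prop :=
  ∀ γ : D.ι →₀ ℕ, γ.degree < m → coeff a γ hy = 0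

variable {hy}

theorem Vanish.mul {m l : ℕ} {i j : ℤ} (h : i + j = k) {a : (D.dom W).sec V i}
    {b : (D.dom W).sec V j} (ha : Vanish hy m a) (hb : Vanish hy l b) :
    Vanish hy (m + l) ((D.dom W).mul h a b) := by
  intro γ hγ
  rw [coeff_mul]
  split_ifs
  · refine Finset.sum_eq_zero fun p hp => ?_
    rw [Finset.HasAntidiagonal.mem_antidiagonal] at hp
    have hd : p.1.degree + p.2.degree = γ.degree := by rw [← hp, map_add]
    rcases lt_or_ge p.1.degree m with h1 | h1
    · simp [ha _ h1]
    · simp [hb p.2 (by omega)]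
  · rfl

theorem Vanish.add {m : ℕ} {a b : (D.dom W).sec V k} (ha : Vanish hy m a) (hb : Vanish hy m b) :
    Vanish hy m (a + b) := fun γ hγ => by
  rw [coeff_add, ha γ hγ, hb γ hγ, add_zero]

theorem Vanish.one_of {a : (D.dom W).sec V k} (h : coeff a 0 hy = 0) : Vanish hy 1 a :=
  fun γ hγ => by
    obtain rfl : γ = 0 := by
      rw [← Finsupp.degree_eq_zero_iff]; omega
    exact h

theorem sec_eq_of_vanish {a b : (D.dom W).sec V k}
    (h : ∀ (y : D.dom W) (hy : y ∈ V) (m : ℕ), Vanish hy m (a - b)) : a = b :=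
  coeff_ext fun y hy γ => sub_eq_zero.1 (h y hy (γ.degree + 1) γ (Nat.lt_succ_self _))

end coeff

/-- The coefficients of a function on a coordinate space. -/
def series {U : Opens C.toGradedSpace} {k : ℤ} (a : C.toGradedSpace.sec U k) :
    (C.ι →₀ ℕ) → U → ℝ :=
  (show C.functions U k from a).1

/-- The coordinate `i`, shifted so that it vanishes at `b`, as a section. -/
noncomputable def shiftedCoord (b : C.toGradedSpace) (i : C.ι) (U : Opens C.toGradedSpace) :
    C.toGradedSpace.sec U (C.deg i) :=
  C.gen b i U

theorem shiftedCoord_of_ne {b : C.toGradedSpace} {i : C.ι} (hi : C.deg i ≠ 0)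
    (U : Opens C.toGradedSpace) : C.shiftedCoord b i U = C.coord i U :=
  Subtype.ext (gen_of_deg_ne_zero hi U)

theorem series_ext {U : Opens C.toGradedSpace} {k : ℤ} {a b : C.toGradedSpace.sec U k}
    (h : ∀ γ y, series a γ y = series b γ y) : a = b :=
  Subtype.ext (funext fun γ => funext fun y => h γ y)

open Classical in
theorem series_const {U : Opens C.toGradedSpace} {k : ℤ} (h : k = 0) (r : ℝ) (γ : C.ι →₀ ℕ)
    (y : U) : series (C.toGradedSpace.const h r U) γ y = if γ = 0 then r else 0 := by
  subst h
  change r * (if γ = 0 then (1:ℝ) else 0) = _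
  split_ifs <;> simp

theorem shiftedCoord_of_eq {b : C.toGradedSpace} {i : C.ι} (hi : C.deg i = 0)
    (U : Opens C.toGradedSpace) :
    C.shiftedCoord b i U = C.coord i U -
      C.toGradedSpace.const hi (C.toBody b ⟨i, hi⟩) U := by
  classical
  refine series_ext fun γ y => ?_
  refine (gen_of_deg_eq_zero hi U γ y).trans ?_
  refine Eq.trans ?_ (congrArg₂ (· - ·) (coordSeries_of_deg_eq_zero hi (U := U) γ y)
    (series_const hi (C.toBody b ⟨i, hi⟩) γ y)).symm
  by_cases hγ : γ = 0
  · simp only [hγ, if_true]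
  · simp only [hγ, if_false, sub_zero]

/-- A constant of degree `k` vanishes or has degree zero. -/
theorem const_cases {U : Opens C.Body} {k : ℤ} {f : C.functions U k} {b : C.Body} (hb : b ∈ U)
    {r : ℝ} (hf : f.1 = r • oneSeries U) : f = 0 ∨ k = 0 := by
  by_cases hr : r = 0
  · left
    exact Subtype.ext (by simp [hf, hr])
  · right
    have : f.1 0 ≠ 0 := fun h => by
      have := congrFun h ⟨b, hb⟩
      rw [hf] at this
      simp [oneSeries, hr] at this
    exact (f.2.1 0 this).2.symm.trans (by simp [totalDeg])

/-- `hadamard_induction` for sections. -/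
theorem sec_induction (b : C.toGradedSpace)
    {P : ∀ (_ : ℕ) {U : Opens C.toGradedSpace} {k : ℤ}, C.toGradedSpace.sec U k → Prop}
    (order_zero : ∀ {U : Opens C.toGradedSpace} {k : ℤ} (f : C.toGradedSpace.sec U k),
      b ∈ U → P 0 f)
    (loc : ∀ {m : ℕ} {U V : Opens C.toGradedSpace} (h : V ≤ U) {k : ℤ}
      (f : C.toGradedSpace.sec U k), b ∈ V → P m (C.toGradedSpace.res h f) → P m f)
    (add : ∀ {m : ℕ} {U : Opens C.toGradedSpace} {k : ℤ} (f g : C.toGradedSpace.sec U k), b ∈ U →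
      P m f → P m g → P m (f + g))
    (zero : ∀ {m : ℕ} {U : Opens C.toGradedSpace} {k : ℤ}, b ∈ U →
      P m (0 : C.toGradedSpace.sec U k))
    (const : ∀ {m : ℕ} {U : Opens C.toGradedSpace} {k : ℤ} (h : k = 0) (r : ℝ), b ∈ U →
      P m (C.toGradedSpace.const h r U))
    (mul : ∀ {m : ℕ} {U : Opens C.toGradedSpace} (i : C.ι) {l k : ℤ} (h : C.deg i + l = k)
      (f : C.toGradedSpace.sec U l), b ∈ U →
      (C.deg i ≠ 0 → ∀ α, series f α ≠ 0 → C.Above i α) →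
      P m f → P (m + 1) (C.toGradedSpace.mul h (C.shiftedCoord b i U) f))
    (m : ℕ) {U : Opens C.toGradedSpace} {k : ℤ} (f : C.toGradedSpace.sec U k) (hb : b ∈ U) :
    P m f := by
  refine hadamard_induction b (P := fun m U k f => @P m U k f) (fun {_ _} f hb => order_zero f hb)
    (fun {_ _ _} h {_} f hb => loc h f hb) (fun {_ _ _} f g hb => add f g hb) ?_ (fun {_ _} i {_ _} h f hb => mul i h f hb) m f hb
  intro m U k f hb r hr
  rcases const_cases hb hr with rfl | rfl
  · exact zero hb
  · have : f = C.toGradedSpace.const rfl r U := Subtype.ext hr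
    rw [this]
    exact const rfl r hb

open Classical in
theorem coeff_const {V : Opens (D.dom W)} {k : ℤ} (h : k = 0) (r : ℝ) (γ : D.ι →₀ ℕ)
    {y : D.dom W} (hy : y ∈ V) :
    coeff ((D.dom W).const h r V) γ hy = if γ = 0 then r else 0 := by
  subst h
  change r * (if γ = 0 then (1:ℝ) else 0) = _
  split_ifs <;> simp

/-- Away from `v`, the function `t - v` has a smooth inverse. -/
theorem exists_local_inverse {v b : ℝ} (h : b ≠ v) : ∃ κ : ℝ → ℝ, ContDiff ℝ ∞ κ ∧
    ∀ᶠ t in nhds b, (t - v) * κ t = 1 := by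
  have hδ : 0 < |b - v| := abs_pos.2 (sub_ne_zero.2 h)
  let φ : ContDiffBump b := ⟨|b - v| / 3, |b - v| / 2, by positivity, by linarith⟩
  refine ⟨fun t => φ t * (t - v)⁻¹, contDiff_iff_contDiffAt.2 fun t => ?_, ?_⟩
  · by_cases ht : t = v
    · subst ht
      have : ∀ᶠ s in nhds t, φ s * (s - t)⁻¹ = 0 := by
        filter_upwards [Metric.ball_mem_nhds t (half_pos hδ)] with s hs
        rw [φ.zero_of_le_dist, zero_mul]
        change |b - t| / 2 ≤ dist s b
        have h1 : dist b t ≤ dist b s + dist s t := dist_triangle _ _ _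
        rw [Real.dist_eq b t, dist_comm b s] at h1
        have h2 : dist s t < |b - t| / 2 := hs
        linarith
      exact contDiffAt_const.congr_of_eventuallyEq this
    · exact φ.contDiffAt.mul ((contDiffAt_id.sub contDiffAt_const).inv (sub_ne_zero.2 ht))
  · have h1 : ∀ᶠ t in nhds b, t ≠ v := isOpen_ne.mem_nhds h
    filter_upwards [h1, Metric.closedBall_mem_nhds b φ.rIn_pos] with t ht ht'
    rw [φ.one_of_mem_closedBall ht', one_mul, mul_inv_cancel₀ (sub_ne_zero.2 ht)]

/-- The values of a morphism are the values of the pull-backs of the coordinates. -/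
theorem coeff_pull_coord (f : D.dom W ⟶ C.toGradedSpace) (j : {i : C.ι // C.deg i = 0})
    {U : Opens C.toGradedSpace} {V : Opens (D.dom W)} (h : V ≤ Opens.comap f.base U) {y : D.dom W}
    (hy : y ∈ V) : coeff (f.pull h (C.coord j.1 U)) 0 hy = C.toBody (f.base y) j := by
  by_contra hne
  set v := coeff (f.pull h (C.coord j.1 U)) 0 hy with hv
  obtain ⟨κ, hκ, hκ'⟩ := exists_local_inverse (v := v) (b := C.toBody (f.base y) j)
    fun h => hne h.symm
  obtain ⟨T, hT, hTo, hbT⟩ := mem_nhds_iff.1 hκ'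
  let b' : C.toGradedSpace := (fun _ => v : C.Body)
  let U' : Opens C.toGradedSpace :=
    U ⊓ (⟨{z | z j ∈ T}, hTo.preimage (continuous_apply j)⟩ : Opens C.Body)
  have hU' : U' ≤ U := inf_le_left
  let V' : Opens (D.dom W) := V ⊓ Opens.comap f.base U'
  have hyV' : y ∈ V' := ⟨hy, h hy, hbT⟩
  have hV' : V' ≤ Opens.comap f.base U' := inf_le_right
  let k' : C.functions U' 0 := ⟨_, isFunction_body {j} (g := fun z => κ (z ⟨j, by simp⟩))
    (hκ.comp (contDiff_apply ℝ ℝ _))⟩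
  let k : C.toGradedSpace.sec U' 0 := k'
  have hj0 : C.deg j.1 + 0 = 0 := by rw [j.2]; rfl
  have hmul : C.toGradedSpace.mul hj0 (C.shiftedCoord b' j.1 U') k = C.toGradedSpace.one U' := by
    refine series_ext fun γ z => ?_
    change C.mulSeries (C.gen b' j.1 U').1 k'.1 γ z = oneSeries _ γ z
    refine (mulSeries_of_concentrated (fun α hα => by
      funext y
      exact (gen_of_deg_eq_zero j.2 _ α y).trans (if_neg hα))
      (not_admissible_eq_zero k'.2) γ z).trans ?_
    refine (congrArg (· * _) ((gen_of_deg_eq_zero j.2 _ 0 z).trans (if_pos rfl))).trans ?_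
    by_cases hγ : γ = 0
    · subst hγ
      simpa [k', oneSeries] using hT z.2.2
    · simp [k', hγ, oneSeries]
  have h1 := congrArg (fun s => coeff (f.pull hV' s) 0 hyV') hmul
  simp only [f.pull_one, f.pull_mul, coeff_one, if_true, coeff_mul_zero] at h1
  have h4 : coeff (f.pull hV' (C.shiftedCoord b' j.1 U')) 0 hyV' = 0 := by
    rw [shiftedCoord_of_eq j.2, map_sub, coeff_sub, GradedSpace.pull_const, coeff_const,
      if_pos rfl, sub_eq_zero]
    have e : C.coord j.1 U' = C.toGradedSpace.res hU' (C.coord j.1 U) := rfl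
    have hV'' : V' ≤ V := inf_le_left
    rw [e, f.pull_res, ← f.res_pull h hV'', coeff_res hy]
  rw [h4, zero_mul] at h1
  exact zero_ne_one h1

theorem vanish_pull_shiftedCoord (f : D.dom W ⟶ C.toGradedSpace) {U : Opens C.toGradedSpace}
    {V : Opens (D.dom W)} (h : V ≤ Opens.comap f.base U) {y : D.dom W} (hy : y ∈ V) (i : C.ι) :
    Vanish hy 1 (f.pull h (C.shiftedCoord (f.base y) i U)) := by
  refine Vanish.one_of ?_
  by_cases hi : C.deg i = 0
  · rw [shiftedCoord_of_eq hi, map_sub, coeff_sub, GradedSpace.pull_const, coeff_const,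
      if_pos rfl, sub_eq_zero]
    exact coeff_pull_coord f ⟨i, hi⟩ h hy
  · exact coeff_zero_of_ne hy hi _

theorem pull_coord_of_top {M : GradedSpace} (f : M ⟶ C.toGradedSpace) (i : C.ι)
    {U : Opens C.toGradedSpace} {V : Opens M} (h : V ≤ Opens.comap f.base U) :
    f.pull h (C.coord i U) =
      M.res le_top (f.pull (le_top : ⊤ ≤ Opens.comap f.base ⊤) (C.coord i ⊤)) := by
  exact (f.pull_res h le_top (C.coord i ⊤)).trans
    (f.res_pull (le_top : ⊤ ≤ Opens.comap f.base ⊤) le_top (C.coord i ⊤)).symm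

/-- Morphisms from a piece of a coordinate space to a coordinate space are determined by the
pull-backs of the coordinates. -/
theorem dom_hom_ext {f g : D.dom W ⟶ C.toGradedSpace}
    (h : ∀ i, f.pull (le_top : ⊤ ≤ Opens.comap f.base ⊤) (C.coord i ⊤) =
      g.pull (le_top : ⊤ ≤ Opens.comap g.base ⊤) (C.coord i ⊤)) : f = g := by
  have hb : ∀ y, f.base y = g.base y := fun y => by
    funext j
    refine (coeff_pull_coord f j (U := ⊤) (V := ⊤) le_top (Opens.mem_top y)).symm.trans
      (Eq.trans ?_ (coeff_pull_coord g j (U := ⊤) (V := ⊤) le_top (Opens.mem_top y)))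
    rw [h]
  have hcoord : ∀ (i : C.ι) {U : Opens C.toGradedSpace} {V : Opens (D.dom W)}
      (hf : V ≤ Opens.comap f.base U) (hg : V ≤ Opens.comap g.base U),
      f.pull hf (C.coord i U) = g.pull hg (C.coord i U) := fun i U V hf hg => by
    rw [pull_coord_of_top f, pull_coord_of_top g, h]
  have hgen : ∀ (b : C.toGradedSpace) (i : C.ι) {U : Opens C.toGradedSpace} {V : Opens (D.dom W)}
      (hf : V ≤ Opens.comap f.base U) (hg : V ≤ Opens.comap g.base U),
      f.pull hf (C.shiftedCoord b i U) = g.pull hg (C.shiftedCoord b i U) :=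
    fun b i U V hf hg => by
      by_cases hi : C.deg i = 0
      · rw [shiftedCoord_of_eq hi, map_sub, map_sub, GradedSpace.pull_const,
          GradedSpace.pull_const, hcoord i hf hg]
      · rw [shiftedCoord_of_ne hi, hcoord i hf hg]
  refine GradedSpace.hom_ext hb fun U V hf hg k a => sec_eq_of_vanish fun y hy m => ?_
  refine sec_induction (f.base y) (P := fun m U k a => ∀ (V : Opens (D.dom W))
    (hf : V ≤ Opens.comap f.base U) (hg : V ≤ Opens.comap g.base U) (hy : y ∈ V),
    Vanish hy m (f.pull hf a - g.pull hg a)) ?_ ?_ ?_ ?_ ?_ ?_ m a (hf hy) V hf hg hy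
  · intro U k a _ V hf hg hy γ hγ
    exact absurd hγ (Nat.not_lt_zero _)
  · intro m U U' h k a hb' ih V hf hg hy γ hγ
    let V' : Opens (D.dom W) := V ⊓ (Opens.comap f.base U' ⊓ Opens.comap g.base U')
    have hV' : V' ≤ V := inf_le_left
    have hy' : y ∈ V' := ⟨hy, hb', by have := hb y ▸ hb'; exact this⟩
    have h1 : V' ≤ Opens.comap f.base U' := inf_le_right.trans inf_le_left
    have h2 : V' ≤ Opens.comap g.base U' := inf_le_right.trans inf_le_right
    have := ih V' h1 h2 hy' γ hγ
    rw [f.pull_res, g.pull_res, ← f.res_pull hf hV', ← g.res_pull hg hV', ← map_sub] at this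
    exact this
  · intro m U k a b _ iha ihb V hf hg hy
    have := (iha V hf hg hy).add (ihb V hf hg hy)
    rwa [sub_add_sub_comm, ← map_add, ← map_add] at this
  · intro m U k _ V hf hg hy γ _
    rw [map_zero, map_zero, sub_zero, coeff_zero]
  · intro m U k h r _ V hf hg hy γ _
    rw [GradedSpace.pull_const, GradedSpace.pull_const, sub_self, coeff_zero]
  · intro m U i l k hil a hb' _ ih V hf hg hy
    rw [f.pull_mul, g.pull_mul, ← hgen _ i hf hg, ← map_sub, add_comm]
    exact (vanish_pull_shiftedCoord f hf hy i).mul hil (ih V hf hg hy)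

end GradedCoords

namespace GradedCoords

/-- Formal power series with constant coefficients in the graded coordinates. -/
abbrev PSer (D : GradedCoords) : Type := (D.ι →₀ ℕ) → ℝ

variable {C D : GradedCoords}

open Classical in
/-- The product of formal power series with constant coefficients. -/
noncomputable def pmul (f : PSer D) : PSer D →ₗ[ℝ] PSer D where
  toFun g γ := if D.Admissible γ then ∑ p ∈ Finset.HasAntidiagonal.antidiagonal γ,
    (-1 : ℝ) ^ D.crossings p.1 p.2 * (f p.1 * g p.2) else 0
  map_add' g g' := by
    funext γ
    simp only [Pi.add_apply]
    split_ifs <;> simp [mul_add, Finset.sum_add_distrib]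
  map_smul' c g := by
    funext γ
    simp only [Pi.smul_apply, RingHom.id_apply, smul_eq_mul]
    split_ifs
    · rw [Finset.mul_sum]
      exact Finset.sum_congr rfl fun p _ => by ring
    · simp

open Classical in
theorem pmul_apply (f g : PSer D) (γ : D.ι →₀ ℕ) : pmul f g γ = if D.Admissible γ then
    ∑ p ∈ Finset.HasAntidiagonal.antidiagonal γ,
    (-1 : ℝ) ^ D.crossings p.1 p.2 * (f p.1 * g p.2) else 0 := rfl

theorem pmul_assoc (f g h : PSer D) : pmul (pmul f g) h = pmul f (pmul g h) := by
  funext γ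
  exact congrFun (congrFun (mulSeries_assoc (C := D) (Y := Unit) (fun α _ => f α) (fun α _ => g α)
    fun α _ => h α) γ) ()

theorem pmul_add_left (f f' g : PSer D) : pmul (f + f') g = pmul f g + pmul f' g := by
  funext γ
  simp only [Pi.add_apply, pmul_apply]
  split_ifs <;> simp [add_mul, mul_add, Finset.sum_add_distrib]

theorem pmul_smul_left (c : ℝ) (f g : PSer D) : pmul (c • f) g = c • pmul f g := by
  funext γ
  simp only [Pi.smul_apply, pmul_apply, smul_eq_mul]
  split_ifs
  · rw [Finset.mul_sum]
    exact Finset.sum_congr rfl fun p _ => by ring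
  · simp

theorem pmul_zero_left (g : PSer D) : pmul 0 g = 0 := by
  simpa using pmul_smul_left (0 : ℝ) 0 g

/-- Homogeneous series. -/
def Homog (k : ℤ) (s : PSer D) : Prop := ∀ γ, s γ ≠ 0 → D.Admissible γ ∧ D.totalDeg γ = k

theorem Homog.zero (k : ℤ) : Homog k (0 : PSer D) := fun _ h => absurd rfl h

theorem Homog.add {k : ℤ} {f g : PSer D} (hf : Homog k f) (hg : Homog k g) :
    Homog k (f + g) := fun γ h => by
  by_cases h1 : f γ = 0
  · exact hg γ fun h2 => h (by simp [h1, h2])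
  · exact hf γ h1

theorem Homog.smul {k : ℤ} {f : PSer D} (c : ℝ) (hf : Homog k f) : Homog k (c • f) :=
  fun γ h => hf γ fun h1 => h (by simp [h1])

theorem Homog.sum {k : ℤ} {I : Type} {s : Finset I} {f : I → PSer D} (h : ∀ i ∈ s, Homog k (f i)) :
    Homog k (∑ i ∈ s, f i) := by
  classical
  induction s using Finset.induction_on with
  | empty => exact Homog.zero k
  | insert i s hi ih =>
    rw [Finset.sum_insert hi]
    exact (h i (Finset.mem_insert_self _ _)).add (ih fun j hj => h j (Finset.mem_insert_of_mem hj))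

theorem Homog.pmul {i j k : ℤ} (hk : i + j = k) {f g : PSer D} (hf : Homog i f)
    (hg : Homog j g) : Homog k (pmul f g) := fun γ h => by
  rw [pmul_apply] at h
  split_ifs at h with had
  · obtain ⟨p, hp, hne⟩ := Finset.exists_ne_zero_of_sum_ne_zero h
    rw [Finset.HasAntidiagonal.mem_antidiagonal] at hp
    have h1 : f p.1 ≠ 0 := fun h => hne (by simp [h])
    have h2 : g p.2 ≠ 0 := fun h => hne (by simp [h])
    exact ⟨had, by rw [← hp, totalDeg_add, (hf _ h1).2, (hg _ h2).2, hk]⟩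
  · exact absurd rfl h

theorem pmul_comm {i j : ℤ} {f g : PSer D} (hf : Homog i f) (hg : Homog j g) :
    pmul f g = (i * j).negOnePow • pmul g f := by
  classical
  funext γ
  simp only [Pi.smul_apply, pmul_apply]
  split_ifs with had
  · have hswap : ∑ p ∈ Finset.HasAntidiagonal.antidiagonal γ,
        (-1 : ℝ) ^ D.crossings p.1 p.2 * (g p.1 * f p.2) =
        ∑ p ∈ Finset.HasAntidiagonal.antidiagonal γ,
          (-1 : ℝ) ^ D.crossings p.2 p.1 * (g p.2 * f p.1) :=
      Finset.sum_equiv (Equiv.prodComm _ _) (by simp [add_comm]) (by simp)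
    rw [hswap, Finset.smul_sum]
    refine Finset.sum_congr rfl fun p hp => ?_
    rw [Finset.HasAntidiagonal.mem_antidiagonal] at hp
    by_cases h1 : f p.1 = 0
    · simp [h1]
    by_cases h2 : g p.2 = 0
    · simp [h2]
    rw [neg_one_pow_crossings_swap (hp ▸ had), (hf _ h1).2, (hg _ h2).2, smul_mul_assoc,
      mul_comm (f p.1)]
  · simp

theorem pmul_comm_zero {j : ℤ} {f g : PSer D} (hf : Homog 0 f) (hg : Homog j g) :
    pmul f g = pmul g f := by
  rw [pmul_comm hf hg, zero_mul, Int.negOnePow_zero, one_smul]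

open Classical in
/-- The series `1`. -/
noncomputable def pone (D : GradedCoords) : PSer D := fun γ => if γ = 0 then 1 else 0

theorem homog_pone : Homog 0 (pone D) := fun γ h => by
  obtain rfl : γ = 0 := by
    by_contra h'
    exact h (if_neg h')
  exact ⟨fun i => by simp, by simp [totalDeg]⟩

theorem pone_pmul {k : ℤ} {f : PSer D} (hf : Homog k f) : pmul (pone D) f = f := by
  classical
  funext γ
  rw [pmul_apply]
  split_ifs with had
  · rw [Finset.sum_eq_single_of_mem (0, γ) (by simp)]
    · simp [pone, crossings]
    · rintro ⟨a, b⟩ hp hne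
      rw [Finset.HasAntidiagonal.mem_antidiagonal] at hp
      have : a ≠ 0 := by
        rintro rfl
        simp at hp
        exact hne (by simp [hp])
      simp [pone, this]
  · by_contra h
    exact had (hf γ fun h' => h h'.symm).1

/-- Series without terms of length less than `m`. -/
def Ord (m : ℕ) (s : PSer D) : Prop := ∀ γ : D.ι →₀ ℕ, γ.degree < m → s γ = 0

theorem Ord.pmul {m l : ℕ} {a b : PSer D} (ha : Ord m a) (hb : Ord l b) :
    Ord (m + l) (pmul a b) := by
  intro γ hγ
  rw [pmul_apply]
  split_ifs
  · refine Finset.sum_eq_zero fun p hp => ?_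
    rw [Finset.HasAntidiagonal.mem_antidiagonal] at hp
    have hd : p.1.degree + p.2.degree = γ.degree := by rw [← hp, map_add]
    rcases lt_or_ge p.1.degree m with h1 | h1
    · simp [ha _ h1]
    · simp [hb p.2 (by omega)]
  · rfl

theorem Ord.sum {m : ℕ} {I : Type} {s : Finset I} {f : I → PSer D} (h : ∀ i ∈ s, Ord m (f i)) :
    Ord m (∑ i ∈ s, f i) := fun γ hγ => by
  rw [Finset.sum_apply]
  exact Finset.sum_eq_zero fun i hi => h i hi γ hγ

theorem Ord.one_of {s : PSer D} (h : s 0 = 0) : Ord 1 s := fun γ hγ => by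
  obtain rfl : γ = 0 := by
    rw [← Finsupp.degree_eq_zero_iff]; omega
  exact h

theorem Homog.eq_zero_of_ne {k : ℤ} {s : PSer D} (h : Homog k s) (hk : k ≠ 0) : s 0 = 0 := by
  by_contra h'
  exact hk ((h 0 h').2.symm.trans (by simp [totalDeg]))

/-- The coefficient of the product at `γ` only involves coefficients of monomials dividing `γ`. -/
theorem pmul_congr {f f' g g' : PSer D} {γ : D.ι →₀ ℕ}
    (hf : ∀ α, α.degree ≤ γ.degree → f α = f' α) (hg : ∀ α, α.degree ≤ γ.degree → g α = g' α) :
    pmul f g γ = pmul f' g' γ := by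
  rw [pmul_apply, pmul_apply]
  split_ifs
  · refine Finset.sum_congr rfl fun p hp => ?_
    rw [Finset.HasAntidiagonal.mem_antidiagonal] at hp
    have hd : p.1.degree + p.2.degree = γ.degree := by rw [← hp, map_add]
    rw [hf p.1 (by omega), hg p.2 (by omega)]
  · rfl

/-- The function `F` depends smoothly on the coordinates in `J`, on the set `O`. -/
def CylOn (J : Finset {i : C.ι // C.deg i = 0}) (O : Set C.Body) (F : C.Body → ℝ) : Prop :=
  ∃ g : (J → ℝ) → ℝ, ContDiff ℝ ∞ g ∧ ∀ x ∈ O, F x = g fun j => x j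

section cyl

variable {J J' : Finset {i : C.ι // C.deg i = 0}} {O O' : Set C.Body} {F G : C.Body → ℝ}

theorem CylOn.mono (h : CylOn J O F) (hJ : J ⊆ J') (hO : O' ⊆ O) : CylOn J' O' F := by
  obtain ⟨g, hg, h⟩ := h
  exact ⟨fun z => g fun j => z ⟨j.1, hJ j.2⟩,
    hg.comp (contDiff_pi.2 fun j => contDiff_apply ℝ ℝ (⟨j.1, hJ j.2⟩ : J')), fun x hx => h x (hO hx)⟩

theorem CylOn.congr (h : CylOn J O F) (hFG : ∀ x ∈ O, F x = G x) : CylOn J O G := by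
  obtain ⟨g, hg, h⟩ := h
  exact ⟨g, hg, fun x hx => (hFG x hx).symm.trans (h x hx)⟩

theorem CylOn.const (c : ℝ) : CylOn J O fun _ => c := ⟨fun _ => c, contDiff_const, fun _ _ => rfl⟩

theorem CylOn.coord {j : {i : C.ι // C.deg i = 0}} (hj : j ∈ J) : CylOn J O fun x => x j :=
  ⟨fun z => z ⟨j, hj⟩, contDiff_apply ℝ ℝ _, fun _ _ => rfl⟩

theorem CylOn.add (hF : CylOn J O F) (hG : CylOn J O G) : CylOn J O fun x => F x + G x := by
  obtain ⟨f, hf, hF⟩ := hF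
  obtain ⟨g, hg, hG⟩ := hG
  exact ⟨fun z => f z + g z, hf.add hg, fun x hx => by simp only [hF x hx, hG x hx]⟩

theorem CylOn.mul (hF : CylOn J O F) (hG : CylOn J O G) : CylOn J O fun x => F x * G x := by
  obtain ⟨f, hf, hF⟩ := hF
  obtain ⟨g, hg, hG⟩ := hG
  exact ⟨fun z => f z * g z, hf.mul hg, fun x hx => by simp only [hF x hx, hG x hx]⟩

theorem CylOn.sum {I : Type} {s : Finset I} {F : I → C.Body → ℝ} (h : ∀ i ∈ s, CylOn J O (F i)) :
    CylOn J O fun x => ∑ i ∈ s, F i x := by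
  classical
  induction s using Finset.induction_on with
  | empty => simpa using CylOn.const 0
  | insert i s hi ih =>
    simp only [Finset.sum_insert hi]
    exact (h i (Finset.mem_insert_self _ _)).add (ih fun j hj => h j (Finset.mem_insert_of_mem hj))

/-- The partial derivative in the direction of a coordinate of degree zero. -/
noncomputable def partialD (j : {i : C.ι // C.deg i = 0}) (F : C.Body → ℝ) : C.Body → ℝ :=
  fun b => deriv (fun t => F (Function.update b j t)) (b j)

theorem eventually_update (hO : IsOpen O) {x : C.Body} (hx : x ∈ O)
    (j : {i : C.ι // C.deg i = 0}) : ∀ᶠ t in nhds (x j), Function.update x j t ∈ O := by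
  have : Continuous fun t : ℝ => Function.update x j t := continuous_const.update j continuous_id
  refine this.continuousAt.eventually_mem (hO.mem_nhds ?_)
  rwa [Function.update_eq_self]

theorem partialD_congr (hO : IsOpen O) (h : ∀ x ∈ O, F x = G x) (j : {i : C.ι // C.deg i = 0})
    {x : C.Body} (hx : x ∈ O) : partialD j F x = partialD j G x := by
  classical
  refine Filter.EventuallyEq.deriv_eq ?_
  filter_upwards [eventually_update hO hx j] with t ht
  exact h _ ht

open Classical in
theorem CylOn.hasDerivAt (hO : IsOpen O) {g : (J → ℝ) → ℝ} (hg : ContDiff ℝ ∞ g)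
    (h : ∀ x ∈ O, F x = g fun j => x j) (j : {i : C.ι // C.deg i = 0}) {x : C.Body} (hx : x ∈ O) :
    HasDerivAt (fun t => F (Function.update x j t)) (if hj : j ∈ J then
      fderiv ℝ g (fun j => x j) (Pi.single ⟨j, hj⟩ 1) else 0) (x j) := by
  have h1 : HasDerivAt (fun t => g fun i : J => Function.update x j t i) (if hj : j ∈ J then
      fderiv ℝ g (fun j => x j) (Pi.single ⟨j, hj⟩ 1) else 0) (x j) := by
    split_ifs with hj
    · have h2 : HasDerivAt (fun t : ℝ => fun i : J => Function.update x j t i)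
          (Pi.single ⟨j, hj⟩ 1) (x j) := by
        rw [hasDerivAt_pi]
        intro i
        by_cases hi : i.1 = j
        · obtain ⟨i, hi'⟩ := i
          subst hi
          simpa using hasDerivAt_id' (x i)
        · have : i ≠ ⟨j, hj⟩ := fun h => hi (congrArg Subtype.val h)
          simpa [hi, this] using hasDerivAt_const (x j) (x i.1)
      have h3 : HasFDerivAt g (fderiv ℝ g fun j => x j) (fun i : J => Function.update x j (x j) i) := by
        rw [Function.update_eq_self]
        exact (hg.differentiable (by simp) _).hasFDerivAt
      exact h3.comp_hasDerivAt (x j) h2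
    · have : (fun t => g fun i : J => Function.update x j t i) = fun t => g fun i : J => x i := by
        funext t
        congr 1
        funext i
        exact Function.update_of_ne (fun h : i.1 = j => hj (h ▸ i.2)) _ _
      rw [this]
      exact hasDerivAt_const _ _
  refine h1.congr_of_eventuallyEq ?_
  filter_upwards [eventually_update hO hx j] with t ht
  exact h _ ht

theorem CylOn.differentiableAt (hO : IsOpen O)
    (h : CylOn J O F) (j : {i : C.ι // C.deg i = 0})
    {x : C.Body} (hx : x ∈ O) : DifferentiableAt ℝ (fun t => F (Function.update x j t)) (x j) := by
  obtain ⟨g, hg, h⟩ := h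
  exact (CylOn.hasDerivAt hO hg h j hx).differentiableAt

theorem CylOn.partialD (hO : IsOpen O) (h : CylOn J O F) (j : {i : C.ι // C.deg i = 0}) :
    CylOn J O (partialD j F) := by
  classical
  obtain ⟨g, hg, h⟩ := h
  refine ⟨fun z => if hj : j ∈ J then fderiv ℝ g z (Pi.single ⟨j, hj⟩ 1) else 0, ?_,
    fun x hx => (CylOn.hasDerivAt hO hg h j hx).deriv⟩
  split_ifs with hj
  · exact (hg.fderiv_right (m := ∞) (by simp)).clm_apply contDiff_const
  · exact contDiff_const

theorem CylOn.partialD_eq_zero (hO : IsOpen O) (h : CylOn J O F) {j : {i : C.ι // C.deg i = 0}}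
    (hj : j ∉ J) {x : C.Body} (hx : x ∈ O) : GradedCoords.partialD j F x = 0 := by
  classical
  obtain ⟨g, hg, h⟩ := h
  refine (CylOn.hasDerivAt hO hg h j hx).deriv.trans ?_
  rw [dif_neg hj]

theorem partialD_add (hO : IsOpen O) (hF : CylOn J O F) (hG : CylOn J O G)
    (j : {i : C.ι // C.deg i = 0}) {x : C.Body} (hx : x ∈ O) :
    partialD j (fun x => F x + G x) x = partialD j F x + partialD j G x := by
  classical
  exact deriv_add (hF.differentiableAt hO j hx) (hG.differentiableAt hO j hx)

theorem partialD_smul (c : ℝ) (F : C.Body → ℝ) (j : {i : C.ι // C.deg i = 0}) :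
    partialD j (fun x => c * F x) = fun x => c * partialD j F x := by
  funext x
  exact deriv_const_mul_field c

open Classical in
theorem partialD_coord_mul (hO : IsOpen O) (hF : CylOn J O F) (i j : {i : C.ι // C.deg i = 0})
    {x : C.Body} (hx : x ∈ O) :
    partialD i (fun x => x j * F x) x = (if i = j then F x else 0) + x j * partialD i F x := by
  have h1 := (hF.differentiableAt hO i hx).hasDerivAt
  by_cases hij : i = j
  · subst hij
    have h2 : HasDerivAt (fun t : ℝ => Function.update x i t i) 1 (x i) := by
      simpa using hasDerivAt_id' (x i)
    refine (h2.mul h1).deriv.trans ?_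
    simp only [Function.update_self, Function.update_eq_self, if_true, one_mul]
    rfl
  · have h2 : HasDerivAt (fun t : ℝ => Function.update x i t j) 0 (x i) := by
      simpa [Function.update_of_ne (Ne.symm hij)] using hasDerivAt_const (x i) (x j)
    refine (h2.mul h1).deriv.trans ?_
    simp only [Function.update_eq_self, hij, if_false, zero_mul]
    rfl

end cyl

end GradedCoords

namespace GradedCoords

variable {C D : GradedCoords}

/-- The term of order `m` (times `m!`) of the Taylor expansion of `F` at `b` in the increments
`n`. -/
noncomputable def taylorTerm (b : C.Body) (n : {i : C.ι // C.deg i = 0} → PSer D) :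
    ℕ → (C.Body → ℝ) → PSer D
  | 0, F => F b • pone D
  | m + 1, F => ∑ᶠ j, pmul (n j) (taylorTerm b n m (partialD j F))

section taylor

variable {b : C.Body} {n : {i : C.ι // C.deg i = 0} → PSer D}
  {J : Finset {i : C.ι // C.deg i = 0}} {O : Set C.Body} {F G : C.Body → ℝ}

theorem taylorTerm_congr (hO : IsOpen O) (hb : b ∈ O) (m : ℕ) {F G : C.Body → ℝ}
    (h : ∀ x ∈ O, F x = G x) : taylorTerm b n m F = taylorTerm b n m G := by
  induction m generalizing F G with
  | zero => simp only [taylorTerm, h b hb]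
  | succ m ih =>
    simp only [taylorTerm]
    exact finsum_congr fun j => by rw [ih fun x hx => partialD_congr hO h j hx]

theorem partialD_zero (j : {i : C.ι // C.deg i = 0}) :
    partialD j (fun _ : C.Body => (0 : ℝ)) = fun _ => 0 := by
  funext x
  simp [partialD]

theorem taylorTerm_zero (m : ℕ) : taylorTerm b n m (fun _ => 0) = 0 := by
  induction m with
  | zero => simp [taylorTerm]
  | succ m ih => simp [taylorTerm, partialD_zero, ih]

theorem taylorTerm_succ (hO : IsOpen O) (hb : b ∈ O) (hF : CylOn J O F) (m : ℕ) :
    taylorTerm b n (m + 1) F = ∑ j ∈ J, pmul (n j) (taylorTerm b n m (partialD j F)) := by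
  simp only [taylorTerm]
  refine finsum_eq_sum_of_support_subset _ fun j hj => ?_
  by_contra hjJ
  refine hj ?_
  change pmul (n j) (taylorTerm b n m (partialD j F)) = 0
  rw [taylorTerm_congr hO hb m (G := fun _ => 0)
    fun x hx => hF.partialD_eq_zero hO (by simpa using hjJ) hx, taylorTerm_zero, map_zero]

theorem taylorTerm_add (hO : IsOpen O) (hb : b ∈ O) (m : ℕ) {F G : C.Body → ℝ}
    (hF : CylOn J O F) (hG : CylOn J O G) :
    taylorTerm b n m (fun x => F x + G x) = taylorTerm b n m F + taylorTerm b n m G := by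
  induction m generalizing F G with
  | zero => simp only [taylorTerm, add_smul]
  | succ m ih =>
    rw [taylorTerm_succ hO hb hF, taylorTerm_succ hO hb hG, taylorTerm_succ hO hb (hF.add hG),
      ← Finset.sum_add_distrib]
    refine Finset.sum_congr rfl fun j _ => ?_
    rw [← map_add, ← ih (hF.partialD hO j) (hG.partialD hO j),
      taylorTerm_congr hO hb m fun x hx => partialD_add hO hF hG j hx]

theorem taylorTerm_smul (c : ℝ) (m : ℕ) (F : C.Body → ℝ) :
    taylorTerm b n m (fun x => c * F x) = c • taylorTerm b n m F := by
  induction m generalizing F with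
  | zero => simp only [taylorTerm, mul_smul]
  | succ m ih =>
    simp only [taylorTerm]
    rw [smul_finsum]
    refine finsum_congr fun j => ?_
    rw [partialD_smul, ih, map_smul]

theorem homog_taylorTerm (hn : ∀ j, Homog 0 (n j)) (hO : IsOpen O) (hb : b ∈ O) (m : ℕ)
    {F : C.Body → ℝ} (hF : CylOn J O F) : Homog 0 (taylorTerm b n m F) := by
  induction m generalizing F with
  | zero => exact homog_pone.smul _
  | succ m ih =>
    rw [taylorTerm_succ hO hb hF]
    exact Homog.sum fun j _ => (hn j).pmul (add_zero 0) (ih (hF.partialD hO j))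

theorem ord_taylorTerm (hn : ∀ j, n j 0 = 0) (hO : IsOpen O) (hb : b ∈ O) (m : ℕ)
    {F : C.Body → ℝ} (hF : CylOn J O F) : Ord m (taylorTerm b n m F) := by
  induction m generalizing F with
  | zero => exact fun γ hγ => absurd hγ (Nat.not_lt_zero _)
  | succ m ih =>
    rw [taylorTerm_succ hO hb hF, add_comm]
    exact Ord.sum fun j _ => (Ord.one_of (hn j)).pmul (ih (hF.partialD hO j))

theorem taylorTerm_coord_mul (hn : ∀ j, Homog 0 (n j)) (hO : IsOpen O) (hb : b ∈ O)
    (j : {i : C.ι // C.deg i = 0}) (m : ℕ) {F : C.Body → ℝ} (hF : CylOn J O F) :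
    taylorTerm b n (m + 1) (fun x => x j * F x) = b j • taylorTerm b n (m + 1) F +
      ((m : ℝ) + 1) • pmul (n j) (taylorTerm b n m F) := by
  classical
  have hJ' : J ⊆ insert j J := Finset.subset_insert _ _
  have hj : j ∈ insert j J := Finset.mem_insert_self _ _
  induction m generalizing F with
  | zero =>
    have hF' := hF.mono hJ' (le_refl O)
    rw [taylorTerm_succ hO hb ((CylOn.coord hj).mul hF'), taylorTerm_succ hO hb hF']
    simp only [taylorTerm]
    simp only [partialD_coord_mul hO hF' _ j hb, add_smul, map_add, Finset.sum_add_distrib]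
    rw [add_comm, Finset.smul_sum]
    congr 1
    · exact Finset.sum_congr rfl fun i _ => by rw [mul_smul, map_smul]
    · rw [Finset.sum_eq_single_of_mem j hj]
      · simp
      · intro i _ hij
        simp [hij]
  | succ m ih =>
    have hF' := hF.mono hJ' (le_refl O)
    have hd := fun i => hF'.partialD hO i
    rw [taylorTerm_succ hO hb ((CylOn.coord hj).mul hF'), taylorTerm_succ hO hb hF' (m + 1)]
    have key : ∀ i, taylorTerm b n (m + 1) (partialD i fun x => x j * F x) =
        (if i = j then taylorTerm b n (m + 1) F else 0) +
          (b j • taylorTerm b n (m + 1) (partialD i F) +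
            ((m : ℝ) + 1) • pmul (n j) (taylorTerm b n m (partialD i F))) := by
      intro i
      rw [taylorTerm_congr hO hb (m + 1) fun x hx => partialD_coord_mul hO hF' i j hx,
        taylorTerm_add hO hb (m + 1) (J := insert j J)
          (F := fun x => if i = j then F x else 0) ?_ ((CylOn.coord hj).mul (hd i))]
      · have ih' := ih (hF.partialD hO i)
        rw [ih']
        congr 1
        split_ifs with hij
        · rfl
        · exact taylorTerm_zero _
      · split_ifs
        · exact hF'
        · exact CylOn.const 0
    simp only [key, map_add, Finset.sum_add_distrib, map_smul]
    rw [Finset.sum_eq_single_of_mem j hj (by intro i _ hij; simp [hij]), if_pos rfl,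
      ← Finset.smul_sum, ← Finset.smul_sum]
    have hsum : ∑ i ∈ insert j J, pmul (n i) (pmul (n j) (taylorTerm b n m (partialD i F))) =
        pmul (n j) (taylorTerm b n (m + 1) F) := by
      rw [taylorTerm_succ hO hb hF', map_sum]
      refine Finset.sum_congr rfl fun i _ => ?_
      rw [← pmul_assoc, ← pmul_assoc, pmul_comm_zero (hn i) (hn j)]
    rw [hsum]
    push_cast
    module

theorem taylorTerm_zero_coord_mul (j : {i : C.ι // C.deg i = 0}) :
    taylorTerm b n 0 (fun x => x j * F x) = b j • taylorTerm b n 0 F := by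
  simp only [taylorTerm, mul_smul]

/-- The Taylor expansion of `F` at `b` in the increments `n`. -/
noncomputable def taylor (b : C.Body) (n : {i : C.ι // C.deg i = 0} → PSer D)
    (F : C.Body → ℝ) : PSer D := fun γ =>
  ∑ m ∈ Finset.range (γ.degree + 1), (m.factorial : ℝ)⁻¹ * taylorTerm b n m F γ

theorem taylor_congr (hO : IsOpen O) (hb : b ∈ O) (h : ∀ x ∈ O, F x = G x) :
    taylor b n F = taylor b n G := by
  funext γ
  simp only [taylor]
  exact Finset.sum_congr rfl fun m _ => by rw [taylorTerm_congr hO hb m h]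

theorem taylor_zero : taylor b n (fun _ => 0) = 0 := by
  funext γ
  simp [taylor, taylorTerm_zero]

theorem taylor_add (hO : IsOpen O) (hb : b ∈ O) (hF : CylOn J O F) (hG : CylOn J O G) :
    taylor b n (fun x => F x + G x) = taylor b n F + taylor b n G := by
  funext γ
  simp only [taylor, Pi.add_apply, taylorTerm_add hO hb _ hF hG, mul_add, Finset.sum_add_distrib]

theorem taylor_smul (c : ℝ) (F : C.Body → ℝ) :
    taylor b n (fun x => c * F x) = c • taylor b n F := by
  funext γ
  simp only [taylor, Pi.smul_apply, taylorTerm_smul, smul_eq_mul, Finset.mul_sum]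
  exact Finset.sum_congr rfl fun m _ => by ring

theorem partialD_const (c : ℝ) (j : {i : C.ι // C.deg i = 0}) :
    partialD j (fun _ : C.Body => c) = fun _ => 0 := by
  funext x
  simp [partialD]

theorem taylor_const (c : ℝ) : taylor b n (fun _ => c) = c • pone D := by
  have h : ∀ m, taylorTerm b n (m + 1) (fun _ => c) = 0 := fun m => by
    simp [taylorTerm, partialD_const, taylorTerm_zero]
  funext γ
  rw [taylor, Finset.sum_range_succ']
  rw [Finset.sum_eq_zero fun m _ => by rw [h]; simp]
  simp [taylorTerm]

theorem taylor_eq_sum (hn : ∀ j, n j 0 = 0) (hO : IsOpen O) (hb : b ∈ O) (hF : CylOn J O F)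
    {γ : D.ι →₀ ℕ} {N : ℕ} (hN : γ.degree ≤ N) : taylor b n F γ =
      (∑ m ∈ Finset.range (N + 1), (m.factorial : ℝ)⁻¹ • taylorTerm b n m F) γ := by
  rw [Finset.sum_apply, taylor]
  refine Finset.sum_subset (Finset.range_mono (by omega)) fun m _ hm => ?_
  rw [Finset.mem_range] at hm
  rw [ord_taylorTerm hn hO hb m hF γ (by omega), mul_zero]

theorem homog_taylor (hn : ∀ j, Homog 0 (n j)) (hO : IsOpen O) (hb : b ∈ O)
    (hF : CylOn J O F) : Homog 0 (taylor b n F) := fun γ h => by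
  obtain ⟨m, _, hm⟩ := Finset.exists_ne_zero_of_sum_ne_zero h
  exact homog_taylorTerm hn hO hb m hF γ (right_ne_zero_of_mul hm)

theorem taylor_coord_mul (hn : ∀ j, Homog 0 (n j)) (hn0 : ∀ j, n j 0 = 0) (hO : IsOpen O)
    (hb : b ∈ O) (hF : CylOn J O F) (j : {i : C.ι // C.deg i = 0}) :
    taylor b n (fun x => x j * F x) = pmul (b j • pone D + n j) (taylor b n F) := by
  classical
  have hF' := hF.mono (Finset.subset_insert j J) (le_refl O)
  have hj : j ∈ insert j J := Finset.mem_insert_self _ _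
  rw [pmul_add_left, pmul_smul_left, pone_pmul (homog_taylor hn hO hb hF)]
  funext γ
  rw [taylor_eq_sum hn0 hO hb ((CylOn.coord hj).mul hF') (Nat.le_succ γ.degree),
    Pi.add_apply, Pi.smul_apply, taylor_eq_sum hn0 hO hb hF (Nat.le_succ γ.degree),
    pmul_congr (fun _ _ => rfl) fun α hα => taylor_eq_sum hn0 hO hb hF hα, map_sum,
    Finset.sum_range_succ', Finset.sum_range_succ' _ (γ.degree + 1)]
  have h : ∀ m : ℕ, ((m + 1).factorial : ℝ)⁻¹ • taylorTerm b n (m + 1) (fun x => x j * F x) =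
      b j • (((m + 1).factorial : ℝ)⁻¹ • taylorTerm b n (m + 1) F) +
        pmul (n j) ((m.factorial : ℝ)⁻¹ • taylorTerm b n m F) := by
    intro m
    rw [taylorTerm_coord_mul hn hO hb j _ hF, map_smul, Nat.factorial_succ, smul_add, smul_smul,
      smul_smul, smul_smul]
    push_cast
    congr 2
    · ring
    · field_simp
  rw [Finset.sum_congr rfl fun m _ => h m, Finset.sum_add_distrib, ← Finset.smul_sum,
    taylorTerm_zero_coord_mul, smul_comm _ (b j)]
  simp only [Pi.add_apply, Pi.smul_apply, smul_eq_mul]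
  ring

end taylor

/-- The value at `φ` of the monomial `ξ^α`, the coordinates being written in increasing order. -/
noncomputable def monomialAt (φ : C.ι → PSer D) (α : C.ι →₀ ℕ) : PSer D :=
  ((Finsupp.toMultiset α).sort (· ≤ ·)).foldr (fun i s => pmul (φ i) s) (pone D)

theorem monomialAt_zero (φ : C.ι → PSer D) : monomialAt φ 0 = pone D := by
  simp [monomialAt]

theorem monomialAt_add_single (φ : C.ι → PSer D) {α : C.ι →₀ ℕ} {i : C.ι}
    (h : ∀ j ∈ α.support, i ≤ j) :
    monomialAt φ (α + Finsupp.single i 1) = pmul (φ i) (monomialAt φ α) := by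
  rw [monomialAt, map_add, Finsupp.toMultiset_single, one_smul, add_comm, Multiset.singleton_add,
    Multiset.sort_cons]
  · rfl
  · intro j hj
    exact h j (by simpa using hj)

/-- Induction on exponents, removing the smallest coordinate. -/
theorem exponent_induction {P : (C.ι →₀ ℕ) → Prop} (zero : P 0)
    (add : ∀ α i, (∀ j ∈ α.support, i ≤ j) → P α → P (α + Finsupp.single i 1)) (α : C.ι →₀ ℕ) :
    P α := by
  induction hd : α.degree generalizing α with
  | zero =>
    rw [Finsupp.degree_eq_zero_iff] at hd
    exact hd ▸ zero
  | succ d ih =>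
    have hne : α.support.Nonempty := Finsupp.support_nonempty_iff.2 fun h => by simp [h] at hd
    set i := α.support.min' hne
    have hi : i ∈ α.support := Finset.min'_mem _ _
    have hsub : α - Finsupp.single i 1 + Finsupp.single i 1 = α :=
      tsub_add_cancel_of_le (Finsupp.single_le_iff.2
        (Nat.one_le_iff_ne_zero.2 (Finsupp.mem_support_iff.1 hi)))
    rw [← hsub]
    refine add _ i (fun j hj => Finset.min'_le _ _ (Finsupp.support_tsub hj)) (ih _ ?_)
    have := congrArg Finsupp.degree hsub
    rw [map_add, Finsupp.degree_single, hd] at this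
    omega

theorem homog_monomialAt {φ : C.ι → PSer D} (hφ : ∀ i, Homog (C.deg i) (φ i)) (α : C.ι →₀ ℕ) :
    Homog (C.totalDeg α) (monomialAt φ α) := by
  induction α using exponent_induction with
  | zero => rw [monomialAt_zero]; simpa [totalDeg] using homog_pone
  | add α i h ih =>
    rw [monomialAt_add_single φ h]
    exact (hφ i).pmul (by rw [totalDeg_add, totalDeg_single, add_comm]) ih

theorem ord_monomialAt {φ : C.ι → PSer D} {K : Finset C.ι} (hφ : ∀ i ∈ K, φ i 0 = 0)
    (α : C.ι →₀ ℕ) (hα : α.support ⊆ K) : Ord α.degree (monomialAt φ α) := by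
  induction α using exponent_induction with
  | zero => exact fun γ hγ => absurd hγ (by simp)
  | add α i h ih =>
    have h1 : α.support ⊆ K := fun j hj => hα (by
      rw [Finsupp.mem_support_iff] at hj ⊢
      simp only [Finsupp.coe_add, Pi.add_apply]; omega)
    have h2 : i ∈ K := hα (by simp)
    rw [monomialAt_add_single φ h, map_add, Finsupp.degree_single, add_comm]
    exact (Ord.one_of (hφ i h2)).pmul (ih h1)

end GradedCoords

namespace GradedCoords

variable {C D : GradedCoords}

/-- The family of series `F` only involves the coordinates in `K`, and its coefficients depend
smoothly on the coordinates in `J`, on the set `O`. -/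
def CylSer (J : Finset {i : C.ι // C.deg i = 0}) (K : Finset C.ι) (O : Set C.Body)
    (F : C.Body → PSer C) : Prop :=
  (∀ α : C.ι →₀ ℕ, ¬ α.support ⊆ K → ∀ x ∈ O, F x α = 0) ∧ ∀ α, CylOn J O fun x => F x α

section CylSer

variable {J J' : Finset {i : C.ι // C.deg i = 0}} {K K' : Finset C.ι} {O O' : Set C.Body}
  {F G : C.Body → PSer C}

theorem CylSer.mono (h : CylSer J K O F) (hJ : J ⊆ J') (hK : K ⊆ K') (hO : O' ⊆ O) :
    CylSer J' K' O' F :=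
  ⟨fun α hα x hx => h.1 α (fun h => hα (h.trans hK)) x (hO hx), fun α => (h.2 α).mono hJ hO⟩

theorem CylSer.congr (h : CylSer J K O F) (hFG : ∀ x ∈ O, F x = G x) : CylSer J K O G :=
  ⟨fun α hα x hx => hFG x hx ▸ h.1 α hα x hx,
    fun α => (h.2 α).congr fun x hx => congrFun (hFG x hx) α⟩

theorem CylSer.add (hF : CylSer J K O F) (hG : CylSer J K O G) :
    CylSer J K O fun x => F x + G x :=
  ⟨fun α hα x hx => by simp [hF.1 α hα x hx, hG.1 α hα x hx], fun α => (hF.2 α).add (hG.2 α)⟩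

theorem CylSer.mul_smul {f : C.Body → ℝ} (hf : CylOn J O f) (hF : CylSer J K O F) :
    CylSer J K O fun x => f x • F x :=
  ⟨fun α hα x hx => by simp [hF.1 α hα x hx], fun α => hf.mul (hF.2 α)⟩

theorem CylSer.zero : CylSer J K O fun _ => 0 := ⟨fun _ _ _ _ => rfl, fun _ => CylOn.const 0⟩

theorem CylSer.pone : CylSer J K O fun _ => pone C :=
  ⟨fun α hα _ _ => if_neg fun h => hα (by simp [h]), fun _ => CylOn.const _⟩

theorem CylSer.sum {I : Type} {s : Finset I} {F : I → C.Body → PSer C}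
    (h : ∀ i ∈ s, CylSer J K O (F i)) : CylSer J K O fun x => ∑ i ∈ s, F i x := by
  classical
  induction s using Finset.induction_on with
  | empty => simpa using CylSer.zero
  | insert i s hi ih =>
    simp only [Finset.sum_insert hi]
    exact (h i (Finset.mem_insert_self _ _)).add (ih fun j hj => h j (Finset.mem_insert_of_mem hj))

theorem CylSer.pmul (hF : CylSer J K O F) (hG : CylSer J K O G) :
    CylSer J K O fun x => pmul (F x) (G x) := by
  refine ⟨fun γ hγ x hx => ?_, fun γ => ?_⟩
  · simp only [pmul_apply]
    split_ifs
    · refine Finset.sum_eq_zero fun p hp => ?_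
      rw [Finset.HasAntidiagonal.mem_antidiagonal] at hp
      by_cases hs : p.1.support ⊆ K
      · have hs' : ¬ p.2.support ⊆ K := fun hs' => by
          classical
          exact hγ (hp ▸ Finsupp.support_add.trans (Finset.union_subset hs hs'))
        simp [hG.1 p.2 hs' x hx]
      · simp [hF.1 p.1 hs x hx]
    · rfl
  · simp only [pmul_apply]
    split_ifs
    · exact CylOn.sum fun p _ => (CylOn.const _).mul ((hF.2 _).mul (hG.2 _))
    · exact CylOn.const 0

end CylSer

theorem finsum_comp_of_injective {A B : Type} {M : Type} [AddCommMonoid M] {e : A → B}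
    (he : Function.Injective e) {G : B → M} (h : ∀ b ∉ Set.range e, G b = 0) :
    ∑ᶠ b, G b = ∑ᶠ a, G (e a) := by
  classical
  rw [← finsum_mem_range he]
  refine finsum_congr fun b => ?_
  rw [finsum_eq_if]
  split_ifs with hb
  · rfl
  · exact h b hb

/-- The exponents of monomials in the coordinates in `K` with all exponents at most `N`. -/
noncomputable def box (K : Finset C.ι) (N : ℕ) : Finset (C.ι →₀ ℕ) :=
  K.finsupp fun _ => Finset.range (N + 1)

theorem mem_box {K : Finset C.ι} {N : ℕ} {α : C.ι →₀ ℕ} (h : α.support ⊆ K) (hN : α.degree ≤ N) :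
    α ∈ box K N :=
  Finset.mem_finsupp_iff.2 ⟨h, fun i _ => Finset.mem_range_succ_iff.2
    ((Finsupp.le_degree i α).trans hN)⟩

theorem support_subset_of_mem_box {K : Finset C.ι} {N : ℕ} {α : C.ι →₀ ℕ} (h : α ∈ box K N) :
    α.support ⊆ K := (Finset.mem_finsupp_iff.1 h).1

/-- The value of the coordinates of degree zero. -/
def basePt (φ : C.ι → PSer D) : C.Body := fun j => φ j.1 0

/-- The nilpotent part of the values of the coordinates of degree zero. -/
noncomputable def incr (φ : C.ι → PSer D) (j : {i : C.ι // C.deg i = 0}) : PSer D :=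
  φ j.1 - φ j.1 0 • pone D

theorem incr_zero (φ : C.ι → PSer D) (j) : incr φ j 0 = 0 := by
  simp [incr, pone]

theorem homog_incr {φ : C.ι → PSer D} (hφ : ∀ i, Homog (C.deg i) (φ i)) (j) :
    Homog 0 (incr φ j) := by
  rw [incr, sub_eq_add_neg, ← neg_smul]
  exact (j.2 ▸ hφ j.1).add (homog_pone.smul _)

theorem base_add_incr (φ : C.ι → PSer D) (j : {i : C.ι // C.deg i = 0}) :
    basePt φ j • pone D + incr φ j = φ j.1 := by
  simp [basePt, incr]

/-- The Taylor expansion at the values `φ` of the coordinates. -/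
noncomputable abbrev taylorAt (φ : C.ι → PSer D) (F : C.Body → ℝ) : PSer D :=
  taylor (basePt φ) (incr φ) F

/-- The substitution of the values `φ` for the coordinates in a series `F`. -/
noncomputable def substSeries (φ : C.ι → PSer D) (F : C.Body → PSer C) : PSer D := fun γ =>
  ∑ᶠ α, pmul (taylorAt φ fun x => F x α) (monomialAt φ α) γ

section subst

variable {φ : C.ι → PSer D} {J : Finset {i : C.ι // C.deg i = 0}} {K : Finset C.ι}
  {O : Set C.Body} {F G : C.Body → PSer C}

theorem substSeries_congr (hO : IsOpen O) (hb : basePt φ ∈ O) (h : ∀ x ∈ O, F x = G x) :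
    substSeries φ F = substSeries φ G := by
  funext γ
  refine finsum_congr fun α => ?_
  rw [taylorAt, taylor_congr hO hb fun x hx => congrFun (h x hx) α]

theorem taylorAt_eq_zero (hO : IsOpen O) (hb : basePt φ ∈ O) {f : C.Body → ℝ}
    (h : ∀ x ∈ O, f x = 0) : taylorAt φ f = 0 := by
  rw [taylorAt, taylor_congr hO hb h, taylor_zero]

variable (hφ : ∀ i, Homog (C.deg i) (φ i)) (hO : IsOpen O) (hb : basePt φ ∈ O)
  (hK : ∀ i ∈ K, C.deg i ≠ 0) (hF : CylSer J K O F)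

include hφ hO hb hK hF

theorem support_substSeries (γ : D.ι →₀ ℕ) :
    (Function.support fun α => pmul (taylorAt φ fun x => F x α) (monomialAt φ α) γ) ⊆
      box K γ.degree := fun α hα => by
  by_contra hmem
  refine hα ?_
  change pmul (taylorAt φ fun x => F x α) (monomialAt φ α) γ = 0
  by_cases hs : α.support ⊆ K
  · have hd : γ.degree < 0 + α.degree := by
      rw [zero_add]
      by_contra hd
      exact hmem (mem_box hs (not_lt.1 hd))
    exact Ord.pmul (fun _ h => absurd h (Nat.not_lt_zero _))
      (ord_monomialAt (fun i hi => (hφ i).eq_zero_of_ne (hK i hi)) α hs) γ hd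
  · rw [taylorAt_eq_zero hO hb fun x hx => hF.1 α hs x hx, pmul_zero_left]
    rfl

theorem substSeries_eq_sum {γ : D.ι →₀ ℕ} {N : ℕ} (hN : γ.degree ≤ N) :
    substSeries φ F γ =
      (∑ α ∈ box K N, pmul (taylorAt φ fun x => F x α) (monomialAt φ α)) γ := by
  rw [Finset.sum_apply]
  refine finsum_eq_sum_of_support_subset _ fun α hα => ?_
  have := support_substSeries hφ hO hb hK hF γ hα
  rw [Finset.mem_coe, box, Finset.mem_finsupp_iff] at this ⊢
  exact ⟨this.1, fun i hi => Finset.range_mono (by omega) (this.2 i hi)⟩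

theorem substSeries_add (hG : CylSer J K O G) :
    substSeries φ (fun x => F x + G x) = substSeries φ F + substSeries φ G := by
  funext γ
  rw [Pi.add_apply, substSeries_eq_sum hφ hO hb hK hF le_rfl,
    substSeries_eq_sum hφ hO hb hK hG le_rfl, substSeries_eq_sum hφ hO hb hK (hF.add hG) le_rfl,
    ← Pi.add_apply, ← Finset.sum_add_distrib]
  refine congrFun (Finset.sum_congr rfl fun α _ => ?_) γ
  rw [← pmul_add_left, ← taylor_add hO hb (hF.2 α) (hG.2 α)]
  rfl

omit hφ hO hb hK hF in
theorem substSeries_smul (c : ℝ) (F : C.Body → PSer C) :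
    substSeries φ (fun x => c • F x) = c • substSeries φ F := by
  funext γ
  simp only [substSeries, Pi.smul_apply]
  rw [smul_finsum]
  refine finsum_congr fun α => ?_
  simp only [smul_eq_mul, taylorAt, taylor_smul, pmul_smul_left, Pi.smul_apply]

omit hO hb hK hF in
theorem substSeries_one : substSeries φ (fun _ => pone C) = pone D := by
  have h1 : ∀ i ∈ (∅ : Finset C.ι), C.deg i ≠ 0 := by simp
  funext γ
  rw [substSeries_eq_sum hφ isOpen_univ (Set.mem_univ _) h1
    (CylSer.pone (J := ∅) (O := Set.univ)) le_rfl,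
    Finset.sum_eq_single_of_mem 0 (mem_box (by simp) (by simp))]
  · rw [monomialAt_zero, taylorAt, taylor_const, pmul_smul_left, pone_pmul homog_pone]
    simp [pone]
  · intro α hα h0
    exact absurd (Finsupp.support_eq_empty.1
      (Finset.subset_empty.1 (support_subset_of_mem_box hα))) h0

theorem homog_substSeries {k : ℤ} (hk : ∀ x ∈ O, Homog k (F x)) :
    Homog k (substSeries φ F) := fun γ hγ => by
  rw [substSeries_eq_sum hφ hO hb hK hF le_rfl] at hγ
  refine Homog.sum (fun α _ => ?_) γ hγ
  by_cases hα : ∀ x ∈ O, F x α = 0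
  · rw [taylorAt_eq_zero hO hb hα, pmul_zero_left]
    exact Homog.zero k
  · push Not at hα
    obtain ⟨x, hx, hx'⟩ := hα
    rw [← (hk x hx α hx').2]
    exact (homog_taylor (homog_incr hφ) hO hb (hF.2 α)).pmul (zero_add _) (homog_monomialAt hφ α)

theorem pmul_substSeries (s : PSer D) (γ : D.ι →₀ ℕ) : pmul s (substSeries φ F) γ =
    ∑ α ∈ box K γ.degree, pmul s (pmul (taylorAt φ fun x => F x α) (monomialAt φ α)) γ := by
  rw [pmul_congr (fun _ _ => rfl) fun α hα => substSeries_eq_sum hφ hO hb hK hF hα, map_sum,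
    Finset.sum_apply]

theorem substSeries_coord_smul (j : {i : C.ι // C.deg i = 0}) :
    substSeries φ (fun x => x j • F x) = pmul (φ j.1) (substSeries φ F) := by
  classical
  have hJ := Finset.subset_insert j J
  have h1 : CylSer (insert j J) K O fun x => x j • F x :=
    CylSer.mul_smul (CylOn.coord (Finset.mem_insert_self _ _)) (hF.mono hJ le_rfl le_rfl)
  funext γ
  rw [pmul_substSeries hφ hO hb hK hF, substSeries_eq_sum hφ hO hb hK h1 le_rfl, Finset.sum_apply]
  refine Finset.sum_congr rfl fun α _ => ?_
  have := taylor_coord_mul (homog_incr hφ) (incr_zero φ) hO hb (hF.2 α) j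
  rw [base_add_incr] at this
  rw [← pmul_assoc, ← this]
  rfl

/-- Multiplication by a coordinate of nonzero degree that comes first. -/
theorem substSeries_coord_mul {i : C.ι}
    (hA : ∀ x ∈ O, ∀ α, F x α ≠ 0 → C.Above i α) :
    substSeries φ (fun x γ => if γ i = 0 then 0 else F x (γ - Finsupp.single i 1)) =
      pmul (φ i) (substSeries φ F) := by
  classical
  funext γ
  rw [pmul_substSeries hφ hO hb hK hF, substSeries]
  have hinj : Function.Injective fun α : C.ι →₀ ℕ => α + Finsupp.single i 1 :=
    add_left_injective _
  have hterm : ∀ α : C.ι →₀ ℕ, pmul (taylorAt φ fun x => if (α + Finsupp.single i 1 : C.ι →₀ ℕ) i = 0 then 0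
      else F x (α + Finsupp.single i 1 - Finsupp.single i 1))
      (monomialAt φ (α + Finsupp.single i 1)) =
      pmul (φ i) (pmul (taylorAt φ fun x => F x α) (monomialAt φ α)) := by
    intro α
    have e : (fun x => if (α + Finsupp.single i 1 : C.ι →₀ ℕ) i = 0 then 0
      else F x (α + Finsupp.single i 1 - Finsupp.single i 1)) = fun x => F x α := by
      funext x
      rw [if_neg (by simp), add_tsub_cancel_right]
    rw [e]
    by_cases ha : C.Above i α
    · rw [monomialAt_add_single φ ha.1, ← pmul_assoc, ← pmul_assoc,
        pmul_comm_zero (homog_taylor (homog_incr hφ) hO hb (hF.2 α)) (hφ i)]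
    · have : ∀ x ∈ O, F x α = 0 := fun x hx => by
        by_contra h
        exact ha (hA x hx α h)
      rw [taylorAt_eq_zero hO hb this, pmul_zero_left, pmul_zero_left, map_zero]
  have hrange : ∀ β ∉ Set.range fun α : C.ι →₀ ℕ => α + Finsupp.single i 1,
      pmul (taylorAt φ fun x => if β i = 0 then 0 else F x (β - Finsupp.single i 1))
        (monomialAt φ β) γ = 0 := by
    intro β hβ
    have : β i = 0 := by
      by_contra h
      exact hβ ⟨β - Finsupp.single i 1,
        tsub_add_cancel_of_le (Finsupp.single_le_iff.2 (Nat.one_le_iff_ne_zero.2 h))⟩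
    simp only [this, if_true]
    rw [taylorAt, taylor_zero, pmul_zero_left]
    rfl
  rw [finsum_comp_of_injective hinj hrange]
  rw [finsum_congr fun α => congrFun (hterm α) γ]
  refine finsum_eq_sum_of_support_subset _ fun α hα => ?_
  by_contra hmem
  refine hα ?_
  change pmul (φ i) (pmul (taylorAt φ fun x => F x α) (monomialAt φ α)) γ = 0
  rw [pmul_congr (f' := φ i) (g' := 0) (fun _ _ => rfl), map_zero]
  · rfl
  · intro β hβ
    by_contra hne
    have := support_substSeries hφ hO hb hK hF β hne
    rw [Finset.mem_coe, box, Finset.mem_finsupp_iff] at this hmem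
    exact hmem ⟨this.1, fun i hi => Finset.range_mono (by omega) (this.2 i hi)⟩

end subst

section smooth

variable {J : Finset {i : C.ι // C.deg i = 0}} {K : Finset C.ι} {O : Set C.Body}
  {J' : Finset {i : D.ι // D.deg i = 0}} {K' : Finset D.ι} {O' : Set D.Body}
  {φ : D.Body → C.ι → PSer D}

theorem CylOn.comp {f : C.Body → ℝ} (hf : CylOn J O f) {b : D.Body → C.Body}
    (hb : ∀ y ∈ O', b y ∈ O) (hs : ∀ j ∈ J, CylOn J' O' fun y => b y j) :
    CylOn J' O' fun y => f (b y) := by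
  obtain ⟨g, hg, h⟩ := hf
  choose u hu hu' using fun j : J => hs j.1 j.2
  refine ⟨fun z => g fun j => u j z, hg.comp (contDiff_pi.2 hu), fun y hy => ?_⟩
  change f (b y) = _
  rw [h _ (hb y hy)]
  congr 1
  funext j
  exact hu' j y hy

theorem CylSer.taylorTerm (hO : IsOpen O) (hb : ∀ y ∈ O', basePt (φ y) ∈ O)
    (hs : ∀ j ∈ J, CylSer J' K' O' fun y => φ y j.1) (m : ℕ) {f : C.Body → ℝ}
    (hf : CylOn J O f) :
    CylSer J' K' O' fun y => taylorTerm (basePt (φ y)) (incr (φ y)) m f := by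
  induction m generalizing f with
  | zero =>
    exact CylSer.mul_smul (hf.comp hb fun j hj => (hs j hj).2 0) CylSer.pone
  | succ m ih =>
    refine CylSer.congr (F := fun y => ∑ j ∈ J, GradedCoords.pmul (incr (φ y) j)
      (GradedCoords.taylorTerm (basePt (φ y)) (incr (φ y)) m (GradedCoords.partialD j f)))
      (CylSer.sum fun j hj => CylSer.pmul ?_ (ih (hf.partialD hO j)))
      fun y hy => (taylorTerm_succ hO (hb y hy) hf m).symm
    refine CylSer.congr (F := fun y => φ y j.1 + ((-1 : ℝ) * φ y j.1 0) • GradedCoords.pone D)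
      ((hs j hj).add (CylSer.mul_smul ((CylOn.const _).mul ((hs j hj).2 0)) CylSer.pone))
      fun y _ => ?_
    rw [incr, neg_one_mul, neg_smul, sub_eq_add_neg]

theorem CylSer.taylorAt (hO : IsOpen O) (hb : ∀ y ∈ O', basePt (φ y) ∈ O)
    (hs : ∀ j ∈ J, CylSer J' K' O' fun y => φ y j.1) {f : C.Body → ℝ} (hf : CylOn J O f) :
    CylSer J' K' O' fun y => taylorAt (φ y) f := by
  have h := fun m => CylSer.taylorTerm hO hb hs m hf
  exact ⟨fun α hα y hy => Finset.sum_eq_zero fun m _ => by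
    have := (h m).1 α hα y hy
    simp only at this
    rw [this, mul_zero],
    fun α => CylOn.sum fun m _ => (CylOn.const _).mul ((h m).2 α)⟩

theorem CylSer.monomialAt (hs : ∀ i ∈ K, CylSer J' K' O' fun y => φ y i) (α : C.ι →₀ ℕ)
    (hα : α.support ⊆ K) : CylSer J' K' O' fun y => monomialAt (φ y) α := by
  induction α using exponent_induction with
  | zero => simp only [monomialAt_zero]; exact CylSer.pone
  | add α i h ih =>
    have h1 : α.support ⊆ K := fun j hj => hα (by
      rw [Finsupp.mem_support_iff] at hj ⊢
      simp only [Finsupp.coe_add, Pi.add_apply]; omega)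
    simp only [monomialAt_add_single _ h]
    exact (hs i (hα (by simp))).pmul (ih h1)

theorem CylSer.substSeries (hφ : ∀ y ∈ O', ∀ i, Homog (C.deg i) (φ y i)) (hO : IsOpen O)
    (hb : ∀ y ∈ O', basePt (φ y) ∈ O) (hK : ∀ i ∈ K, C.deg i ≠ 0) {F : C.Body → PSer C}
    (hF : CylSer J K O F) (hJs : ∀ j ∈ J, CylSer J' K' O' fun y => φ y j.1)
    (hKs : ∀ i ∈ K, CylSer J' K' O' fun y => φ y i) :
    CylSer J' K' O' fun y => substSeries (φ y) F := by
  have h := fun α (hα : α.support ⊆ K) =>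
    (CylSer.taylorAt hO hb hJs (hF.2 α)).pmul (CylSer.monomialAt hKs α hα)
  have hN := fun N => CylSer.sum fun α (hα : α ∈ box K N) => h α (support_subset_of_mem_box hα)
  refine ⟨fun γ hγ y hy => ?_, fun γ => ?_⟩
  · exact (substSeries_eq_sum (hφ y hy) hO (hb y hy) hK hF le_rfl).trans
      ((hN γ.degree).1 γ hγ y hy)
  · exact ((hN γ.degree).2 γ).congr fun y hy =>
      (substSeries_eq_sum (hφ y hy) hO (hb y hy) hK hF le_rfl).symm

end smooth

end GradedCoords

namespace GradedCoords

variable {C D : GradedCoords}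

theorem mulF_assoc {U : Opens C.Body} {i j k ij jk l : ℤ} (hij : i + j = ij) (hjk : j + k = jk)
    (h₁ : ij + k = l) (h₂ : i + jk = l) (a : C.functions U i) (b : C.functions U j)
    (c : C.functions U k) : mulF h₁ (mulF hij a b) c = mulF h₂ a (mulF hjk b c) :=
  C.toGradedSpace.mul_assoc hij hjk h₁ h₂ a b c

theorem mulF_comm {U : Opens C.Body} {i j k : ℤ} (h : i + j = k) (h' : j + i = k)
    (a : C.functions U i) (b : C.functions U j) :
    mulF h a b = (i * j).negOnePow • mulF h' b a :=
  C.toGradedSpace.mul_comm h h' a b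

open Classical in
/-- The family of coefficients of a function, extended by zero. -/
noncomputable def extend {U : Opens C.Body} {k : ℤ} (a : C.functions U k) (x : C.Body) : PSer C :=
  fun γ => if h : x ∈ U then a.1 γ ⟨x, h⟩ else 0

section extend

variable {U V : Opens C.Body} {k : ℤ} {x : C.Body}

theorem extend_apply (a : C.functions U k) (hx : x ∈ U) (γ : C.ι →₀ ℕ) :
    extend a x γ = a.1 γ ⟨x, hx⟩ := dif_pos hx

theorem homog_extend (a : C.functions U k) (x : C.Body) : Homog k (extend a x) := fun γ h => by
  by_cases hx : x ∈ U
  · rw [extend_apply _ hx] at h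
    exact a.2.1 γ fun h' => h (by rw [h']; rfl)
  · exact absurd (dif_neg hx) h

theorem extend_res (h : V ≤ U) (a : C.functions U k) (hx : x ∈ V) :
    extend (resF h a) x = extend a x := by
  funext γ
  rw [extend_apply _ hx, extend_apply _ (h hx)]
  rfl

theorem extend_add (a b : C.functions U k) (x : C.Body) :
    extend (a + b) x = extend a x + extend b x := by
  funext γ
  by_cases hx : x ∈ U
  · simp only [Pi.add_apply, extend_apply _ hx]
    rfl
  · simp [extend, hx]

theorem extend_smul (c : ℝ) (a : C.functions U k) (x : C.Body) :
    extend (c • a) x = c • extend a x := by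
  funext γ
  by_cases hx : x ∈ U
  · simp only [Pi.smul_apply, extend_apply _ hx]
    rfl
  · simp [extend, hx]

theorem extend_one (hx : x ∈ U) :
    extend (⟨oneSeries U, IsFunction.one U⟩ : C.functions U 0) x = pone C := by
  funext γ
  rw [extend_apply _ hx]
  rfl

theorem exists_cylSer (a : C.functions U k) (hx : x ∈ U) :
    ∃ (J : Finset {i : C.ι // C.deg i = 0}) (K : Finset C.ι) (O : Set C.Body), IsOpen O ∧ x ∈ O ∧
      O ⊆ U ∧ (∀ i ∈ K, C.deg i ≠ 0) ∧ CylSer J K O (extend a) := by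
  classical
  obtain ⟨J, K, V, hV, h1, h2⟩ := a.2.2 ⟨x, hx⟩
  obtain ⟨V', hV', hVo, hxV⟩ := mem_nhds_iff.1 hV
  refine ⟨J, K.filter fun i => C.deg i ≠ 0, Subtype.val '' V',
    U.isOpen.isOpenMap_subtype_val _ hVo, ⟨_, hxV, rfl⟩, ?_, fun i hi => (Finset.mem_filter.1 hi).2,
    ?_, fun α => ?_⟩
  · rintro _ ⟨y, _, rfl⟩
    exact y.2
  · rintro α hα _ ⟨y, hy, rfl⟩
    rw [extend_apply _ y.2]
    by_cases hs : α.support ⊆ K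
    · by_contra hne
      have had := (a.2.1 α fun h => hne (by rw [h]; rfl)).1
      refine hα fun i hi => Finset.mem_filter.2 ⟨hs hi, fun h0 => ?_⟩
      exact Finsupp.mem_support_iff.1 hi ((had i).1 h0)
    · exact h1 α hs y (hV' hy)
  · obtain ⟨g, hg, h⟩ := h2 α
    refine ⟨g, hg, ?_⟩
    rintro _ ⟨y, hy, rfl⟩
    exact (extend_apply _ y.2 α).trans (h y (hV' hy))

theorem exists_common_cylSer {I : Type} {d : I → ℤ} (φ : ∀ i, C.functions U (d i)) (s : Finset I)
    (hx : x ∈ U) : ∃ (J : Finset {i : C.ι // C.deg i = 0}) (K : Finset C.ι) (O : Set C.Body),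
      IsOpen O ∧ x ∈ O ∧ ∀ i ∈ s, CylSer J K O (extend (φ i)) := by
  classical
  induction s using Finset.induction_on with
  | empty => exact ⟨∅, ∅, Set.univ, isOpen_univ, Set.mem_univ _, by simp⟩
  | insert i s hi ih =>
    obtain ⟨J, K, O, hO, hxO, h⟩ := ih
    obtain ⟨J', K', O', hO', hxO', _, _, h'⟩ := exists_cylSer (φ i) hx
    refine ⟨J ∪ J', K ∪ K', O ∩ O', hO.inter hO', ⟨hxO, hxO'⟩, fun j hj => ?_⟩
    rcases Finset.mem_insert.1 hj with rfl | hj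
    · exact h'.mono Finset.subset_union_right Finset.subset_union_right Set.inter_subset_right
    · exact (h j hj).mono Finset.subset_union_left Finset.subset_union_left Set.inter_subset_left

theorem isFunction_of_cylSer {s : C.Body → PSer C} (hs : ∀ x ∈ U, Homog k (s x))
    (h : ∀ x ∈ U, ∃ (J : Finset {i : C.ι // C.deg i = 0}) (K : Finset C.ι) (O : Set C.Body),
      IsOpen O ∧ x ∈ O ∧ CylSer J K O s) : C.IsFunction U k fun γ y => s y γ := by
  refine ⟨fun γ hγ => ?_, fun x => ?_⟩
  · obtain ⟨y, hy⟩ := Function.ne_iff.1 hγ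
    exact hs y y.2 γ hy
  · obtain ⟨J, K, O, hO, hx, h1, h2⟩ := h x x.2
    exact ⟨J, K, Subtype.val ⁻¹' O, (hO.preimage continuous_subtype_val).mem_nhds hx,
      fun α hα y hy => h1 α hα y hy, fun α => by
        obtain ⟨g, hg, h⟩ := h2 α
        exact ⟨g, hg, fun y hy => h y hy⟩⟩

end extend

/-- The substitution of the values `φ` for the coordinates in a function. -/
noncomputable def subst (φ : C.ι → PSer D) {U : Opens C.Body} {k : ℤ} (a : C.functions U k) :
    PSer D :=
  substSeries φ (extend a)

/-- The coordinate `i` as a function. -/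
noncomputable def coordF (C : GradedCoords) (i : C.ι) (U : Opens C.Body) :
    C.functions U (C.deg i) :=
  ⟨C.coordSeries i U, C.coordSeries_isFunction i U⟩

section subst

variable {φ : C.ι → PSer D} {U V : Opens C.Body} {k : ℤ}

theorem subst_smul (c : ℝ) (a : C.functions U k) : subst φ (c • a) = c • subst φ a := by
  rw [subst, subst, ← substSeries_smul]
  congr 1
  funext x
  exact extend_smul c a x

theorem subst_res (h : V ≤ U) (a : C.functions U k) (hb : basePt φ ∈ V) :
    subst φ (resF h a) = subst φ a :=
  substSeries_congr V.isOpen hb fun _ hx => extend_res h a hx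

variable (hφ : ∀ i, Homog (C.deg i) (φ i)) (hb : basePt φ ∈ U)

include hφ hb

theorem subst_add (a b : C.functions U k) : subst φ (a + b) = subst φ a + subst φ b := by
  classical
  obtain ⟨J, K, O, hO, hbO, _, hK, ha⟩ := exists_cylSer a hb
  obtain ⟨J', K', O', hO', hbO', _, hK', hb'⟩ := exists_cylSer b hb
  have e : extend (a + b) = fun x => extend a x + extend b x := funext (extend_add a b)
  rw [subst, e]
  refine substSeries_add hφ (hO.inter hO') ⟨hbO, hbO'⟩ (K := K ∪ K') ?_
    (ha.mono (Finset.subset_union_left (s₂ := J')) Finset.subset_union_left Set.inter_subset_left)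
    (hb'.mono Finset.subset_union_right Finset.subset_union_right Set.inter_subset_right)
  intro i hi
  rcases Finset.mem_union.1 hi with h | h
  · exact hK i h
  · exact hK' i h

theorem subst_one : subst φ (⟨oneSeries U, IsFunction.one U⟩ : C.functions U 0) = pone D :=
  (substSeries_congr U.isOpen hb fun _ hx => extend_one hx).trans (substSeries_one hφ)

theorem homog_subst (a : C.functions U k) : Homog k (subst φ a) := by
  obtain ⟨J, K, O, hO, hbO, _, hK, ha⟩ := exists_cylSer a hb
  exact homog_substSeries hφ hO hbO hK ha fun x _ => homog_extend a x

theorem subst_sub (a b : C.functions U k) : subst φ (a - b) = subst φ a - subst φ b := by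
  have h : subst φ ((-1 : ℝ) • b) = -subst φ b := by rw [subst_smul, neg_one_smul]
  have e : a - b = a + (-1 : ℝ) • b := Subtype.ext (by simp [sub_eq_add_neg])
  rw [e, subst_add hφ hb, h, sub_eq_add_neg]

theorem subst_const (a : C.functions U k) {r : ℝ} (ha : a.1 = r • oneSeries U) :
    subst φ a = r • pone D := by
  refine (substSeries_congr (G := fun _ => r • pone C) U.isOpen hb fun x hx => ?_).trans
    ((substSeries_smul r _).trans (congrArg (r • ·) (substSeries_one hφ)))
  funext γ
  rw [extend_apply _ hx, ha]
  rfl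

omit hφ hb in
theorem subst_zero : subst φ (0 : C.functions U k) = 0 := by
  have := subst_smul (φ := φ) 0 (0 : C.functions U k)
  rwa [zero_smul, zero_smul] at this

theorem subst_coord_mul_of_eq (j : {i : C.ι // C.deg i = 0}) {l : ℤ} (h : C.deg j.1 + l = k)
    (a : C.functions U l) :
    subst φ (mulF h (C.coordF j.1 U) a) = pmul (φ j.1) (subst φ a) := by
  obtain ⟨J, K, O, hO, hbO, hOU, hK, ha⟩ := exists_cylSer a hb
  rw [subst, subst, ← substSeries_coord_smul hφ hO hbO hK ha j]
  refine substSeries_congr hO hbO fun x hx => ?_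
  funext γ
  rw [extend_apply _ (hOU hx)]
  refine (mulSeries_of_concentrated (fun α hα => ?_) (not_admissible_eq_zero a.2) γ _).trans ?_
  · funext y
    exact (coordSeries_of_deg_eq_zero j.2 α y).trans (if_neg hα)
  · change _ = x j * extend a x γ
    rw [extend_apply _ (hOU hx)]
    exact congrArg (· * _) ((coordSeries_of_deg_eq_zero j.2 0 _).trans (if_pos rfl))

theorem subst_coord_mul_of_above {i : C.ι} (hi : C.deg i ≠ 0) {l : ℤ} (h : C.deg i + l = k)
    (a : C.functions U l) (hA : ∀ α, a.1 α ≠ 0 → C.Above i α) :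
    subst φ (mulF h (C.coordF i U) a) = pmul (φ i) (subst φ a) := by
  obtain ⟨J, K, O, hO, hbO, hOU, hK, ha⟩ := exists_cylSer a hb
  rw [subst, subst, ← substSeries_coord_mul hφ hO hbO hK ha fun x hx α hα => hA α fun h0 => hα (by
    rw [extend_apply _ (hOU hx), h0]; rfl)]
  refine substSeries_congr hO hbO fun x hx => ?_
  funext γ
  rw [extend_apply _ (hOU hx), extend_apply _ (hOU hx)]
  exact mulSeries_coord hi hA γ _

/-- The value of a shifted coordinate. -/
theorem subst_gen_mul_of_eq (j : {i : C.ι // C.deg i = 0}) {l : ℤ}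
    (h : C.deg j.1 + l = k) (a : C.functions U l) :
    subst φ (mulF h (C.gen (basePt φ) j.1 U) a) = pmul (incr φ j) (subst φ a) := by
  have hl : l = k := by rw [← h, j.2, zero_add]
  subst hl
  have e : mulF h (C.gen (basePt φ) j.1 U) a = mulF h (C.coordF j.1 U) a - basePt φ j • a := by
    refine Subtype.ext (funext fun γ => funext fun y => ?_)
    have h1 := mulSeries_of_concentrated (f := (C.gen (basePt φ) j.1 U).1) (fun α hα => by
      funext y
      exact (gen_of_deg_eq_zero j.2 U α y).trans (if_neg hα)) (not_admissible_eq_zero a.2) γ y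
    have h2 := mulSeries_of_concentrated (f := (C.coordF j.1 U).1) (fun α hα => by
      funext y
      exact (coordSeries_of_deg_eq_zero j.2 α y).trans (if_neg hα)) (not_admissible_eq_zero a.2) γ y
    refine h1.trans ?_
    refine Eq.trans ?_ (congrArg (· - basePt φ j * a.1 γ y) h2).symm
    rw [gen_of_deg_eq_zero j.2, if_pos rfl, sub_mul]
    exact congrArg (fun t => t * _ - _)
      ((coordSeries_of_deg_eq_zero j.2 0 y).trans (if_pos rfl)).symm
  have h1 : incr φ j = φ j.1 + (-basePt φ j) • pone D := by
    simp [incr, basePt, sub_eq_add_neg]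
  rw [e, subst_sub hφ hb, subst_coord_mul_of_eq hφ hb, subst_smul, h1, pmul_add_left,
    pmul_smul_left, pone_pmul (homog_subst hφ hb a), neg_smul, sub_eq_add_neg]

end subst

end GradedCoords

namespace GradedSpace

variable {M : GradedSpace} {U : Opens M} {i j k : ℤ} (h : i + j = k)

theorem mul_add_right (a : M.sec U i) (b b' : M.sec U j) :
    M.mul h a (b + b') = M.mul h a b + M.mul h a b' := map_add _ _ _

theorem mul_add_left (a a' : M.sec U i) (b : M.sec U j) :
    M.mul h (a + a') b = M.mul h a b + M.mul h a' b := LinearMap.map_add₂ _ _ _ _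

theorem mul_smul_right (c : ℝ) (a : M.sec U i) (b : M.sec U j) :
    M.mul h a (c • b) = c • M.mul h a b := map_smul _ _ _

theorem mul_smul_left (c : ℝ) (a : M.sec U i) (b : M.sec U j) :
    M.mul h (c • a) b = c • M.mul h a b := LinearMap.map_smul₂ _ _ _ _

theorem mul_zero_left (b : M.sec U j) : M.mul h (0 : M.sec U i) b = 0 := LinearMap.map_zero₂ _ _

theorem units_smul_real {E : Type} [AddCommGroup E] [Module ℝ E] (u : ℤˣ) (x : E) :
    u • x = ((u : ℤ) : ℝ) • x := by
  rcases Int.units_eq_one_or u with rfl | rfl <;> simp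

theorem eq_zero_of_eq_neg {E : Type} [AddCommGroup E] [Module ℝ E] {x : E} (h : x = -x) :
    x = 0 := by
  have h2 : (2 : ℝ) • x = 0 := by rw [two_smul]; nth_rewrite 2 [h]; exact add_neg_cancel x
  exact (smul_eq_zero.1 h2).resolve_left two_ne_zero

end GradedSpace

namespace GradedCoords

open GradedSpace

variable {C D : GradedCoords}

theorem mulF_add_right {U : Opens C.Body} {i j k : ℤ} (h : i + j = k) (a : C.functions U i)
    (b b' : C.functions U j) : mulF h a (b + b') = mulF h a b + mulF h a b' :=
  C.toGradedSpace.mul_add_right (U := U) h a b b'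

theorem mulF_add_left {U : Opens C.Body} {i j k : ℤ} (h : i + j = k) (a a' : C.functions U i)
    (b : C.functions U j) : mulF h (a + a') b = mulF h a b + mulF h a' b :=
  C.toGradedSpace.mul_add_left (U := U) h a a' b

theorem mulF_smul_left {U : Opens C.Body} {i j k : ℤ} (h : i + j = k) (c : ℝ)
    (a : C.functions U i) (b : C.functions U j) : mulF h (c • a) b = c • mulF h a b :=
  C.toGradedSpace.mul_smul_left (U := U) h c a b

theorem res_mulF {U V : Opens C.Body} (hV : V ≤ U) {i j k : ℤ} (h : i + j = k)
    (a : C.functions U i) (b : C.functions U j) :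
    resF hV (mulF h a b) = mulF h (resF hV a) (resF hV b) := rfl

theorem gen_eq_coordF {b : C.Body} {i : C.ι} (hi : C.deg i ≠ 0) (U : Opens C.Body) :
    C.gen b i U = C.coordF i U :=
  Subtype.ext (gen_of_deg_ne_zero hi U)

/-- The monomials in `ξ^i f`. -/
theorem coordF_mul_ne_zero {i : C.ι} (hi : C.deg i ≠ 0) {U : Opens C.Body} {l k : ℤ}
    (h : C.deg i + l = k) (f : C.functions U l) {α : C.ι →₀ ℕ}
    (hα : (mulF h (C.coordF i U) f).1 α ≠ 0) :
    C.Admissible α ∧ ∃ β, f.1 β ≠ 0 ∧ α = Finsupp.single i 1 + β := by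
  obtain ⟨y, hy⟩ := Function.ne_iff.1 hα
  have hy' : C.mulSeries (C.coordSeries i U) f.1 α y ≠ 0 := hy
  refine ⟨((mulF h (C.coordF i U) f).2.1 α hα).1, ?_⟩
  rw [mulSeries] at hy'
  split_ifs at hy' with had
  · obtain ⟨p, hp, hne⟩ := Finset.exists_ne_zero_of_sum_ne_zero hy'
    rw [Finset.HasAntidiagonal.mem_antidiagonal] at hp
    have h1 := left_ne_zero_of_mul (right_ne_zero_of_mul hne)
    have h2 := right_ne_zero_of_mul (right_ne_zero_of_mul hne)
    refine ⟨p.2, fun h => h2 (by rw [h]; rfl), ?_⟩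
    rw [← hp]
    congr 1
    by_contra h3
    exact h1 ((coordSeries_of_deg_ne_zero hi _ _).trans (if_neg h3))
  · exact absurd rfl hy'

section

variable {φ : C.ι → PSer D} (hφ : ∀ i, Homog (C.deg i) (φ i))

/-- A function that only involves coordinates from `i` on. -/
theorem above_coordF_mul_of_le {i j : C.ι} (hij : i ≤ j) (hne : i = j → ¬ Odd (C.deg i))
    (hi : C.deg i ≠ 0) (hj : C.deg j ≠ 0) {U : Opens C.Body} {l k : ℤ} (h : C.deg j + l = k)
    (f : C.functions U l) (hf : ∀ α, f.1 α ≠ 0 → C.Above j α) (α : C.ι →₀ ℕ)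
    (hα : (mulF h (C.coordF j U) f).1 α ≠ 0) : C.Above i α := by
  obtain ⟨had, β, hβ, rfl⟩ := coordF_mul_ne_zero hj h f hα
  have hA := hf β hβ
  refine ⟨fun l hl => ?_, fun l => ?_⟩
  · classical
    rcases Finset.mem_union.1 (Finsupp.support_add hl) with h1 | h1
    · have := Finsupp.support_single_subset h1
      rw [Finset.mem_singleton] at this
      exact this ▸ hij
    · exact hij.trans (hA.1 l h1)
  · by_cases hl : i = l
    · subst hl
      refine ⟨fun h0 => absurd h0 hi, fun hodd => ?_⟩
      have hij' : i < j := lt_of_le_of_ne hij fun h => hne h hodd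
      have h1 : β i = 0 := by
        by_contra h
        exact (hA.1 i (Finsupp.mem_support_iff.2 h)).not_gt hij'
      simp [h1, Finsupp.single_eq_of_ne' hij'.ne']
    · have := had l
      simpa [Finsupp.single_eq_of_ne' hl] using this

theorem above_coordF_mul_of_lt {i j : C.ι} (hij : j < i) (hi : C.deg i ≠ 0)
    {U : Opens C.Body} {l k : ℤ} (h : C.deg i + l = k) (f : C.functions U l)
    (hf : ∀ α, f.1 α ≠ 0 → C.Above j α) (α : C.ι →₀ ℕ)
    (hα : (mulF h (C.coordF i U) f).1 α ≠ 0) : C.Above j α := by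
  obtain ⟨had, β, hβ, rfl⟩ := coordF_mul_ne_zero hi h f hα
  have hA := hf β hβ
  refine ⟨fun l hl => ?_, fun l => ?_⟩
  · classical
    rcases Finset.mem_union.1 (Finsupp.support_add hl) with h1 | h1
    · have := Finsupp.support_single_subset h1
      rw [Finset.mem_singleton] at this
      exact this ▸ hij.le
    · exact hA.1 l h1
  · by_cases hl : j = l
    · subst hl
      have := hA.2 j
      simpa [Finsupp.single_eq_of_ne' hij.ne'] using this
    · have := had l
      simpa [Finsupp.single_eq_of_ne' hl] using this

include hφ

theorem pmul_self_eq_zero {i : C.ι} (hodd : Odd (C.deg i)) (s : PSer D) :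
    pmul (φ i) (pmul (φ i) s) = 0 := by
  have h1 := pmul_comm (hφ i) (hφ i)
  rw [Int.negOnePow_odd _ (hodd.mul hodd), Units.neg_smul, one_smul] at h1
  rw [← pmul_assoc, eq_zero_of_eq_neg h1, pmul_zero_left]

omit hφ in
theorem coordF_mul_self_eq_zero {i : C.ι} (hodd : Odd (C.deg i)) {U : Opens C.Body} {l k m : ℤ}
    (h : C.deg i + l = k) (h' : C.deg i + k = m) (f : C.functions U l) :
    mulF h' (C.coordF i U) (mulF h (C.coordF i U) f) = 0 := by
  have h1 := mulF_comm rfl rfl (C.coordF i U) (C.coordF i U)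
  rw [Int.negOnePow_odd _ (hodd.mul hodd), Units.neg_smul, one_smul] at h1
  rw [← mulF_assoc rfl h (by omega) h', eq_zero_of_eq_neg h1]
  exact C.toGradedSpace.mul_zero_left (U := U) (show C.deg i + C.deg i + l = m by omega) f

theorem subst_coord_mul_mod {i : C.ι} (hi : C.deg i ≠ 0) (m : ℕ) {U : Opens C.Body} {l : ℤ}
    (u : C.functions U l) (hb : basePt φ ∈ U) : ∀ {k : ℤ} (h : C.deg i + l = k),
    Ord m (subst φ (mulF h (C.coordF i U) u) - pmul (φ i) (subst φ u)) := by
  refine hadamard_induction (basePt φ) (P := fun m U l u => ∀ {k : ℤ} (h : C.deg i + l = k),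
    Ord m (subst φ (mulF h (C.coordF i U) u) - pmul (φ i) (subst φ u))) ?_ ?_ ?_ ?_ ?_ m u hb
  · intro U l u _ k h γ hγ
    exact absurd hγ (Nat.not_lt_zero _)
  · intro m U V hV l u hbV ih k h
    have := ih h
    have e : mulF h (C.coordF i V) (resF hV u) = resF hV (mulF h (C.coordF i U) u) := rfl
    rwa [e, subst_res hV _ hbV, subst_res hV _ hbV] at this
  · intro m U l u v hb ihu ihv k h γ hγ
    have h1 := ihu h γ hγ
    have h2 := ihv h γ hγ
    rw [mulF_add_right, subst_add hφ hb, subst_add hφ hb, map_add, add_sub_add_comm, Pi.add_apply,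
      h1, h2, add_zero]
  · intro m U l u hb r hr k h γ _
    rw [subst_coord_mul_of_above hφ hb hi h u, sub_self]
    · rfl
    · intro α hα
      obtain rfl : α = 0 := by
        by_contra h0
        refine hα ?_
        rw [hr]
        funext y
        simp [oneSeries, h0]
      refine ⟨by simp, fun j => ⟨fun hj => ?_, fun _ => ?_⟩⟩
      · have : i ≠ j := by rintro rfl; exact hi hj
        simp [this]
      · rw [zero_add, Finsupp.single_apply]; split_ifs <;> simp
  · intro m U j l l' hl f hb hf ih k h
    have hn : C.deg i + l = k - C.deg j := by omega
    have hn' : C.deg j + (k - C.deg j) = k := by omega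
    have hswap : mulF h (C.coordF i U) (mulF hl (C.gen (basePt φ) j U) f) =
        (((C.deg i * C.deg j).negOnePow : ℤ) : ℝ) •
          mulF hn' (C.gen (basePt φ) j U) (mulF hn (C.coordF i U) f) := by
      rw [← mulF_assoc (ij := C.deg i + C.deg j) rfl hl (by omega) h,
        mulF_comm rfl (add_comm _ _), units_smul_real, mulF_smul_left,
        mulF_assoc (add_comm _ _) hn (by omega) hn']
    by_cases hj : C.deg j = 0
    · have h1 : (C.deg i * C.deg j).negOnePow = 1 := by rw [hj, mul_zero, Int.negOnePow_zero]
      rw [hswap, h1]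
      have h2 := subst_gen_mul_of_eq hφ hb ⟨j, hj⟩ hn' (mulF hn (C.coordF i U) f)
      have h3 := subst_gen_mul_of_eq hφ hb ⟨j, hj⟩ hl f
      rw [Units.val_one, Int.cast_one, one_smul, h2, h3, ← pmul_assoc,
        ← pmul_comm_zero (homog_incr hφ _) (hφ i), pmul_assoc, ← map_sub, add_comm]
      exact (Ord.one_of (incr_zero φ _)).pmul (ih hn)
    · rw [gen_eq_coordF hj] at hswap ⊢
      rcases lt_trichotomy i j with hij | hij | hij
      · rw [subst_coord_mul_of_above hφ hb hi h _ (above_coordF_mul_of_le hij.le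
          (fun h => absurd h hij.ne) hi hj hl f (hf hj)), sub_self]
        exact fun _ _ => rfl
      · subst hij
        by_cases hodd : Odd (C.deg i)
        · rw [coordF_mul_self_eq_zero hodd, subst_zero, subst_coord_mul_of_above hφ hb hi hl f (hf hj),
            pmul_self_eq_zero hφ hodd, sub_self]
          exact fun _ _ => rfl
        · rw [subst_coord_mul_of_above hφ hb hi h _ (above_coordF_mul_of_le le_rfl
            (fun _ => hodd) hi hi hl f (hf hj)), sub_self]
          exact fun _ _ => rfl
      · rw [hswap, subst_smul, subst_coord_mul_of_above hφ hb hj hn' _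
          (above_coordF_mul_of_lt hij hi hn f (hf hj)),
          subst_coord_mul_of_above hφ hb hj hl f (hf hj), ← pmul_assoc, pmul_comm (hφ i) (hφ j),
          units_smul_real, pmul_smul_left, pmul_assoc, ← smul_sub, ← map_sub, ← map_smul, add_comm]
        refine (Ord.one_of ((hφ j).eq_zero_of_ne hj)).pmul fun γ hγ => ?_
        rw [Pi.smul_apply, ih hn γ hγ, smul_zero]

theorem subst_coord_mul (i : C.ι) {U : Opens C.Body} {l k : ℤ} (h : C.deg i + l = k)
    (u : C.functions U l) (hb : basePt φ ∈ U) :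
    subst φ (mulF h (C.coordF i U) u) = pmul (φ i) (subst φ u) := by
  by_cases hi : C.deg i = 0
  · exact subst_coord_mul_of_eq hφ hb ⟨i, hi⟩ h u
  · funext γ
    exact sub_eq_zero.1 (subst_coord_mul_mod hφ hi (γ.degree + 1) u hb h γ (Nat.lt_succ_self _))

/-- Substitution is multiplicative. -/
theorem subst_mul {U : Opens C.Body} {k l n : ℤ} (h : k + l = n) (a : C.functions U k)
    (u : C.functions U l) (hb : basePt φ ∈ U) :
    subst φ (mulF h a u) = pmul (subst φ a) (subst φ u) := by
  have key : ∀ m : ℕ, ∀ {l n : ℤ} (h : k + l = n) (u : C.functions U l),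
      Ord m (subst φ (mulF h a u) - pmul (subst φ a) (subst φ u)) := fun m => by
    refine hadamard_induction (basePt φ) (P := fun m U k a => ∀ {l n : ℤ} (h : k + l = n)
      (u : C.functions U l), Ord m (subst φ (mulF h a u) - pmul (subst φ a) (subst φ u)))
      ?_ ?_ ?_ ?_ ?_ m a hb
    · intro U k a _ l n h u γ hγ
      exact absurd hγ (Nat.not_lt_zero _)
    · intro m U V hV k a hbV ih l n h u
      have := ih h (resF hV u)
      rwa [← res_mulF, subst_res hV _ hbV, subst_res hV _ hbV, subst_res hV _ hbV] at this
    · intro m U k a b hb iha ihb l n h u γ hγ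
      have h1 := iha h u γ hγ
      have h2 := ihb h u γ hγ
      rw [mulF_add_left, subst_add hφ hb, subst_add hφ hb, pmul_add_left, add_sub_add_comm,
        Pi.add_apply, h1, h2, add_zero]
    · intro m U k a hb r hr l n h u γ _
      rw [subst_const hφ hb a hr, pmul_smul_left, pone_pmul (homog_subst hφ hb u)]
      rcases const_cases hb hr with rfl | rfl
      · have h0 : r = 0 := by
          have := congrFun (congrFun hr 0) ⟨_, hb⟩
          simpa [oneSeries] using this.symm
        have h1 : mulF h (0 : C.functions U k) u = 0 :=
          C.toGradedSpace.mul_zero_left (U := U) h u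
        rw [h1, subst_zero, h0, zero_smul, sub_self]
        rfl
      · obtain rfl : l = n := by rw [← h, zero_add]
        have h1 : a = r • (⟨oneSeries U, IsFunction.one U⟩ : C.functions U 0) := Subtype.ext hr
        have h2 : mulF h (⟨oneSeries U, IsFunction.one U⟩ : C.functions U 0) u = u :=
          C.toGradedSpace.one_mul (U := U) u
        rw [h1, mulF_smul_left, h2, subst_smul, sub_self]
        rfl
    · intro m U i l k hl f hb _ ih l' n h u
      have hn : l + l' = n - C.deg i := by omega
      have hn' : C.deg i + (n - C.deg i) = n := by omega
      rw [mulF_assoc hl hn h hn', add_comm]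
      by_cases hi : C.deg i = 0
      · have h1 := subst_gen_mul_of_eq hφ hb ⟨i, hi⟩ hn' (mulF hn f u)
        have h2 := subst_gen_mul_of_eq hφ hb ⟨i, hi⟩ hl f
        rw [h1, h2, pmul_assoc, ← map_sub]
        exact (Ord.one_of (incr_zero φ _)).pmul (ih hn u)
      · rw [gen_eq_coordF hi, subst_coord_mul hφ i hn' _ hb, subst_coord_mul hφ i hl _ hb, pmul_assoc,
          ← map_sub]
        exact (Ord.one_of ((hφ i).eq_zero_of_ne hi)).pmul (ih hn u)
  funext γ
  exact sub_eq_zero.1 (key (γ.degree + 1) h u γ (Nat.lt_succ_self _))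

theorem subst_coordF (i : C.ι) {U : Opens C.Body} (hb : basePt φ ∈ U) :
    subst φ (C.coordF i U) = φ i := by
  have h : mulF (add_zero (C.deg i)) (C.coordF i U)
      (⟨oneSeries U, IsFunction.one U⟩ : C.functions U 0) = C.coordF i U := by
    rw [mulF_comm _ (zero_add _), mul_zero, Int.negOnePow_zero, one_smul]
    exact C.toGradedSpace.one_mul (U := U) (C.coord i U)
  rw [← h, subst_coord_mul hφ i _ _ hb, subst_one hφ hb,
    ← pmul_comm_zero homog_pone (hφ i), pone_pmul (hφ i)]

end

end GradedCoords

namespace GradedCoords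

open GradedSpace

variable {C D : GradedCoords}

section

variable {W : Opens D.Body} (φ : ∀ i, D.functions W (C.deg i))

/-- The values of a family of functions at a point. -/
noncomputable def vals (y : D.Body) (i : C.ι) : PSer D := extend (φ i) y

theorem homog_vals (y : D.Body) (i : C.ι) : Homog (C.deg i) (vals φ y i) := homog_extend _ _

theorem continuous_basePt_vals : Continuous fun y : W => basePt (vals φ y.1) := by
  refine continuous_pi fun j => continuous_iff_continuousAt.2 fun y => ?_
  obtain ⟨J, K, O, hO, hy, hOW, -, -, h⟩ := exists_cylSer (φ j.1) y.2
  obtain ⟨g, hg, h⟩ := h 0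
  have h1 : ContinuousAt (fun y : W => g fun j => y.1 j) y := by
    exact (hg.continuous.comp (continuous_pi fun j =>
      (continuous_apply _).comp continuous_subtype_val)).continuousAt
  refine h1.congr ?_
  filter_upwards [(hO.preimage continuous_subtype_val).mem_nhds hy] with z hz
  exact (h z.1 hz).symm

theorem isFunction_subst {V : Opens D.Body} (hV : V ≤ W) {U : Opens C.Body}
    (h : ∀ y ∈ V, basePt (vals φ y) ∈ U) {k : ℤ} (a : C.functions U k) :
    D.IsFunction V k fun γ y => subst (vals φ y.1) a γ := by
  classical
  refine isFunction_of_cylSer (s := fun y => subst (vals φ y) a)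
    (fun y hy => homog_subst (homog_vals φ y) (h y hy) a) fun y hy => ?_
  obtain ⟨J, K, O, hO, hbO, hOU, hK, ha⟩ := exists_cylSer a (h y hy)
  obtain ⟨J', K', O', hO', hyO', hs⟩ := exists_common_cylSer φ
    (J.map (Function.Embedding.subtype _) ∪ K) (hV hy)
  refine ⟨J', K', O' ∩ Subtype.val '' ((fun y : W => basePt (vals φ y.1)) ⁻¹' O),
    hO'.inter (W.isOpen.isOpenMap_subtype_val _ (hO.preimage (continuous_basePt_vals φ))),
    ⟨hyO', ⟨y, hV hy⟩, hbO, rfl⟩, ?_⟩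
  have hs' := fun i hi => (hs i hi).mono le_rfl le_rfl (Set.inter_subset_left
    (t := Subtype.val '' ((fun y : W => basePt (vals φ y.1)) ⁻¹' O)))
  refine CylSer.substSeries (fun y _ => homog_vals φ y) hO ?_ hK ha (fun j hj => hs' j.1 ?_)
    fun i hi => hs' i (Finset.mem_union_right _ hi)
  · rintro _ ⟨_, y, hy, rfl⟩
    exact hy
  · exact Finset.mem_union_left _ (Finset.mem_map.2 ⟨j, hj, rfl⟩)

end

/-- Values of the coordinates define a morphism from an open piece of a coordinate space to a
coordinate space. -/
theorem exists_dom_hom {W : Opens D.Body} (φ : ∀ i, (D.dom W).sec ⊤ (C.deg i)) :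
    ∃ f : D.dom W ⟶ C.toGradedSpace,
      ∀ i, f.pull (le_top : ⊤ ≤ Opens.comap f.base ⊤) (C.coord i ⊤) = φ i := by
  let W' : Opens D.Body := openImage W ⊤
  let φ' : ∀ i, D.functions W' (C.deg i) := φ
  have hW : ∀ y : W, y.1 ∈ W' := fun y => ⟨y, trivial, rfl⟩
  let b : C(D.dom W, C.toGradedSpace) := ⟨fun y : W => basePt (vals φ' y.1),
    (continuous_basePt_vals φ').comp
      (continuous_subtype_val.subtype_mk fun y : W => hW y)⟩
  have hmem : ∀ {U : Opens C.toGradedSpace} {V : Opens (D.dom W)}, V ≤ Opens.comap b U →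
      ∀ y ∈ openImage W V, basePt (vals φ' y) ∈ (show Opens C.Body from U) := by
    rintro U V h _ ⟨y, hy, rfl⟩
    exact h hy
  have hφ := homog_vals φ'
  let f : Hom (D.dom W) C.toGradedSpace :=
    { base := b
      pull := fun {U V} h {k} =>
        { toFun := fun a => (⟨fun γ y => subst (vals φ' y.1) (show C.functions U k from a) γ,
            isFunction_subst φ' (openImage_mono W le_top) (hmem h) _⟩ :
              D.functions (openImage W V) k)
          map_add' := fun a a' => Subtype.ext <| funext fun γ => funext fun y =>
            congrFun (subst_add (hφ y.1) (hmem h y.1 y.2) _ _) γ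
          map_smul' := fun c a => Subtype.ext <| funext fun γ => funext fun y =>
            congrFun (subst_smul c _) γ }
      pull_one := fun {U V} h => Subtype.ext <| funext fun γ => funext fun y =>
        congrFun (subst_one (hφ y.1) (hmem h y.1 y.2)) γ
      pull_mul := fun {U V} h {i j k} hk a a' => Subtype.ext <| funext fun γ => funext fun y =>
        congrFun (subst_mul (hφ y.1) hk _ _ (hmem h y.1 y.2)) γ
      res_pull := fun {U V V'} h h' k a => rfl
      pull_res := fun {U U' V} h h' k a => Subtype.ext <| funext fun γ => funext fun y =>
        congrFun (subst_res h' _ (hmem h y.1 y.2)) γ }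
  refine ⟨f, fun i => Subtype.ext <| funext fun γ => funext fun y => ?_⟩
  have h1 := congrFun (subst_coordF (hφ y.1) i (U := ⊤) trivial) γ
  exact h1.trans (extend_apply (φ' i) y.2 γ)

end GradedCoords

namespace GradedSpace

open GradedCoords

/-- A chart of a graded manifold. -/
theorem _root_.IsGradedManifold.exists_chart {N : GradedSpace} (hN : IsGradedManifold N) (x : N) :
    ∃ U : Opens N, x ∈ U ∧ ∃ (D : GradedCoords) (W : Opens D.Body),
      Nonempty (N.restrict U ≅ D.dom W) := hN.2.2 x

variable {N : GradedSpace} {C : GradedCoords}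

/-- The pull-back of global sections. -/
def gpull {M N : GradedSpace} (f : M ⟶ N) {k : ℤ} : N.sec ⊤ k →ₗ[ℝ] M.sec ⊤ k :=
  f.pull (le_top : ⊤ ≤ Opens.comap f.base ⊤)

theorem gpull_comp {M N P : GradedSpace} (f : M ⟶ N) (g : N ⟶ P) {k : ℤ} (a : P.sec ⊤ k) :
    gpull (f ≫ g) a = gpull f (gpull g a) := comp_pull f g _ _ _ a

theorem gpull_id {M : GradedSpace} {k : ℤ} (a : M.sec ⊤ k) : gpull (𝟙 M) a = a := M.res_self _ a

theorem coord_pull_comp {M : GradedSpace} (e : M ⟶ N) (f : N ⟶ C.toGradedSpace) (i : C.ι) :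
    (e ≫ f).pull (le_top : ⊤ ≤ Opens.comap (e ≫ f).base ⊤) (C.coord i ⊤) =
      e.pull (le_top : ⊤ ≤ Opens.comap e.base ⊤)
        (f.pull (le_top : ⊤ ≤ Opens.comap f.base ⊤) (C.coord i ⊤)) :=
  comp_pull e f _ _ _ _

/-- Spaces for which morphisms to coordinate spaces are families of functions. -/
def HasCoordHoms (N : GradedSpace) : Prop :=
  ∀ (C : GradedCoords) (φ : ∀ i, N.sec ⊤ (C.deg i)), ∃! f : N ⟶ C.toGradedSpace,
    ∀ i, f.pull (le_top : ⊤ ≤ Opens.comap f.base ⊤) (C.coord i ⊤) = φ i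

theorem hasCoordHoms_of_iso {M : GradedSpace} (e : N ≅ M) (h : HasCoordHoms M) :
    HasCoordHoms N := fun C φ => by
  obtain ⟨f, hf, hfu⟩ := h C fun i => e.inv.pull (le_top : ⊤ ≤ Opens.comap e.inv.base ⊤) (φ i)
  refine ⟨e.hom ≫ f, fun i => ?_, fun g hg => ?_⟩
  · rw [coord_pull_comp, hf]
    refine (comp_pull e.hom e.inv le_top le_top le_top (φ i)).symm.trans ?_
    refine (pull_congr e.hom_inv_id _ le_top _).trans ?_
    exact N.res_self _ _
  · have : e.inv ≫ g = f := hfu _ fun i => by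
      refine (coord_pull_comp e.inv g i).trans ?_
      rw [hg]
    rw [← this, e.hom_inv_id_assoc]

theorem hasCoordHoms_dom {D : GradedCoords} (W : Opens D.Body) : HasCoordHoms (D.dom W) :=
  fun C φ => by
    obtain ⟨f, hf⟩ := exists_dom_hom φ
    exact ⟨f, hf, fun g hg => dom_hom_ext fun i => (hg i).trans (hf i).symm⟩

/-- An open subspace of an open subspace. -/
def restrictRestrictIso (M : GradedSpace) (U : Opens M) (W : Opens (M.restrict U)) (U' : Opens M)
    (h : ∀ x, x ∈ U' ↔ x ∈ openImage U W) : (M.restrict U).restrict W ≅ M.restrict U' where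
  hom := lift (incl _ W ≫ incl M U) U' fun x => (h _).2 ⟨x.1, x.2, rfl⟩
  inv := lift (lift (incl M U') U fun x => openImage_le U W ((h _).1 x.2)) W fun x =>
    mem_openImage.1 ((h _).1 x.2)
  hom_inv_id := by
    refine incl_cancel (incl_cancel ?_)
    simp
  inv_hom_id := by
    refine incl_cancel ?_
    rw [Category.assoc, lift_incl, ← Category.assoc, lift_incl, lift_incl, Category.id_comp]

/-- The restriction of an isomorphism to an open subspace. -/
def restrictIso {M M' : GradedSpace} (e : M ≅ M') (U : Opens M') :
    M.restrict (Opens.comap e.hom.base U) ≅ M'.restrict U where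
  hom := restrictHom e.hom U
  inv := lift (incl M' U ≫ e.inv) _ fun x => by
    have := congrArg (fun f : M' ⟶ M' => f.base x.1) e.inv_hom_id
    change e.hom.base (e.inv.base x.1) ∈ U
    exact (congrArg (· ∈ U) this).mpr x.2
  hom_inv_id := by
    refine incl_cancel ?_
    rw [Category.assoc, lift_incl, ← Category.assoc, restrictHom_incl, Category.assoc,
      e.hom_inv_id, Category.comp_id, Category.id_comp]
  inv_hom_id := by
    refine incl_cancel ?_
    rw [Category.assoc, restrictHom_incl, ← Category.assoc, lift_incl, Category.assoc,
      e.inv_hom_id, Category.comp_id, Category.id_comp]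

theorem _root_.IsGradedManifold.restrict (hN : IsGradedManifold N) (V : Opens N) :
    IsGradedManifold (N.restrict V) := by
  have h1 := hN.1
  have h2 := hN.2.1
  refine ⟨inferInstanceAs (T3Space V), inferInstanceAs (SecondCountableTopology V), fun x => ?_⟩
  obtain ⟨U, hxU, D, W, ⟨e⟩⟩ := hN.exists_chart x.1
  let A : Opens (N.restrict V) := Opens.comap (incl N V).base U
  let B : Opens (N.restrict U) := Opens.comap (incl N U).base V
  let W' : Opens (D.dom W) := Opens.comap e.inv.base B
  let B' : Opens (N.restrict U) := Opens.comap e.hom.base W'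
  have hB : ∀ y, y ∈ B' ↔ y ∈ B := fun y => by
    have := congrArg (fun f : N.restrict U ⟶ N.restrict U => f.base y) e.hom_inv_id
    exact iff_of_eq (congrArg (· ∈ B) this)
  refine ⟨A, hxU, D, openImage W W', ⟨?_⟩⟩
  refine (restrictRestrictIso N V A (V ⊓ U) fun y => ?_) ≪≫
    (restrictRestrictIso N U B' (V ⊓ U) fun y => ?_).symm ≪≫ restrictIso e W' ≪≫
    restrictRestrictIso D.toGradedSpace W W' (openImage W W') fun y => Iff.rfl
  · exact ⟨fun h => ⟨⟨y, h.1⟩, h.2, rfl⟩, by rintro ⟨z, hz, rfl⟩; exact ⟨z.2, hz⟩⟩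
  · constructor
    · exact fun h => ⟨⟨y, h.2⟩, (hB _).2 h.1, rfl⟩
    · rintro ⟨z, hz, rfl⟩
      exact ⟨(hB _).1 hz, z.2⟩

/-- Morphisms from a graded manifold to a coordinate space are determined by the coordinates. -/
theorem coord_hom_ext (hN : IsGradedManifold N) {f g : N ⟶ C.toGradedSpace}
    (h : ∀ i, f.pull (le_top : ⊤ ≤ Opens.comap f.base ⊤) (C.coord i ⊤) =
      g.pull (le_top : ⊤ ≤ Opens.comap g.base ⊤) (C.coord i ⊤)) : f = g := by
  choose U hxU D W e using hN.exists_chart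
  refine hom_ext_local (V := U) (fun x => ⟨x, hxU x⟩) fun x => ?_
  obtain ⟨e⟩ := e x
  refine (hasCoordHoms_of_iso e (hasCoordHoms_dom _) C fun i => _).unique
    (fun i => coord_pull_comp (incl N (U x)) f i) fun i => ?_
  rw [h]
  exact coord_pull_comp (incl N (U x)) g i

/-- Morphisms from a graded manifold to a coordinate space are families of functions. -/
theorem _root_.IsGradedManifold.hasCoordHoms (hN : IsGradedManifold N) : HasCoordHoms N :=
  fun C φ => by
    choose U hxU D W e using hN.exists_chart
    have hU : ∀ x, HasCoordHoms (N.restrict (U x)) := fun x =>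
      hasCoordHoms_of_iso (e x).some (hasCoordHoms_dom _)
    choose f hf _ using fun x => hU x C fun i =>
      (incl N (U x)).pull (le_top : ⊤ ≤ Opens.comap (incl N (U x)).base ⊤) (φ i)
    obtain ⟨g, hg⟩ := exists_glue_hom (V := U) (f := f) (fun x => ⟨x, hxU x⟩) fun x y =>
      coord_hom_ext (hN.restrict _) fun i => by
        rw [coord_pull_comp, coord_pull_comp, hf, hf]
        refine (gpull_comp (inclLE N _) (incl N (U x)) (φ i)).symm.trans ?_
        refine Eq.trans ?_ (gpull_comp (inclLE N _) (incl N (U y)) (φ i))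
        rw [inclLE_incl, inclLE_incl]
    refine ⟨g, fun i => ?_, fun g' hg' => coord_hom_ext hN fun i => ?_⟩
    · refine sec_ext fun x _ => ⟨openImage (U x) ⊤, le_top, ⟨⟨x, hxU x⟩, trivial, rfl⟩, ?_⟩
      have h1 := coord_pull_comp (incl N (U x)) g i
      rw [hg, hf] at h1
      exact h1.symm
    · rw [hg']
      refine sec_ext fun x _ => ⟨openImage (U x) ⊤, le_top, ⟨⟨x, hxU x⟩, trivial, rfl⟩, ?_⟩
      have h1 := coord_pull_comp (incl N (U x)) g i
      rw [hg, hf] at h1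
      exact h1

end GradedSpace

namespace GradedSpace

/-- Graded spaces `P i` on open subsets of a space `Y`, with transition maps between their
sections. -/
structure GlueData (Y : Type) [TopologicalSpace Y] where
  I : Type
  P : I → GradedSpace
  j : ∀ i, P i → Y
  isOpenEmbedding : ∀ i, Topology.IsOpenEmbedding (j i)
  cover : ∀ y, ∃ i x, j i x = y
  T : ∀ {i l : I} {V : Opens (P i)} {V' : Opens (P l)}, (∀ x ∈ V, ∃ x' ∈ V', j l x' = j i x) →
    ∀ {k : ℤ}, (P l).sec V' k →ₗ[ℝ] (P i).sec V k
  T_one : ∀ {i l : I} {V : Opens (P i)} {V' : Opens (P l)}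
    (h : ∀ x ∈ V, ∃ x' ∈ V', j l x' = j i x), T h ((P l).one V') = (P i).one V
  T_mul : ∀ {i l : I} {V : Opens (P i)} {V' : Opens (P l)}
    (h : ∀ x ∈ V, ∃ x' ∈ V', j l x' = j i x) {a b c : ℤ} (hc : a + b = c) (s : (P l).sec V' a)
    (t : (P l).sec V' b), T h ((P l).mul hc s t) = (P i).mul hc (T h s) (T h t)
  T_self : ∀ {i : I} {V V' : Opens (P i)} (h : ∀ x ∈ V, ∃ x' ∈ V', j i x' = j i x) (h' : V ≤ V')
    {k : ℤ} (s : (P i).sec V' k), T h s = (P i).res h' s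
  T_T : ∀ {i l m : I} {V : Opens (P i)} {V' : Opens (P l)} {V'' : Opens (P m)}
    (h : ∀ x ∈ V, ∃ x' ∈ V', j l x' = j i x) (h' : ∀ x ∈ V', ∃ x' ∈ V'', j m x' = j l x)
    (h'' : ∀ x ∈ V, ∃ x' ∈ V'', j m x' = j i x) {k : ℤ} (s : (P m).sec V'' k),
    T h (T h' s) = T h'' s

namespace GlueData

variable {Y : Type} [TopologicalSpace Y] (G : GlueData Y)

/-- The part of `P i` that lies in `W`. -/
def pre (i : G.I) (W : Opens Y) : Opens (G.P i) :=
  Opens.comap ⟨G.j i, (G.isOpenEmbedding i).continuous⟩ W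

variable {G}

theorem mem_pre {i : G.I} {W : Opens Y} {x : G.P i} : x ∈ G.pre i W ↔ G.j i x ∈ W := Iff.rfl

theorem pre_mono {W W' : Opens Y} (h : W ≤ W') (i : G.I) : G.pre i W ≤ G.pre i W' :=
  fun _ hx => h hx

theorem res_T {i l : G.I} {V₁ V : Opens (G.P i)} {V' : Opens (G.P l)}
    (h : ∀ x ∈ V, ∃ x' ∈ V', G.j l x' = G.j i x) (h₁ : V₁ ≤ V) {k : ℤ} (s : (G.P l).sec V' k) :
    (G.P i).res h₁ (G.T h s) = G.T (fun x hx => h x (h₁ hx)) s := by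
  rw [← G.T_self (fun x hx => ⟨x, h₁ hx, rfl⟩) h₁, G.T_T]

theorem T_res {i l : G.I} {V : Opens (G.P i)} {V' V₁ : Opens (G.P l)}
    (h : ∀ x ∈ V, ∃ x' ∈ V', G.j l x' = G.j i x) (h₁ : V' ≤ V₁) {k : ℤ} (s : (G.P l).sec V₁ k) :
    G.T h ((G.P l).res h₁ s) =
      G.T (fun x hx => (h x hx).imp fun _ h => ⟨h₁ h.1, h.2⟩) s := by
  rw [← G.T_self (fun x hx => ⟨x, h₁ hx, rfl⟩) h₁, G.T_T]

variable (G)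

/-- Compatible families of sections. -/
def sections (W : Opens Y) (k : ℤ) : Submodule ℝ (∀ i, (G.P i).sec (G.pre i W) k) where
  carrier := {s | ∀ (i l : G.I) (V : Opens (G.P i)) (hV : V ≤ G.pre i W)
    (h : ∀ x ∈ V, ∃ x' ∈ G.pre l W, G.j l x' = G.j i x), G.T h (s l) = (G.P i).res hV (s i)}
  add_mem' {s t} hs ht i l V hV h := by
    simp only [Pi.add_apply, map_add]
    rw [hs i l V hV h, ht i l V hV h]
  zero_mem' i l V hV h := by simp
  smul_mem' c s hs i l V hV h := by
    simp only [Pi.smul_apply, map_smul]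
    rw [hs i l V hV h]

/-- The glued graded space. -/
def glued : GradedSpace where
  carrier := Y
  sec W k := G.sections W k
  one W := ⟨fun i => (G.P i).one _, fun i l V hV h => by rw [G.T_one, (G.P i).res_one]⟩
  mul {W a b c} hc := LinearMap.mk₂ ℝ
    (fun s t => (⟨fun i => (G.P i).mul hc (s.1 i) (t.1 i), fun i l V hV h => by
      rw [G.T_mul, (G.P i).res_mul, s.2 i l V hV h, t.2 i l V hV h]⟩ : G.sections W c))
    (fun _ _ _ => Subtype.ext (funext fun i => mul_add_left _ _ _ _))
    (fun _ _ _ => Subtype.ext (funext fun i => mul_smul_left _ _ _ _))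
    (fun _ _ _ => Subtype.ext (funext fun i => mul_add_right _ _ _ _))
    (fun _ _ _ => Subtype.ext (funext fun i => mul_smul_right _ _ _ _))
  one_mul s := Subtype.ext (funext fun i => (G.P i).one_mul _)
  mul_assoc h₁ h₂ h₃ h₄ s t u := Subtype.ext (funext fun i => (G.P i).mul_assoc h₁ h₂ h₃ h₄ _ _ _)
  mul_comm h h' s t := Subtype.ext (funext fun i => (G.P i).mul_comm h h' _ _)
  res {W W'} hW {k} :=
    { toFun := fun s => (⟨fun i => (G.P i).res (pre_mono hW i) (s.1 i), fun i l V hV h => by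
        rw [T_res, s.2 i l V (hV.trans (pre_mono hW i)), (G.P i).res_res]⟩ : G.sections W' k)
      map_add' := fun s t => Subtype.ext (funext fun i => map_add _ _ _)
      map_smul' := fun c s => Subtype.ext (funext fun i => map_smul _ _ _) }
  res_self _ s := Subtype.ext (funext fun i => (G.P i).res_self _ _)
  res_res _ _ s := Subtype.ext (funext fun i => (G.P i).res_res _ _ _)
  res_one _ := Subtype.ext (funext fun i => (G.P i).res_one _)
  res_mul _ _ _ _ hk s t := Subtype.ext (funext fun i => (G.P i).res_mul _ hk _ _)
  locality {W A} V hV hW k s t hst := Subtype.ext (funext fun i =>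
    (G.P i).locality (fun a => G.pre i (V a)) (fun a => pre_mono (hV a) i) (fun x hx => by
      obtain ⟨a, ha⟩ := Opens.mem_iSup.1 (hW hx)
      exact Opens.mem_iSup.2 ⟨a, ha⟩) _ _ fun a =>
        congrFun (congrArg Subtype.val (hst a)) i)
  gluing {W A} V hV hW k s hs := by
    have hc : ∀ i, G.pre i W ≤ iSup fun a => G.pre i (V a) := fun i x hx => by
      obtain ⟨a, ha⟩ := Opens.mem_iSup.1 (hW hx)
      exact Opens.mem_iSup.2 ⟨a, ha⟩
    choose u hu using fun i => (G.P i).gluing (fun a => G.pre i (V a))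
      (fun a => pre_mono (hV a) i) (hc i) (fun a => (s a).1 i) fun a b =>
        congrFun (congrArg Subtype.val (hs a b)) i
    refine ⟨⟨u, fun i l U hU h => ?_⟩, fun a => Subtype.ext (funext fun i => hu i a)⟩
    refine (G.P i).locality (fun a => U ⊓ G.pre i (V a)) (fun a => inf_le_left) (fun x hx => by
      obtain ⟨a, ha⟩ := Opens.mem_iSup.1 (hc i (hU hx))
      exact Opens.mem_iSup.2 ⟨a, hx, ha⟩) _ _ fun a => ?_
    have h' : ∀ x ∈ U ⊓ G.pre i (V a), ∃ x' ∈ G.pre l (V a), G.j l x' = G.j i x := fun x hx => by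
      obtain ⟨x', _, hx'⟩ := h x hx.1
      exact ⟨x', mem_pre.2 (hx' ▸ hx.2), hx'⟩
    have h1 := (s a).2 i l _ inf_le_right h'
    rw [← hu l a, ← hu i a, T_res, (G.P i).res_res] at h1
    rw [res_T, (G.P i).res_res]
    exact h1

/-- The inclusion of a piece into the glued space. -/
def ofPiece (i : G.I) : G.P i ⟶ G.glued :=
  Hom.mk (M := G.P i) (N := G.glued) (base := ⟨G.j i, (G.isOpenEmbedding i).continuous⟩)
    (pull := fun {W V} h {k} => ((G.P i).res (show V ≤ G.pre i W from h)).comp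
      ((LinearMap.proj i).comp (G.sections W k).subtype))
    (pull_one := fun _ => (G.P i).res_one _)
    (pull_mul := fun _ _ _ _ hk _ _ => (G.P i).res_mul _ hk _ _)
    (res_pull := fun _ _ _ _ => (G.P i).res_res _ _ _)
    (pull_res := fun _ _ _ _ => (G.P i).res_res _ _ _)

/-- The image of a piece. -/
def image (i : G.I) : Opens G.glued :=
  ⟨Set.range (G.j i), (G.isOpenEmbedding i).isOpen_range⟩

theorem mem_image (i : G.I) (x : G.P i) : (G.ofPiece i).base x ∈ G.image i := ⟨x, rfl⟩

/-- A piece of a glued space is an open subspace. -/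
noncomputable def pieceIso (i : G.I) : G.P i ≅ G.glued.restrict (G.image i) :=
  isoOfBijective (lift (G.ofPiece i) (G.image i) (G.mem_image i))
    (G.isOpenEmbedding i).isEmbedding.toHomeomorph (fun x => rfl) fun W k => by
    let W' : Opens Y := openImage (G.image i) W
    have hpre : ∀ {l : G.I} (x : G.P l), x ∈ G.pre l W' →
        ∃ x' ∈ G.pre i W', G.j i x' = G.j l x := by
      rintro l x ⟨⟨_, x', rfl⟩, hz, hx⟩
      exact ⟨x', ⟨⟨_, x', rfl⟩, hz, rfl⟩, hx⟩
    have hle : Opens.comap (lift (G.ofPiece i) (G.image i) (G.mem_image i)).base W ≤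
        G.pre i W' := fun x hx => ⟨_, hx, rfl⟩
    have hge : G.pre i W' ≤
        Opens.comap (lift (G.ofPiece i) (G.image i) (G.mem_image i)).base W := by
      rintro x ⟨z, hz, hx⟩
      exact (congrArg (· ∈ W) (Subtype.ext hx)).mp hz
    constructor
    · intro s t hst
      have h1 : (G.P i).res hle ((show G.sections W' k from s).1 i) =
        (G.P i).res hle ((show G.sections W' k from t).1 i) := hst
      have h2 := congrArg ((G.P i).res hge) h1
      rw [(G.P i).res_res, (G.P i).res_res, (G.P i).res_self, (G.P i).res_self] at h2
      refine Subtype.ext (funext fun l => ?_)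
      have hs := (show G.sections W' k from s).2 l i _ le_rfl fun x hx => hpre x hx
      have ht := (show G.sections W' k from t).2 l i _ le_rfl fun x hx => hpre x hx
      rw [(G.P l).res_self] at hs ht
      exact hs.symm.trans ((congrArg _ h2).trans ht)
    · intro a
      let s : G.sections W' k := ⟨fun l => G.T (fun x hx => hpre x hx) ((G.P i).res hge a),
        fun l m V hV h => by rw [res_T, G.T_T]⟩
      refine ⟨s, ?_⟩
      change (G.P i).res hle (G.T _ ((G.P i).res hge a)) = a
      rw [G.T_self _ le_rfl, (G.P i).res_res, (G.P i).res_res, (G.P i).res_self]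

theorem pieceIso_hom_incl (i : G.I) :
    (G.pieceIso i).hom ≫ incl G.glued (G.image i) = G.ofPiece i :=
  lift_incl _ _ _

theorem isGradedManifold_glued [T3Space Y] [SecondCountableTopology Y]
    (h : ∀ i, IsGradedManifold (G.P i)) : IsGradedManifold G.glued := by
  refine ⟨inferInstanceAs (T3Space Y), inferInstanceAs (SecondCountableTopology Y), fun y => ?_⟩
  obtain ⟨i, x, rfl⟩ := G.cover y
  obtain ⟨U, hxU, D, W, ⟨e⟩⟩ := (h i).exists_chart x
  let B : Opens (G.glued.restrict (G.image i)) := Opens.comap (G.pieceIso i).inv.base U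
  let B' : Opens (G.P i) := Opens.comap (G.pieceIso i).hom.base B
  have hB : ∀ z, z ∈ B' ↔ z ∈ U := fun z =>
    iff_of_eq (congrArg (· ∈ U) (congrArg (fun f : G.P i ⟶ G.P i => f.base z)
      (G.pieceIso i).hom_inv_id))
  have hBU : B' = U := Opens.ext (Set.ext hB)
  refine ⟨openImage (G.image i) B, ⟨⟨G.j i x, x, rfl⟩, (hB x).2 hxU, rfl⟩, D, W, ⟨?_⟩⟩
  exact (restrictRestrictIso G.glued (G.image i) B _ fun y => Iff.rfl).symm ≪≫
    (restrictIso (G.pieceIso i) B).symm ≪≫ eqToIso (congrArg (G.P i).restrict hBU) ≪≫ e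

end GlueData

end GradedSpace

namespace GradedCoords

open GradedSpace

theorem isGradedManifold (C : GradedCoords) : IsGradedManifold C.toGradedSpace :=
  ⟨inferInstanceAs (T3Space C.Body), inferInstanceAs (SecondCountableTopology C.Body),
    fun _ => ⟨⊤, trivial, C, ⊤, ⟨Iso.refl _⟩⟩⟩

/-- The union of two families of coordinates. -/
noncomputable def sum (C D : GradedCoords) : GradedCoords where
  ι := C.ι ⊕ₗ D.ι
  countable := inferInstanceAs (Countable (C.ι ⊕ D.ι))
  deg i := Sum.elim C.deg D.deg (ofLex i)

variable (C D : GradedCoords)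

theorem exists_fst : ∃ f : (C.sum D).toGradedSpace ⟶ C.toGradedSpace,
    ∀ i : C.ι, gpull f (C.coord i ⊤) = (C.sum D).coord (Sum.inlₗ i) ⊤ := by
  obtain ⟨f, hf, -⟩ := (C.sum D).isGradedManifold.hasCoordHoms C
    fun i => (C.sum D).coord (Sum.inlₗ i) ⊤
  exact ⟨f, hf⟩

theorem exists_snd : ∃ f : (C.sum D).toGradedSpace ⟶ D.toGradedSpace,
    ∀ i : D.ι, gpull f (D.coord i ⊤) = (C.sum D).coord (Sum.inrₗ i) ⊤ := by
  obtain ⟨f, hf, -⟩ := (C.sum D).isGradedManifold.hasCoordHoms D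
    fun i => (C.sum D).coord (Sum.inrₗ i) ⊤
  exact ⟨f, hf⟩

/-- The projection to the first family of coordinates. -/
noncomputable def fst : (C.sum D).toGradedSpace ⟶ C.toGradedSpace := (exists_fst C D).choose

/-- The projection to the second family of coordinates. -/
noncomputable def snd : (C.sum D).toGradedSpace ⟶ D.toGradedSpace := (exists_snd C D).choose

variable {C D}

theorem gpull_fst (i : C.ι) : gpull (fst C D) (C.coord i ⊤) = (C.sum D).coord (Sum.inlₗ i) ⊤ :=
  (exists_fst C D).choose_spec i

theorem gpull_snd (i : D.ι) : gpull (snd C D) (D.coord i ⊤) = (C.sum D).coord (Sum.inrₗ i) ⊤ :=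
  (exists_snd C D).choose_spec i

theorem isGradedProduct_sum : IsGradedProduct (fst C D) (snd C D) := fun N hN f g => by
  let φ : ∀ i, N.sec ⊤ ((C.sum D).deg i) := fun i =>
    Sum.rec (motive := fun s => N.sec ⊤ (Sum.elim C.deg D.deg s))
      (fun i => gpull f (C.coord i ⊤)) (fun i => gpull g (D.coord i ⊤)) (ofLex i)
  obtain ⟨h, hh, -⟩ := hN.hasCoordHoms (C.sum D) φ
  refine ⟨h, ⟨coord_hom_ext hN fun i => ?_, coord_hom_ext hN fun i => ?_⟩, ?_⟩
  · refine (gpull_comp h (fst C D) _).trans ?_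
    rw [gpull_fst]
    exact hh (Sum.inlₗ i)
  · refine (gpull_comp h (snd C D) _).trans ?_
    rw [gpull_snd]
    exact hh (Sum.inrₗ i)
  · rintro h' ⟨h1, h2⟩
    refine coord_hom_ext hN fun i => ?_
    rw [hh]
    change gpull h' _ = _
    induction i using Lex.rec with | _ i => ?_
    rcases i with i | i
    · exact (congrArg _ (gpull_fst i)).symm.trans
        ((gpull_comp h' (fst C D) _).symm.trans (by rw [h1]; rfl))
    · exact (congrArg _ (gpull_snd i)).symm.trans
        ((gpull_comp h' (snd C D) _).symm.trans (by rw [h2]; rfl))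

/-- The values of a morphism between coordinate spaces. -/
theorem base_apply (f : D.toGradedSpace ⟶ C.toGradedSpace) (j : {i : C.ι // C.deg i = 0})
    (y : D.toGradedSpace) : C.toBody (f.base y) j = series (gpull f (C.coord j.1 ⊤)) 0 ⟨y, trivial⟩ := by
  have h := coeff_pull_coord (W := ⊤) (incl D.toGradedSpace ⊤ ≫ f) j (U := ⊤) (V := ⊤) le_top
    (y := ⟨y, trivial⟩) trivial
  refine h.symm.trans ?_
  exact congrArg (fun s : (D.toGradedSpace.restrict ⊤).sec ⊤ _ => coeff s 0 _)
    (gpull_comp (incl D.toGradedSpace ⊤) f (C.coord j.1 ⊤))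

/-- The points of a sum of coordinate spaces. -/
noncomputable def sumHomeo (C D : GradedCoords) : (C.sum D).Body ≃ₜ C.Body × D.Body where
  toFun y := (fun j => y ⟨Sum.inlₗ j.1, j.2⟩, fun j => y ⟨Sum.inrₗ j.1, j.2⟩)
  invFun z j := Sum.rec (motive := fun s => Sum.elim C.deg D.deg s = 0 → ℝ)
    (fun i hi => z.1 ⟨i, hi⟩) (fun i hi => z.2 ⟨i, hi⟩) (ofLex j.1) j.2
  left_inv y := by
    funext ⟨j, hj⟩
    induction j using Lex.rec with | _ j => ?_
    rcases j with j | j <;> rfl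
  right_inv z := rfl
  continuous_toFun := by fun_prop
  continuous_invFun := by
    refine continuous_pi fun ⟨j, hj⟩ => ?_
    induction j using Lex.rec with | _ j => ?_
    rcases j with j | j
    · exact (continuous_apply _).comp continuous_fst
    · exact (continuous_apply _).comp continuous_snd

theorem sumHomeo_apply (y : (C.sum D).toGradedSpace) :
    sumHomeo C D y = ((fst C D).base y, (snd C D).base y) := by
  refine Prod.ext (funext fun j => ?_) (funext fun j => ?_)
  · refine Eq.trans ?_ (base_apply (fst C D) j y).symm
    rw [gpull_fst]
    exact ((coordSeries_of_deg_eq_zero (C := C.sum D) (i := Sum.inlₗ j.1) j.2 0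
      (⟨y, trivial⟩ : (⊤ : Opens (C.sum D).Body))).trans (if_pos rfl)).symm
  · refine Eq.trans ?_ (base_apply (snd C D) j y).symm
    rw [gpull_snd]
    exact ((coordSeries_of_deg_eq_zero (C := C.sum D) (i := Sum.inrₗ j.1) j.2 0
      (⟨y, trivial⟩ : (⊤ : Opens (C.sum D).Body))).trans (if_pos rfl)).symm

end GradedCoords

namespace GradedSpace

open GradedCoords

/-- The homeomorphism of underlying spaces of an isomorphism. -/
def homeoOfIso {M N : GradedSpace} (e : M ≅ N) : M ≃ₜ N where
  toFun := e.hom.base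
  invFun := e.inv.base
  left_inv x := congrArg (fun f : M ⟶ M => f.base x) e.hom_inv_id
  right_inv x := congrArg (fun f : N ⟶ N => f.base x) e.inv_hom_id
  continuous_toFun := e.hom.base.continuous
  continuous_invFun := e.inv.base.continuous

/-- A product of an open piece `U` of `M` and of `K`. -/
structure LocalProduct (M K : GradedSpace) where
  U : Opens M
  P : GradedSpace
  p : P ⟶ M
  q : P ⟶ K
  isGradedManifold : IsGradedManifold P
  mem : ∀ x, p.base x ∈ U
  isProduct : ∀ N, IsGradedManifold N → ∀ (f : N ⟶ M) (g : N ⟶ K), (∀ x, f.base x ∈ U) →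
    ∃! h : N ⟶ P, h ≫ p = f ∧ h ≫ q = g
  isOpenEmbedding : Topology.IsOpenEmbedding fun x => (p.base x, q.base x)
  mem_range : ∀ (m : M) (k : K), m ∈ U → ∃ x, (p.base x, q.base x) = (m, k)

theorem exists_localProduct {M : GradedSpace} (hM : IsGradedManifold M) (D : GradedCoords)
    (m : M) : ∃ L : LocalProduct M D.toGradedSpace, m ∈ L.U := by
  obtain ⟨U, hmU, C, W, ⟨e⟩⟩ := hM.2.2 m
  let V : Opens (C.sum D).toGradedSpace := Opens.comap (fst C D).base W
  let P := (C.sum D).toGradedSpace.restrict V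
  let p : P ⟶ M := restrictHom (fst C D) W ≫ e.inv ≫ incl M U
  let q : P ⟶ D.toGradedSpace := incl _ V ≫ snd C D
  let a : P → W × D.toGradedSpace := fun y => (⟨(fst C D).base y.1, y.2⟩, (snd C D).base y.1)
  have ha' : (Prod.map Subtype.val id : W × D.toGradedSpace → C.Body × D.Body) ∘ a =
      sumHomeo C D ∘ Subtype.val := by
    funext y
    exact (sumHomeo_apply y.1).symm
  have ha : Topology.IsOpenEmbedding a := by
    refine ((W.isOpen.isOpenEmbedding_subtypeVal.prodMap .id).of_comp_iff a).1 ?_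
    refine (congrArg Topology.IsOpenEmbedding ha').mpr ?_
    exact (sumHomeo C D).isOpenEmbedding.comp V.isOpen.isOpenEmbedding_subtypeVal
  have hb : Topology.IsOpenEmbedding fun z : W => (e.inv.base z).1 :=
    U.isOpen.isOpenEmbedding_subtypeVal.comp (homeoOfIso e).symm.isOpenEmbedding
  refine ⟨⟨U, P, p, q, (C.sum D).isGradedManifold.restrict V,
    fun x => (e.inv.base ((restrictHom (fst C D) W).base x)).2, fun N hN f g hf => ?_,
    (hb.prodMap .id).comp ha, fun m' k hm' => ?_⟩, hmU⟩
  · obtain ⟨h, ⟨h1, h2⟩, hu⟩ := isGradedProduct_sum (C := C) (D := D) N hN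
      (lift f U hf ≫ e.hom ≫ incl C.toGradedSpace W) g
    have hV : ∀ x, h.base x ∈ V := fun x => by
      have := congrArg (fun φ : N ⟶ C.toGradedSpace => φ.base x) h1
      exact (congrArg (· ∈ W) this).mpr ((lift f U hf ≫ e.hom).base x).2
    refine ⟨lift h V hV, ⟨?_, ?_⟩, ?_⟩
    · have : lift h V hV ≫ restrictHom (fst C D) W = lift f U hf ≫ e.hom := by
        refine incl_cancel ?_
        rw [Category.assoc, restrictHom_incl, ← Category.assoc]
        exact (congrArg (· ≫ fst C D) (lift_incl h V hV)).trans
          (h1.trans (Category.assoc _ _ _).symm)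
      change lift h V hV ≫ restrictHom (fst C D) W ≫ e.inv ≫ incl M U = f
      rw [← Category.assoc, this, Category.assoc, e.hom_inv_id_assoc, lift_incl]
    · change lift h V hV ≫ incl _ V ≫ snd C D = g
      rw [← Category.assoc, lift_incl, h2]
    · rintro h' ⟨h1', h2'⟩
      refine incl_cancel ?_
      rw [lift_incl]
      refine hu _ ⟨?_, ?_⟩
      · have h3 : h' ≫ restrictHom (fst C D) W = lift f U hf ≫ e.hom := by
          rw [← cancel_mono e.inv, Category.assoc, Category.assoc, e.hom_inv_id, Category.comp_id]
          refine incl_cancel ?_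
          rw [lift_incl, Category.assoc, Category.assoc]
          exact h1'
        rw [Category.assoc, ← restrictHom_incl, ← Category.assoc, ← Category.assoc]
        exact congrArg (· ≫ incl C.toGradedSpace W) h3
      · rw [Category.assoc]
        exact h2'
  · let z : W := e.hom.base ⟨m', hm'⟩
    let y : (C.sum D).Body := (sumHomeo C D).symm (z.1, k)
    have hy := sumHomeo_apply (C := C) (D := D) y
    rw [(sumHomeo C D).apply_symm_apply] at hy
    have hy1 : (fst C D).base y = z.1 := (congrArg Prod.fst hy).symm
    have hyV : y ∈ V := (congrArg (· ∈ W) hy1).mpr z.2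
    refine ⟨⟨y, hyV⟩, Prod.ext ?_ (congrArg Prod.snd hy).symm⟩
    have h1 : (restrictHom (fst C D) W).base ⟨y, hyV⟩ = z := Subtype.ext hy1
    change (e.inv.base ((restrictHom (fst C D) W).base ⟨y, hyV⟩)).1 = m'
    rw [h1]
    exact congrArg Subtype.val ((homeoOfIso e).symm_apply_apply ⟨m', hm'⟩)

end GradedSpace

namespace GradedSpace

theorem top_le_incl {M : GradedSpace} (V : Opens M) :
    (⊤ : Opens (M.restrict V)) ≤ Opens.comap (incl M V).base V := fun x _ => x.2

theorem incl_pull_injective {M : GradedSpace} {V : Opens M} {k : ℤ} {s t : M.sec V k}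
    (h : (⊤ : Opens (M.restrict V)) ≤ Opens.comap (incl M V).base V)
    (hst : (incl M V).pull h s = (incl M V).pull h t) : s = t := by
  have h1 : openImage V ⊤ ≤ V := openImage_le _ _
  have h2 : V ≤ openImage V ⊤ := fun x hx => ⟨⟨x, hx⟩, trivial, rfl⟩
  have h3 : M.res h1 s = M.res h1 t := hst
  have h4 := congrArg (M.res h2) h3
  rwa [M.res_res, M.res_res, M.res_self, M.res_self] at h4

theorem exists_incl_pull {M : GradedSpace} {V : Opens M} {k : ℤ} (s : (M.restrict V).sec ⊤ k) :
    (incl M V).pull (top_le_incl V)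
      (M.res (fun x hx => ⟨⟨x, hx⟩, trivial, rfl⟩ : V ≤ openImage V ⊤) s) = s :=
  (M.res_res _ _ _).trans (M.res_self _ _)

/-- Morphisms from the pieces that are compatible with the transition maps glue. -/
def GlueData.desc {Y : Type} [TopologicalSpace Y] (G : GlueData Y) {N : GradedSpace}
    (f : ∀ i, G.P i ⟶ N) (b : C(Y, N)) (hb : ∀ i x, b (G.j i x) = (f i).base x)
    (hf : ∀ {i l : G.I} {V : Opens (G.P i)} {V' : Opens (G.P l)}
      (h : ∀ x ∈ V, ∃ x' ∈ V', G.j l x' = G.j i x) {U : Opens N}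
      (hV : V ≤ Opens.comap (f i).base U) (hV' : V' ≤ Opens.comap (f l).base U) {k : ℤ}
      (s : N.sec U k), G.T h ((f l).pull hV' s) = (f i).pull hV s) : G.glued ⟶ N :=
  have aux : ∀ {U : Opens N} {W : Opens Y}, W ≤ Opens.comap b U → ∀ i,
      G.pre i W ≤ Opens.comap (f i).base U := fun {U _} h i x hx =>
    (congrArg (· ∈ U) (hb i x)).mp (h hx)
  { base := b
    pull := fun {U W} h {k} =>
      { toFun := fun s => (⟨fun i => (f i).pull (aux h i) s, fun i l V hV h' => by
          rw [hf h' (hV.trans (aux h i)), (f i).res_pull]⟩ : G.sections W k)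
        map_add' := fun _ _ => Subtype.ext (funext fun i => map_add _ _ _)
        map_smul' := fun _ _ => Subtype.ext (funext fun i => map_smul _ _ _) }
    pull_one := fun h => Subtype.ext (funext fun i => (f i).pull_one (aux h i))
    pull_mul := fun h _ _ _ hk s t => Subtype.ext (funext fun i => (f i).pull_mul (aux h i) hk s t)
    res_pull := fun h h' _ s =>
      Subtype.ext (funext fun i => (f i).res_pull (aux h i) (GlueData.pre_mono h' i) s)
    pull_res := fun h h' _ s => Subtype.ext (funext fun i => (f i).pull_res (aux h i) h' s) }

theorem GlueData.ofPiece_desc {Y : Type} [TopologicalSpace Y] (G : GlueData Y) {N : GradedSpace}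
    (f : ∀ i, G.P i ⟶ N) (b : C(Y, N)) (hb : ∀ i x, b (G.j i x) = (f i).base x)
    (hf : ∀ {i l : G.I} {V : Opens (G.P i)} {V' : Opens (G.P l)}
      (h : ∀ x ∈ V, ∃ x' ∈ V', G.j l x' = G.j i x) {U : Opens N}
      (hV : V ≤ Opens.comap (f i).base U) (hV' : V' ≤ Opens.comap (f l).base U) {k : ℤ}
      (s : N.sec U k), G.T h ((f l).pull hV' s) = (f i).pull hV s) (i : G.I) :
    G.ofPiece i ≫ G.desc f b hb hf = f i := by
  refine hom_ext (fun x => hb i x) fun U V h1 h2 k s => ?_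
  have h3 : Opens.comap b U ≤ Opens.comap (G.desc f b hb hf).base U := le_rfl
  rw [comp_pull _ _ h1 (W := Opens.comap b U) h1 h3]
  exact (f i).res_pull _ _ s

namespace LocalProduct

variable {M K : GradedSpace}

theorem exists_trans (L L' : LocalProduct M K) (V : Opens L.P)
    (h : ∀ x ∈ V, L.p.base x ∈ L'.U) : ∃ t : L.P.restrict V ⟶ L'.P,
      t ≫ L'.p = incl L.P V ≫ L.p ∧ t ≫ L'.q = incl L.P V ≫ L.q :=
  (L'.isProduct _ (L.isGradedManifold.restrict V) _ _ fun x => h x.1 x.2).exists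

/-- The change of local products. -/
noncomputable def trans (L L' : LocalProduct M K) (V : Opens L.P)
    (h : ∀ x ∈ V, L.p.base x ∈ L'.U) : L.P.restrict V ⟶ L'.P := (L.exists_trans L' V h).choose

theorem trans_p (L L' : LocalProduct M K) (V : Opens L.P) (h : ∀ x ∈ V, L.p.base x ∈ L'.U) :
    L.trans L' V h ≫ L'.p = incl L.P V ≫ L.p := (L.exists_trans L' V h).choose_spec.1

theorem trans_q (L L' : LocalProduct M K) (V : Opens L.P) (h : ∀ x ∈ V, L.p.base x ∈ L'.U) :
    L.trans L' V h ≫ L'.q = incl L.P V ≫ L.q := (L.exists_trans L' V h).choose_spec.2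

/-- The points of a local product. -/
def point (L : LocalProduct M K) (x : L.P) : M × K := (L.p.base x, L.q.base x)

theorem point_injective (L : LocalProduct M K) : Function.Injective L.point :=
  L.isOpenEmbedding.injective

theorem point_eq {Z : GradedSpace} {L L' : LocalProduct M K} {a : Z ⟶ L.P} {b : Z ⟶ L'.P}
    (hp : a ≫ L.p = b ≫ L'.p) (hq : a ≫ L.q = b ≫ L'.q) (z : Z) :
    L.point (a.base z) = L'.point (b.base z) :=
  Prod.ext (congrArg (fun f : Z ⟶ M => f.base z) hp) (congrArg (fun f : Z ⟶ K => f.base z) hq)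

section T

variable {L L' : LocalProduct M K} {V : Opens L.P} {V' : Opens L'.P}
  (h : ∀ x ∈ V, ∃ x' ∈ V', L'.point x' = L.point x)

include h in
theorem mem_of_point : ∀ x ∈ V, L.p.base x ∈ L'.U := fun x hx => by
  obtain ⟨x', -, hx'⟩ := h x hx
  exact (congrArg (· ∈ L'.U) (congrArg Prod.fst hx')).mp (L'.mem x')

include h in
theorem trans_mem (x : L.P.restrict V) : (L.trans L' V (mem_of_point h)).base x ∈ V' := by
  obtain ⟨x', hx', e⟩ := h x.1 x.2
  have := point_eq (L.trans_p L' V (mem_of_point h)) (L.trans_q L' V (mem_of_point h)) x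
  exact L'.point_injective (e.trans this.symm) ▸ hx'

include h in
theorem top_le_trans : (⊤ : Opens (L.P.restrict V)) ≤
    Opens.comap (L.trans L' V (mem_of_point h)).base V' := fun x _ => trans_mem h x

/-- The pull-back of sections under the change of local products. -/
noncomputable def T {k : ℤ} : L'.P.sec V' k →ₗ[ℝ] L.P.sec V k :=
  (L.P.res (fun x hx => ⟨⟨x, hx⟩, trivial, rfl⟩ : V ≤ openImage V ⊤)).comp
    ((L.trans L' V (mem_of_point h)).pull (top_le_trans h))

theorem incl_pull_T {k : ℤ} (s : L'.P.sec V' k) :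
    (incl L.P V).pull (top_le_incl V) (T h s) =
      (L.trans L' V (mem_of_point h)).pull (top_le_trans h) s :=
  exists_incl_pull _

theorem pull_T {Z : GradedSpace} (hZ : IsGradedManifold Z) {a : Z ⟶ L.P} {b : Z ⟶ L'.P}
    (hp : a ≫ L.p = b ≫ L'.p) (hq : a ≫ L.q = b ≫ L'.q) {W : Opens Z}
    (ha : W ≤ Opens.comap a.base V) (hb : W ≤ Opens.comap b.base V') {k : ℤ}
    (s : L'.P.sec V' k) : a.pull ha (T h s) = b.pull hb s := by
  let c : Z.restrict W ⟶ L.P.restrict V := lift (incl Z W ≫ a) V fun x => ha x.2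
  have hcl : c ≫ incl L.P V = incl Z W ≫ a := lift_incl _ _ _
  have hc : c ≫ L.trans L' V (mem_of_point h) = incl Z W ≫ b := by
    obtain ⟨m, -, hm⟩ := L'.isProduct _ (hZ.restrict W) (incl Z W ≫ b ≫ L'.p)
      (incl Z W ≫ b ≫ L'.q) fun x => L'.mem _
    refine (hm _ ⟨?_, ?_⟩).trans (hm _ ⟨?_, ?_⟩).symm
    · rw [Category.assoc, trans_p, ← Category.assoc, hcl, Category.assoc, hp]
    · rw [Category.assoc, trans_q, ← Category.assoc, hcl, Category.assoc, hq]
    · rw [Category.assoc]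
    · rw [Category.assoc]
  have h0 : (⊤ : Opens (Z.restrict W)) ≤ Opens.comap (incl Z W).base W := fun x _ => x.2
  refine incl_pull_injective h0 ?_
  have h1 : (⊤ : Opens (Z.restrict W)) ≤ Opens.comap (incl Z W ≫ a).base V := fun x _ => ha x.2
  have h2 : (⊤ : Opens (Z.restrict W)) ≤ Opens.comap (incl Z W ≫ b).base V' := fun x _ => hb x.2
  have h3 : (⊤ : Opens (Z.restrict W)) ≤
    Opens.comap (c ≫ L.trans L' V (mem_of_point h)).base V' := fun x _ => trans_mem h _
  rw [← comp_pull (incl Z W) a h1 h0 ha, ← comp_pull (incl Z W) b h2 h0 hb,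
    pull_congr (lift_incl (incl Z W ≫ a) V fun x => ha x.2).symm h1 h1,
    comp_pull c (incl L.P V) h1 (W := ⊤) (fun _ _ => trivial) (top_le_incl V), incl_pull_T,
    pull_congr hc.symm h2 h3,
    comp_pull c (L.trans L' V (mem_of_point h)) h3 (W := ⊤) (fun _ _ => trivial) (top_le_trans h)]

theorem T_one : T h (L'.P.one V') = L.P.one V := by
  refine incl_pull_injective (top_le_incl V) ?_
  rw [incl_pull_T, Hom.pull_one, Hom.pull_one]

theorem T_mul {i j k : ℤ} (hk : i + j = k) (s : L'.P.sec V' i) (t : L'.P.sec V' j) :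
    T h (L'.P.mul hk s t) = L.P.mul hk (T h s) (T h t) := by
  refine incl_pull_injective (top_le_incl V) ?_
  rw [incl_pull_T, Hom.pull_mul, Hom.pull_mul, incl_pull_T, incl_pull_T]

theorem T_pull {N : GradedSpace} {f : L.P ⟶ N} {f' : L'.P ⟶ N}
    (hf : L.trans L' V (mem_of_point h) ≫ f' = incl L.P V ≫ f) {U : Opens N}
    (hV : V ≤ Opens.comap f.base U) (hV' : V' ≤ Opens.comap f'.base U) {k : ℤ} (s : N.sec U k) :
    T h (f'.pull hV' s) = f.pull hV s := by
  have h0 : (⊤ : Opens (L.P.restrict V)) ≤ Opens.comap (incl L.P V).base V := fun x _ => x.2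
  refine incl_pull_injective h0 ?_
  have h1 : (⊤ : Opens (L.P.restrict V)) ≤ Opens.comap (incl L.P V ≫ f).base U :=
    fun x _ => hV x.2
  have h2 : (⊤ : Opens (L.P.restrict V)) ≤
      Opens.comap (L.trans L' V (mem_of_point h) ≫ f').base U := fun x hx => hV' (top_le_trans h hx)
  rw [incl_pull_T, ← comp_pull _ f h1 h0 hV,
    ← comp_pull _ f' h2 (top_le_trans h) hV', pull_congr hf h2 h1]

end T

/-- The gluing data of a family of local products over a cover of `M`. -/
noncomputable abbrev glueData {I : Type} (L : I → LocalProduct M K)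
    (hL : ∀ m : M, ∃ i, m ∈ (L i).U) : GlueData (M × K) where
  I := I
  P i := (L i).P
  j i := (L i).point
  isOpenEmbedding i := (L i).isOpenEmbedding
  cover y := by
    obtain ⟨i, hi⟩ := hL y.1
    exact ⟨i, (L i).mem_range y.1 y.2 hi⟩
  T h := T h
  T_one h := T_one h
  T_mul h _ _ _ hc s t := T_mul h hc s t
  T_self {i V V'} h h' k s := by
    have := pull_T h (L i).isGradedManifold (a := 𝟙 _) (b := 𝟙 _) rfl rfl (W := V) le_rfl h' s
    exact ((L i).P.res_self le_rfl _).symm.trans this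
  T_T {i l m V V' V''} h h' h'' k s := by
    have hZ := (L i).isGradedManifold.restrict V
    have e1 := (L i).trans_p (L l) V (mem_of_point h)
    have e2 := (L i).trans_q (L l) V (mem_of_point h)
    have e3 := (L i).trans_p (L m) V (mem_of_point h'')
    have e4 := (L i).trans_q (L m) V (mem_of_point h'')
    refine incl_pull_injective (top_le_incl V) ?_
    rw [incl_pull_T, incl_pull_T]
    exact pull_T h' hZ (e1.trans e3.symm) (e2.trans e4.symm) _ _ s

section Product

variable {I : Type} (L : I → LocalProduct M K) (hL : ∀ m : M, ∃ i, m ∈ (L i).U)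

theorem exists_proj {N : GradedSpace} (f : ∀ i, (L i).P ⟶ N) (b : C(M × K, N))
    (hb : ∀ i x, b ((L i).point x) = (f i).base x)
    (hf : ∀ i l (V : Opens (L i).P) (h : ∀ x ∈ V, (L i).p.base x ∈ (L l).U),
      (L i).trans (L l) V h ≫ f l = incl (L i).P V ≫ f i) :
    ∃ g : (glueData L hL).glued ⟶ N, (∀ x, g.base x = b x) ∧
      ∀ i, (glueData L hL).ofPiece i ≫ g = f i :=
  ⟨(glueData L hL).desc f b hb fun {i l V _} h {_} hV hV' {_} s =>
      T_pull (L := L i) (L' := L l) h (hf i l V (mem_of_point h)) hV hV' s,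
    fun _ => rfl, fun i => GlueData.ofPiece_desc _ _ _ _ _ i⟩

theorem exists_fst : ∃ g : (glueData L hL).glued ⟶ M, (∀ x, g.base x = x.1) ∧
    ∀ i, (glueData L hL).ofPiece i ≫ g = (L i).p :=
  exists_proj L hL (fun i => (L i).p) ⟨Prod.fst, continuous_fst⟩ (fun _ _ => rfl)
    fun i l V h => (L i).trans_p (L l) V h

theorem exists_snd : ∃ g : (glueData L hL).glued ⟶ K, (∀ x, g.base x = x.2) ∧
    ∀ i, (glueData L hL).ofPiece i ≫ g = (L i).q :=
  exists_proj L hL (fun i => (L i).q) ⟨Prod.snd, continuous_snd⟩ (fun _ _ => rfl)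
    fun i l V h => (L i).trans_q (L l) V h

/-- The projection of the glued product to the first factor. -/
noncomputable def fst : (glueData L hL).glued ⟶ M := (exists_fst L hL).choose

/-- The projection of the glued product to the second factor. -/
noncomputable def snd : (glueData L hL).glued ⟶ K := (exists_snd L hL).choose

theorem fst_base (x : M × K) : (fst L hL).base x = x.1 := (exists_fst L hL).choose_spec.1 x

theorem snd_base (x : M × K) : (snd L hL).base x = x.2 := (exists_snd L hL).choose_spec.1 x

theorem ofPiece_fst (i : I) : (glueData L hL).ofPiece i ≫ fst L hL = (L i).p :=
  (exists_fst L hL).choose_spec.2 i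

theorem ofPiece_snd (i : I) : (glueData L hL).ofPiece i ≫ snd L hL = (L i).q :=
  (exists_snd L hL).choose_spec.2 i

theorem comp_ofPiece_eq {Z : GradedSpace} (hZ : IsGradedManifold Z) {i l : I} {a : Z ⟶ (L i).P}
    {b : Z ⟶ (L l).P} (hp : a ≫ (L i).p = b ≫ (L l).p) (hq : a ≫ (L i).q = b ≫ (L l).q) :
    a ≫ (glueData L hL).ofPiece i = b ≫ (glueData L hL).ofPiece l := by
  have hbase := point_eq hp hq
  refine hom_ext (fun x => hbase x) fun W V ha hb k s => ?_
  let G := glueData L hL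
  let V₁ : Opens (L i).P := G.pre i W ⊓ Opens.comap (L i).p.base (L l).U
  have h : ∀ x ∈ V₁, ∃ x' ∈ G.pre l W, G.j l x' = G.j i x := fun x hx => by
    obtain ⟨x', hx'⟩ := (L l).mem_range ((L i).p.base x) ((L i).q.base x) hx.2
    exact ⟨x', (congrArg (· ∈ W) hx').mpr hx.1, hx'⟩
  have h1 : V ≤ Opens.comap a.base V₁ := fun x hx => by
    refine ⟨ha hx, ?_⟩
    exact (congrArg (· ∈ (L l).U) (congrArg Prod.fst (hbase x))).mpr ((L l).mem _)
  have h2 : V ≤ Opens.comap b.base (G.pre l W) := hb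
  have key := (show G.sections W k from s).2 i l V₁ inf_le_left h
  have e1 : (a ≫ G.ofPiece i).pull ha s =
      a.pull h1 ((L i).P.res inf_le_left ((show G.sections W k from s).1 i)) :=
    comp_pull a (G.ofPiece i) ha h1 (fun x hx => hx.1) s
  have e2 : (b ≫ G.ofPiece l).pull hb s = b.pull h2 ((show G.sections W k from s).1 l) :=
    (comp_pull b (G.ofPiece l) hb h2 le_rfl s).trans
      (congrArg _ ((L l).P.res_self _ _))
  refine e1.trans (Eq.trans ?_ e2.symm)
  exact (congrArg (a.pull h1) key.symm).trans (pull_T h hZ hp hq h1 h2 _)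

theorem isGradedProduct : IsGradedProduct (fst L hL) (snd L hL) := fun N hN f g => by
  let G := glueData L hL
  have ex : ∃ h : N ⟶ G.glued, h ≫ fst L hL = f ∧ h ≫ snd L hL = g := by
    let V : I → Opens N := fun i => Opens.comap f.base (L i).U
    have hV : ∀ x, ∃ i, x ∈ V i := fun x => hL (f.base x)
    choose c hc _ using fun i => (L i).isProduct _ (hN.restrict (V i)) (incl N (V i) ≫ f)
      (incl N (V i) ≫ g) fun x => x.2
    obtain ⟨h, hh⟩ := exists_glue_hom (f := fun i => c i ≫ G.ofPiece i) hV fun i l => by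
      refine (Category.assoc _ _ _).symm.trans (Eq.trans ?_ (Category.assoc _ _ _))
      refine comp_ofPiece_eq L hL (hN.restrict _) ?_ ?_
      · simp only [Category.assoc, (hc i).1, (hc l).1]
        rw [← Category.assoc, inclLE_incl, ← Category.assoc, inclLE_incl]
      · simp only [Category.assoc, (hc i).2, (hc l).2]
        rw [← Category.assoc, inclLE_incl, ← Category.assoc, inclLE_incl]
    refine ⟨h, hom_ext_local hV fun i => ?_, hom_ext_local hV fun i => ?_⟩
    · rw [← Category.assoc, hh, Category.assoc, ofPiece_fst, (hc i).1]
    · rw [← Category.assoc, hh, Category.assoc, ofPiece_snd, (hc i).2]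
  obtain ⟨h, h1, h2⟩ := ex
  refine ⟨h, ⟨h1, h2⟩, fun h' hh' => ?_⟩
  have hbase : ∀ x, h'.base x = h.base x := fun x => Prod.ext
    ((fst_base L hL _).symm.trans
      ((congrArg (fun φ : N ⟶ M => φ.base x) (hh'.1.trans h1.symm)).trans (fst_base L hL _)))
    ((snd_base L hL _).symm.trans
      ((congrArg (fun φ : N ⟶ K => φ.base x) (hh'.2.trans h2.symm)).trans (snd_base L hL _)))
  let V : I → Opens N := fun i => Opens.comap h.base (G.image i)
  have hV : ∀ x, ∃ i, x ∈ V i := fun x => by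
    obtain ⟨i, y, hy⟩ := G.cover (h.base x)
    exact ⟨i, y, hy⟩
  refine hom_ext_local hV fun i => ?_
  have fac : ∀ u : N ⟶ G.glued, (∀ x : V i, u.base x.1 ∈ G.image i) →
      ∃ a : N.restrict (V i) ⟶ (L i).P, a ≫ G.ofPiece i = incl N (V i) ≫ u := fun u hu =>
    ⟨lift (incl N (V i) ≫ u) (G.image i) hu ≫ (G.pieceIso i).inv, by
      rw [← G.pieceIso_hom_incl, Category.assoc, Iso.inv_hom_id_assoc]
      exact lift_incl _ _ _⟩
  obtain ⟨a, ha⟩ := fac h fun x => x.2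
  obtain ⟨a', ha'⟩ := fac h' fun x => (congrArg (· ∈ G.image i) (hbase x.1)).mpr x.2
  obtain ⟨m, -, hm⟩ := (L i).isProduct _ (hN.restrict (V i)) (incl N (V i) ≫ f)
    (incl N (V i) ≫ g) fun x => by
      obtain ⟨y, hy⟩ := x.2
      have e1 : f.base x.1 = (L i).p.base y :=
        (congrArg (fun φ : N ⟶ M => φ.base x.1) h1).symm.trans
          ((fst_base L hL _).trans (congrArg Prod.fst hy).symm)
      exact (congrArg (· ∈ (L i).U) e1).mpr ((L i).mem y)
  have hp : ∀ (u : N ⟶ G.glued) (a : N.restrict (V i) ⟶ (L i).P),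
      u ≫ fst L hL = f → u ≫ snd L hL = g → a ≫ G.ofPiece i = incl N (V i) ≫ u → a = m :=
    fun u a hu1 hu2 hau => hm a ⟨by
      rw [← ofPiece_fst L hL i, ← Category.assoc, hau, Category.assoc, hu1], by
      rw [← ofPiece_snd L hL i, ← Category.assoc, hau, Category.assoc, hu2]⟩
  rw [← ha, ← ha', hp h a h1 h2 ha, hp h' a' hh'.1 hh'.2 ha']

end Product

end LocalProduct

end GradedSpace

theorem IsGradedManifold.exists_product {M : GradedSpace} (hM : IsGradedManifold M)
    (D : GradedCoords) : ∃ (P : GradedSpace) (p : P ⟶ M) (q : P ⟶ D.toGradedSpace),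
      IsGradedManifold P ∧ IsGradedProduct p q := by
  choose L hL using GradedSpace.exists_localProduct hM D
  have hc : ∀ m, ∃ i, m ∈ (L i).U := fun m => ⟨m, hL m⟩
  have hM1 := hM.1
  have hM2 := hM.2.1
  have hD := D.isGradedManifold
  have hD1 := hD.1
  have hD2 := hD.2.1
  exact ⟨_, GradedSpace.LocalProduct.fst L hc, GradedSpace.LocalProduct.snd L hc,
    GradedSpace.GlueData.isGradedManifold_glued _ fun i => (L i).isGradedManifold,
    GradedSpace.LocalProduct.isGradedProduct L hc⟩

namespace GradedSpace

theorem mul_units_smul_right {M : GradedSpace} {U : Opens M} {i j k : ℤ} (h : i + j = k) (u : ℤˣ)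
    (a : M.sec U i) (b : M.sec U j) : M.mul h a (u • b) = u • M.mul h a b := by
  rw [units_smul_real, units_smul_real, mul_smul_right]

theorem mul_units_smul_left {M : GradedSpace} {U : Opens M} {i j k : ℤ} (h : i + j = k) (u : ℤˣ)
    (a : M.sec U i) (b : M.sec U j) : M.mul h (u • a) b = u • M.mul h a b := by
  rw [units_smul_real, units_smul_real, mul_smul_left]

theorem map_units_smul {E F : Type} [AddCommGroup E] [Module ℝ E] [AddCommGroup F] [Module ℝ F]
    (f : E →ₗ[ℝ] F) (u : ℤˣ) (a : E) : f (u • a) = u • f a := by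
  rw [units_smul_real, units_smul_real, map_smul]

theorem negOnePow_smul_smul {E : Type} [AddCommGroup E] [Module ℝ E] (i j : ℤ) (a : E) :
    i.negOnePow • j.negOnePow • a = (i + j).negOnePow • a := by
  rw [smul_smul, Int.negOnePow_add]

theorem negOnePow_congr {i j : ℤ} (h : Even (i - j)) : i.negOnePow = j.negOnePow :=
  Int.negOnePow_eq_iff _ _ |>.2 h

/-- The functions `a + ε b` on `M`, where `ε` is a constant of degree `-1`. -/
abbrev dual (M : GradedSpace) : GradedSpace where
  carrier := M
  sec U k := M.sec U k × M.sec U (k + 1)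
  one U := (M.one U, 0)
  mul {U i j k} h := LinearMap.mk₂ ℝ
    (fun a b => (M.mul h a.1 b.1, M.mul (show i + 1 + j = k + 1 by omega) a.2 b.1 +
      i.negOnePow • M.mul (show i + (j + 1) = k + 1 by omega) a.1 b.2))
    (fun _ _ _ => Prod.ext (mul_add_left _ _ _ _) (by
      simp only [Prod.fst_add, Prod.snd_add, mul_add_left, smul_add]; abel))
    (fun _ _ _ => Prod.ext (mul_smul_left _ _ _ _) (by
      simp only [Prod.smul_fst, Prod.smul_snd, mul_smul_left, smul_add, units_smul_real]
      rw [smul_comm (_ : ℝ) (_ : ℝ)]))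
    (fun _ _ _ => Prod.ext (mul_add_right _ _ _ _) (by
      simp only [Prod.fst_add, Prod.snd_add, mul_add_right, smul_add]; abel))
    (fun _ _ _ => Prod.ext (mul_smul_right _ _ _ _) (by
      simp only [Prod.smul_fst, Prod.smul_snd, mul_smul_right, smul_add, units_smul_real]
      rw [smul_comm (_ : ℝ) (_ : ℝ)]))
  one_mul a := Prod.ext (M.one_mul _) (by
    change M.mul _ 0 a.1 + _ = a.2
    rw [mul_zero_left, zero_add, Int.negOnePow_zero, one_smul]
    exact M.one_mul _)
  mul_assoc {U i j k ij jk l} hij hjk h₁ h₂ a b c := Prod.ext (M.mul_assoc _ _ _ _ _ _ _) (by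
    simp only [LinearMap.mk₂_apply, mul_add_left, mul_add_right, mul_units_smul_left,
      mul_units_smul_right, smul_add, negOnePow_smul_smul]
    rw [M.mul_assoc _ hjk _ (show i + 1 + jk = l + 1 by omega) a.2,
      M.mul_assoc _ (show j + 1 + k = jk + 1 by omega) _ (show i + (jk + 1) = l + 1 by omega) a.1,
      M.mul_assoc _ (show j + (k + 1) = jk + 1 by omega) _ (show i + (jk + 1) = l + 1 by omega) a.1,
      add_assoc, hij])
  mul_comm {U i j k} h h' a b := Prod.ext (M.mul_comm h h' _ _) (by
    simp only [LinearMap.mk₂_apply, Prod.smul_snd, smul_add, negOnePow_smul_smul]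
    rw [M.mul_comm (show i + 1 + j = k + 1 by omega) (show j + (i + 1) = k + 1 by omega) a.2 b.1,
      M.mul_comm (show i + (j + 1) = k + 1 by omega) (show j + 1 + i = k + 1 by omega) a.1 b.2,
      negOnePow_smul_smul]
    refine (add_comm _ _).trans (congrArg₂ (· + ·) ?_ ?_)
    · rw [negOnePow_congr (i := i + i * (j + 1)) (j := i * j) ⟨i, by ring⟩]
    · rw [show (i + 1) * j = i * j + j by ring])
  res {U V} h {k} := (M.res h (k := k)).prodMap (M.res h (k := k + 1))
  res_self h a := Prod.ext (M.res_self h _) (M.res_self h _)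
  res_res h h' a := Prod.ext (M.res_res h h' _) (M.res_res h h' _)
  res_one h := Prod.ext (M.res_one h) (map_zero (M.res h))
  res_mul h i j k hk a b := Prod.ext (M.res_mul h hk _ _) (by
    simp only [LinearMap.mk₂_apply, LinearMap.prodMap_apply, map_add, M.res_mul, map_units_smul])
  locality V hV hU k a b hab := Prod.ext
    (M.locality V hV hU _ _ fun i => congrArg Prod.fst (hab i))
    (M.locality V hV hU _ _ fun i => congrArg Prod.snd (hab i))
  gluing V hV hU k s hs := by
    obtain ⟨a, ha⟩ := M.gluing V hV hU (fun i => (s i).1) fun i j => congrArg Prod.fst (hs i j)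
    obtain ⟨b, hb⟩ := M.gluing V hV hU (fun i => (s i).2) fun i j => congrArg Prod.snd (hs i j)
    exact ⟨(a, b), fun i => Prod.ext (ha i) (hb i)⟩

/-- A morphism acts on the coefficients of dual numbers. -/
def dualMap {M N : GradedSpace} (f : M ⟶ N) : M.dual ⟶ N.dual :=
  Hom.mk (M := M.dual) (N := N.dual) (base := f.base)
    (pull := fun {U V} h {k} => (f.pull (U := U) (V := V) h (k := k)).prodMap
      (f.pull (U := U) (V := V) h (k := k + 1)))
    (pull_one := fun h => Prod.ext (f.pull_one h) (map_zero (f.pull h (k := 1))))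
    (pull_mul := fun h i j k hk a b => Prod.ext (f.pull_mul h hk _ _) (by
      simp only [dual, LinearMap.mk₂_apply, LinearMap.prodMap_apply, map_add, map_units_smul,
        f.pull_mul]))
    (res_pull := fun h h' _ _ => Prod.ext (f.res_pull h h' _) (f.res_pull h h' _))
    (pull_res := fun h h' _ _ => Prod.ext (f.pull_res h h' _) (f.pull_res h h' _))

/-- The dual numbers over an isomorphic space. -/
def dualIso {M N : GradedSpace} (e : M ≅ N) : M.dual ≅ N.dual where
  hom := dualMap e.hom
  inv := dualMap e.inv
  hom_inv_id := by
    have : dualMap e.hom ≫ dualMap e.inv = dualMap (e.hom ≫ e.inv) := rfl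
    rw [this, e.hom_inv_id]
    rfl
  inv_hom_id := by
    have : dualMap e.inv ≫ dualMap e.hom = dualMap (e.inv ≫ e.hom) := rfl
    rw [this, e.inv_hom_id]
    rfl

end GradedSpace

namespace GradedCoords

open GradedSpace

variable (C : GradedCoords)

/-- The coordinates of `C` and a first coordinate of degree `-1`. -/
noncomputable abbrev withOdd : GradedCoords where
  ι := WithBot C.ι
  countable := inferInstanceAs (Countable (Option C.ι))
  deg := WithBot.recBotCoe (-1) C.deg

variable {C}

theorem withOdd_deg_bot : C.withOdd.deg (⊥ : WithBot C.ι) = -1 := rfl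

/-- The exponent of `ε ^ n ξ ^ α`. -/
noncomputable def join (n : ℕ) (α : C.ι →₀ ℕ) : WithBot C.ι →₀ ℕ :=
  (Finsupp.single (⊥ : WithBot C.ι) n : WithBot C.ι →₀ ℕ) +
    α.mapDomain ((↑) : C.ι → WithBot C.ι)

theorem join_bot (n : ℕ) (α : C.ι →₀ ℕ) : join n α (⊥ : WithBot C.ι) = n := by
  have : α.mapDomain ((↑) : C.ι → WithBot C.ι) ⊥ = 0 :=
    Finsupp.mapDomain_of_notMem_range _ _ (by simp)
  simp [join, this]

theorem join_coe (n : ℕ) (α : C.ι →₀ ℕ) (i : C.ι) : join n α (i : WithBot C.ι) = α i := by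
  have : α.mapDomain ((↑) : C.ι → WithBot C.ι) i = α i :=
    Finsupp.mapDomain_apply WithBot.coe_injective _ _
  simp [join, this]

/-- The exponents of the coordinates of `C`. -/
noncomputable def rest (β : WithBot C.ι →₀ ℕ) : C.ι →₀ ℕ :=
  Finsupp.comapDomain ((↑) : C.ι → WithBot C.ι) β WithBot.coe_injective.injOn

theorem ext_withOdd {β β' : WithBot C.ι →₀ ℕ} (h : β (⊥ : WithBot C.ι) = β' (⊥ : WithBot C.ι))
    (h' : ∀ i : C.ι, β (i : WithBot C.ι) = β' (i : WithBot C.ι)) : β = β' :=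
  Finsupp.ext fun i => WithBot.recBotCoe (C := fun i => β i = β' i) h h' i

theorem join_rest (β : WithBot C.ι →₀ ℕ) : join (β (⊥ : WithBot C.ι)) (rest β) = β :=
  ext_withOdd (join_bot _ _) fun _ => join_coe _ _ _

theorem rest_join (n : ℕ) (α : C.ι →₀ ℕ) : rest (join n α) = α :=
  Finsupp.ext fun _ => join_coe _ _ _

theorem join_add (n m : ℕ) (α β : C.ι →₀ ℕ) : join (n + m) (α + β) = join n α + join m β :=
  ext_withOdd (by simp [join_bot]) fun i => by simp [join_coe]

theorem rest_add (α β : WithBot C.ι →₀ ℕ) : rest (α + β) = rest α + rest β :=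
  Finsupp.ext fun _ => rfl

theorem sum_antidiagonal_join {E : Type} [AddCommMonoid E] (n : ℕ) (γ : C.ι →₀ ℕ)
    (F : (WithBot C.ι →₀ ℕ) × (WithBot C.ι →₀ ℕ) → E) [DecidableEq C.ι] [DecidableEq (WithBot C.ι)] :
    ∑ p ∈ Finset.HasAntidiagonal.antidiagonal (join n γ), F p =
      ∑ q ∈ Finset.HasAntidiagonal.antidiagonal γ,
        ∑ m ∈ Finset.HasAntidiagonal.antidiagonal n, F (join m.1 q.1, join m.2 q.2) := by
  rw [← Finset.sum_product']
  refine Finset.sum_nbij' (fun p => ((rest p.1, rest p.2),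
    (p.1 (⊥ : WithBot C.ι), p.2 (⊥ : WithBot C.ι))))
    (fun r => (join r.2.1 r.1.1, join r.2.2 r.1.2)) ?_ ?_ ?_ ?_ ?_
  · intro p hp
    rw [Finset.HasAntidiagonal.mem_antidiagonal] at hp
    rw [Finset.mem_product, Finset.HasAntidiagonal.mem_antidiagonal,
      Finset.HasAntidiagonal.mem_antidiagonal]
    refine ⟨?_, ?_⟩
    · rw [← rest_add, hp, rest_join]
    · exact (DFunLike.congr_fun hp (⊥ : WithBot C.ι)).trans (join_bot _ _)
  · intro r hr
    rw [Finset.mem_product, Finset.HasAntidiagonal.mem_antidiagonal,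
      Finset.HasAntidiagonal.mem_antidiagonal] at hr
    rw [Finset.HasAntidiagonal.mem_antidiagonal, ← hr.1, ← hr.2, join_add]
  · intro p _
    exact Prod.ext (join_rest _) (join_rest _)
  · intro r _
    simp only [rest_join, join_bot]
  · intro p _
    simp only [join_rest]

theorem admissible_join {n : ℕ} {α : C.ι →₀ ℕ} :
    C.withOdd.Admissible (join n α) ↔ n ≤ 1 ∧ C.Admissible α := by
  constructor
  · intro h
    refine ⟨?_, fun i => ?_⟩
    · have : join n α (⊥ : WithBot C.ι) ≤ 1 := (h (⊥ : WithBot C.ι)).2 ⟨-1, rfl⟩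
      rwa [join_bot] at this
    · have : (C.deg i = 0 → join n α (i : WithBot C.ι) = 0) ∧
          (Odd (C.deg i) → join n α (i : WithBot C.ι) ≤ 1) := h (i : WithBot C.ι)
      rwa [join_coe] at this
  · rintro ⟨h, h'⟩ i
    refine WithBot.recBotCoe (C := fun i => (C.withOdd.deg i = 0 → join n α i = 0) ∧
      (Odd (C.withOdd.deg i) → join n α i ≤ 1)) ⟨fun h0 => ?_, fun _ => ?_⟩ (fun i => ?_) i
    · rw [withOdd_deg_bot] at h0
      omega
    · rwa [join_bot]
    · rw [join_coe]
      exact h' i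

theorem totalDeg_join (n : ℕ) (α : C.ι →₀ ℕ) :
    C.withOdd.totalDeg (join n α) = C.totalDeg α - n := by
  have h1 : C.withOdd.totalDeg (Finsupp.single (⊥ : WithBot C.ι) n : WithBot C.ι →₀ ℕ) = -n := by
    refine (Finsupp.sum_single_index (by simp)).trans ?_
    rw [withOdd_deg_bot]
    ring
  have h2 : C.withOdd.totalDeg (α.mapDomain ((↑) : C.ι → WithBot C.ι)) = C.totalDeg α :=
    Finsupp.sum_mapDomain_index_inj WithBot.coe_injective
  rw [join, totalDeg_add, h1, h2]
  ring

theorem crossings_join_zero (n : ℕ) (α β : C.ι →₀ ℕ) :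
    C.withOdd.crossings (join n α) (join 0 β) = C.crossings α β := by
  have h0 : (join 0 β : WithBot C.ι →₀ ℕ) = β.mapDomain ((↑) : C.ι → WithBot C.ι) := by
    simp [join]
  have h1 : ∀ γ, C.withOdd.crossings (Finsupp.single (⊥ : WithBot C.ι) n : WithBot C.ι →₀ ℕ) γ = 0 :=
    fun γ => by
      refine (Finsupp.sum_single_index (by simp)).trans ?_
      refine Finset.sum_eq_zero fun j _ => if_neg fun h => ?_
      exact not_lt_bot (α := WithBot C.ι) h.1
  rw [h0, join, crossings_add_left, h1, zero_add]
  refine (Finsupp.sum_mapDomain_index_inj WithBot.coe_injective).trans ?_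
  refine Finsupp.sum_congr fun i _ => ?_
  refine (Finsupp.sum_mapDomain_index_inj WithBot.coe_injective).trans ?_
  refine Finsupp.sum_congr fun j _ => ?_
  have : (j : WithBot C.ι) < (i : WithBot C.ι) ↔ j < i := WithBot.coe_lt_coe
  exact if_congr (and_congr this Iff.rfl) rfl rfl

theorem neg_one_pow_crossings_join_one {α β : C.ι →₀ ℕ} (h : C.Admissible α) :
    (-1 : ℝ) ^ C.withOdd.crossings (join 0 α) (join 1 β) =
      (C.totalDeg α).negOnePow • (-1 : ℝ) ^ C.crossings α β := by
  have e : (join 1 β : WithBot C.ι →₀ ℕ) = join 1 0 + join 0 β := by rw [← join_add]; simp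
  have h1 : C.withOdd.crossings (join 1 0) (join 0 α) = 0 := by
    rw [crossings_join_zero]
    exact Finsupp.sum_zero_index
  have h2 : C.withOdd.Admissible (join 0 α + join 1 0) := by
    rw [← join_add, admissible_join]
    simpa using h
  rw [e, crossings_add_right, pow_add, neg_one_pow_crossings_swap h2, h1, crossings_join_zero,
    totalDeg_join, totalDeg_join, pow_zero, smul_mul_assoc, _root_.one_mul]
  congr 1
  refine negOnePow_congr ⟨-C.totalDeg α, ?_⟩
  have : C.totalDeg 0 = 0 := Finsupp.sum_zero_index
  rw [this]
  push_cast
  ring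

end GradedCoords

namespace GradedCoords

open GradedSpace

variable {C : GradedCoords}

/-- The coordinates of degree zero of `C.withOdd`. -/
def withOddZero : {i : WithBot C.ι // C.withOdd.deg i = 0} ≃ {i : C.ι // C.deg i = 0} where
  toFun i := match i with
    | ⟨⊥, h⟩ => absurd h (by simp)
    | ⟨(i : C.ι), h⟩ => ⟨i, h⟩
  invFun i := ⟨(i.1 : WithBot C.ι), i.2⟩
  left_inv i := match i with
    | ⟨⊥, h⟩ => absurd h (by simp)
    | ⟨(i : C.ι), h⟩ => rfl
  right_inv i := rfl

/-- The points of `C.withOdd`. -/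
noncomputable def withOddHomeo : C.Body ≃ₜ C.withOdd.Body where
  toFun y i := y (withOddZero i)
  invFun z i := z (withOddZero.symm i)
  left_inv y := funext fun i => congrArg y (withOddZero.apply_symm_apply i)
  right_inv z := funext fun i => congrArg z (withOddZero.symm_apply_apply i)

theorem isFunction_join {U : Opens C.withOdd.Body} {k : ℤ} {f : (WithBot C.ι →₀ ℕ) → U → ℝ}
    (hf : C.withOdd.IsFunction U k f) {U' : Opens C.Body} (hU' : ∀ y ∈ U', withOddHomeo y ∈ U)
    (n : ℕ) {l : ℤ} (hl : k + n = l) :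
    C.IsFunction U' l fun α y => f (join n α) ⟨withOddHomeo y.1, hU' y.1 y.2⟩ := by
  classical
  refine ⟨fun α hα => ?_, fun x => ?_⟩
  · have h := hf.1 (join n α) fun h0 => hα (funext fun y => congrFun h0 _)
    refine ⟨(admissible_join.1 h.1).2, ?_⟩
    have := h.2
    rw [totalDeg_join] at this
    omega
  · obtain ⟨J, K, V, hV, h1, h2⟩ := hf.2 ⟨withOddHomeo x.1, hU' x.1 x.2⟩
    have hc : Continuous fun y : U' => (⟨withOddHomeo y.1, hU' y.1 y.2⟩ : U) :=
      (withOddHomeo.continuous.comp continuous_subtype_val).subtype_mk _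
    refine ⟨J.image withOddZero, K.preimage _ WithBot.coe_injective.injOn, _,
      hc.continuousAt.preimage_mem_nhds hV, fun α hα y hy => h1 _ (fun hs => hα fun i hi => ?_) _ hy,
      fun α => ?_⟩
    · rw [Finset.mem_preimage]
      refine hs (Finsupp.mem_support_iff.2 ?_)
      rw [join_coe]
      exact Finsupp.mem_support_iff.1 hi
    · obtain ⟨g, hg, hg'⟩ := h2 (join n α)
      refine ⟨fun z => g fun j => z ⟨withOddZero j.1, Finset.mem_image_of_mem _ j.2⟩,
        hg.comp (contDiff_pi.2 fun j => contDiff_apply ℝ ℝ _), fun y hy => hg' _ hy⟩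

theorem isFunction_rest {U : Opens C.withOdd.Body} {k : ℤ} {U' : Opens C.Body}
    (hU' : ∀ z ∈ U, withOddHomeo.symm z ∈ U') {f : ℕ → (C.ι →₀ ℕ) → U' → ℝ}
    (hf : ∀ n, C.IsFunction U' (k + (n : ℕ)) (f n)) (hf' : ∀ n, 1 < n → f n = 0) :
    C.withOdd.IsFunction U k fun β z =>
      f (β (⊥ : WithBot C.ι)) (rest β) ⟨withOddHomeo.symm z.1, hU' z.1 z.2⟩ := by
  classical
  refine ⟨fun β hβ => ?_, fun x => ?_⟩
  · have h0 : f (β (⊥ : WithBot C.ι)) (rest β) ≠ 0 := fun h0 => hβ (funext fun z => congrFun h0 _)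
    have h := (hf _).1 _ h0
    have h1 : β (⊥ : WithBot C.ι) ≤ 1 := by
      by_contra h1
      exact h0 (by rw [hf' _ (not_le.1 h1)]; rfl)
    rw [← join_rest β, admissible_join, totalDeg_join]
    exact ⟨⟨h1, h.1⟩, by have := h.2; omega⟩
  · have hc : Continuous fun z : U => (⟨withOddHomeo.symm z.1, hU' z.1 z.2⟩ : U') :=
      (withOddHomeo.symm.continuous.comp continuous_subtype_val).subtype_mk _
    obtain ⟨J, K, V, hV, h1, h2⟩ := (hf 0).2 ⟨withOddHomeo.symm x.1, hU' x.1 x.2⟩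
    obtain ⟨J', K', V', hV', h1', h2'⟩ := (hf 1).2 ⟨withOddHomeo.symm x.1, hU' x.1 x.2⟩
    refine ⟨(J ∪ J').image withOddZero.symm, insert ⊥ ((K ∪ K').image (↑)), _,
      hc.continuousAt.preimage_mem_nhds (Filter.inter_mem hV hV'), fun β hβ y hy => ?_, fun β => ?_⟩
    · have key : ∀ L : Finset C.ι, L ⊆ K ∪ K' → ¬ (rest β).support ⊆ L := fun L hL hs => hβ (by
        intro i hi
        induction i using WithBot.recBotCoe with
        | bot => exact Finset.mem_insert_self _ _
        | coe i =>
          refine Finset.mem_insert_of_mem (Finset.mem_image_of_mem _ (hL (hs ?_)))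
          exact Finsupp.mem_support_iff.2 (show β (i : WithBot C.ι) ≠ 0 from Finsupp.mem_support_iff.1 hi))
      change f (β (⊥ : WithBot C.ι)) (rest β) _ = 0
      match β (⊥ : WithBot C.ι) with
      | 0 => exact h1 _ (key K Finset.subset_union_left) _ hy.1
      | 1 => exact h1' _ (key K' Finset.subset_union_right) _ hy.2
      | n + 2 => rw [hf' (n + 2) (by omega)]; rfl
    · have key : ∃ g : (↥(J ∪ J') → ℝ) → ℝ, ContDiff ℝ ∞ g ∧ ∀ y ∈ V ∩ V',
          f (β (⊥ : WithBot C.ι)) (rest β) y = g fun j => y.1 j := by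
        match β (⊥ : WithBot C.ι) with
        | 0 => exact smooth_mono (V := V ∩ V') Finset.subset_union_left
                ((h2 (rest β)).imp fun g hg => ⟨hg.1, fun y hy => hg.2 y hy.1⟩)
        | 1 => exact smooth_mono (V := V ∩ V') Finset.subset_union_right
                ((h2' (rest β)).imp fun g hg => ⟨hg.1, fun y hy => hg.2 y hy.2⟩)
        | n + 2 => exact ⟨0, contDiff_const, fun y _ => by rw [hf' (n + 2) (by omega)]; rfl⟩
      obtain ⟨g, hg, hg'⟩ := key
      refine ⟨fun z => g fun j => z ⟨withOddZero.symm j.1, Finset.mem_image_of_mem _ j.2⟩,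
        hg.comp (contDiff_pi.2 fun j => contDiff_apply ℝ ℝ _), fun y hy => hg' _ hy⟩

theorem mulSeries_join_zero {Y Y' : Type} (φ : Y' → Y) (f g : (WithBot C.ι →₀ ℕ) → Y → ℝ)
    (γ : C.ι →₀ ℕ) (y : Y') : C.withOdd.mulSeries f g (join 0 γ) (φ y) =
      C.mulSeries (fun α y => f (join 0 α) (φ y)) (fun α y => g (join 0 α) (φ y)) γ y := by
  classical
  simp only [mulSeries, admissible_join]
  by_cases h : C.Admissible γ
  · rw [if_pos ⟨Nat.zero_le 1, h⟩, if_pos h]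
    have key := sum_antidiagonal_join 0 γ fun p =>
      (-1 : ℝ) ^ C.withOdd.crossings p.1 p.2 * (f p.1 (φ y) * g p.2 (φ y))
    have hanti : Finset.HasAntidiagonal.antidiagonal 0 = {((0 : ℕ), 0)} := rfl
    simp only [hanti, Finset.sum_singleton, crossings_join_zero] at key
    convert key
  · rw [if_neg fun h' => h h'.2, if_neg h]

theorem mulSeries_join_one {Y Y' : Type} (φ : Y' → Y) {i : ℤ} (f g : (WithBot C.ι →₀ ℕ) → Y → ℝ)
    (hf : ∀ α, f (join 0 α) ≠ 0 → C.totalDeg α = i) (γ : C.ι →₀ ℕ) (y : Y') :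
    C.withOdd.mulSeries f g (join 1 γ) (φ y) =
      C.mulSeries (fun α y => f (join 1 α) (φ y)) (fun α y => g (join 0 α) (φ y)) γ y +
      i.negOnePow • C.mulSeries (fun α y => f (join 0 α) (φ y)) (fun α y => g (join 1 α) (φ y)) γ y := by
  classical
  simp only [mulSeries, admissible_join]
  by_cases h : C.Admissible γ
  · rw [if_pos ⟨le_rfl, h⟩, if_pos h, if_pos h]
    have key := sum_antidiagonal_join 1 γ fun p =>
      (-1 : ℝ) ^ C.withOdd.crossings p.1 p.2 * (f p.1 (φ y) * g p.2 (φ y))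
    have hanti : Finset.HasAntidiagonal.antidiagonal 1 = {((0 : ℕ), 1), (1, 0)} := rfl
    simp only [hanti] at key
    rw [Finset.smul_sum, ← Finset.sum_add_distrib]
    refine Eq.trans (by convert key) (Finset.sum_congr rfl fun q hq => ?_)
    rw [Finset.HasAntidiagonal.mem_antidiagonal] at hq
    rw [Finset.sum_pair (by simp), crossings_join_zero, add_comm]
    congr 1
    by_cases h0 : f (join 0 q.1) = 0
    · simp [h0]
    · rw [neg_one_pow_crossings_join_one (hq ▸ h).left, hf _ h0, smul_mul_assoc]
  · rw [if_neg fun h' => h h'.2, if_neg h, if_neg h, smul_zero, add_zero]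

theorem join_eq_zero {n : ℕ} {α : C.ι →₀ ℕ} : (join n α : WithBot C.ι →₀ ℕ) = 0 ↔ n = 0 ∧ α = 0 := by
  constructor
  · intro h
    refine ⟨by rw [← join_bot n α, h]; rfl, ?_⟩
    rw [← rest_join n α, h]
    exact Finsupp.ext fun _ => rfl
  · rintro ⟨rfl, rfl⟩
    simp [join]

/-- The dual numbers over the space of the coordinates `C`. -/
noncomputable def dualToWithOdd : C.toGradedSpace.dual ⟶ C.withOdd.toGradedSpace :=
  Hom.mk (M := C.toGradedSpace.dual) (N := C.withOdd.toGradedSpace)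
    (base := ⟨withOddHomeo, withOddHomeo.continuous⟩)
    (pull := fun {U V} h {k} =>
      { toFun := fun f =>
          ((⟨_, isFunction_join (U' := V) (show C.withOdd.functions U k from f).2
              (fun y hy => h hy) 0 (add_zero k)⟩ : C.functions V k),
          (⟨_, isFunction_join (U' := V) (show C.withOdd.functions U k from f).2
              (fun y hy => h hy) 1 rfl⟩ : C.functions V (k + 1)))
        map_add' := fun _ _ => rfl
        map_smul' := fun _ _ => rfl })
    (pull_one := fun {U V} h => Prod.ext
      (Subtype.ext <| funext fun α => funext fun y =>
        if_congr (join_eq_zero.trans (and_iff_right rfl)) rfl rfl)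
      (Subtype.ext <| funext fun α => funext fun y =>
        if_neg fun h => absurd (join_eq_zero.1 h).1 one_ne_zero))
    (pull_mul := fun {U V} h i j k hk a b => Prod.ext
      (Subtype.ext <| funext fun α => funext fun y =>
        mulSeries_join_zero (fun y : V => (⟨withOddHomeo y.1, h y.2⟩ : U)) _ _ α y)
      (Subtype.ext <| funext fun α => funext fun y =>
        mulSeries_join_one (i := i) (fun y : V => (⟨withOddHomeo y.1, h y.2⟩ : U)) _ _
          (fun α hα => by
            have := ((show C.withOdd.functions U i from a).2.1 _ hα).2
            rwa [totalDeg_join, Nat.cast_zero, sub_zero] at this) α y))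
    (res_pull := fun _ _ _ _ => rfl)
    (pull_res := fun _ _ _ _ => rfl)

theorem dualToWithOdd_bijective (U : Opens C.withOdd.toGradedSpace) (k : ℤ) :
    Function.Bijective ((dualToWithOdd (C := C)).pull
      (le_refl (Opens.comap (dualToWithOdd (C := C)).base U)) (k := k)) := by
  constructor
  · intro f g hfg
    have h0 := congrArg Prod.fst hfg
    have h1 := congrArg Prod.snd hfg
    refine Subtype.ext <| funext fun β => funext fun z => ?_
    have hz : withOddHomeo (withOddHomeo.symm z.1) ∈ U := by
      rw [Homeomorph.apply_symm_apply]
      exact z.2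
    have hzz : (⟨withOddHomeo (withOddHomeo.symm z.1), hz⟩ : U) = z :=
      Subtype.ext (withOddHomeo.apply_symm_apply _)
    have key : ∀ n α, (show C.withOdd.functions U k from f).1 (join n α)
        ⟨withOddHomeo (withOddHomeo.symm z.1), hz⟩ =
        (show C.withOdd.functions U k from g).1 (join n α)
        ⟨withOddHomeo (withOddHomeo.symm z.1), hz⟩ := by
      intro n α
      match n with
      | 0 => exact congrFun (congrFun (congrArg Subtype.val h0) α) ⟨withOddHomeo.symm z.1, hz⟩
      | 1 => exact congrFun (congrFun (congrArg Subtype.val h1) α) ⟨withOddHomeo.symm z.1, hz⟩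
      | n + 2 =>
        have h : ¬ C.withOdd.Admissible (join (n + 2) α) := fun h => by
          have := (admissible_join.1 h).1
          omega
        have h' : ∀ a : C.withOdd.functions U k, a.1 (join (n + 2) α) = 0 := fun a => by
          by_contra h0
          exact h (a.2.1 _ h0).1
        rw [h', h']
    have := key (β (⊥ : WithBot C.ι)) (rest β)
    rw [join_rest] at this
    exact (congrArg ((show C.withOdd.functions U k from f).1 β) hzz).symm.trans
      (this.trans (congrArg ((show C.withOdd.functions U k from g).1 β) hzz))
  · rintro ⟨f₀, f₁⟩
    let U' : Opens C.Body := Opens.comap (dualToWithOdd (C := C)).base U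
    let f : ℕ → (C.ι →₀ ℕ) → U' → ℝ := fun n => match n with
      | 0 => (show C.functions U' k from f₀).1
      | 1 => (show C.functions U' (k + 1) from f₁).1
      | _ => 0
    have hU' : ∀ z ∈ U, withOddHomeo.symm z ∈ U' := fun z hz => by
      exact (congrArg (· ∈ U) (withOddHomeo.apply_symm_apply z)).mpr hz
    have hf : ∀ n : ℕ, C.IsFunction U' (k + n) (f n) := fun n => match n with
      | 0 => (congrArg (fun l => C.IsFunction U' l _) (add_zero k)).mpr
          (show C.functions U' k from f₀).2
      | 1 => (show C.functions U' (k + 1) from f₁).2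
      | n + 2 => IsFunction.zero _ _
    have hf' : ∀ n, 1 < n → f n = 0 := fun n hn => match n with
      | n + 2 => rfl
    have key : ∀ n α (y : U'), f ((join n α) (⊥ : WithBot C.ι)) (rest (join n α))
        ⟨withOddHomeo.symm (withOddHomeo y.1), hU' _ y.2⟩ = f n α y := fun n α y => by
      have : (⟨withOddHomeo.symm (withOddHomeo y.1), hU' _ y.2⟩ : U') = y :=
        Subtype.ext (withOddHomeo.symm_apply_apply _)
      rw [this, join_bot, rest_join]
    exact ⟨(⟨_, isFunction_rest hU' hf hf'⟩ : C.withOdd.functions U k), Prod.ext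
      (Subtype.ext <| funext fun α => funext fun y => key 0 α y)
      (Subtype.ext <| funext fun α => funext fun y => key 1 α y)⟩

variable (C) in
/-- The dual numbers over a coordinate space are a coordinate space. -/
noncomputable def dualIsoWithOdd : C.toGradedSpace.dual ≅ C.withOdd.toGradedSpace :=
  isoOfBijective dualToWithOdd withOddHomeo (fun _ => rfl) dualToWithOdd_bijective

end GradedCoords

theorem IsGradedManifold.dual {M : GradedSpace} (hM : IsGradedManifold M) :
    IsGradedManifold M.dual := by
  refine ⟨hM.1, hM.2.1, fun x => ?_⟩
  obtain ⟨U, hx, C, W, ⟨e⟩⟩ := hM.2.2 x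
  let i := C.dualIsoWithOdd
  let W' : Opens C.withOdd.toGradedSpace := Opens.comap i.inv.base W
  have h : Opens.comap i.hom.base W' = W := Opens.ext <| Set.ext fun y =>
    iff_of_eq (congrArg (· ∈ W)
      (congrArg (fun f : C.toGradedSpace.dual ⟶ C.toGradedSpace.dual => f.base y) i.hom_inv_id))
  exact ⟨U, hx, C.withOdd, W', ⟨GradedSpace.dualIso e ≪≫
    eqToIso (congrArg (C.toGradedSpace.dual.restrict) h.symm) ≪≫ GradedSpace.restrictIso i W'⟩⟩

namespace GradedSpace

variable {M N : GradedSpace}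

/-- The morphism that sets `ε = 0`. -/
def inclDual (N : GradedSpace) : N ⟶ N.dual :=
  Hom.mk (M := N) (N := N.dual) (base := ContinuousMap.id N)
    (pull := fun {U V} h {k} => (N.res (U := U) (V := V) h (k := k)).comp (LinearMap.fst ℝ _ _))
    (pull_one := fun h => N.res_one h)
    (pull_mul := fun h _ _ _ hk a b => N.res_mul h hk a.1 b.1)
    (res_pull := fun h h' _ a => N.res_res h h' a.1)
    (pull_res := fun h h' _ a => N.res_res h' h a.1)

/-- The effect of `ε ↦ ε + ε'` on sections. -/
def codiagPull {U V : Opens N} (h : V ≤ U) {k : ℤ} : N.dual.sec U k →ₗ[ℝ] N.dual.dual.sec V k where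
  toFun a := ((N.res h a.1, N.res h a.2), (N.res h a.2, 0))
  map_add' a b := by
    simp only [Prod.fst_add, Prod.snd_add, map_add, Prod.mk_add_mk, add_zero]
  map_smul' c a := by
    simp only [Prod.smul_fst, Prod.smul_snd, map_smul, Prod.smul_mk, smul_zero, RingHom.id_apply]

theorem codiagPull_one {U V : Opens N} (h : V ≤ U) :
    codiagPull h (N.dual.one U) = N.dual.dual.one V := by
  have h0 : N.res h (0 : N.sec U (0 + 1)) = 0 := map_zero _
  exact Prod.ext (Prod.ext (N.res_one h) h0) (Prod.ext h0 rfl)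

theorem codiagPull_mul {U V : Opens N} (h : V ≤ U) {i j k : ℤ} (hk : i + j = k)
    (a : N.dual.sec U i) (b : N.dual.sec U j) :
    codiagPull h (N.dual.mul hk a b) = N.dual.dual.mul hk (codiagPull h a) (codiagPull h b) := by
  have e : ∀ {l : ℤ} (hl : i + 1 + (j + 1) = l), (0 : N.sec V l) =
      (i + 1).negOnePow • N.mul hl (N.res h a.2) (N.res h b.2) +
        i.negOnePow • N.mul hl (N.res h a.2) (N.res h b.2) := fun hl => by
    rw [Int.negOnePow_succ, Units.neg_smul, neg_add_cancel]
  have e1 := (N.dual.res_mul h hk a b)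
  refine Prod.ext e1 (Prod.ext (congrArg Prod.snd e1) ?_)
  refine (e (show i + 1 + (j + 1) = k + 1 + 1 by omega)).trans (congrArg₂ (· + ·) ?_ ?_)
  · exact (zero_add _).symm.trans (congrArg₂ (· + ·) (LinearMap.map_zero₂ _ _).symm rfl)
  · exact congrArg _ ((add_zero _).symm.trans (congrArg₂ (· + ·) rfl
      ((congrArg _ (map_zero _)).trans (smul_zero _)).symm))

/-- The morphism that sends `ε` to the sum of the two odd constants. -/
def codiag (N : GradedSpace) : N.dual.dual ⟶ N.dual :=
  Hom.mk (M := N.dual.dual) (N := N.dual) (base := ContinuousMap.id N)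
    (pull := fun {U V} h => codiagPull (N := N) (U := U) (V := V) h)
    (pull_one := fun h => codiagPull_one (N := N) h)
    (pull_mul := fun h _ _ _ hk a b => codiagPull_mul (N := N) h hk a b)
    (res_pull := fun {U V V'} h h' k a => by
      refine Prod.ext (Prod.ext (N.res_res _ _ _) (N.res_res _ _ _))
        (Prod.ext (N.res_res _ _ _) (map_zero (N.res (U := V) (V := V') h' (k := k + 1 + 1)))))
    (pull_res := fun h h' k a => by
      refine Prod.ext (Prod.ext (N.res_res _ _ _) (N.res_res _ _ _))
        (Prod.ext (N.res_res _ _ _) rfl))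

theorem dualMap_comp {P : GradedSpace} (f : M ⟶ N) (g : N ⟶ P) :
    dualMap (f ≫ g) = dualMap f ≫ dualMap g := rfl

theorem inclDual_dualMap (f : M ⟶ N) : inclDual M ≫ dualMap f = f ≫ inclDual N :=
  hom_ext (fun _ => rfl) fun U V h _ k a => by
    rw [comp_pull (inclDual M) (dualMap f) h (W := Opens.comap f.base U) h le_rfl,
      comp_pull f (inclDual N) h (W := U) h le_rfl]
    refine (f.res_pull _ _ _).trans ?_
    exact (congrArg (f.pull h) (N.res_self _ _)).symm

theorem codiag_dualMap (f : M ⟶ N) :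
    codiag M ≫ dualMap f = dualMap (dualMap f) ≫ codiag N :=
  hom_ext (fun _ => rfl) fun U V h _ k a => by
    rw [comp_pull (codiag M) (dualMap f) h (W := Opens.comap f.base U) h le_rfl,
      comp_pull (dualMap (dualMap f)) (codiag N) h (W := U) h le_rfl]
    have e : ∀ {l : ℤ} (b : N.sec U l), M.res h (f.pull (le_refl (Opens.comap f.base U)) b) =
      f.pull h (N.res (le_refl U) b) := fun b =>
        (f.res_pull _ _ _).trans (congrArg (f.pull h) (N.res_self _ _)).symm
    exact Prod.ext (Prod.ext (e _) (e _)) (Prod.ext (e _) (map_zero (f.pull h)).symm)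

end GradedSpace

namespace QSpace

open GradedSpace

/-- The morphism `a ↦ a + ε Q a`. -/
def flow (E : QSpace) : E.toGradedSpace.dual ⟶ E.toGradedSpace :=
  Hom.mk (M := E.toGradedSpace.dual) (N := E.toGradedSpace) (base := ContinuousMap.id E.carrier)
    (pull := fun {U V} h {k} => (E.res (U := U) (V := V) h (k := k)).prod
      ((E.Q rfl).comp (E.res (U := U) (V := V) h (k := k))))
    (pull_one := fun {U V} h => by
      have h1 : E.Q (rfl : (0 : ℤ) + 1 = 1) (E.one V) = 0 := by
        have := E.Q_mul (rfl : (0 : ℤ) + 1 = 1) (rfl : (0 : ℤ) + 1 = 1) (rfl : (0 : ℤ) + 1 = 1)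
          (zero_add 0) (add_zero 1) (zero_add 1) (E.one V) (E.one V)
        rw [E.one_mul, Int.negOnePow_zero, one_smul, E.one_mul] at this
        have h2 := E.mul_comm (add_zero 1) (zero_add 1) (E.Q (rfl : (0 : ℤ) + 1 = 1) (E.one V))
          (E.one V)
        rw [h2, E.one_mul, mul_zero, Int.negOnePow_zero, one_smul] at this
        simpa using this
      refine Prod.ext (E.res_one h) ?_
      exact (congrArg (E.Q rfl) (E.res_one h)).trans h1)
    (pull_mul := fun {U V} h i j k hk a b => Prod.ext (E.res_mul h hk a b) (by
      refine (congrArg (E.Q rfl) (E.res_mul h hk a b)).trans ?_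
      exact E.Q_mul rfl rfl rfl hk _ _ _ _))
    (res_pull := fun h h' _ a => Prod.ext (E.res_res _ _ _)
      ((E.Q_res h' rfl _).symm.trans (congrArg (E.Q rfl) (E.res_res _ _ _))))
    (pull_res := fun h h' _ a => Prod.ext (E.res_res _ _ _)
      (congrArg (E.Q rfl) (E.res_res _ _ _)))

theorem inclDual_flow (E : QSpace) : inclDual E.toGradedSpace ≫ E.flow = 𝟙 _ :=
  hom_ext (fun _ => rfl) fun U V h _ k a => by
    rw [comp_pull (inclDual E.toGradedSpace) E.flow h (W := U) h le_rfl]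
    exact E.res_res _ _ _

theorem dualMap_flow (E : QSpace) :
    dualMap E.flow ≫ E.flow = codiag E.toGradedSpace ≫ E.flow :=
  hom_ext (fun _ => rfl) fun U V h _ k a => by
    rw [comp_pull (dualMap E.flow) E.flow h (W := U) h le_rfl,
      comp_pull (codiag E.toGradedSpace) E.flow h (W := U) h le_rfl]
    refine Prod.ext (Prod.ext rfl ?_) (Prod.ext rfl ?_)
    · exact E.Q_res _ _ _
    · exact (congrArg (E.Q rfl) (E.Q_res _ _ _).symm).trans (E.Q_Q rfl rfl _)

theorem isQMap_iff {M N : QSpace} (f : M.toGradedSpace ⟶ N.toGradedSpace) :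
    IsQMap f ↔ dualMap f ≫ N.flow = M.flow ≫ f := by
  have key : ∀ {U : Opens N.toGradedSpace} {V : Opens M.toGradedSpace}
      (h : V ≤ Opens.comap f.base U) {k : ℤ} (a : N.sec U k),
      (dualMap f ≫ N.flow).pull h a = (f.pull h a, f.pull h (N.Q rfl a)) ∧
      (M.flow ≫ f).pull h a = (f.pull h a, M.Q rfl (f.pull h a)) := fun {U V} h k a => by
    rw [comp_pull (dualMap f) N.flow h (W := U) h le_rfl,
      comp_pull M.flow f h (W := V) le_rfl h]
    refine ⟨Prod.ext ?_ ?_, Prod.ext (M.res_self _ _) ?_⟩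
    · exact congrArg (f.pull h) (N.res_self _ _)
    · exact congrArg (fun b => f.pull h (N.Q rfl b)) (N.res_self _ _)
    · exact congrArg (M.Q rfl) (M.res_self _ _)
  constructor
  · intro hf
    refine hom_ext (fun _ => rfl) fun U V h _ k a => ?_
    rw [(key h a).1, (key h a).2, hf h]
  · intro hf U V h k l hl a
    subst hl
    have := pull_congr hf (U := U) (V := V) h h a
    rw [(key h a).1, (key h a).2] at this
    exact (congrArg Prod.snd this).symm

/-- The homological vector field with a given flow. -/
def ofFlow (N : GradedSpace) (Φ : N.dual ⟶ N) (h₁ : inclDual N ≫ Φ = 𝟙 N)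
    (h₂ : dualMap Φ ≫ Φ = codiag N ≫ Φ) : QSpace :=
  have hb : ∀ U : Opens N, U ≤ Opens.comap Φ.base U := fun U x hx =>
    (congrArg (· ∈ U) (congrArg (fun f : N ⟶ N => f.base x) h₁)).mpr hx
  have h0 : ∀ {U : Opens N} {k : ℤ} (a : N.sec U k), (Φ.pull (hb U) a).1 = a := fun {U k} a => by
    have := pull_congr h₁ (hb U) le_rfl a
    rw [comp_pull (inclDual N) Φ (hb U) (W := U) le_rfl (hb U)] at this
    exact (N.res_self _ _).symm.trans (this.trans (N.res_self _ _))
  { toGradedSpace := N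
    Q := fun {U k l} hl => hl ▸ (LinearMap.snd ℝ (N.sec U k) (N.sec U (k + 1))).comp (Φ.pull (hb U))
    Q_mul := fun {U i j k i' j' k'} hi hj hk h h₁ h₂ a b => by
      subst hi hj hk
      have := congrArg Prod.snd (Φ.pull_mul (hb U) h a b)
      refine this.trans ?_
      change N.mul _ (Φ.pull (hb U) a).2 (Φ.pull (hb U) b).1 +
        i.negOnePow • N.mul _ (Φ.pull (hb U) a).1 (Φ.pull (hb U) b).2 = _
      rw [h0, h0]
      rfl
    Q_Q := fun {U k l m} hl hm a => by
      subst hl hm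
      have := (comp_pull (dualMap Φ) Φ (fun x hx => hb U (hb U hx)) (W := U) (hb U) (hb U) a).symm.trans
        ((pull_congr h₂ (U := U) (V := U) (fun x hx => hb U (hb U hx)) (hb U) a).trans
          (comp_pull (codiag N) Φ _ (W := U) le_rfl (hb U) a))
      exact congrArg (fun z => z.2.2) this
    Q_res := fun {U V} h k l hl a => by
      subst hl
      have e1 := Φ.pull_res (hb V) h a
      have e2 := Φ.res_pull (hb U) h a
      exact congrArg Prod.snd (e1.trans e2.symm) }

theorem flow_ofFlow {N : GradedSpace} (Φ : N.dual ⟶ N) (h₁ : inclDual N ≫ Φ = 𝟙 N)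
    (h₂ : dualMap Φ ≫ Φ = codiag N ≫ Φ) : (ofFlow N Φ h₁ h₂).flow = Φ := by
  have hbase : ∀ x : N, Φ.base x = x := fun x => congrArg (fun f : N ⟶ N => f.base x) h₁
  refine hom_ext (fun x => (hbase x).symm) fun U V h h' k a => ?_
  have hb : ∀ U : Opens N, U ≤ Opens.comap Φ.base U := fun U x hx =>
    (congrArg (· ∈ U) (hbase x)).mpr hx
  have h0 : (Φ.pull (hb V) (N.res h a)).1 = N.res h a := by
    have := pull_congr h₁ (hb V) le_rfl (N.res h a)
    rw [comp_pull (inclDual N) Φ (hb V) (W := V) le_rfl (hb V)] at this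
    exact (N.res_self _ _).symm.trans (this.trans (N.res_self _ _))
  have h1 : (ofFlow N Φ h₁ h₂).flow.pull h a = Φ.pull (hb V) (N.res h a) := Prod.ext h0.symm rfl
  exact h1.trans (Φ.pull_res (hb V) h a)

end QSpace

namespace GradedSpace

variable {M N P : GradedSpace}

/-- The pull-back of sections over an open set that contains the image. -/
def pullOn (f : M ⟶ N) {U : Opens N} (hU : ∀ x, f.base x ∈ U) {k : ℤ} :
    N.sec U k →ₗ[ℝ] M.sec ⊤ k := f.pull (fun x _ => hU x : ⊤ ≤ Opens.comap f.base U)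

theorem pullOn_comp (f : M ⟶ N) (g : N ⟶ P) {U : Opens P} (hU : ∀ x, (f ≫ g).base x ∈ U) {k : ℤ}
    (a : P.sec U k) : pullOn (f ≫ g) hU a =
      pullOn f (U := Opens.comap g.base U) hU (g.pull (le_refl (Opens.comap g.base U)) a) :=
  comp_pull _ _ _ _ _ _

theorem pullOn_comp' (f : M ⟶ N) (g : N ⟶ P) {U : Opens P} (hU : ∀ x, (f ≫ g).base x ∈ U)
    (hU' : ∀ x, g.base x ∈ U) {k : ℤ} (a : P.sec U k) :
    pullOn (f ≫ g) hU a = gpull f (pullOn g hU' a) :=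
  comp_pull _ _ _ _ _ _

theorem pullOn_congr {f g : M ⟶ N} (h : f = g) {U : Opens N} (hU : ∀ x, f.base x ∈ U)
    (hU' : ∀ x, g.base x ∈ U) {k : ℤ} (a : N.sec U k) : pullOn f hU a = pullOn g hU' a :=
  pull_congr h _ _ a

theorem pullOn_res (f : M ⟶ N) {U V : Opens N} (hU : ∀ x, f.base x ∈ U) (hV : ∀ x, f.base x ∈ V)
    (h : U ≤ V) {k : ℤ} (a : N.sec V k) : pullOn f hU (N.res h a) = pullOn f hV a :=
  f.pull_res _ h a

theorem pullOn_mul (f : M ⟶ N) {U : Opens N} (hU : ∀ x, f.base x ∈ U) {i j k : ℤ} (h : i + j = k)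
    (a : N.sec U i) (b : N.sec U j) :
    pullOn f hU (N.mul h a b) = M.mul h (pullOn f hU a) (pullOn f hU b) :=
  f.pull_mul _ h a b

theorem pullOn_incl {V : Opens M} (h : ∀ x, (incl M V).base x ∈ V) {k : ℤ} (a : (M.restrict V).sec ⊤ k) :
    pullOn (incl M V) h (M.res (fun x hx => ⟨⟨x, hx⟩, trivial, rfl⟩ : V ≤ openImage V ⊤) a) = a :=
  exists_incl_pull a

theorem homeo_iso_isGradedManifold (e : M ≅ N) (hN : IsGradedManifold N) : IsGradedManifold M := by
  have h1 := hN.1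
  have h2 := hN.2.1
  refine ⟨(homeoOfIso e).isEmbedding.t3Space, (homeoOfIso e).isEmbedding.secondCountableTopology,
    fun x => ?_⟩
  obtain ⟨U, hxU, C, W, ⟨c⟩⟩ := hN.2.2 (e.hom.base x)
  exact ⟨Opens.comap e.hom.base U, hxU, C, W, ⟨restrictIso e U ≪≫ c⟩⟩

theorem gpull_dualMap (f : M ⟶ N) {k : ℤ} (a : N.dual.sec ⊤ k) :
    gpull (dualMap f) a = ((gpull f a.1, gpull f a.2) : M.dual.sec ⊤ k) := rfl

theorem gpull_inclDual {k : ℤ} (a : N.dual.sec ⊤ k) : gpull (inclDual N) a = a.1 := N.res_self _ _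

theorem gpull_codiag {k : ℤ} (a : N.dual.sec ⊤ k) :
    gpull (codiag N) a = (((a.1, a.2), (a.2, 0)) : N.dual.dual.sec ⊤ k) :=
  Prod.ext (Prod.ext (N.res_self _ _) (N.res_self _ _)) (Prod.ext (N.res_self _ _) rfl)

end GradedSpace

namespace GradedCoords

variable (D : GradedCoords)

/-- The coordinates `w` of `T[1]V`. -/
noncomputable def wCoord (α : D.ι) : D.shiftedTangent.toGradedSpace.sec ⊤ (D.deg α) :=
  D.shiftedTangent.coord (Sum.inlₗ α) ⊤

/-- The coordinates `v` of `T[1]V`. -/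
noncomputable def vCoord (α : D.ι) : D.shiftedTangent.toGradedSpace.sec ⊤ (D.deg α + 1) :=
  D.shiftedTangent.coord (Sum.inrₗ α) ⊤

end GradedCoords

namespace QSpace

open GradedSpace

theorem gpull_flow (E : QSpace) {k : ℤ} (a : E.sec ⊤ k) :
    gpull E.flow a = ((a, E.Q rfl a) : E.toGradedSpace.dual.sec ⊤ k) :=
  Prod.ext (E.res_self _ _) (congrArg (E.Q rfl) (E.res_self _ _))

section Maps

variable {L M N : QSpace}

theorem isQMap_id (M : QSpace) : IsQMap (M := M) (N := M) (𝟙 M.toGradedSpace) :=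
  fun h _ _ hl a => M.Q_res h hl a

theorem IsQMap.comp {f : L.toGradedSpace ⟶ M.toGradedSpace} {g : M.toGradedSpace ⟶ N.toGradedSpace}
    (hf : IsQMap f) (hg : IsQMap g) : IsQMap (M := L) (N := N) (f ≫ g) := by
  rw [isQMap_iff] at hf hg ⊢
  rw [dualMap_comp, Category.assoc, hg, ← Category.assoc, hf, Category.assoc]

theorem isQMap_incl (M : QSpace) (U : Opens M.toGradedSpace) :
    IsQMap (M := M.restrict U) (N := M) (incl M.toGradedSpace U) :=
  fun _ _ _ hl a => M.Q_res _ hl a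

theorem IsQMap.inv {e : M.toGradedSpace ≅ N.toGradedSpace} (he : IsQMap (M := M) (N := N) e.hom) :
    IsQMap (M := N) (N := M) e.inv := by
  rw [isQMap_iff] at he ⊢
  have h1 : dualMap e.inv ≫ dualMap e.hom = 𝟙 N.toGradedSpace.dual :=
    (congrArg dualMap e.inv_hom_id).trans rfl
  rw [← cancel_mono e.hom, Category.assoc, Category.assoc, e.inv_hom_id, Category.comp_id, ← he,
    ← Category.assoc, h1, Category.id_comp]

/-- Being a `Q`-map is local on the source. -/
theorem isQMap_of_local {I : Type} {V : I → Opens M.toGradedSpace} (hV : ∀ x, ∃ i, x ∈ V i)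
    {f : M.toGradedSpace ⟶ N.toGradedSpace}
    (h : ∀ i, IsQMap (M := M.restrict (V i)) (N := N) (incl M.toGradedSpace (V i) ≫ f)) :
    IsQMap f := by
  rw [isQMap_iff]
  refine hom_ext_local (M := M.toGradedSpace.dual) hV fun i => ?_
  have h1 := (isQMap_iff (M := M.restrict (V i)) (N := N) _).1 (h i)
  have h2 := (isQMap_iff (M := M.restrict (V i)) (N := M) _).1 (isQMap_incl M (V i))
  refine Eq.trans h1 ?_
  exact (congrArg (· ≫ f) h2).symm

/-- A morphism into an open subspace is a `Q`-map if it is one into the whole space. -/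
theorem isQMap_of_incl {U : Opens N.toGradedSpace} {f : M.toGradedSpace ⟶ N.toGradedSpace.restrict U}
    (h : IsQMap (M := M) (N := N) (f ≫ incl N.toGradedSpace U)) :
    IsQMap (M := M) (N := N.restrict U) f := by
  rw [isQMap_iff] at h
  have h2 := (isQMap_iff (M := N.restrict U) (N := N) _).1 (isQMap_incl N U)
  refine @(isQMap_iff (M := M) (N := N.restrict U) f).2 (incl_cancel ?_)
  refine Eq.trans ?_ (h.trans (Category.assoc _ _ _).symm)
  exact congrArg (dualMap f ≫ ·) h2.symm

end Maps

/-- A morphism to a product of `Q`-manifolds is a `Q`-map if its components are. -/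
theorem isQMap_of_product {N P A B : QSpace} {p : P.toGradedSpace ⟶ A.toGradedSpace}
    {q : P.toGradedSpace ⟶ B.toGradedSpace} (hpq : IsGradedProduct p q) (hp : IsQMap p)
    (hq : IsQMap q) (hN : IsGradedManifold N.toGradedSpace)
    {h : N.toGradedSpace ⟶ P.toGradedSpace} (h1 : IsQMap (M := N) (N := A) (h ≫ p))
    (h2 : IsQMap (M := N) (N := B) (h ≫ q)) : IsQMap h := by
  rw [isQMap_iff] at *
  obtain ⟨m, -, hm⟩ := hpq _ hN.dual (N.flow ≫ h ≫ p) (N.flow ≫ h ≫ q)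
  refine (hm _ ⟨?_, ?_⟩).trans (hm _ ⟨Category.assoc _ _ _, Category.assoc _ _ _⟩).symm
  · rw [← h1, Category.assoc, ← hp]
    rfl
  · rw [← h2, Category.assoc, ← hq]
    rfl

section Tangent

variable (D : GradedCoords)

theorem exists_hom_shiftedTangent {N : GradedSpace} (hN : IsGradedManifold N)
    (φ : ∀ α, N.sec ⊤ (D.deg α)) (ψ : ∀ α, N.sec ⊤ (D.deg α + 1)) :
    ∃ f : N ⟶ D.shiftedTangent.toGradedSpace,
      (∀ α, gpull f (D.wCoord α) = φ α) ∧
      ∀ α, gpull f (D.vCoord α) = ψ α := by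
  obtain ⟨f, hf, -⟩ := hN.hasCoordHoms D.shiftedTangent fun i =>
    Sum.rec (motive := fun s => N.sec ⊤ (Sum.elim D.deg (fun α => D.deg α + 1) s)) φ ψ (ofLex i)
  exact ⟨f, fun α => hf (Sum.inlₗ α), fun α => hf (Sum.inrₗ α)⟩

variable {D} in
theorem hom_shiftedTangent_ext {N : GradedSpace} (hN : IsGradedManifold N)
    {f g : N ⟶ D.shiftedTangent.toGradedSpace}
    (h : ∀ α, gpull f (D.wCoord α) =
      gpull g (D.wCoord α))
    (h' : ∀ α, gpull f (D.vCoord α) =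
      gpull g (D.vCoord α)) : f = g :=
  coord_hom_ext hN fun i => by
    induction i using Lex.rec with | _ i => ?_
    rcases i with i | i
    · exact h i
    · exact h' i

/-- The canonical flow of `T[1]V`. -/
noncomputable def tangentFlow : D.shiftedTangent.toGradedSpace.dual ⟶ D.shiftedTangent.toGradedSpace :=
  (exists_hom_shiftedTangent D D.shiftedTangent.isGradedManifold.dual
    (fun α => (D.wCoord α, D.vCoord α))
    fun α => (D.vCoord α, 0)).choose

theorem gpull_tangentFlow_inl (α : D.ι) :
    gpull (tangentFlow D) (D.wCoord α) =
      (D.wCoord α, D.vCoord α) :=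
  (exists_hom_shiftedTangent D D.shiftedTangent.isGradedManifold.dual _ _).choose_spec.1 α

theorem gpull_tangentFlow_inr (α : D.ι) :
    gpull (tangentFlow D) (D.vCoord α) =
      (D.vCoord α, 0) :=
  (exists_hom_shiftedTangent D D.shiftedTangent.isGradedManifold.dual _ _).choose_spec.2 α

theorem inclDual_tangentFlow :
    inclDual D.shiftedTangent.toGradedSpace ≫ tangentFlow D = 𝟙 _ := by
  refine hom_shiftedTangent_ext D.shiftedTangent.isGradedManifold (fun α => ?_) fun α => ?_
  · refine (gpull_comp (inclDual _) (tangentFlow D) _).trans (Eq.trans ?_ (gpull_id _).symm)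
    rw [gpull_tangentFlow_inl, gpull_inclDual]
  · refine (gpull_comp (inclDual _) (tangentFlow D) _).trans (Eq.trans ?_ (gpull_id _).symm)
    rw [gpull_tangentFlow_inr, gpull_inclDual]

theorem dualMap_tangentFlow : dualMap (tangentFlow D) ≫ tangentFlow D =
    codiag D.shiftedTangent.toGradedSpace ≫ tangentFlow D := by
  refine hom_shiftedTangent_ext D.shiftedTangent.isGradedManifold.dual.dual
    (fun α => ?_) fun α => ?_
  · refine (gpull_comp (dualMap _) (tangentFlow D) _).trans
      (Eq.trans ?_ (gpull_comp (codiag _) (tangentFlow D) _).symm)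
    rw [gpull_tangentFlow_inl, gpull_codiag, gpull_dualMap]
    exact Prod.ext (gpull_tangentFlow_inl D α) (gpull_tangentFlow_inr D α)
  · refine (gpull_comp (dualMap _) (tangentFlow D) _).trans
      (Eq.trans ?_ (gpull_comp (codiag _) (tangentFlow D) _).symm)
    rw [gpull_tangentFlow_inr, gpull_codiag, gpull_dualMap]
    exact Prod.ext (gpull_tangentFlow_inr D α) (map_zero (gpull (tangentFlow D)))

/-- The canonical `Q`-manifold `T[1]V`. -/
noncomputable def tangent : QSpace :=
  ofFlow D.shiftedTangent.toGradedSpace (tangentFlow D) (inclDual_tangentFlow D)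
    (dualMap_tangentFlow D)

theorem flow_tangent : (tangent D).flow = tangentFlow D := flow_ofFlow _ _ _

variable {D}

/-- The `Q`-maps to `T[1]V`. -/
theorem isQMap_tangent_iff {N : QSpace} (hN : IsGradedManifold N.toGradedSpace)
    (f : N.toGradedSpace ⟶ D.shiftedTangent.toGradedSpace) :
    IsQMap (M := N) (N := tangent D) f ↔
      ∀ α, N.Q rfl (gpull f (D.wCoord α)) =
        gpull f (D.vCoord α) := by
  refine (isQMap_iff (M := N) (N := tangent D) f).trans ?_
  rw [flow_tangent]
  have h0 : ∀ {k : ℤ} (a : D.shiftedTangent.toGradedSpace.sec ⊤ k),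
      gpull (dualMap f ≫ tangentFlow D) a = gpull (dualMap f) (gpull (tangentFlow D) a) :=
    fun a => gpull_comp (dualMap f) (tangentFlow D) a
  have h2 : ∀ {k : ℤ} (a : D.shiftedTangent.toGradedSpace.sec ⊤ k),
      gpull (N.flow ≫ f) a = (gpull f a, N.Q rfl (gpull f a)) :=
    fun a => (gpull_comp N.flow f _).trans (gpull_flow N _)
  constructor
  · intro h α
    have h3 := (h0 _).symm.trans ((congrArg (fun g : N.toGradedSpace.dual ⟶ _ =>
      gpull g (D.wCoord α)) h).trans (h2 _))
    rw [gpull_tangentFlow_inl] at h3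
    exact (congrArg Prod.snd h3).symm
  · intro h
    refine hom_shiftedTangent_ext hN.dual (fun α => ?_) fun α => ?_
    · refine (h0 _).trans (Eq.trans ?_ (h2 _).symm)
      rw [gpull_tangentFlow_inl]
      exact Prod.ext rfl (h α).symm
    · refine (h0 _).trans (Eq.trans ?_ (h2 _).symm)
      rw [gpull_tangentFlow_inr]
      refine Prod.ext rfl ((map_zero (gpull f)).trans ?_)
      change 0 = N.Q rfl (gpull f (D.vCoord α))
      exact (N.Q_Q rfl rfl _).symm.trans (congrArg (N.Q rfl) (h α))

/-- `Q`-maps to `T[1]V` are families of functions. -/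
theorem exists_qmap_tangent {N : QSpace} (hN : IsGradedManifold N.toGradedSpace)
    (φ : ∀ α, N.sec ⊤ (D.deg α)) : ∃! f : N.toGradedSpace ⟶ D.shiftedTangent.toGradedSpace,
      IsQMap (M := N) (N := tangent D) f ∧
        ∀ α, gpull f (D.wCoord α) = φ α := by
  obtain ⟨f, h1, h2⟩ := exists_hom_shiftedTangent D hN φ fun α => N.Q rfl (φ α)
  refine ⟨f, ⟨(isQMap_tangent_iff hN f).2 fun α => ?_, h1⟩, fun g hg =>
    hom_shiftedTangent_ext hN (fun α => (hg.2 α).trans (h1 α).symm) fun α => ?_⟩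
  · rw [h1]
    exact (h2 α).symm
  · rw [h2, ← hg.2]
    exact ((isQMap_tangent_iff hN g).1 hg.1 α).symm

end Tangent

/-- The product of a `Q`-manifold and `T[1]V`. -/
theorem exists_product_tangent {E : QSpace} (hE : IsGradedManifold E.toGradedSpace)
    (D : GradedCoords) : ∃ (P : QSpace) (p : P.toGradedSpace ⟶ E.toGradedSpace)
      (q : P.toGradedSpace ⟶ (tangent D).toGradedSpace), IsGradedManifold P.toGradedSpace ∧
      IsGradedProduct p q ∧ IsQMap p ∧ IsQMap q := by
  obtain ⟨P, p, q, hP, hpq⟩ := hE.exists_product D.shiftedTangent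
  let T := tangent D
  obtain ⟨q, rfl⟩ : ∃ q' : P ⟶ T.toGradedSpace, q' = q := ⟨q, rfl⟩
  have hpq' : IsGradedProduct p q := hpq
  obtain ⟨Φ, ⟨h1, h2⟩, -⟩ := hpq' _ hP.dual (dualMap p ≫ E.flow) (dualMap q ≫ T.flow)
  have hext : ∀ {N : GradedSpace} (_ : IsGradedManifold N) {f g : N ⟶ P}, f ≫ p = g ≫ p →
      f ≫ (q : P ⟶ T.toGradedSpace) = g ≫ q → f = g := fun hN f g hp hq => (hpq' _ hN _ _).unique ⟨hp, hq⟩ ⟨rfl, rfl⟩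
  have key : ∀ {A : QSpace} (r : P ⟶ A.toGradedSpace), Φ ≫ r = dualMap r ≫ A.flow →
      inclDual P ≫ Φ ≫ r = r ∧ dualMap Φ ≫ Φ ≫ r = codiag P ≫ Φ ≫ r := fun {A} r hr => by
    rw [hr]
    constructor
    · rw [← Category.assoc, inclDual_dualMap, Category.assoc, inclDual_flow, Category.comp_id]
    · rw [← Category.assoc, ← dualMap_comp, hr, dualMap_comp, Category.assoc, dualMap_flow,
        ← Category.assoc, ← Category.assoc, codiag_dualMap]
  have e1 := key p h1
  have e2 := key q h2
  have a1 : inclDual P ≫ Φ = 𝟙 P := hext hP (by rw [Category.assoc, e1.1, Category.id_comp])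
    (by rw [Category.assoc, e2.1, Category.id_comp])
  have a2 : dualMap Φ ≫ Φ = codiag P ≫ Φ := hext hP.dual.dual
    (by rw [Category.assoc, e1.2, Category.assoc]) (by rw [Category.assoc, e2.2, Category.assoc])
  refine ⟨ofFlow P Φ a1 a2, p, q, hP, hpq', ?_, ?_⟩
  · refine (isQMap_iff (M := ofFlow P Φ a1 a2) (N := E) p).2 ?_
    rw [flow_ofFlow]
    exact h1.symm
  · refine (isQMap_iff (M := ofFlow P Φ a1 a2) (N := T) q).2 ?_
    rw [flow_ofFlow]
    exact h2.symm

end QSpace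

namespace GradedSpace

variable {M N : GradedSpace}

theorem comap_mono (f : M ⟶ N) {U V : Opens N} (h : U ≤ V) :
    Opens.comap f.base U ≤ Opens.comap f.base V := fun _ hx => h hx

theorem sec_ext_top {I : Type} {V : I → Opens M} (hV : ∀ x, ∃ i, x ∈ V i) {k : ℤ}
    {a b : M.sec ⊤ k} (h : ∀ i, gpull (incl M (V i)) a = gpull (incl M (V i)) b) : a = b :=
  sec_ext fun x _ => by
    obtain ⟨i, hi⟩ := hV x
    exact ⟨openImage (V i) ⊤, le_top, ⟨⟨x, hi⟩, trivial, rfl⟩, h i⟩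

/-- Sections whose degrees are equal. -/
def castSec {U : Opens M} {k l : ℤ} (h : k = l) : M.sec U k →ₗ[ℝ] M.sec U l := h ▸ LinearMap.id

theorem pull_castSec (f : M ⟶ N) {U : Opens N} {V : Opens M} (hU : V ≤ Opens.comap f.base U)
    {k l : ℤ} (h : k = l) (a : N.sec U k) : f.pull hU (castSec h a) = castSec h (f.pull hU a) := by
  subst h; rfl

theorem castSec_eq_iff {U : Opens M} {k l : ℤ} (h : k = l) (a : M.sec U k) (b : M.sec U l) :
    castSec h a = b ↔ a = castSec h.symm b := by
  subst h; rfl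

end GradedSpace

namespace QSpace

open GradedSpace

variable {P E : QSpace}

theorem IsQMap.congr {f g : P.toGradedSpace ⟶ E.toGradedSpace} (h : f = g) (hf : IsQMap f) :
    IsQMap g := by
  subst h
  exact hf

/-- Over `U`, the `Q`-maps to `P` are given by `Q`-maps to `E` and arbitrary values of the
functions `ζ`. -/
def IsFreeOver (p : P.toGradedSpace ⟶ E.toGradedSpace) (U : Opens E.toGradedSpace)
    (D : GradedCoords) (ζ : ∀ i, P.sec (Opens.comap p.base U) (D.deg i)) : Prop :=
  ∀ N : QSpace, IsGradedManifold N.toGradedSpace → ∀ f : N.toGradedSpace ⟶ E.toGradedSpace,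
    IsQMap f → (∀ x, f.base x ∈ U) → ∀ φ : ∀ i, N.sec ⊤ (D.deg i),
    ∃! h : N.toGradedSpace ⟶ P.toGradedSpace, IsQMap h ∧ h ≫ p = f ∧
      ∀ (hh : ∀ x, h.base x ∈ Opens.comap p.base U) i, pullOn h hh (ζ i) = φ i

variable {p : P.toGradedSpace ⟶ E.toGradedSpace} {U : Opens E.toGradedSpace} {D : GradedCoords}
  {ζ : ∀ i, P.sec (Opens.comap p.base U) (D.deg i)}

theorem mem_of_comp_eq {N : GradedSpace} {h : N ⟶ P.toGradedSpace} {f : N ⟶ E.toGradedSpace}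
    (hf : h ≫ p = f) (hU : ∀ x, f.base x ∈ U) (x : N) : h.base x ∈ Opens.comap p.base U :=
  (congrArg (· ∈ U) (congrArg (fun g : N ⟶ E.toGradedSpace => g.base x) hf)).mpr (hU x)

theorem IsFreeOver.exists_hom (hp : IsFreeOver p U D ζ) {N : QSpace}
    (hN : IsGradedManifold N.toGradedSpace) {f : N.toGradedSpace ⟶ E.toGradedSpace}
    (hf : IsQMap f) (hU : ∀ x, f.base x ∈ U) (φ : ∀ i, N.sec ⊤ (D.deg i)) :
    ∃ h : N.toGradedSpace ⟶ P.toGradedSpace, IsQMap h ∧ h ≫ p = f ∧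
      ∃ hh : ∀ x, h.base x ∈ Opens.comap p.base U, ∀ i, pullOn h hh (ζ i) = φ i := by
  obtain ⟨h, h1, h2, h3⟩ := (hp N hN f hf hU φ).exists
  exact ⟨h, h1, h2, mem_of_comp_eq h2 hU, h3 _⟩

theorem IsFreeOver.hom_ext (hp : IsFreeOver p U D ζ) {N : QSpace}
    (hN : IsGradedManifold N.toGradedSpace) {h h' : N.toGradedSpace ⟶ P.toGradedSpace}
    (hQ : IsQMap h) (hQ' : IsQMap h') (hc : IsQMap (M := N) (N := E) (h ≫ p)) (he : h ≫ p = h' ≫ p)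
    (hh : ∀ x, h.base x ∈ Opens.comap p.base U) (hh' : ∀ x, h'.base x ∈ Opens.comap p.base U)
    (heq : ∀ i, pullOn h hh (ζ i) = pullOn h' hh' (ζ i)) : h = h' :=
  (hp N hN (h ≫ p) hc hh fun i => pullOn h hh (ζ i)).unique ⟨hQ, rfl, fun _ _ => rfl⟩
    ⟨hQ', he.symm, fun _ i => (heq i).symm⟩

/-- A second family of functions that determines and is determined by the first. -/
theorem IsFreeOver.transfer (hp : IsFreeOver p U D ζ) {U' : Opens E.toGradedSpace} (hU' : U' ≤ U)
    {D' : GradedCoords} {ζ' : ∀ i, P.sec (Opens.comap p.base U') (D'.deg i)}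
    (H : ∀ N : QSpace, IsGradedManifold N.toGradedSpace →
      ∀ f : N.toGradedSpace ⟶ E.toGradedSpace, IsQMap f → (∀ x, f.base x ∈ U') →
      ∀ φ' : ∀ i, N.sec ⊤ (D'.deg i), ∃ φ : ∀ i, N.sec ⊤ (D.deg i),
      ∀ h : N.toGradedSpace ⟶ P.toGradedSpace, IsQMap h → h ≫ p = f →
      ∀ (hh : ∀ x, h.base x ∈ Opens.comap p.base U) (hh' : ∀ x, h.base x ∈ Opens.comap p.base U'),
      (∀ i, pullOn h hh (ζ i) = φ i) ↔ ∀ i, pullOn h hh' (ζ' i) = φ' i) :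
    IsFreeOver p U' D' ζ' := fun N hN f hf hfU φ' => by
  obtain ⟨φ, hφ⟩ := H N hN f hf hfU φ'
  obtain ⟨h, h1, h2, hh, h3⟩ := hp.exists_hom hN hf (fun x => hU' (hfU x)) φ
  refine ⟨h, ⟨h1, h2, fun hh' => (hφ h h1 h2 hh hh').1 h3⟩, fun g hg => ?_⟩
  have hg' := mem_of_comp_eq hg.2.1 hfU
  have hg'' : ∀ x, g.base x ∈ Opens.comap p.base U := fun x => hU' (hg' x)
  have h4 := (hφ g hg.1 hg.2.1 hg'' hg').2 (hg.2.2 hg')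
  refine hp.hom_ext hN hg.1 h1 ?_ (hg.2.1.trans h2.symm) hg'' hh fun i => (h4 i).trans (h3 i).symm
  rw [hg.2.1]
  exact hf

theorem IsFreeOver.mono (hp : IsFreeOver p U D ζ) {U' : Opens E.toGradedSpace} (hU' : U' ≤ U) :
    IsFreeOver p U' D fun i => P.res (comap_mono p hU') (ζ i) :=
  hp.transfer hU' fun _ _ _ _ _ φ => ⟨φ, fun h _ _ hh hh' =>
    forall_congr' fun i => by rw [pullOn_res h hh' hh]⟩

/-- Freeness is local on the base. -/
theorem isFreeOver_of_cover {I : Type} {O : I → Opens E.toGradedSpace} (hO : ∀ a, O a ≤ U)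
    (hc : ∀ x ∈ U, ∃ a, x ∈ O a)
    (hp : ∀ a, IsFreeOver p (O a) D fun i => P.res (comap_mono p (hO a)) (ζ i)) :
    IsFreeOver p U D ζ := fun N hN f hf hfU φ => by
  let V : I → Opens N.toGradedSpace := fun a => Opens.comap f.base (O a)
  have hV : ∀ x, ∃ a, x ∈ V a := fun x => hc _ (hfU x)
  have hQ : ∀ W : Opens N.toGradedSpace,
      IsQMap (M := N.restrict W) (N := E) (incl N.toGradedSpace W ≫ f) :=
    fun W => IsQMap.comp (L := N.restrict W) (M := N) (N := E) (isQMap_incl N W) hf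
  have hex : ∀ a, ∃ h : N.toGradedSpace.restrict (V a) ⟶ P.toGradedSpace,
      IsQMap (M := N.restrict (V a)) (N := P) h ∧ h ≫ p = incl N.toGradedSpace (V a) ≫ f ∧
      ∃ hh : ∀ x, h.base x ∈ Opens.comap p.base (O a), ∀ i, pullOn h hh
        (P.res (comap_mono p (hO a)) (ζ i)) = gpull (incl N.toGradedSpace (V a)) (φ i) :=
    fun a => (hp a).exists_hom (N := N.restrict (V a)) (hN.restrict (V a))
      (hQ (V a)) (fun x => x.2) fun i => gpull (incl N.toGradedSpace (V a)) (φ i)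
  choose h h1 h2 h3 h4 using hex
  have h5 : ∀ a x, (h a).base x ∈ Opens.comap p.base U := fun a x => hO a (h3 a x)
  have h6 : ∀ a i, pullOn (h a) (h5 a) (ζ i) = gpull (incl N.toGradedSpace (V a)) (φ i) :=
    fun a i => (pullOn_res (h a) (h3 a) (h5 a) _ _).symm.trans (h4 a i)
  have hLE : ∀ {W W' : Opens N.toGradedSpace} (hW : W ≤ W'),
      IsQMap (M := N.restrict W) (N := N.restrict W') (inclLE N.toGradedSpace hW) := fun {W W'} hW =>
    @isQMap_of_incl (N.restrict W) N W' _ ((inclLE_incl hW).symm ▸ isQMap_incl N W)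
  obtain ⟨g, hg⟩ := exists_glue_hom (f := h) hV fun a b => by
    have e : ∀ {W : Opens N.toGradedSpace} {c : I} (hW : W ≤ V c),
        (inclLE N.toGradedSpace hW ≫ h c) ≫ p = incl N.toGradedSpace W ≫ f := fun {W c} hW => by
      rw [Category.assoc, h2 c, ← Category.assoc, inclLE_incl]
    have e' : ∀ {W : Opens N.toGradedSpace} {c : I} (hW : W ≤ V c)
        (hh : ∀ x, (inclLE N.toGradedSpace hW ≫ h c).base x ∈ Opens.comap p.base U) (i : D.ι),
        pullOn (inclLE N.toGradedSpace hW ≫ h c) hh (ζ i) = gpull (incl N.toGradedSpace W) (φ i) :=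
      fun {W c} hW hh i => by
        rw [pullOn_comp' _ _ hh (h5 c), h6]
        exact (gpull_comp (inclLE N.toGradedSpace hW) (incl N.toGradedSpace (V c)) (φ i)).symm.trans
          (by rw [inclLE_incl])
    refine (hp a).hom_ext (N := N.restrict (V a ⊓ V b)) (hN.restrict _) (IsQMap.comp (M := N.restrict (V a)) (hLE _) (h1 a))
      (IsQMap.comp (M := N.restrict (V b)) (hLE _) (h1 b)) ?_ ((e _).trans (e _).symm) (fun x => ?_) (fun x => ?_) fun i => ?_
    · exact IsQMap.congr (P := N.restrict (V a ⊓ V b)) (e _).symm (hQ _)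
    · exact mem_of_comp_eq (e (inf_le_left : V a ⊓ V b ≤ V a)) (fun x => x.2.1) x
    · exact mem_of_comp_eq (e (inf_le_right : V a ⊓ V b ≤ V b)) (fun x => x.2.1) x
    · exact ((pullOn_res (inclLE N.toGradedSpace inf_le_left ≫ h a) _ (fun x => h5 a _) _ _).trans
        (e' _ _ i)).trans ((pullOn_res (inclLE N.toGradedSpace inf_le_right ≫ h b) _
        (fun x => h5 b _) _ _).trans (e' _ _ i)).symm
  have hgp : g ≫ p = f := hom_ext_local hV fun a => by rw [← Category.assoc, hg, h2]
  refine ⟨g, ⟨isQMap_of_local hV fun a => ?_, hgp, fun hh i => sec_ext_top hV fun a => ?_⟩,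
    fun g' hg' => hom_ext_local hV fun a => ?_⟩
  · exact IsQMap.congr (P := N.restrict (V a)) (hg a).symm (h1 a)
  · rw [← h6, ← pullOn_comp' (incl N.toGradedSpace (V a)) g (fun x => hh x.1)]
    exact pullOn_congr (hg a) _ _ _
  · rw [hg]
    have ehg : (incl N.toGradedSpace (V a) ≫ g') ≫ p = incl N.toGradedSpace (V a) ≫ f := by
      rw [Category.assoc, hg'.2.1]
    have hm : ∀ x : V a, (incl N.toGradedSpace (V a) ≫ g').base x ∈ Opens.comap p.base (O a) :=
      fun x => mem_of_comp_eq (h := incl N.toGradedSpace (V a) ≫ g') (f := incl N.toGradedSpace (V a) ≫ f)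
        ehg (fun x => x.2) x
    have hm' : ∀ x, g'.base x ∈ Opens.comap p.base U := mem_of_comp_eq hg'.2.1 hfU
    refine (hp a).hom_ext (N := N.restrict (V a)) (hN.restrict _) (IsQMap.comp (L := N.restrict (V a)) (M := N) (isQMap_incl N (V a)) hg'.1)
      (h1 a) ?_ ?_ hm (h3 a) fun i => ?_
    · exact IsQMap.congr (P := N.restrict (V a)) ehg.symm (hQ _)
    · exact ehg.trans (h2 a).symm
    · exact (pullOn_res (incl N.toGradedSpace (V a) ≫ g') hm (fun x => hm' x.1) _ _).trans
        ((pullOn_comp' _ _ _ hm' _).trans ((congrArg _ (hg'.2.2 hm' i)).trans (h4 a i).symm))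

/-- The composition of two free maps. -/
theorem IsFreeOver.comp (hp : IsFreeOver p U D ζ) (hpQ : IsQMap p) {P' : QSpace}
    {p' : P'.toGradedSpace ⟶ P.toGradedSpace} {D' : GradedCoords}
    {y : ∀ i, P'.sec (Opens.comap p'.base ⊤) (D'.deg i)} (hp' : IsFreeOver p' ⊤ D' y)
    (hpQ' : IsQMap p') {D'' : GradedCoords}
    {η : ∀ i, P'.sec (Opens.comap (p' ≫ p).base U) (D''.deg i)}
    (H : ∀ N : QSpace, IsGradedManifold N.toGradedSpace → ∀ ψ : ∀ i, N.sec ⊤ (D''.deg i),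
      ∃ (φ : ∀ i, N.sec ⊤ (D.deg i)) (φ' : ∀ i, N.sec ⊤ (D'.deg i)),
      ∀ (h : N.toGradedSpace ⟶ P'.toGradedSpace)
      (hh : ∀ x, (h ≫ p').base x ∈ Opens.comap p.base U) (ht : ∀ x, h.base x ∈ Opens.comap p'.base ⊤)
      (hh' : ∀ x, h.base x ∈ Opens.comap (p' ≫ p).base U),
      ((∀ i, pullOn (h ≫ p') hh (ζ i) = φ i) ∧ ∀ i, pullOn h ht (y i) = φ' i) ↔
        ∀ i, pullOn h hh' (η i) = ψ i) :
    IsFreeOver (P := P') (E := E) (p' ≫ p) U D'' η := fun N hN f hf hfU ψ => by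
  obtain ⟨φ, φ', hφ⟩ := H N hN ψ
  obtain ⟨g, hg1, hg2, hg3, hg4⟩ := hp.exists_hom hN hf hfU φ
  obtain ⟨h, hh1, hh2, hh3, hh4⟩ := hp'.exists_hom hN hg1 (fun _ => trivial) φ'
  subst hh2
  refine ⟨h, ⟨hh1, (Category.assoc _ _ _).symm.trans hg2, fun hh => (hφ h hg3 hh3 hh).1 ⟨hg4, hh4⟩⟩,
    fun h' hh' => ?_⟩
  have e2 : (h' ≫ p') ≫ p = f := (Category.assoc _ _ _).trans hh'.2.1
  have m1 := mem_of_comp_eq e2 hfU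
  have m2 : ∀ x, h'.base x ∈ Opens.comap p'.base ⊤ := fun _ => trivial
  have m3 : ∀ x, h'.base x ∈ Opens.comap (p' ≫ p).base U := m1
  obtain ⟨a1, a2⟩ := (hφ h' m1 m2 m3).2 (hh'.2.2 m3)
  have hQ : IsQMap (M := N) (N := P) (h' ≫ p') := IsQMap.comp hh'.1 hpQ'
  have e : h' ≫ p' = h ≫ p' := hp.hom_ext hN hQ hg1 (IsQMap.comp hQ hpQ) (e2.trans hg2.symm) m1 hg3
    fun i => (a1 i).trans (hg4 i).symm
  exact hp'.hom_ext hN hh'.1 hh1 hQ e m2 hh3 fun i => (a2 i).trans (hh4 i).symm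

/-- Two free maps with the same coordinates are isomorphic. -/
theorem IsFreeOver.exists_iso {ζ : ∀ i, P.sec (Opens.comap p.base ⊤) (D.deg i)}
    (hp : IsFreeOver p ⊤ D ζ) (hP : IsGradedManifold P.toGradedSpace) (hpQ : IsQMap p) {P' : QSpace}
    {p' : P'.toGradedSpace ⟶ E.toGradedSpace} {ζ' : ∀ i, P'.sec (Opens.comap p'.base ⊤) (D.deg i)}
    (hp' : IsFreeOver p' ⊤ D ζ') (hP' : IsGradedManifold P'.toGradedSpace) (hpQ' : IsQMap p') :
    ∃ e : P.toGradedSpace ≅ P'.toGradedSpace, IsQMap (M := P) (N := P') e.hom ∧ e.hom ≫ p' = p := by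
  have ht : ∀ x, (𝟙 P.toGradedSpace : _ ⟶ _).base x ∈ Opens.comap p.base ⊤ := fun _ => trivial
  have ht' : ∀ x, (𝟙 P'.toGradedSpace : _ ⟶ _).base x ∈ Opens.comap p'.base ⊤ := fun _ => trivial
  obtain ⟨a, a1, a2, a3, a4⟩ := hp'.exists_hom hP hpQ (fun _ => trivial)
    fun i => pullOn (𝟙 P.toGradedSpace) ht (ζ i)
  obtain ⟨b, b1, b2, b3, b4⟩ := hp.exists_hom hP' hpQ' (fun _ => trivial)
    fun i => pullOn (𝟙 P'.toGradedSpace) ht' (ζ' i)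
  have t : ∀ (x : P.toGradedSpace), (a ≫ b).base x ∈ Opens.comap p.base ⊤ := fun _ => trivial
  have t' : ∀ (x : P'.toGradedSpace), (b ≫ a).base x ∈ Opens.comap p'.base ⊤ := fun _ => trivial
  have u : ∀ x : P.toGradedSpace, (a ≫ 𝟙 _).base x ∈ Opens.comap p'.base ⊤ := fun _ => trivial
  have u' : ∀ x : P'.toGradedSpace, (b ≫ 𝟙 _).base x ∈ Opens.comap p.base ⊤ := fun _ => trivial
  have c : (a ≫ b) ≫ p = 𝟙 _ ≫ p := by rw [Category.assoc, b2, a2, Category.id_comp]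
  have c' : (b ≫ a) ≫ p' = 𝟙 _ ≫ p' := by rw [Category.assoc, a2, b2, Category.id_comp]
  have hab : a ≫ b = 𝟙 P.toGradedSpace := by
    refine hp.hom_ext hP (IsQMap.comp a1 b1) (isQMap_id P) (c ▸ ?_) c t ht fun i => ?_
    · rw [Category.id_comp]; exact hpQ
    · rw [pullOn_comp' a b t b3, b4, ← pullOn_comp' a (𝟙 P'.toGradedSpace) u, ← a4]
      exact pullOn_congr (Category.comp_id _) _ _ _
  have hba : b ≫ a = 𝟙 P'.toGradedSpace := by
    refine hp'.hom_ext hP' (IsQMap.comp b1 a1) (isQMap_id P') (c' ▸ ?_) c' t' ht' fun i => ?_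
    · rw [Category.id_comp]; exact hpQ'
    · rw [pullOn_comp' b a t' a3, a4, ← pullOn_comp' b (𝟙 P.toGradedSpace) u', ← b4]
      exact pullOn_congr (Category.comp_id _) _ _ _
  exact ⟨⟨a, b, hab, hba⟩, a1, a2⟩

end QSpace

namespace GradedCoords

/-- Countably many copies of a family of coordinates. -/
noncomputable def natCoords (D : GradedCoords) : GradedCoords where
  ι := ℕ ×ₗ D.ι
  countable := inferInstanceAs (Countable (ℕ × D.ι))
  deg i := D.deg (ofLex i).2

/-- Infinitely many coordinates in every degree. -/
noncomputable def universal : GradedCoords where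
  ι := ℤ ×ₗ ℕ
  countable := inferInstanceAs (Countable (ℤ × ℕ))
  deg i := (ofLex i).1

theorem exists_equiv {C D : GradedCoords} (hC : ∀ d, Infinite {i // C.deg i = d})
    (hD : ∀ d, Infinite {i // D.deg i = d}) : ∃ σ : C.ι ≃ D.ι, ∀ i, D.deg (σ i) = C.deg i := by
  have h : ∀ d, Nonempty ({i // C.deg i = d} ≃ {i // D.deg i = d}) := fun d => by
    obtain ⟨a⟩ := nonempty_denumerable {i // C.deg i = d}
    obtain ⟨b⟩ := nonempty_denumerable {i // D.deg i = d}
    exact ⟨Denumerable.equiv₂ _ _⟩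
  refine ⟨(Equiv.sigmaFiberEquiv C.deg).symm.trans
    ((Equiv.sigmaCongrRight fun d => (h d).some).trans (Equiv.sigmaFiberEquiv D.deg)), fun i => ?_⟩
  exact ((h (C.deg i)).some ⟨i, rfl⟩).2

theorem infinite_universal (d : ℤ) : Infinite {i // universal.deg i = d} :=
  Infinite.of_injective (fun n : ℕ => (⟨toLex (d, n), rfl⟩ : {i // universal.deg i = d}))
    fun _ _ h => congrArg (fun s : {i // universal.deg i = d} => (ofLex s.1).2) h

theorem infinite_natCoords_universal (d : ℤ) : Infinite {i // universal.natCoords.deg i = d} :=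
  Infinite.of_injective (fun n : ℕ =>
    (⟨toLex (0, toLex (d, n)), rfl⟩ : {i // universal.natCoords.deg i = d}))
    fun _ _ h => congrArg (fun s : {i // universal.natCoords.deg i = d} => (ofLex (ofLex s.1).2).2) h

theorem infinite_sum_universal (D : GradedCoords) (d : ℤ) :
    Infinite {i // (D.sum universal).deg i = d} :=
  Infinite.of_injective (fun n : ℕ =>
    (⟨Sum.inrₗ (toLex (d, n)), rfl⟩ : {i // (D.sum universal).deg i = d}))
    fun a b h => by
      have h1 := Sum.inr_injective (toLex.injective (congrArg Subtype.val h))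
      exact congrArg (fun s : ℤ ×ₗ ℕ => (ofLex s).2) h1

end GradedCoords

namespace QSpace

open GradedSpace

variable {P E : QSpace} {p : P.toGradedSpace ⟶ E.toGradedSpace} {U : Opens E.toGradedSpace}
  {D : GradedCoords} {ζ : ∀ i, P.sec (Opens.comap p.base U) (D.deg i)}

theorem IsFreeOver.reindex (hp : IsFreeOver p U D ζ) {D' : GradedCoords} (σ : D'.ι ≃ D.ι)
    (hσ : ∀ i, D.deg (σ i) = D'.deg i) : IsFreeOver p U D' fun i => castSec (hσ i) (ζ (σ i)) :=
  hp.transfer le_rfl fun N _ f _ _ φ' =>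
    ⟨fun j => castSec ((hσ _).symm.trans (congrArg D.deg (σ.apply_symm_apply j))) (φ' (σ.symm j)),
      fun h _ _ hh _ => by
        have h1 : ∀ i, pullOn h hh (castSec (hσ i) (ζ (σ i))) = castSec (hσ i) (pullOn h hh (ζ (σ i))) :=
          fun i => pull_castSec _ _ _ _
        constructor
        · intro H i
          refine (h1 i).trans ((castSec_eq_iff _ _ _).2 ((H _).trans ?_))
          have h2 : ∀ (j : D'.ι) (hj : j = i) (h : D'.deg j = D.deg (σ i)),
            castSec h (φ' j) = castSec (hσ i).symm (φ' i) := fun j hj h => by subst hj; rfl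
          exact h2 _ (σ.symm_apply_apply i) _
        · intro H j
          obtain ⟨i, rfl⟩ := σ.surjective j
          have h2 := (castSec_eq_iff _ _ _).1 ((h1 i).symm.trans (H i))
          refine h2.trans ?_
          have h3 : ∀ (j : D'.ι) (hj : j = i) (h : D'.deg j = D.deg (σ i)),
            castSec (hσ i).symm (φ' i) = castSec h (φ' j) := fun j hj h => by subst hj; rfl
          exact h3 _ (σ.symm_apply_apply i) _⟩

/-- Freeness is invariant under isomorphisms. -/
theorem IsFreeOver.of_iso (hp : IsFreeOver p U D ζ) {P' : QSpace}
    {p' : P'.toGradedSpace ⟶ E.toGradedSpace} (e : P'.toGradedSpace ≅ P.toGradedSpace)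
    (he : IsQMap (M := P') (N := P) e.hom) (hep : e.hom ≫ p = p') :
    ∃ ζ' : ∀ i, P'.sec (Opens.comap p'.base U) (D.deg i), IsFreeOver p' U D ζ' := by
  subst hep
  refine ⟨fun i => e.hom.pull (le_refl (Opens.comap e.hom.base (Opens.comap p.base U))) (ζ i),
    fun N hN f hf hfU φ => ?_⟩
  obtain ⟨h, h1, h2, hh, h3⟩ := hp.exists_hom hN hf hfU φ
  have hinv : (h ≫ e.inv) ≫ e.hom = h := by rw [Category.assoc, e.inv_hom_id, Category.comp_id]
  refine ⟨h ≫ e.inv, ⟨IsQMap.comp h1 he.inv, ?_, fun hh' i => ?_⟩, fun g hg => ?_⟩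
  · rw [← Category.assoc, hinv, h2]
  · have t : ∀ x, ((h ≫ e.inv) ≫ e.hom).base x ∈ Opens.comap p.base U := hh'
    refine (pullOn_comp (h ≫ e.inv) e.hom t (ζ i)).symm.trans ?_
    rw [pullOn_congr hinv t hh, h3]
  · have t : ∀ x, (g ≫ e.hom).base x ∈ Opens.comap p.base U :=
      mem_of_comp_eq (h := g ≫ e.hom) (by rw [Category.assoc, hg.2.1]) hfU
    have hQ : IsQMap (M := N) (N := P) (g ≫ e.hom) := IsQMap.comp hg.1 he
    have e1 : g ≫ e.hom = h := by
      refine hp.hom_ext hN hQ h1 ?_ ?_ t hh fun i => ?_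
      · rw [Category.assoc, hg.2.1]; exact hf
      · rw [Category.assoc, hg.2.1, h2]
      · rw [h3, ← hg.2.2 t]
        exact pullOn_comp g e.hom t (ζ i)
    rw [← e1, Category.assoc, e.hom_inv_id, Category.comp_id]

/-- The fibre coordinates of a product with `T[1]V`. -/
theorem isFreeOver_of_product {q : P.toGradedSpace ⟶ (tangent D).toGradedSpace} (hp : IsQMap p)
    (hq : IsQMap q) (hpq : IsGradedProduct p q) :
    IsFreeOver p ⊤ D (fun α => (gpull q (D.wCoord α) : P.sec ⊤ _)) := fun N hN f hf _ φ => by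
  obtain ⟨g, ⟨hg, hgφ⟩, hg'⟩ := exists_qmap_tangent hN φ
  obtain ⟨h, ⟨h1, h2⟩, h3⟩ := hpq _ hN f g
  refine ⟨h, ⟨isQMap_of_product hpq hp hq hN (h1 ▸ hf) (h2 ▸ hg), h1, fun _ α => ?_⟩,
    fun k hk => h3 k ⟨hk.2.1, hg' _ ⟨IsQMap.comp hk.1 hq, fun α => ?_⟩⟩⟩
  · exact (gpull_comp h q (D.wCoord α)).symm.trans ((congrArg (gpull · (D.wCoord α)) h2).trans (hgφ α))
  · exact (gpull_comp k q (D.wCoord α)).trans (hk.2.2 (fun _ => trivial) α)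

/-- Freeness may be checked on the open subspace. -/
theorem IsFreeOver.of_restrict {C : GradedCoords}
    {ζ : ∀ i, (P.restrict (Opens.comap p.base U)).sec ⊤ (C.deg i)}
    (hp : IsFreeOver (P := P.restrict (Opens.comap p.base U)) (E := E.restrict U) (restrictHom p U)
      ⊤ C ζ) : ∃ ζ' : ∀ i, P.sec (Opens.comap p.base U) (C.deg i), IsFreeOver p U C ζ' := by
  let W : Opens P.toGradedSpace := Opens.comap p.base U
  have hW : W ≤ openImage W ⊤ := fun x hx => ⟨⟨x, hx⟩, trivial, rfl⟩
  refine ⟨fun i => P.res hW (ζ i), fun N hN f hf hfU φ => ?_⟩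
  have key : ∀ (k : N.toGradedSpace ⟶ P.toGradedSpace.restrict W)
      (t : ∀ x, (k ≫ incl P.toGradedSpace W).base x ∈ W) (t' : ∀ x, k.base x ∈ (⊤ : Opens W)) (i : C.ι),
      pullOn (k ≫ incl P.toGradedSpace W) t (P.res hW (ζ i)) = pullOn k t' (ζ i) := fun k t t' i => by
    have t2 : ∀ x, (incl P.toGradedSpace W).base x ∈ W := fun x => Subtype.property (p := (· ∈ W)) x
    exact (pullOn_comp' k (incl P.toGradedSpace W) t t2 _).trans (congrArg (gpull k) (pullOn_incl t2 _))
  have hfQ : IsQMap (M := N) (N := E.restrict U) (lift f U hfU) :=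
    isQMap_of_incl (by rw [lift_incl]; exact hf)
  have hres : restrictHom p U ≫ incl E.toGradedSpace U = incl P.toGradedSpace W ≫ p :=
    restrictHom_incl p U
  obtain ⟨h, h1, h2, hh, h3⟩ := hp.exists_hom hN hfQ (fun _ => trivial) φ
  obtain ⟨h, rfl⟩ : ∃ h' : N.toGradedSpace ⟶ P.toGradedSpace.restrict W, h' = h := ⟨h, rfl⟩
  have hc : (h ≫ incl P.toGradedSpace W) ≫ p = f := by
    rw [Category.assoc, ← hres, ← Category.assoc]
    exact (congrArg (· ≫ incl E.toGradedSpace U) h2).trans (lift_incl _ _ _)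
  refine ⟨h ≫ incl P.toGradedSpace W,
    ⟨IsQMap.comp (M := P.restrict W) h1 (isQMap_incl P W), hc, fun t i => (key h t hh i).trans (h3 i)⟩,
    fun g hg => ?_⟩
  have tg : ∀ x, g.base x ∈ W := mem_of_comp_eq hg.2.1 hfU
  have tg' : ∀ x, (lift g W tg ≫ incl P.toGradedSpace W).base x ∈ W := tg
  have hgc : lift g W tg ≫ restrictHom p U = lift f U hfU := incl_cancel (by
    rw [Category.assoc, hres, ← Category.assoc, lift_incl, lift_incl, hg.2.1])
  have hgQ : IsQMap (M := N) (N := P.restrict W) (lift g W tg) :=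
    isQMap_of_incl (by rw [lift_incl]; exact hg.1)
  have e : lift g W tg = h := by
    refine hp.hom_ext hN hgQ h1 ?_ (hgc.trans h2.symm) (fun _ => trivial) hh fun i => ?_
    · exact IsQMap.congr (E := E.restrict U) hgc.symm hfQ
    · refine ((key (lift g W tg) tg' (fun _ => trivial) i).symm.trans ?_).trans (h3 i).symm
      exact (pullOn_congr (lift_incl g W tg) _ tg _).trans (hg.2.2 tg i)
  rw [← e, lift_incl]

/-- A bundle with contractible fibre has local fibre coordinates. -/
theorem exists_isFreeOver_of_contractible {F : QSpace} (hF : IsContractible F)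
    (hp : IsLocallyTrivialQBundle p F) : ∃ C : GradedCoords, ∀ x : E.toGradedSpace,
      ∃ U : Opens E.toGradedSpace, x ∈ U ∧
        ∃ ζ : ∀ i, P.sec (Opens.comap p.base U) (C.deg i), IsFreeOver p U C ζ := by
  obtain ⟨C, e, he⟩ := hF
  refine ⟨C, fun x => ?_⟩
  obtain ⟨U, hxU, q, hq, hpq⟩ := hp.2 x
  have hFm : IsGradedManifold F.toGradedSpace :=
    homeo_iso_isGradedManifold e C.shiftedTangent.isGradedManifold
  have heQ : IsQMap (M := F) (N := tangent C) e.hom := (isQMap_tangent_iff hFm e.hom).2 he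
  let W : Opens P.toGradedSpace := Opens.comap p.base U
  have h1 : IsQMap (M := P.restrict W) (N := tangent C) (q ≫ e.hom) :=
    IsQMap.comp (L := P.restrict W) (M := F) (N := tangent C) hq heQ
  have h2 : IsQMap (M := P.restrict W) (N := E.restrict U) (restrictHom p U) :=
    isQMap_of_incl (M := P.restrict W) (N := E) (IsQMap.congr (P := P.restrict W)
      (restrictHom_incl p U).symm (IsQMap.comp (L := P.restrict W) (isQMap_incl P W) hp.1))
  have h3 : IsGradedProduct (restrictHom p U) (q ≫ e.hom) := fun N hN f g => by
    obtain ⟨h, ⟨a1, a2⟩, a3⟩ := hpq N hN f (g ≫ e.inv)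
    refine ⟨h, ⟨a1, ?_⟩, fun k hk => a3 k ⟨hk.1, ?_⟩⟩
    · refine (Category.assoc _ _ _).symm.trans ?_
      rw [a2, Category.assoc, e.inv_hom_id, Category.comp_id]
    · have h4 : (k ≫ q) ≫ e.hom = g := (Category.assoc _ _ _).trans hk.2
      rw [← h4, Category.assoc, e.hom_inv_id, Category.comp_id]
  exact ⟨U, hxU, IsFreeOver.of_restrict
    (isFreeOver_of_product (P := P.restrict W) (E := E.restrict U) h2 h1 h3)⟩

variable {P' : QSpace} {p' : P'.toGradedSpace ⟶ P.toGradedSpace}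

theorem IsFreeOver.comp_sum (hp : IsFreeOver p U D ζ) (hpQ : IsQMap p) {D' : GradedCoords}
    {y : ∀ i, P'.sec (Opens.comap p'.base ⊤) (D'.deg i)} (hp' : IsFreeOver p' ⊤ D' y)
    (hpQ' : IsQMap p') : ∃ η : ∀ i, P'.sec (Opens.comap (p' ≫ p).base U) ((D.sum D').deg i),
      IsFreeOver (P := P') (E := E) (p' ≫ p) U (D.sum D') η := by
  have hle : Opens.comap (p' ≫ p).base U ≤ Opens.comap p'.base ⊤ := fun _ _ => trivial
  refine ⟨fun i => Sum.rec (motive := fun s => P'.sec (Opens.comap (p' ≫ p).base U)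
    (Sum.elim D.deg D'.deg s)) (fun i => p'.pull (le_refl (Opens.comap p'.base _)) (ζ i))
    (fun i => P'.res hle (y i)) (ofLex i), hp.comp hpQ hp' hpQ' fun N _ ψ =>
    ⟨fun i => ψ (Sum.inlₗ i), fun i => ψ (Sum.inrₗ i), fun h hh ht hh' => ⟨fun H i => ?_, fun H =>
      ⟨fun i => ?_, fun i => ?_⟩⟩⟩⟩
  · induction i using Lex.rec with | _ i => ?_
    rcases i with i | i
    · exact (pullOn_comp h p' hh (ζ i)).symm.trans (H.1 i)
    · exact (pullOn_res h hh' ht hle (y i)).trans (H.2 i)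
  · exact (pullOn_comp h p' hh (ζ i)).trans (H (Sum.inlₗ i))
  · exact (pullOn_res h hh' ht hle (y i)).symm.trans (H (Sum.inrₗ i))

/-- Adding a family of fibre coordinates to countably many families. -/
def consFamily (p' : P'.toGradedSpace ⟶ P.toGradedSpace) (p : P.toGradedSpace ⟶ E.toGradedSpace)
    (ζ : ∀ i, P.sec (Opens.comap p.base U) (D.deg i))
    (y : ∀ i, P'.sec (Opens.comap p'.base ⊤) (D.natCoords.deg i)) (i : D.natCoords.ι) :
    P'.sec (Opens.comap (p' ≫ p).base U) (D.natCoords.deg i) :=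
  Nat.rec (motive := fun _ => P'.sec (Opens.comap (p' ≫ p).base U) (D.deg (ofLex i).2))
    (p'.pull (le_refl (Opens.comap p'.base _)) (ζ (ofLex i).2))
    (fun n _ => P'.res (fun _ _ => trivial : _ ≤ Opens.comap p'.base ⊤) (y (toLex (n, (ofLex i).2))))
    (ofLex i).1

theorem IsFreeOver.cons (hp : IsFreeOver p U D ζ) (hpQ : IsQMap p)
    {y : ∀ i, P'.sec (Opens.comap p'.base ⊤) (D.natCoords.deg i)}
    (hp' : IsFreeOver p' ⊤ D.natCoords y) (hpQ' : IsQMap p') :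
    IsFreeOver (P := P') (E := E) (p' ≫ p) U D.natCoords (consFamily p' p ζ y) := by
  have hle : Opens.comap (p' ≫ p).base U ≤ Opens.comap p'.base ⊤ := fun _ _ => trivial
  refine hp.comp hpQ hp' hpQ' fun N _ ψ => ⟨fun i => ψ (toLex (0, i)),
    fun i => ψ (toLex ((ofLex i).1 + 1, (ofLex i).2)), fun h hh ht hh' => ⟨fun H i => ?_, fun H =>
      ⟨fun i => ?_, fun i => ?_⟩⟩⟩
  · induction i using Lex.rec with | _ i => ?_
    obtain ⟨n, i⟩ := i
    cases n with
    | zero => exact (pullOn_comp h p' hh (ζ i)).symm.trans (H.1 i)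
    | succ n => exact (pullOn_res h hh' ht hle (y (toLex (n, i)))).trans (H.2 (toLex (n, i)))
  · exact (pullOn_comp h p' hh (ζ i)).trans (H (toLex (0, i)))
  · exact (pullOn_res h hh' ht hle (y i)).symm.trans (H (toLex ((ofLex i).1 + 1, (ofLex i).2)))

end QSpace

section Swindle

variable {F F' : Type*} [AddCommGroup F] [AddCommGroup F']

/-- The bijection `g` acting along the line `(c, s)` in `F × F`. -/
def rotatedEquiv (c s : F →+ F) (h : ∀ x, c (c x) + s (s x) = x) (g : F ≃ F) : F × F ≃ F × F where
  toFun x := (x.1 + c (g (c x.1 + s x.2) - (c x.1 + s x.2)),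
    x.2 + s (g (c x.1 + s x.2) - (c x.1 + s x.2)))
  invFun x := (x.1 + c (g.symm (c x.1 + s x.2) - (c x.1 + s x.2)),
    x.2 + s (g.symm (c x.1 + s x.2) - (c x.1 + s x.2)))
  left_inv x := by
    have e : ∀ u, c (x.1 + c u) + s (x.2 + s u) = c x.1 + s x.2 + u := fun u => by
      rw [map_add, map_add, add_add_add_comm, h]
    simp only [e, add_sub_cancel, Equiv.symm_apply_apply]
    refine Prod.ext ?_ ?_ <;> simp <;> abel
  right_inv x := by
    have e : ∀ u, c (x.1 + c u) + s (x.2 + s u) = c x.1 + s x.2 + u := fun u => by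
      rw [map_add, map_add, add_add_add_comm, h]
    simp only [e, add_sub_cancel, Equiv.apply_symm_apply]
    refine Prod.ext ?_ ?_ <;> simp <;> abel

/-- A deformation of the identity to `(g, g⁻¹)`. -/
def pairEquiv (c s : F →+ F) (h : ∀ x, c (c x) + s (s x) = x) (g : F ≃ F) : F × F ≃ F × F :=
  (rotatedEquiv c s h g.symm).trans (g.prodCongr (Equiv.refl F))

/-- A bijection acting on the pairs of consecutive entries of a sequence. -/
def onPairs (θ : F × F ≃ F × F) : (ℕ → F) ≃ (ℕ → F) where
  toFun φ n := if n % 2 = 0 then (θ (φ n, φ (n + 1))).1 else (θ (φ (n - 1), φ n)).2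
  invFun φ n := if n % 2 = 0 then (θ.symm (φ n, φ (n + 1))).1 else (θ.symm (φ (n - 1), φ n)).2
  left_inv φ := by
    funext n
    by_cases hn : n % 2 = 0
    · have h1 : ¬ (n + 1) % 2 = 0 := by omega
      simp [hn, h1]
    · have h1 : (n - 1) % 2 = 0 := by omega
      have h2 : n - 1 + 1 = n := by omega
      simp [hn, h1, h2]
  right_inv φ := by
    funext n
    by_cases hn : n % 2 = 0
    · have h1 : ¬ (n + 1) % 2 = 0 := by omega
      simp [hn, h1]
    · have h1 : (n - 1) % 2 = 0 := by omega
      have h2 : n - 1 + 1 = n := by omega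
      simp [hn, h1, h2]

/-- A bijection acting on the tail of a sequence. -/
def onTail (Ψ : (ℕ → F) ≃ (ℕ → F)) : (ℕ → F) ≃ (ℕ → F) where
  toFun φ n := Nat.casesOn n (φ 0) (Ψ fun m => φ (m + 1))
  invFun φ n := Nat.casesOn n (φ 0) (Ψ.symm fun m => φ (m + 1))
  left_inv φ := by
    funext n
    cases n with
    | zero => rfl
    | succ n => exact congrFun (Ψ.symm_apply_apply _) n
  right_inv φ := by
    funext n
    cases n with
    | zero => rfl
    | succ n => exact congrFun (Ψ.apply_symm_apply _) n

/-- A deformation of the identity to `(g, 1, 1, …)`. -/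
def swindle (c s : F →+ F) (h : ∀ x, c (c x) + s (s x) = x) (g : F ≃ F) : (ℕ → F) ≃ (ℕ → F) :=
  (onPairs (pairEquiv c s h g)).trans (onTail (onPairs (pairEquiv c s h g)))

variable {c s : F →+ F} {h : ∀ x, c (c x) + s (s x) = x} {g : F ≃ F}

theorem swindle_apply_of_left (hc : ∀ x, c x = x) (hs : ∀ x, s x = 0) (φ : ℕ → F) :
    swindle c s h g φ = φ := by
  have e : pairEquiv c s h g = Equiv.refl _ := Equiv.ext fun x => by
    simp [pairEquiv, rotatedEquiv, hc, hs]
  have e2 : onPairs (Equiv.refl (F × F)) = Equiv.refl _ := Equiv.ext fun φ => by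
    funext n
    by_cases hn : n % 2 = 0 <;> simp [onPairs]
  funext n
  simp only [swindle, e, e2]
  cases n <;> rfl

theorem swindle_apply_of_right (hc : ∀ x, c x = 0) (hs : ∀ x, s x = x) (φ : ℕ → F) (n : ℕ) :
    swindle c s h g φ n = Nat.casesOn n (g (φ 0)) fun m => φ (m + 1) := by
  have e : ∀ x, pairEquiv c s h g x = (g x.1, g.symm x.2) := fun x => by
    simp [pairEquiv, rotatedEquiv, hc, hs]
  have e1 : ∀ (φ : ℕ → F) n, onPairs (pairEquiv c s h g) φ n =
      if n % 2 = 0 then g (φ n) else g.symm (φ n) := fun φ n => by simp [onPairs, e]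
  cases n with
  | zero => exact e1 φ 0
  | succ n =>
    change onPairs _ (fun m => onPairs _ φ (m + 1)) n = φ (n + 1)
    rw [e1, e1]
    by_cases hn : n % 2 = 0
    · have h1 : ¬ (n + 1) % 2 = 0 := by omega
      simp [hn, h1]
    · have h1 : (n + 1) % 2 = 0 := by omega
      simp [hn, h1]

theorem swindle_map {c' s' : F' →+ F'} {h' : ∀ x, c' (c' x) + s' (s' x) = x} {g' : F' ≃ F'}
    (k : F →+ F') (hc : ∀ x, k (c x) = c' (k x)) (hs : ∀ x, k (s x) = s' (k x))
    (hg : ∀ x, k (g x) = g' (k x)) (φ : ℕ → F) (n : ℕ) :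
    swindle c' s' h' g' (fun m => k (φ m)) n = k (swindle c s h g φ n) := by
  have hg' : ∀ x, k (g.symm x) = g'.symm (k x) := fun x => by
    rw [Equiv.eq_symm_apply, ← hg, g.apply_symm_apply]
  have e : ∀ x y, pairEquiv c' s' h' g' (k x, k y) =
      (k (pairEquiv c s h g (x, y)).1, k (pairEquiv c s h g (x, y)).2) := fun x y => by
    simp [pairEquiv, rotatedEquiv, hc, hs, hg, hg']
  have e1 : ∀ φ : ℕ → F, onPairs (pairEquiv c' s' h' g') (fun m => k (φ m)) =
      fun n => k (onPairs (pairEquiv c s h g) φ n) := fun φ => by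
    funext n
    simp only [onPairs, Equiv.coe_fn_mk, e]
    split_ifs <;> rfl
  change onTail _ (onPairs _ fun m => k (φ m)) n = k (onTail _ (onPairs _ φ) n)
  rw [e1]
  cases n with
  | zero => rfl
  | succ n => exact congrFun (e1 fun m => onPairs (pairEquiv c s h g) φ (m + 1)) n

end Swindle

/-- Families of functions whose degrees are those of the coordinates `D`. -/
abbrev GradedCoords.Family (D : GradedCoords) (N : GradedSpace) : Type :=
  ∀ i : D.ι, N.sec ⊤ (D.deg i)

namespace GradedCoords.Family

open GradedSpace

variable {D : GradedCoords} {M N : GradedSpace}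

/-- The pull-back of families. -/
def pull (f : M ⟶ N) : D.Family N →+ D.Family M where
  toFun φ i := gpull f (φ i)
  map_zero' := funext fun _ => map_zero _
  map_add' _ _ := funext fun _ => map_add _ _ _

/-- The product of a family with a function. -/
def mul (c : N.sec ⊤ 0) : D.Family N →+ D.Family N where
  toFun φ i := N.mul (zero_add _) c (φ i)
  map_zero' := funext fun _ => map_zero _
  map_add' _ _ := funext fun _ => map_add _ _ _

theorem pull_mul (f : M ⟶ N) (c : N.sec ⊤ 0) (φ : D.Family N) :
    pull f (mul c φ) = mul (gpull f c) (pull f φ) := funext fun _ => f.pull_mul _ _ _ _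

theorem mul_mul_add {c s : N.sec ⊤ 0} (h : N.mul (zero_add 0) c c + N.mul (zero_add 0) s s = N.one ⊤)
    (φ : D.Family N) : mul c (mul c φ) + mul s (mul s φ) = φ := funext fun i => by
  refine Eq.trans ?_ (N.one_mul (φ i))
  rw [← h, map_add, LinearMap.add_apply, N.mul_assoc (zero_add 0) (zero_add _) _ (zero_add _),
    N.mul_assoc (zero_add 0) (zero_add _) _ (zero_add _)]
  rfl

/-- A family for countably many copies of `D` is a sequence of families for `D`. -/
def curry : D.natCoords.Family N ≃ (ℕ → D.Family N) where
  toFun φ n i := φ (toLex (n, i))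
  invFun φ i := φ (ofLex i).1 (ofLex i).2
  left_inv _ := rfl
  right_inv _ := rfl

end GradedCoords.Family

namespace QSpace

open GradedSpace GradedCoords

variable {P E : QSpace}

/-- A `Q`-map from some `Q`-manifold to the open subspace `U`. -/
structure Point {E : QSpace} (U : Opens E.toGradedSpace) where
  src : QSpace
  isGradedManifold : IsGradedManifold src.toGradedSpace
  map : src.toGradedSpace ⟶ E.toGradedSpace
  isQMap : IsQMap map
  mem : ∀ x, map.base x ∈ U

/-- A natural bijection of families of functions on `Q`-manifolds over `U`. -/
structure FamilyAut (D : GradedCoords) {E : QSpace} (U : Opens E.toGradedSpace) where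
  app : ∀ T : Point U, D.Family T.src.toGradedSpace ≃ D.Family T.src.toGradedSpace
  nat : ∀ (T S : Point U) (k : S.src.toGradedSpace ⟶ T.src.toGradedSpace), IsQMap k →
    k ≫ T.map = S.map → ∀ φ, Family.pull k (app T φ) = app S (Family.pull k φ)

variable {p : P.toGradedSpace ⟶ E.toGradedSpace} {U : Opens E.toGradedSpace} {D : GradedCoords}
  {ζ ζ' : ∀ i, P.sec (Opens.comap p.base U) (D.deg i)}

/-- The `Q`-map with given fibre coordinates. -/
noncomputable def IsFreeOver.hom (hp : IsFreeOver p U D ζ) (T : Point U)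
    (φ : D.Family T.src.toGradedSpace) : T.src.toGradedSpace ⟶ P.toGradedSpace :=
  (hp.exists_hom T.isGradedManifold T.isQMap T.mem φ).choose

theorem IsFreeOver.hom_mem (hp : IsFreeOver p U D ζ) (T : Point U)
    (φ : D.Family T.src.toGradedSpace) (x : T.src.toGradedSpace) :
    (hp.hom T φ).base x ∈ Opens.comap p.base U :=
  (hp.exists_hom T.isGradedManifold T.isQMap T.mem φ).choose_spec.2.2.choose x

theorem IsFreeOver.pullOn_hom (hp : IsFreeOver p U D ζ) (T : Point U)
    (φ : D.Family T.src.toGradedSpace) (i : D.ι) : pullOn (hp.hom T φ) (hp.hom_mem T φ) (ζ i) = φ i :=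
  (hp.exists_hom T.isGradedManifold T.isQMap T.mem φ).choose_spec.2.2.choose_spec i

theorem IsFreeOver.eq_hom (hp : IsFreeOver p U D ζ) (T : Point U)
    (φ : D.Family T.src.toGradedSpace) {h : T.src.toGradedSpace ⟶ P.toGradedSpace} (hQ : IsQMap h)
    (hh : h ≫ p = T.map) (ht : ∀ x, h.base x ∈ Opens.comap p.base U)
    (hφ : ∀ i, pullOn h ht (ζ i) = φ i) : h = hp.hom T φ := by
  have hs := (hp.exists_hom T.isGradedManifold T.isQMap T.mem φ).choose_spec
  exact (hp _ T.isGradedManifold T.map T.isQMap T.mem φ).unique ⟨hQ, hh, fun _ => hφ⟩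
    ⟨hs.1, hs.2.1, fun _ => hp.pullOn_hom T φ⟩

theorem IsFreeOver.isQMap_hom (hp : IsFreeOver p U D ζ) (T : Point U)
    (φ : D.Family T.src.toGradedSpace) : IsQMap (hp.hom T φ) :=
  (hp.exists_hom T.isGradedManifold T.isQMap T.mem φ).choose_spec.1

theorem IsFreeOver.hom_comp (hp : IsFreeOver p U D ζ) (T : Point U)
    (φ : D.Family T.src.toGradedSpace) : hp.hom T φ ≫ p = T.map :=
  (hp.exists_hom T.isGradedManifold T.isQMap T.mem φ).choose_spec.2.1

/-- The change of fibre coordinates. -/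
noncomputable def IsFreeOver.change (hp : IsFreeOver p U D ζ) (hp' : IsFreeOver p U D ζ') :
    FamilyAut D U where
  app T :=
    { toFun := fun φ i => pullOn (hp.hom T φ) (hp.hom_mem T φ) (ζ' i)
      invFun := fun φ i => pullOn (hp'.hom T φ) (hp'.hom_mem T φ) (ζ i)
      left_inv := fun φ => funext fun i => by
        have e : hp.hom T φ = hp'.hom T fun i => pullOn (hp.hom T φ) (hp.hom_mem T φ) (ζ' i) :=
          hp'.eq_hom T _ (hp.isQMap_hom T φ) (hp.hom_comp T φ) (hp.hom_mem T φ) fun _ => rfl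
        exact (pullOn_congr e (hp.hom_mem T φ) _ (ζ i)).symm.trans (hp.pullOn_hom T φ i)
      right_inv := fun φ => funext fun i => by
        have e : hp'.hom T φ = hp.hom T fun i => pullOn (hp'.hom T φ) (hp'.hom_mem T φ) (ζ i) :=
          hp.eq_hom T _ (hp'.isQMap_hom T φ) (hp'.hom_comp T φ) (hp'.hom_mem T φ) fun _ => rfl
        exact (pullOn_congr e (hp'.hom_mem T φ) _ (ζ' i)).symm.trans (hp'.pullOn_hom T φ i) }
  nat T S k hk hkT φ := funext fun i => by
    have t : ∀ x, (k ≫ hp.hom T φ).base x ∈ Opens.comap p.base U := fun x => hp.hom_mem T φ _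
    have e : k ≫ hp.hom T φ = hp.hom S (Family.pull k φ) := by
      refine hp.eq_hom S _ (IsQMap.comp hk (hp.isQMap_hom T φ)) ?_ t fun i => ?_
      · rw [Category.assoc, hp.hom_comp, hkT]
      · rw [pullOn_comp' k _ t (hp.hom_mem T φ), hp.pullOn_hom]
        rfl
    exact (pullOn_comp' k _ t (hp.hom_mem T φ) (ζ' i)).symm.trans (pullOn_congr e t _ _)

theorem IsFreeOver.change_app (hp : IsFreeOver p U D ζ) (hp' : IsFreeOver p U D ζ') (T : Point U)
    {h : T.src.toGradedSpace ⟶ P.toGradedSpace} (hQ : IsQMap h) (hh : h ≫ p = T.map)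
    (ht : ∀ x, h.base x ∈ Opens.comap p.base U) :
    (hp.change hp').app T (fun i => pullOn h ht (ζ i)) = fun i => pullOn h ht (ζ' i) :=
  funext fun i => (pullOn_congr (hp.eq_hom T _ hQ hh ht fun _ => rfl) ht _ (ζ' i)).symm

/-- New fibre coordinates from a natural bijection. -/
theorem IsFreeOver.act (hp : IsFreeOver p U D ζ) (hP : IsGradedManifold P.toGradedSpace)
    (hpQ : IsQMap p) (Θ : FamilyAut D U) :
    ∃ η : ∀ i, P.sec (Opens.comap p.base U) (D.deg i), IsFreeOver p U D η ∧
      ∀ (T : Point U) (h : T.src.toGradedSpace ⟶ P.toGradedSpace), IsQMap h → h ≫ p = T.map →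
        ∀ ht : ∀ x, h.base x ∈ Opens.comap p.base U,
        (fun i => pullOn h ht (η i)) = Θ.app T fun i => pullOn h ht (ζ i) := by
  let W : Opens P.toGradedSpace := Opens.comap p.base U
  have hW : W ≤ openImage W ⊤ := fun x hx => ⟨⟨x, hx⟩, trivial, rfl⟩
  have t0 : ∀ x, (incl P.toGradedSpace W).base x ∈ W := fun x => Subtype.property (p := (· ∈ W)) x
  let T₀ : Point U := ⟨P.restrict W, hP.restrict W, incl P.toGradedSpace W ≫ p,
    IsQMap.comp (L := P.restrict W) (isQMap_incl P W) hpQ, t0⟩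
  let ζ₀ : D.Family (P.toGradedSpace.restrict W) := fun i => pullOn (incl P.toGradedSpace W) t0 (ζ i)
  let η₀ : D.Family (P.toGradedSpace.restrict W) := Θ.app T₀ ζ₀
  have key : ∀ (T : Point U) (h : T.src.toGradedSpace ⟶ P.toGradedSpace), IsQMap h → h ≫ p = T.map →
      ∀ ht : ∀ x, h.base x ∈ Opens.comap p.base U,
      (fun i => pullOn h ht (P.res hW (η₀ i))) = Θ.app T fun i => pullOn h ht (ζ i) := by
    intro T h hQ hh ht
    have e : lift h W ht ≫ incl P.toGradedSpace W = h := lift_incl h W ht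
    have t1 : ∀ x, (lift h W ht ≫ incl P.toGradedSpace W).base x ∈ W := ht
    have hl : IsQMap (M := T.src) (N := P.restrict W) (lift h W ht) :=
      isQMap_of_incl (IsQMap.congr e.symm hQ)
    have h1 := Θ.nat T₀ T (lift h W ht) hl ((Category.assoc _ _ _).symm.trans
      ((congrArg (· ≫ p) e).trans hh)) ζ₀
    have h2 : Family.pull (lift h W ht) ζ₀ = fun i => pullOn h ht (ζ i) := funext fun i =>
      (pullOn_comp' (lift h W ht) _ t1 t0 (ζ i)).symm.trans (pullOn_congr e t1 ht _)
    refine Eq.trans (funext fun i => ?_) (h1.trans (congrArg (Θ.app T) h2))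
    exact (pullOn_congr e t1 ht _).symm.trans ((pullOn_comp' (lift h W ht) _ t1 t0 _).trans
      (congrArg (gpull (lift h W ht)) (pullOn_incl t0 (η₀ i))))
  refine ⟨fun i => P.res hW (η₀ i), hp.transfer le_rfl fun N hN f hf hfU φ' =>
    ⟨(Θ.app ⟨N, hN, f, hf, hfU⟩).symm φ', fun h hQ hh ht ht' => ?_⟩, key⟩
  have h1 := key ⟨N, hN, f, hf, hfU⟩ h hQ hh ht'
  constructor
  · intro H i
    have h2 : (fun i => pullOn h ht' (ζ i)) = (Θ.app ⟨N, hN, f, hf, hfU⟩).symm φ' := funext H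
    rw [h2, Equiv.apply_symm_apply] at h1
    exact congrFun h1 i
  · intro H i
    have h2 : (fun i => pullOn h ht' (P.res hW (η₀ i))) = φ' := funext H
    rw [h2] at h1
    rw [h1, Equiv.symm_apply_apply]

/-- Fibre coordinates over the members of a cover that agree on the overlaps. -/
theorem exists_isFreeOver_of_cover {I : Type} {O : I → Opens E.toGradedSpace}
    {ζ : ∀ a i, P.sec (Opens.comap p.base (O a)) (D.deg i)} (hO : ∀ a, O a ≤ U)
    (hU : ∀ x ∈ U, ∃ a, x ∈ O a) (hζ : ∀ a, IsFreeOver p (O a) D (ζ a))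
    (h : ∀ a b i, P.res (inf_le_left : Opens.comap p.base (O a) ⊓ Opens.comap p.base (O b) ≤ _) (ζ a i) =
      P.res (inf_le_right : Opens.comap p.base (O a) ⊓ Opens.comap p.base (O b) ≤ _) (ζ b i)) :
    ∃ η : ∀ i, P.sec (Opens.comap p.base U) (D.deg i), IsFreeOver p U D η := by
  choose η hη using fun i => P.gluing (fun a => Opens.comap p.base (O a)) (fun a => comap_mono p (hO a))
    (fun x hx => by
      obtain ⟨a, ha⟩ := hU _ hx
      exact Opens.mem_iSup.2 ⟨a, ha⟩) (fun a => ζ a i) (fun a b => h a b i)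
  refine ⟨η, isFreeOver_of_cover hO hU fun a => ?_⟩
  have e : (fun i => P.res (comap_mono p (hO a)) (η i)) = ζ a := funext fun i => hη i a
  rw [e]
  exact hζ a

end QSpace

namespace QSpace

open GradedSpace GradedCoords

variable {P E : QSpace} {p : P.toGradedSpace ⟶ E.toGradedSpace} {U : Opens E.toGradedSpace}
  {D : GradedCoords}

theorem pullOn_one {M N : GradedSpace} (f : M ⟶ N) {V : Opens N} (hV : ∀ x, f.base x ∈ V) :
    pullOn f hV (N.one V) = M.one ⊤ := f.pull_one _

section

variable {c s : E.sec U 0}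

theorem pullOn_mul_add (h : E.mul (zero_add 0) c c + E.mul (zero_add 0) s s = E.one U) (T : Point U) :
    T.src.mul (zero_add 0) (pullOn T.map T.mem c) (pullOn T.map T.mem c) +
      T.src.mul (zero_add 0) (pullOn T.map T.mem s) (pullOn T.map T.mem s) = T.src.one ⊤ := by
  rw [← pullOn_mul, ← pullOn_mul, ← map_add, h, pullOn_one]

/-- The deformation of `(g, 1, 1, …)` to the identity, where `c` and `s` are the coordinates of a
rotating unit vector. -/
noncomputable def swindleAut (h : E.mul (zero_add 0) c c + E.mul (zero_add 0) s s = E.one U)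
    (g : FamilyAut D U) : FamilyAut D.natCoords U where
  app T := Family.curry.trans ((swindle (Family.mul (pullOn T.map T.mem c))
    (Family.mul (pullOn T.map T.mem s)) (Family.mul_mul_add (pullOn_mul_add h T)) (g.app T)).trans
    Family.curry.symm)
  nat T S k hk hkT φ := by
    have e : ∀ a : E.sec U 0, gpull k (pullOn T.map T.mem a) = pullOn S.map S.mem a := fun a => by
      have t : ∀ x, (k ≫ T.map).base x ∈ U := fun x => T.mem _
      exact (pullOn_comp' k T.map t T.mem a).symm.trans (pullOn_congr hkT t S.mem a)
    have e' : ∀ (a : E.sec U 0) (φ : D.Family T.src.toGradedSpace),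
        Family.pull k (Family.mul (pullOn T.map T.mem a) φ) =
          Family.mul (pullOn S.map S.mem a) (Family.pull k φ) := fun a φ => by
      rw [Family.pull_mul, e]
    refine Family.curry.injective (funext fun n => ?_)
    exact (swindle_map (Family.pull k) (e' c) (e' s) (g.nat T S k hk hkT) (Family.curry φ) n).symm

theorem swindleAut_app_left (h : E.mul (zero_add 0) c c + E.mul (zero_add 0) s s = E.one U)
    (g : FamilyAut D U) (T : Point U) (hc : pullOn T.map T.mem c = T.src.one ⊤)
    (hs : pullOn T.map T.mem s = 0) (φ : D.natCoords.Family T.src.toGradedSpace) :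
    (swindleAut h g).app T φ = φ := by
  have e := swindle_apply_of_left (c := Family.mul (pullOn T.map T.mem c))
    (s := Family.mul (pullOn T.map T.mem s)) (h := Family.mul_mul_add (pullOn_mul_add h T))
    (g := g.app T) (fun x => ?_) (fun x => ?_) (Family.curry φ)
  · exact Family.curry.injective e
  · rw [hc]
    exact funext fun i => T.src.one_mul _
  · rw [hs]
    exact funext fun i => by
      change T.src.mul _ 0 _ = 0
      rw [map_zero, LinearMap.zero_apply]

theorem swindleAut_app_right (h : E.mul (zero_add 0) c c + E.mul (zero_add 0) s s = E.one U)
    (g : FamilyAut D U) (T : Point U) (hc : pullOn T.map T.mem c = 0)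
    (hs : pullOn T.map T.mem s = T.src.one ⊤) (φ : D.natCoords.Family T.src.toGradedSpace) (n : ℕ) :
    Family.curry ((swindleAut h g).app T φ) n =
      Nat.casesOn n (g.app T (Family.curry φ 0)) fun m => Family.curry φ (m + 1) := by
  refine swindle_apply_of_right (fun x => ?_) (fun x => ?_) _ n
  · rw [hc]
    exact funext fun i => by
      change T.src.mul _ 0 _ = 0
      rw [map_zero, LinearMap.zero_apply]
  · rw [hs]
    exact funext fun i => T.src.one_mul _

end

theorem res_eq_of_point {V : Opens P.toGradedSpace} {k : ℤ} {A B : Opens P.toGradedSpace} (hA : V ≤ A)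
    (hB : V ≤ B) {a : P.sec A k} {b : P.sec B k}
    (h : ∀ (tA : ∀ x, (incl P.toGradedSpace V).base x ∈ A) (tB : ∀ x, (incl P.toGradedSpace V).base x ∈ B),
      pullOn (incl P.toGradedSpace V) tA a = pullOn (incl P.toGradedSpace V) tB b) :
    P.res hA a = P.res hB b := by
  have h1 := h (fun x => hA (Subtype.property (p := (· ∈ V)) x))
    fun x => hB (Subtype.property (p := (· ∈ V)) x)
  have hV : V ≤ openImage V ⊤ := fun x hx => ⟨⟨x, hx⟩, trivial, rfl⟩
  have hV' : openImage V ⊤ ≤ V := by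
    rintro _ ⟨x, _, rfl⟩
    exact x.2
  have h2 : P.res (hV'.trans hA) a = P.res (hV'.trans hB) b := h1
  have h3 := congrArg (P.res hV) h2
  rwa [P.res_res, P.res_res] at h3

variable {P' : QSpace} {p' : P'.toGradedSpace ⟶ P.toGradedSpace}

theorem pullOn_consFamily {ζ : ∀ i, P.sec (Opens.comap p.base U) (D.deg i)}
    {y : ∀ i, P'.sec (Opens.comap p'.base ⊤) (D.natCoords.deg i)} {N : GradedSpace}
    (h : N ⟶ P'.toGradedSpace) (t : ∀ x, h.base x ∈ Opens.comap (p' ≫ p).base U)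
    (t' : ∀ x, (h ≫ p').base x ∈ Opens.comap p.base U) (ht : ∀ x, h.base x ∈ Opens.comap p'.base ⊤)
    (n : ℕ) :
    Family.curry (fun i => pullOn h t (consFamily p' p ζ y i)) n =
      Nat.casesOn n (fun i => pullOn (h ≫ p') t' (ζ i)) fun m i => pullOn h ht (y (toLex (m, i))) := by
  cases n with
  | zero => exact funext fun i => (pullOn_comp h p' t' (ζ i)).symm
  | succ n => exact funext fun i => pullOn_res h t ht _ (y (toLex (n, i)))

/-- Fibre coordinates over two open sets can be modified, after adding countably many families of
coordinates, to fibre coordinates over the union. -/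
theorem exists_isFreeOver_sup (hpQ : IsQMap p) (hP' : IsGradedManifold P'.toGradedSpace)
    (hpQ' : IsQMap p') {y : ∀ i, P'.sec (Opens.comap p'.base ⊤) (D.natCoords.deg i)}
    (hy : IsFreeOver p' ⊤ D.natCoords y) {O₁ O₂ W₁ W₂ : Opens E.toGradedSpace} (h₁ : W₁ ≤ O₁)
    (h₂ : W₂ ≤ O₂) (hW : W₁ ⊓ W₂ = ⊥) (hO : ∀ x ∈ O₁ ⊔ O₂, x ∈ W₁ ∨ x ∈ O₁ ⊓ O₂ ∨ x ∈ W₂)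
    {ζ₁ : ∀ i, P.sec (Opens.comap p.base O₁) (D.deg i)} (hζ₁ : IsFreeOver p O₁ D ζ₁)
    {ζ₂ : ∀ i, P.sec (Opens.comap p.base O₂) (D.deg i)} (hζ₂ : IsFreeOver p O₂ D ζ₂)
    {c s : E.sec (O₁ ⊓ O₂) 0} (h : E.mul (zero_add 0) c c + E.mul (zero_add 0) s s = E.one _)
    (hc₁ : E.res (inf_le_left : (O₁ ⊓ O₂) ⊓ W₁ ≤ _) c = E.one _)
    (hs₁ : E.res (inf_le_left : (O₁ ⊓ O₂) ⊓ W₁ ≤ _) s = 0)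
    (hc₂ : E.res (inf_le_left : (O₁ ⊓ O₂) ⊓ W₂ ≤ _) c = 0)
    (hs₂ : E.res (inf_le_left : (O₁ ⊓ O₂) ⊓ W₂ ≤ _) s = E.one _) :
    ∃ η : ∀ i, P'.sec (Opens.comap (p' ≫ p).base (O₁ ⊔ O₂)) (D.natCoords.deg i),
      IsFreeOver (P := P') (E := E) (p' ≫ p) (O₁ ⊔ O₂) D.natCoords η := by
  have hQ : IsQMap (M := P') (N := E) (p' ≫ p) := IsQMap.comp hpQ' hpQ
  have g₁ := hζ₁.mono (inf_le_left : O₁ ⊓ O₂ ≤ O₁)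
  have g₂ := hζ₂.mono (inf_le_right : O₁ ⊓ O₂ ≤ O₂)
  have f₁ := IsFreeOver.cons hζ₁ hpQ hy hpQ'
  have f₂ := IsFreeOver.cons hζ₂ hpQ hy hpQ'
  obtain ⟨η, hη, hη'⟩ := (IsFreeOver.cons g₁ hpQ hy hpQ').act hP' hQ (swindleAut h (g₁.change g₂))
  have key₁ : ∀ (T : Point (O₁ ⊓ O₂)), (∀ x, T.map.base x ∈ W₁) →
      ∀ k : T.src.toGradedSpace ⟶ P'.toGradedSpace, IsQMap k → k ≫ p' ≫ p = T.map →
      ∀ (t : ∀ x, k.base x ∈ Opens.comap (p' ≫ p).base (O₁ ⊓ O₂))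
        (t₁ : ∀ x, k.base x ∈ Opens.comap (p' ≫ p).base O₁) (i : D.natCoords.ι),
      pullOn k t (η i) = pullOn k t₁ (consFamily p' p ζ₁ y i) := fun T hT k hk hkT t t₁ i => by
    have tT : ∀ x, T.map.base x ∈ (O₁ ⊓ O₂) ⊓ W₁ := fun x => ⟨T.mem x, hT x⟩
    have e1 := hη' T k hk hkT t
    rw [swindleAut_app_left h _ T] at e1
    · refine (congrFun e1 i).trans ?_
      have a1 := pullOn_consFamily (p := p) (p' := p')
        (ζ := fun i => P.res (comap_mono p (inf_le_left : O₁ ⊓ O₂ ≤ O₁)) (ζ₁ i)) (y := y)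
        k t t (fun _ => trivial) (ofLex i).1
      have a2 := pullOn_consFamily (p := p) (p' := p') (ζ := ζ₁) (y := y) k t₁ t₁ (fun _ => trivial)
        (ofLex i).1
      refine congrFun (a1.trans (Eq.trans ?_ a2.symm)) (ofLex i).2
      congr 1
      exact funext fun i => pullOn_res (k ≫ p') t t₁ _ _
    · rw [← pullOn_res T.map tT T.mem inf_le_left, hc₁, pullOn_one]
    · rw [← pullOn_res T.map tT T.mem inf_le_left, hs₁, map_zero]
  have key₂ : ∀ (T : Point (O₁ ⊓ O₂)), (∀ x, T.map.base x ∈ W₂) →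
      ∀ k : T.src.toGradedSpace ⟶ P'.toGradedSpace, IsQMap k → k ≫ p' ≫ p = T.map →
      ∀ (t : ∀ x, k.base x ∈ Opens.comap (p' ≫ p).base (O₁ ⊓ O₂))
        (t₂ : ∀ x, k.base x ∈ Opens.comap (p' ≫ p).base O₂) (i : D.natCoords.ι),
      pullOn k t (η i) = pullOn k t₂ (consFamily p' p ζ₂ y i) := fun T hT k hk hkT t t₂ i => by
    have tT : ∀ x, T.map.base x ∈ (O₁ ⊓ O₂) ⊓ W₂ := fun x => ⟨T.mem x, hT x⟩
    have e1 := hη' T k hk hkT t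
    have e2 := swindleAut_app_right h (g₁.change g₂) T (by
      rw [← pullOn_res T.map tT T.mem inf_le_left, hc₂, map_zero]) (by
      rw [← pullOn_res T.map tT T.mem inf_le_left, hs₂, pullOn_one])
      (fun i => pullOn k t (consFamily p' p (fun i => P.res (comap_mono p inf_le_left) (ζ₁ i)) y i))
      (ofLex i).1
    have a1 := fun n => pullOn_consFamily (p := p) (p' := p')
        (ζ := fun i => P.res (comap_mono p (inf_le_left : O₁ ⊓ O₂ ≤ O₁)) (ζ₁ i)) (y := y)
        k t t (fun _ => trivial) n
    have a2 := pullOn_consFamily (p := p) (p' := p') (ζ := ζ₂) (y := y) k t₂ t₂ (fun _ => trivial)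
        (ofLex i).1
    refine (congrFun e1 i).trans (congrFun (e2.trans (Eq.trans ?_ a2.symm)) (ofLex i).2)
    rw [a1]
    have hkp : (k ≫ p') ≫ p = T.map := (Category.assoc _ _ _).trans hkT
    have a3 := g₁.change_app g₂ T (IsQMap.comp hk hpQ') hkp t
    cases (ofLex i).1 with
    | zero => exact a3.trans (funext fun i => pullOn_res (k ≫ p') t t₂ _ _)
    | succ n => exact a1 (n + 1)
  have glue : ∀ {W O : Opens E.toGradedSpace} (hWO : W ≤ O)
      {θ : ∀ i, P'.sec (Opens.comap (p' ≫ p).base O) (D.natCoords.deg i)},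
      (∀ (T : Point (O₁ ⊓ O₂)), (∀ x, T.map.base x ∈ W) →
      ∀ k : T.src.toGradedSpace ⟶ P'.toGradedSpace, IsQMap k → k ≫ p' ≫ p = T.map →
      ∀ (t : ∀ x, k.base x ∈ Opens.comap (p' ≫ p).base (O₁ ⊓ O₂))
        (t₁ : ∀ x, k.base x ∈ Opens.comap (p' ≫ p).base O) (i : D.natCoords.ι),
      pullOn k t (η i) = pullOn k t₁ (θ i)) → ∀ {V : Opens P'.toGradedSpace}
      (hV : V ≤ Opens.comap (p' ≫ p).base (O₁ ⊓ O₂)) (hV' : V ≤ Opens.comap (p' ≫ p).base W) i,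
      P'.res hV (η i) = P'.res hV' (P'.res (comap_mono _ hWO) (θ i)) := by
    intro W O hWO θ H V hV hV' i
    rw [P'.res_res]
    refine res_eq_of_point _ _ fun tA tB => ?_
    exact H ⟨P'.restrict V, hP'.restrict V, incl P'.toGradedSpace V ≫ p' ≫ p,
      IsQMap.comp (L := P'.restrict V) (isQMap_incl P' V) hQ, tA⟩
      (fun x => hV' (Subtype.property (p := (· ∈ V)) x)) (incl P'.toGradedSpace V) (isQMap_incl P' V)
      rfl tA tB i
  have hV₀ : ∀ {V A B : Opens P'.toGradedSpace} (hA : V ≤ A) (hB : V ≤ B) {k : ℤ} (a : P'.sec A k)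
      (b : P'.sec B k), V ≤ Opens.comap (p' ≫ p).base W₁ → V ≤ Opens.comap (p' ≫ p).base W₂ →
      P'.res hA a = P'.res hB b := fun {_ _ _} _ _ {_} _ _ b₁ b₂ =>
    sec_ext fun x hx => (hW.le ⟨b₁ hx, b₂ hx⟩ : _ ∈ (⊥ : Opens E.toGradedSpace)).elim
  refine exists_isFreeOver_of_cover (P := P') (p := p' ≫ p) (I := Option Bool)
    (O := fun a => Option.casesOn a (O₁ ⊓ O₂) fun b => Bool.casesOn b W₁ W₂)
    (ζ := fun a => Option.rec (motive := fun a => ∀ i, P'.sec (Opens.comap (p' ≫ p).base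
      (Option.casesOn a (O₁ ⊓ O₂) fun b => Bool.casesOn b W₁ W₂)) (D.natCoords.deg i)) η
      (fun b => Bool.rec (fun i => P'.res (comap_mono _ h₁) (consFamily p' p ζ₁ y i))
        (fun i => P'.res (comap_mono _ h₂) (consFamily p' p ζ₂ y i)) b) a) ?_ ?_ ?_ ?_
  · rintro (_ | _ | _)
    · exact inf_le_left.trans le_sup_left
    · exact h₁.trans le_sup_left
    · exact h₂.trans le_sup_right
  · intro x hx
    rcases hO x hx with hx | hx | hx
    · exact ⟨some false, hx⟩
    · exact ⟨none, hx⟩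
    · exact ⟨some true, hx⟩
  · rintro (_ | _ | _)
    · exact hη
    · exact f₁.mono h₁
    · exact f₂.mono h₂
  · rintro (_ | _ | _) (_ | _ | _) i
    · rfl
    · exact glue h₁ key₁ _ _ i
    · exact glue h₂ key₂ _ _ i
    · exact (glue h₁ key₁ _ _ i).symm
    · rfl
    · exact hV₀ _ _ _ _ inf_le_left inf_le_right
    · exact (glue h₂ key₂ _ _ i).symm
    · exact hV₀ _ _ _ _ inf_le_right inf_le_left
    · rfl

end QSpace

namespace GradedCoords

open GradedSpace

/-- Functions of finitely many of the degree zero coordinates, locally. -/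
def IsSmooth {C : GradedCoords} {U : Opens C.toGradedSpace} (g : U → ℝ) : Prop :=
  ∀ x : U, ∃ (J : Finset {i : C.ι // C.deg i = 0}), ∃ V ∈ nhds x, ∃ G : (J → ℝ) → ℝ,
    ContDiff ℝ ∞ G ∧ ∀ y ∈ V, g y = G fun j => C.toBody y.1 j

open Classical in
/-- A smooth function of the degree zero coordinates as a section. -/
noncomputable def ofBody {C : GradedCoords} {U : Opens C.toGradedSpace} (g : U → ℝ) (hg : IsSmooth g) :
    C.toGradedSpace.sec U 0 :=
  (⟨fun α y => if α = 0 then g y else 0, fun α hα => by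
    obtain rfl : α = 0 := by
      by_contra h
      exact hα (funext fun y => if_neg h)
    exact ⟨fun i => ⟨fun _ => rfl, fun _ => Nat.zero_le _⟩, by simp [totalDeg]⟩, fun x => by
    obtain ⟨J, V, hV, G, hG, hg⟩ := hg x
    refine ⟨J, ∅, V, hV, fun α hα y _ => if_neg ?_, fun α => ?_⟩
    · rintro rfl
      exact hα (by simp)
    · refine ⟨fun z => if α = 0 then G z else 0, ?_, fun y hy => ?_⟩
      · split_ifs
        · exact hG
        · exact contDiff_const
      · simp only [hg y hy]⟩ : C.functions U 0)

section ofBody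

variable {C : GradedCoords} {U : Opens C.toGradedSpace} {g g' : U → ℝ} {hg : IsSmooth g} {hg' : IsSmooth g'}

theorem series_ofBody (y : U) : series (ofBody g hg) 0 y = g y := by
  classical
  change (if (0 : C.ι →₀ ℕ) = 0 then g y else 0) = g y
  exact if_pos rfl

theorem ofBody_mul_add (h : ∀ y, g y * g y + g' y * g' y = 1) :
    C.toGradedSpace.mul (zero_add 0) (ofBody g hg) (ofBody g hg) +
      C.toGradedSpace.mul (zero_add 0) (ofBody g' hg') (ofBody g' hg') = C.toGradedSpace.one U := by
  classical
  have h0 : C.Admissible 0 := fun i => ⟨fun _ => rfl, fun _ => Nat.zero_le _⟩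
  have key : ∀ (u : U → ℝ) γ y, C.mulSeries (fun α y => if α = 0 then u y else 0)
      (fun α y => if α = 0 then u y else 0) γ y = if γ = 0 then u y * u y else 0 := fun u γ y => by
    by_cases hγ : γ = 0
    · subst hγ
      simp [mulSeries, h0, crossings]
    · rw [if_neg hγ]
      unfold mulSeries
      split_ifs
      · refine Finset.sum_eq_zero fun q hq => ?_
        rw [Finset.HasAntidiagonal.mem_antidiagonal] at hq
        by_cases hq1 : q.1 = 0
        · have hq2 : q.2 ≠ 0 := fun h => hγ (by rw [← hq, hq1, h, add_zero])
          simp [hq2]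
        · simp [hq1]
      · rfl
  refine Subtype.ext (funext fun γ => funext fun y => ?_)
  refine (congrArg₂ (· + ·) (key g γ y) (key g' γ y)).trans ?_
  change _ = oneSeries _ γ y
  by_cases hγ : γ = 0
  · simp only [hγ, if_true, oneSeries]
    exact h y
  · simp [hγ, oneSeries]

theorem res_ofBody_one {V : Opens C.toGradedSpace} (hV : V ≤ U) (h : ∀ y (hy : y ∈ V), g ⟨y, hV hy⟩ = 1) :
    C.toGradedSpace.res (U := U) (V := V) hV (ofBody g hg) = C.toGradedSpace.one V := by
  classical
  refine Subtype.ext (funext fun γ => funext fun y => ?_)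
  change (if γ = 0 then g ⟨y.1, hV y.2⟩ else 0) = oneSeries V γ y
  rw [h y.1 y.2]
  rfl

theorem res_ofBody_zero {V : Opens C.toGradedSpace} (hV : V ≤ U) (h : ∀ y (hy : y ∈ V), g ⟨y, hV hy⟩ = 0) :
    C.toGradedSpace.res (U := U) (V := V) hV (ofBody g hg) = 0 := by
  classical
  refine Subtype.ext (funext fun γ => funext fun y => ?_)
  change (if γ = 0 then g ⟨y.1, hV y.2⟩ else 0) = 0
  rw [h y.1 y.2, ite_self]

end ofBody

/-- Countably many coordinates of degree zero. -/
def realCoords : GradedCoords where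
  ι := ℕ
  deg _ := 0

end GradedCoords

namespace GradedSpace

open GradedCoords

variable {M N : GradedSpace}

/-- The value of a function of degree zero at a point. -/
noncomputable def value (hM : IsGradedManifold M) (s : M.sec ⊤ 0) (x : M) : ℝ :=
  realCoords.toBody ((hM.hasCoordHoms realCoords fun _ => s).choose.base x) ⟨(0 : ℕ), rfl⟩

theorem exists_value (hM : IsGradedManifold M) (s : M.sec ⊤ 0) :
    ∃ f : M ⟶ realCoords.toGradedSpace, (∀ i, gpull f (realCoords.coord i ⊤) = s) ∧
      ∀ x, value hM s x = realCoords.toBody (f.base x) ⟨(0 : ℕ), rfl⟩ :=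
  ⟨_, (hM.hasCoordHoms realCoords fun _ => s).choose_spec.1, fun _ => rfl⟩

theorem value_gpull (hM : IsGradedManifold M) (hN : IsGradedManifold N) (f : M ⟶ N) (s : N.sec ⊤ 0)
    (x : M) : value hM (gpull f s) x = value hN s (f.base x) := by
  obtain ⟨a, ha, ha'⟩ := exists_value hM (gpull f s)
  obtain ⟨b, hb, hb'⟩ := exists_value hN s
  have e : a = f ≫ b := coord_hom_ext hM fun i =>
    (ha i).trans ((congrArg (gpull f) (hb i)).symm.trans (gpull_comp f b _).symm)
  rw [ha', hb', e]
  rfl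

theorem value_coords (C : GradedCoords) (s : C.toGradedSpace.sec ⊤ 0) (y : C.toGradedSpace) :
    value C.isGradedManifold s y = series s 0 ⟨y, trivial⟩ := by
  obtain ⟨b, hb, hb'⟩ := exists_value C.isGradedManifold s
  rw [hb', base_apply, ← hb (0 : ℕ)]
  rfl

theorem value_zero (hM : IsGradedManifold M) (x : M) : value hM 0 x = 0 := by
  obtain ⟨a, ha, -⟩ := exists_value hM (0 : M.sec ⊤ 0)
  have h := value_gpull hM realCoords.isGradedManifold a 0 x
  rw [map_zero, value_coords] at h
  exact h

theorem toBody_apply (hM : IsGradedManifold M) (f : M ⟶ realCoords.toGradedSpace) (n : ℕ) (x : M) :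
    realCoords.toBody (f.base x) ⟨n, rfl⟩ = value hM (gpull f (realCoords.coord n ⊤)) x := by
  classical
  have e := value_gpull hM realCoords.isGradedManifold f (realCoords.coord n ⊤) x
  refine Eq.trans ?_ e.symm
  refine Eq.trans ?_ (value_coords realCoords (realCoords.coord n ⊤) (f.base x)).symm
  change _ = if (0 : ℕ →₀ ℕ) = 0 then realCoords.toBody (f.base x) ⟨n, rfl⟩ else 0
  exact (if_pos rfl).symm

theorem continuous_value (hM : IsGradedManifold M) (s : M.sec ⊤ 0) : Continuous (value hM s) :=
  (continuous_apply (A := fun _ : {i : realCoords.ι // realCoords.deg i = 0} => ℝ) _).comp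
    (hM.hasCoordHoms realCoords fun _ => s).choose.base.continuous

end GradedSpace

namespace GradedSpace

open GradedCoords

variable {M : GradedSpace}

theorem exists_bump (hM : IsGradedManifold M) (x : M) {G : Set M} (hG : IsOpen G) (hx : x ∈ G) :
    ∃ b : M.sec ⊤ 0, value hM b x = 1 ∧ ∀ z ∉ G, value hM b z = 0 := by
  obtain ⟨U, hxU, C, W, ⟨e⟩⟩ := hM.2.2 x
  have := hM.1
  obtain ⟨K, hK, hKc, hKG⟩ := exists_mem_nhds_isClosed_subset ((hG.inter U.isOpen).mem_nhds ⟨hx, hxU⟩)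
  let f : M.restrict U ⟶ C.toGradedSpace := e.hom ≫ incl _ W
  have hf : Topology.IsOpenEmbedding f.base :=
    (W.isOpenEmbedding' : Topology.IsOpenEmbedding (Subtype.val : W → C.toGradedSpace)).comp
      (homeoOfIso e).isOpenEmbedding
  let y₀ : C.Body := f.base ⟨x, hxU⟩
  have hS : f.base '' (Subtype.val ⁻¹' K) ∈ nhds y₀ := hf.isOpenMap.image_mem_nhds
    (continuous_subtype_val.continuousAt.preimage_mem_nhds hK)
  have hpi : ∀ S : Set C.Body, S ∈ nhds y₀ → ∃ I : Set {i : C.ι // C.deg i = 0}, I.Finite ∧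
      ∃ t : {i : C.ι // C.deg i = 0} → Set ℝ, (∀ i, t i ∈ nhds (y₀ i)) ∧ I.pi t ⊆ S := fun S hS => by
    rwa [nhds_pi, Filter.mem_pi] at hS
  obtain ⟨I, hI, t, ht, hIt⟩ := hpi _ hS
  choose ε hε hεt using fun i => Metric.mem_nhds_iff.1 (ht i)
  let φ : {i : C.ι // C.deg i = 0} → ℝ → ℝ := fun j r =>
    Real.smoothTransition (1 - (2 * (r - y₀ j) / ε j) ^ 2)
  have hφ : ∀ j, ContDiff ℝ ∞ (φ j) := fun j => Real.smoothTransition.contDiff.comp (by fun_prop)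
  let g : (⊤ : Opens C.toGradedSpace) → ℝ := fun y => ∏ j ∈ hI.toFinset, φ j (C.toBody y.1 j)
  have hg : IsSmooth g := fun y => ⟨hI.toFinset, Set.univ, Filter.univ_mem,
    fun z => ∏ j : hI.toFinset, φ j.1 (z j),
    contDiff_prod fun j _ => (hφ j.1).comp (contDiff_apply ℝ ℝ j), fun y _ =>
    (Finset.prod_coe_sort hI.toFinset fun j => φ j (C.toBody y.1 j)).symm⟩
  let Y' : Opens C.Body := ⟨⋃ j ∈ I, {y | ε j / 2 < |y j - y₀ j|},
    isOpen_biUnion fun j _ => isOpen_lt continuous_const (by fun_prop)⟩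
  let Y : Opens C.toGradedSpace := Y'
  have hY : ∀ y ∈ Y, g ⟨y, trivial⟩ = 0 := fun y hy => by
    obtain ⟨j, hj, hy⟩ := Set.mem_iUnion₂.1 hy
    refine Finset.prod_eq_zero (i := j) (hI.mem_toFinset.2 hj) ?_
    refine Real.smoothTransition.zero_of_nonpos ?_
    have h1 : 1 < |2 * (C.toBody y j - y₀ j) / ε j| := by
      rw [abs_div, abs_mul, abs_of_pos (hε j), abs_two, lt_div_iff₀ (hε j)]
      have : ε j / 2 < |C.toBody y j - y₀ j| := hy
      linarith
    have h2 := one_lt_sq_iff_one_lt_abs (2 * (C.toBody y j - y₀ j) / ε j) |>.2 h1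
    change 1 - (2 * (C.toBody y j - y₀ j) / ε j) ^ 2 ≤ 0
    linarith
  let b₀ : C.toGradedSpace.sec ⊤ 0 := ofBody g hg
  have hb₀ : C.toGradedSpace.res (U := ⊤) (V := Y) le_top b₀ = 0 := res_ofBody_zero _ hY
  let V : Bool → Opens M := fun a => Bool.rec ⟨Kᶜ, hKc.isOpen_compl⟩ U a
  let s : ∀ a, (M.restrict (V a)).sec ⊤ 0 := fun a =>
    Bool.rec (motive := fun a => (M.restrict (V a)).sec ⊤ 0) 0 (gpull f b₀) a
  have hmix : ∀ (G : Opens M) (hi : G ≤ openImage U ⊤), (∀ z ∈ G, z ∉ K) →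
      M.res hi (gpull f b₀) = 0 := fun G hi hGK => by
    have hG' : G ≤ openImage U (Opens.comap f.base Y) := fun z hz => by
      obtain ⟨z, -, rfl⟩ := hi hz
      refine ⟨z, ?_, rfl⟩
      by_contra hzY
      have h1 : f.base z ∈ f.base '' (Subtype.val ⁻¹' K) := hIt fun j hj => hεt j (by
        rw [Metric.mem_ball, Real.dist_eq]
        by_contra h2
        refine hzY (Set.mem_iUnion₂.2 ⟨j, hj, ?_⟩)
        have := hε j
        change ε j / 2 < |C.toBody (f.base z) j - y₀ j|
        change ¬ |C.toBody (f.base z) j - y₀ j| < ε j at h2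
        linarith)
      obtain ⟨z', hz', h3⟩ := h1
      obtain rfl := hf.injective h3
      exact hGK _ hz hz'
    have h4 : M.res (openImage_mono U le_top) (gpull f b₀) =
        (0 : M.sec (openImage U (Opens.comap f.base Y)) 0) := by
      refine (f.res_pull (le_top : ⊤ ≤ Opens.comap f.base ⊤)
        (le_top : Opens.comap f.base Y ≤ ⊤) b₀).trans ?_
      refine (f.pull_res (U := Y) (U' := ⊤) (le_refl (Opens.comap f.base Y)) le_top b₀).symm.trans ?_
      rw [hb₀, map_zero]
      rfl
    exact (M.res_res (openImage_mono U le_top) hG' _).symm.trans ((congrArg _ h4).trans (map_zero _))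
  obtain ⟨b, hb, -⟩ := exists_glue_sec (V := V) (U := ⊤) (fun _ => ⊤) (fun _ => le_top) (fun z _ => by
    by_cases hz : z ∈ K
    · exact ⟨true, ⟨z, (hKG hz).2⟩, trivial, rfl⟩
    · exact ⟨false, ⟨z, hz⟩, trivial, rfl⟩) s (by
    rintro (_ | _) (_ | _) G hi hj
    · rfl
    · refine (map_zero _).trans (hmix G hj fun z hz => ?_).symm
      obtain ⟨z, -, rfl⟩ := hi hz
      exact z.2
    · refine (hmix G hi fun z hz => ?_).trans (map_zero _).symm
      obtain ⟨z, -, rfl⟩ := hj hz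
      exact z.2
    · rfl)
  refine ⟨b, ?_, fun z hz => ?_⟩
  · refine (value_gpull (hM.restrict U) hM (incl M U) b ⟨x, hxU⟩).symm.trans ?_
    refine (congrArg (fun a => value (hM.restrict U) a ⟨x, hxU⟩) (hb true)).trans ?_
    refine (value_gpull (hM.restrict U) C.isGradedManifold f b₀ ⟨x, hxU⟩).trans ?_
    refine (value_coords C b₀ _).trans ((series_ofBody _).trans ?_)
    refine Finset.prod_eq_one fun j _ => ?_
    change Real.smoothTransition (1 - (2 * (y₀ j - y₀ j) / ε j) ^ 2) = 1
    simp
  · have hzK : z ∈ V false := fun h => hz (hKG h).1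
    refine (value_gpull (hM.restrict (V false)) hM (incl M (V false)) b ⟨z, hzK⟩).symm.trans ?_
    refine (congrArg (fun a => value (hM.restrict (V false)) a ⟨z, hzK⟩) (hb false)).trans ?_
    exact value_zero _ _

theorem exists_bump_cover (hM : IsGradedManifold M) {A B : Set M} (hA : IsClosed A) (hB : IsClosed B)
    (hAB : Disjoint A B) : ∃ (b : ℕ → M.sec ⊤ 0) (σ : ℕ → Prop), (∀ x, ∃ n, 1 / 2 < value hM (b n) x) ∧
      (∀ n, σ n → ∀ x ∈ A, value hM (b n) x = 0) ∧ ∀ n, ¬ σ n → ∀ x ∈ B, value hM (b n) x = 0 := by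
  have h : ∀ x : M, ∃ (b : M.sec ⊤ 0) (σ : Prop), value hM b x = 1 ∧
      (σ → ∀ x ∈ A, value hM b x = 0) ∧ (¬ σ → ∀ x ∈ B, value hM b x = 0) := fun x => by
    by_cases hx : x ∈ A
    · obtain ⟨b, h1, h2⟩ := exists_bump hM x hB.isOpen_compl fun h => hAB.le_bot ⟨hx, h⟩
      exact ⟨b, False, h1, False.elim, fun _ z hz => h2 z fun h => h hz⟩
    · obtain ⟨b, h1, h2⟩ := exists_bump hM x hA.isOpen_compl hx
      exact ⟨b, True, h1, fun _ z hz => h2 z fun h => h hz, fun h => (h trivial).elim⟩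
  choose b σ h1 h2 h3 using h
  have := hM.2.1
  obtain ⟨s, hs, hs'⟩ := countable_cover_nhds (f := fun x => {z | 1 / 2 < value hM (b x) z}) fun x =>
    (isOpen_lt continuous_const (continuous_value hM (b x))).mem_nhds (by
      change 1 / 2 < value hM (b x) x
      rw [h1]
      norm_num)
  rcases s.eq_empty_or_nonempty with rfl | hne
  · have he : ∀ x : M, False := fun x => by
      have : x ∈ (Set.univ : Set M) := trivial
      rw [← hs'] at this
      simp at this
    exact ⟨fun _ => 0, fun _ => True, fun x => (he x).elim, fun _ _ x => (he x).elim,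
      fun _ _ x => (he x).elim⟩
  · obtain ⟨u, rfl⟩ := hs.exists_eq_range hne
    refine ⟨fun n => b (u n), fun n => σ (u n), fun x => ?_, fun n => h2 _, fun n => h3 _⟩
    have : x ∈ (Set.univ : Set M) := trivial
    rw [← hs'] at this
    simpa using this

end GradedSpace

/-- The sum of the weights `w` over the first `N` members of the partition of unity made from `u`. -/
def partialSelection (w u : ℕ → ℝ) (N : ℕ) : ℝ :=
  ∑ m ∈ Finset.range N, w m * (u m * ∏ k ∈ Finset.range m, (1 - u k))

theorem partialSelection_eq {w u : ℕ → ℝ} {n : ℕ} (hn : u n = 1) {N : ℕ} (hN : n + 1 ≤ N) :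
    partialSelection w u N = partialSelection w u (n + 1) := by
  induction N, hN using Nat.le_induction with
  | base => rfl
  | succ N hN ih =>
    rw [← ih, partialSelection, Finset.sum_range_succ,
      Finset.prod_eq_zero (i := n) (Finset.mem_range.2 hN) (by rw [hn, sub_self])]
    simp [partialSelection]

theorem partialSelection_eq_of {w u : ℕ → ℝ} {n m : ℕ} (hn : u n = 1) (hm : u m = 1) :
    partialSelection w u (n + 1) = partialSelection w u (m + 1) :=
  (partialSelection_eq hn (N := max n m + 1) (by omega)).symm.trans
    (partialSelection_eq hm (N := max n m + 1) (by omega))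

theorem partialSelection_eq_zero {w u : ℕ → ℝ} (h : ∀ n, w n = 0 ∨ u n = 0) (N : ℕ) :
    partialSelection w u N = 0 :=
  Finset.sum_eq_zero fun n _ => by rcases h n with h | h <;> simp [h]

theorem partialSelection_eq_one {w u : ℕ → ℝ} (h : ∀ n, w n = 1 ∨ u n = 0) {n : ℕ} (hn : u n = 1) :
    partialSelection w u (n + 1) = 1 := by
  have h1 : ∀ N, partialSelection w u N = 1 - ∏ k ∈ Finset.range N, (1 - u k) := fun N => by
    induction N with
    | zero => simp [partialSelection]
    | succ N ih =>
      rw [partialSelection, Finset.sum_range_succ, ← partialSelection, ih, Finset.prod_range_succ]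
      rcases h N with h | h
      · rw [h]; ring
      · rw [h]; ring
  rw [h1, Finset.prod_eq_zero (i := n) (by simp) (by rw [hn, sub_self]), sub_zero]

theorem partialSelection_congr {w u u' : ℕ → ℝ} {N : ℕ} (h : ∀ n < N, u n = u' n) :
    partialSelection w u N = partialSelection w u' N :=
  Finset.sum_congr rfl fun m hm => by
    rw [h m (Finset.mem_range.1 hm), Finset.prod_congr rfl fun k hk => by
      rw [h k ((Finset.mem_range.1 hk).trans (Finset.mem_range.1 hm))]]

theorem contDiff_partialSelection {F : Type*} [NormedAddCommGroup F] [NormedSpace ℝ F] (w : ℕ → ℝ)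
    {u : ℕ → F → ℝ} (hu : ∀ n, ContDiff ℝ ∞ (u n)) (N : ℕ) :
    ContDiff ℝ ∞ fun z => partialSelection w (fun n => u n z) N :=
  ContDiff.sum fun m _ => contDiff_const.mul ((hu m).mul
    (contDiff_prod fun k _ => contDiff_const.sub (hu k)))

theorem continuous_partialSelection {F : Type*} [TopologicalSpace F] (w : ℕ → ℝ)
    {u : ℕ → F → ℝ} (hu : ∀ n, Continuous (u n)) (N : ℕ) :
    Continuous fun z => partialSelection w (fun n => u n z) N :=
  continuous_finsetSum _ fun m _ => continuous_const.mul ((hu m).mul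
    (continuous_finsetProd _ fun k _ => continuous_const.sub (hu k)))

namespace GradedCoords

open GradedSpace

/-- The value of a coordinate. -/
def realCoord (y : realCoords.toGradedSpace) (n : ℕ) : ℝ := realCoords.toBody y ⟨n, rfl⟩

theorem continuous_realCoord (n : ℕ) : Continuous fun y => realCoord y n :=
  continuous_apply (A := fun _ : {i : realCoords.ι // realCoords.deg i = 0} => ℝ) _

/-- A smooth step. -/
noncomputable def step (t : ℝ) : ℝ := Real.smoothTransition (2 * t)

theorem contDiff_step : ContDiff ℝ ∞ step := Real.smoothTransition.contDiff.comp (by fun_prop)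

theorem step_zero : step 0 = 0 := Real.smoothTransition.zero_of_nonpos (by simp)

theorem step_eq_one {t : ℝ} (h : 1 / 2 < t) : step t = 1 :=
  Real.smoothTransition.one_of_one_le (by linarith)

/-- The points at which some coordinate is large. -/
def largeSet : Opens realCoords.toGradedSpace :=
  ⟨{y | ∃ n, 1 / 2 < realCoord y n}, by
    simp only [Set.ofPred_exists]
    exact isOpen_iUnion fun n => isOpen_lt continuous_const (continuous_realCoord n)⟩

open Classical in
/-- The selection of the weights `w`. -/
noncomputable def selection (w : ℕ → ℝ) (y : largeSet) : ℝ :=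
  partialSelection w (fun n => step (realCoord y.1 n)) (Nat.find y.2 + 1)

theorem selection_eq (w : ℕ → ℝ) (y : largeSet) {n : ℕ} (hn : 1 / 2 < realCoord y.1 n) :
    selection w y = partialSelection w (fun n => step (realCoord y.1 n)) (n + 1) := by
  classical
  exact partialSelection_eq_of (step_eq_one (Nat.find_spec y.2)) (step_eq_one hn)

theorem isSmooth_selection (w : ℕ → ℝ) {F : ℝ → ℝ} (hF : ContDiff ℝ ∞ F) :
    IsSmooth (C := realCoords) (U := largeSet) fun y => F (selection w y) := by
  classical
  intro x
  obtain ⟨n, hn⟩ := x.2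
  let c : ℕ → {i : realCoords.ι // realCoords.deg i = 0} := fun k => ⟨k, rfl⟩
  let J : Finset {i : realCoords.ι // realCoords.deg i = 0} := (Finset.range (n + 1)).image c
  let u : ℕ → (J → ℝ) → ℝ := fun k z => step (if h : c k ∈ J then z ⟨c k, h⟩ else 0)
  have hu : ∀ k, ContDiff ℝ ∞ (u k) := fun k => contDiff_step.comp (by
    split_ifs
    · exact contDiff_apply ℝ ℝ _
    · exact contDiff_const)
  refine ⟨J, {y | 1 / 2 < realCoord y.1 n},
    (isOpen_lt continuous_const ((continuous_realCoord n).comp continuous_subtype_val)).mem_nhds hn,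
    fun z => F (partialSelection w (fun k => u k z) (n + 1)),
    hF.comp (contDiff_partialSelection w hu _), fun y hy => ?_⟩
  refine congrArg F ((selection_eq w y hy).trans (partialSelection_congr fun k hk => ?_))
  have h : c k ∈ J := Finset.mem_image_of_mem c (Finset.mem_range.2 hk)
  change _ = step (if h : c k ∈ J then realCoords.toBody y.1 (c k) else 0)
  rw [dif_pos h]
  rfl

theorem isOpen_partialSelection (w : ℕ → ℝ) {s : Set ℝ} (hs : IsOpen s) :
    IsOpen {y : realCoords.toGradedSpace | ∃ n, 1 / 2 < realCoord y n ∧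
      partialSelection w (fun n => step (realCoord y n)) (n + 1) ∈ s} := by
  simp only [Set.ofPred_exists]
  exact isOpen_iUnion fun n => (isOpen_lt continuous_const (continuous_realCoord n)).inter
    (hs.preimage (continuous_partialSelection w
      (fun k => contDiff_step.continuous.comp (continuous_realCoord k)) _))

end GradedCoords

namespace GradedSpace

open GradedCoords

variable {M : GradedSpace}

/-- Disjoint closed sets are separated by a rotation of the plane. -/
theorem exists_rotation (hM : IsGradedManifold M) {A B : Set M} (hA : IsClosed A) (hB : IsClosed B)
    (hAB : Disjoint A B) : ∃ (W₁ W₂ : Opens M) (c s : M.sec ⊤ 0), A ⊆ W₁ ∧ B ⊆ W₂ ∧ W₁ ⊓ W₂ = ⊥ ∧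
      M.mul (zero_add 0) c c + M.mul (zero_add 0) s s = M.one ⊤ ∧
      M.res (le_top : W₁ ≤ ⊤) c = M.one W₁ ∧ M.res (le_top : W₁ ≤ ⊤) s = 0 ∧
      M.res (le_top : W₂ ≤ ⊤) c = 0 ∧ M.res (le_top : W₂ ≤ ⊤) s = M.one W₂ := by
  classical
  obtain ⟨b, σ, hb, hbA, hbB⟩ := exists_bump_cover hM hA hB hAB
  obtain ⟨f, hf, -⟩ := hM.hasCoordHoms realCoords b
  have hfb : ∀ x n, realCoord (f.base x) n = value hM (b n) x := fun x n =>
    (toBody_apply hM f n x).trans (congrArg (fun s => value hM s x) (hf n))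
  let w : ℕ → ℝ := fun n => if σ n then 1 else 0
  have hfΩ : ∀ x, f.base x ∈ largeSet := fun x => by
    obtain ⟨n, hn⟩ := hb x
    exact ⟨n, by rwa [hfb]⟩
  let α : ℝ → ℝ := fun r => Real.pi / 2 * Real.smoothTransition (3 * r - 1)
  have hα : ContDiff ℝ ∞ α := contDiff_const.mul (Real.smoothTransition.contDiff.comp (by fun_prop))
  let c₀ : realCoords.toGradedSpace.sec largeSet 0 :=
    ofBody (fun y => Real.cos (α (selection w y))) (isSmooth_selection w (Real.contDiff_cos.comp hα))
  let s₀ : realCoords.toGradedSpace.sec largeSet 0 :=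
    ofBody (fun y => Real.sin (α (selection w y))) (isSmooth_selection w (Real.contDiff_sin.comp hα))
  let Y : ∀ s : Set ℝ, IsOpen s → Opens realCoords.toGradedSpace := fun s hs =>
    ⟨_, isOpen_partialSelection w hs⟩
  have hY : ∀ s hs, Y s hs ≤ largeSet := fun s hs y ⟨n, hn, _⟩ => ⟨n, hn⟩
  have hYs : ∀ s hs y (hy : y ∈ Y s hs), selection w ⟨y, hY s hs hy⟩ ∈ s :=
    fun s hs y ⟨n, hn, h⟩ => by rwa [selection_eq w ⟨y, hY s hs ⟨n, hn, h⟩⟩ hn]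
  let Y₁ := Y (Set.Iio (1 / 3)) isOpen_Iio
  let Y₂ := Y (Set.Ioi (2 / 3)) isOpen_Ioi
  have hY₁ : Y₁ ≤ largeSet := hY _ isOpen_Iio
  have hY₂ : Y₂ ≤ largeSet := hY _ isOpen_Ioi
  have hα₁ : ∀ y (hy : y ∈ Y₁), α (selection w ⟨y, hY₁ hy⟩) = 0 := fun y hy => by
    have h : selection w ⟨y, hY₁ hy⟩ < 1 / 3 := hYs _ isOpen_Iio y hy
    change Real.pi / 2 * Real.smoothTransition _ = 0
    rw [Real.smoothTransition.zero_of_nonpos (by linarith), mul_zero]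
  have hα₂ : ∀ y (hy : y ∈ Y₂), α (selection w ⟨y, hY₂ hy⟩) = Real.pi / 2 := fun y hy => by
    have h : 2 / 3 < selection w ⟨y, hY₂ hy⟩ := hYs _ isOpen_Ioi y hy
    change Real.pi / 2 * Real.smoothTransition _ = _
    rw [Real.smoothTransition.one_of_one_le (by linarith), mul_one]
  have hres : ∀ (V : Opens realCoords.toGradedSpace) (hV : V ≤ largeSet)
      (a : realCoords.toGradedSpace.sec largeSet 0),
      M.res (le_top : Opens.comap f.base V ≤ ⊤) (pullOn f hfΩ a) =
        f.pull (le_refl (Opens.comap f.base V)) (realCoords.toGradedSpace.res hV a) := fun V hV a =>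
    (f.res_pull _ _ a).trans (f.pull_res _ hV a).symm
  refine ⟨Opens.comap f.base Y₁, Opens.comap f.base Y₂, pullOn f hfΩ c₀, pullOn f hfΩ s₀,
    fun x hx => ?_, fun x hx => ?_, ?_, ?_, ?_, ?_, ?_, ?_⟩
  · obtain ⟨n, hn⟩ := hfΩ x
    refine ⟨n, hn, ?_⟩
    rw [partialSelection_eq_zero, Set.mem_Iio]
    · norm_num
    · intro n
      by_cases h : σ n
      · right
        rw [hfb, hbA n h x hx, step_zero]
      · exact Or.inl (if_neg h)
  · obtain ⟨n, hn⟩ := hfΩ x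
    refine ⟨n, hn, ?_⟩
    rw [partialSelection_eq_one _ (step_eq_one hn), Set.mem_Ioi]
    · norm_num
    · intro n
      by_cases h : σ n
      · exact Or.inl (if_pos h)
      · right
        rw [hfb, hbB n h x hx, step_zero]
  · refine le_bot_iff.1 fun x hx => ?_
    have h1 : selection w _ < 1 / 3 := hYs _ isOpen_Iio _ hx.1
    have h2 : 2 / 3 < selection w _ := hYs _ isOpen_Ioi _ hx.2
    exact absurd (h2.trans h1) (by norm_num)
  · rw [← pullOn_mul, ← pullOn_mul, ← map_add]
    refine (congrArg (pullOn f hfΩ) (ofBody_mul_add fun y => ?_)).trans (f.pull_one _)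
    rw [← sq, ← sq, Real.cos_sq_add_sin_sq]
  · refine (hres Y₁ hY₁ c₀).trans ((congrArg _ (res_ofBody_one _ fun y hy => ?_)).trans
      (f.pull_one _))
    rw [hα₁ y hy, Real.cos_zero]
  · refine (hres Y₁ hY₁ s₀).trans ((congrArg _ (res_ofBody_zero _ fun y hy => ?_)).trans
      (map_zero _))
    rw [hα₁ y hy, Real.sin_zero]
  · refine (hres Y₂ hY₂ c₀).trans ((congrArg _ (res_ofBody_zero _ fun y hy => ?_)).trans
      (map_zero _))
    rw [hα₂ y hy, Real.cos_pi_div_two]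
  · refine (hres Y₂ hY₂ s₀).trans ((congrArg _ (res_ofBody_one _ fun y hy => ?_)).trans
      (f.pull_one _))
    rw [hα₂ y hy, Real.sin_pi_div_two]

end GradedSpace

namespace QSpace

open GradedSpace GradedCoords

variable {P E : QSpace} {p : P.toGradedSpace ⟶ E.toGradedSpace}

/-- Over `U` there are fibre coordinates with infinitely many coordinates in every degree. -/
def HasUniversalCoords (p : P.toGradedSpace ⟶ E.toGradedSpace) (U : Opens E.toGradedSpace) : Prop :=
  ∃ ζ : ∀ i, P.sec (Opens.comap p.base U) (universal.deg i), IsFreeOver p U universal ζ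

theorem IsFreeOver.hasUniversalCoords {U : Opens E.toGradedSpace} {D : GradedCoords}
    {ζ : ∀ i, P.sec (Opens.comap p.base U) (D.deg i)} (hp : IsFreeOver p U D ζ)
    (hD : ∀ d, Infinite {i // D.deg i = d}) : HasUniversalCoords p U := by
  obtain ⟨σ, hσ⟩ := exists_equiv infinite_universal hD
  exact ⟨_, hp.reindex σ hσ⟩

theorem HasUniversalCoords.mono {U U' : Opens E.toGradedSpace} (h : HasUniversalCoords p U)
    (hU : U' ≤ U) : HasUniversalCoords p U' := h.elim fun _ h => ⟨_, h.mono hU⟩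

theorem HasUniversalCoords.iSup {I : Type} {O : I → Opens E.toGradedSpace}
    (hO : ∀ a b, a ≠ b → ∀ x ∈ O a, x ∉ O b) (h : ∀ a, HasUniversalCoords p (O a)) :
    HasUniversalCoords p (⨆ a, O a) := by
  choose ζ hζ using h
  refine exists_isFreeOver_of_cover (fun a => le_iSup O a) (fun x hx => Opens.mem_iSup.1 hx) hζ
    fun a b i => ?_
  by_cases hab : a = b
  · subst hab
    rfl
  · exact sec_bot_ext (U := Opens.comap p.base (O a) ⊓ Opens.comap p.base (O b)) (fun x hx => hO a b hab _ hx.1 hx.2) _ _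

/-- The bundle does not change when countably many families of coordinates are added. -/
def IsAbsorbing (p : P.toGradedSpace ⟶ E.toGradedSpace) : Prop :=
  ∃ (P' : QSpace) (p' : P'.toGradedSpace ⟶ P.toGradedSpace)
    (y : ∀ i, P'.sec (Opens.comap p'.base ⊤) (universal.natCoords.deg i))
    (e : P'.toGradedSpace ≅ P.toGradedSpace), IsGradedManifold P'.toGradedSpace ∧ IsQMap p' ∧
    IsFreeOver p' ⊤ universal.natCoords y ∧ IsQMap (M := P') (N := P) e.hom ∧ e.hom ≫ p = p' ≫ p

theorem HasUniversalCoords.sup (hE : IsGradedManifold E.toGradedSpace) (hpQ : IsQMap p)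
    (hp : IsAbsorbing p) {O₁ O₂ : Opens E.toGradedSpace} (h₁ : HasUniversalCoords p O₁)
    (h₂ : HasUniversalCoords p O₂) : HasUniversalCoords p (O₁ ⊔ O₂) := by
  obtain ⟨ζ₁, hζ₁⟩ := h₁
  obtain ⟨ζ₂, hζ₂⟩ := h₂
  obtain ⟨P', p', y, e, hP', hpQ', hy, he, hep⟩ := hp
  let O : Opens E.toGradedSpace := O₁ ⊔ O₂
  obtain ⟨W₁, W₂, c, s, hW₁, hW₂, hW, hcs, hc₁, hs₁, hc₂, hs₂⟩ := exists_rotation (hE.restrict O)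
    (A := {x : O | x.1 ∉ O₂}) (B := {x : O | x.1 ∉ O₁})
    (O₂.isOpen.isClosed_compl.preimage continuous_subtype_val)
    (O₁.isOpen.isClosed_compl.preimage continuous_subtype_val)
    (Set.disjoint_left.2 fun x hx hx' => x.2.elim hx' hx)
  have hle : O₁ ⊓ O₂ ≤ openImage O ⊤ := fun x hx => ⟨⟨x, Or.inl hx.1⟩, trivial, rfl⟩
  have hres : ∀ {W : Opens O} {V : Opens E.toGradedSpace} (hV : V ≤ O₁ ⊓ O₂) (hVW : V ≤ openImage O W)
      (a : (E.toGradedSpace.restrict O).sec ⊤ 0),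
      E.res hV (E.res hle a) = E.res hVW ((E.toGradedSpace.restrict O).res (le_top : W ≤ ⊤) a) :=
    fun hV hVW a => (E.res_res _ _ _).trans (E.res_res (openImage_mono O le_top) hVW a).symm
  have hle₁ : (O₁ ⊓ O₂) ⊓ (openImage O W₁ ⊓ O₁) ≤ openImage O W₁ := fun x hx => hx.2.1
  have hle₂ : (O₁ ⊓ O₂) ⊓ (openImage O W₂ ⊓ O₂) ≤ openImage O W₂ := fun x hx => hx.2.1
  obtain ⟨η, hη⟩ := exists_isFreeOver_sup (W₁ := openImage O W₁ ⊓ O₁) (W₂ := openImage O W₂ ⊓ O₂)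
    (c := E.res hle c) (s := E.res hle s) hpQ hP' hpQ' hy inf_le_right inf_le_right
    (le_bot_iff.1 (by
      rintro _ ⟨⟨⟨x, hx, rfl⟩, -⟩, ⟨x', hx', h⟩, -⟩
      obtain rfl : x' = x := Subtype.ext h
      exact (hW.le ⟨hx, hx'⟩ : x' ∈ (⊥ : Opens O)).elim)) (fun x hx => by
      by_cases h1 : x ∈ O₁
      · by_cases h2 : x ∈ O₂
        · exact Or.inr (Or.inl ⟨h1, h2⟩)
        · exact Or.inl ⟨⟨⟨x, hx⟩, hW₁ h2, rfl⟩, h1⟩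
      · exact Or.inr (Or.inr ⟨⟨⟨x, hx⟩, hW₂ h1, rfl⟩, hx.resolve_left h1⟩)) hζ₁ hζ₂
    (by
      refine Eq.trans ?_ ((congrArg (E.res hle) hcs).trans (E.res_one _))
      exact (congrArg₂ (· + ·) (E.res_mul hle _ c c).symm (E.res_mul hle _ s s).symm).trans
        (map_add (E.res hle) _ _).symm)
    ((hres _ hle₁ c).trans ((congrArg _ hc₁).trans (E.res_one hle₁)))
    ((hres _ hle₁ s).trans ((congrArg _ hs₁).trans (map_zero _)))
    ((hres _ hle₂ c).trans ((congrArg _ hc₂).trans (map_zero _)))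
    ((hres _ hle₂ s).trans ((congrArg _ hs₂).trans (E.res_one hle₂)))
  obtain ⟨ζ, hζ⟩ := hη.of_iso e.symm he.inv (p' := p) (by
    rw [← hep]
    exact e.inv_hom_id_assoc p)
  exact hζ.hasUniversalCoords infinite_natCoords_universal

theorem HasUniversalCoords.top_of_seq (hE : IsGradedManifold E.toGradedSpace) (hpQ : IsQMap p)
    (hp : IsAbsorbing p) {U : ℕ → Opens E.toGradedSpace} (hU : ∀ x, ∃ n, x ∈ U n)
    (h : ∀ n, HasUniversalCoords p (U n)) : HasUniversalCoords p ⊤ := by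
  have hO : ∀ n, HasUniversalCoords p (partialSups U n) := fun n => by
    induction n with
    | zero => simpa using h 0
    | succ n ih =>
      rw [partialSups_add_one]
      exact HasUniversalCoords.sup hE hpQ hp ih (h (n + 1))
  have := hE.1
  have := hE.2.1
  let _ : MetricSpace E.toGradedSpace := metrizableSpaceMetric _
  obtain ⟨φ, hφ⟩ := exists_continuous_forall_mem_convex_of_local_const (X := E.toGradedSpace)
    (t := fun x => {r : ℝ | 0 ≤ r ∧ ∀ n : ℕ, x ∉ partialSups U n → (n : ℝ) ≤ r})
    (fun x => by
      intro a ha b hb s t hs ht hst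
      have hconv : ∀ c : ℝ, c ≤ a → c ≤ b → c ≤ s • a + t • b := fun c h1 h2 =>
        (convex_Ici c) h1 h2 hs ht hst
      exact ⟨hconv 0 ha.1 hb.1, fun n hn => hconv _ (ha.2 n hn) (hb.2 n hn)⟩)
    (fun x => by
      obtain ⟨m, hm⟩ := hU x
      refine ⟨m, Filter.mem_of_superset ((partialSups U m).isOpen.mem_nhds (le_partialSups U m hm))
        fun z hz => ⟨Nat.cast_nonneg m, fun n hn => ?_⟩⟩
      by_contra hmn
      rw [not_le, Nat.cast_lt] at hmn
      exact hn ((partialSups U).monotone hmn.le hz))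
  let S : ℕ → Opens E.toGradedSpace := fun n =>
    ⟨{x | (n : ℝ) - 1 < φ x ∧ φ x < n + 1}, (isOpen_lt continuous_const φ.continuous).inter
      (isOpen_lt φ.continuous continuous_const)⟩
  have hS : ∀ n, HasUniversalCoords p (S n) := fun n => (hO (n + 1)).mono fun x hx => by
    by_contra hn
    have h1 := (hφ x).2 _ hn
    have h2 : φ x < n + 1 := hx.2
    push_cast at h1
    linarith
  have hdisj : ∀ n m, n + 2 ≤ m → ∀ x ∈ S n, x ∉ S m := fun n m hnm x hx hx' => by
    have h1 : φ x < n + 1 := hx.2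
    have h2 : (m : ℝ) - 1 < φ x := hx'.1
    have h3 : (n : ℝ) + 2 ≤ m := by exact_mod_cast hnm
    linarith
  have hdisj' : ∀ n m, n + 2 ≤ m ∨ m + 2 ≤ n → ∀ x ∈ S n, x ∉ S m := fun n m h x hx hx' =>
    h.elim (fun h => hdisj n m h x hx hx') fun h => hdisj m n h x hx' hx
  have h0 := HasUniversalCoords.iSup (O := fun n => S (2 * n))
    (fun a b hab => hdisj' _ _ (by omega)) fun n => hS _
  have h1 := HasUniversalCoords.iSup (O := fun n => S (2 * n + 1))
    (fun a b hab => hdisj' _ _ (by omega)) fun n => hS _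
  refine (HasUniversalCoords.sup hE hpQ hp h0 h1).mono fun x _ => ?_
  have hx : x ∈ S ⌊φ x⌋₊ :=
    ⟨by have := Nat.floor_le (hφ x).1; change (⌊φ x⌋₊ : ℝ) - 1 < φ x; linarith, Nat.lt_floor_add_one _⟩
  obtain ⟨k, hk⟩ := Nat.even_or_odd' ⌊φ x⌋₊
  rcases hk with hk | hk
  · exact Or.inl (Opens.mem_iSup.2 ⟨k, by rwa [hk] at hx⟩)
  · exact Or.inr (Opens.mem_iSup.2 ⟨k, by rwa [hk] at hx⟩)

/-- An absorbing bundle with local universal fibre coordinates has global ones. -/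
theorem HasUniversalCoords.top (hE : IsGradedManifold E.toGradedSpace) (hpQ : IsQMap p)
    (hp : IsAbsorbing p) (h : ∀ x, ∃ U : Opens E.toGradedSpace, x ∈ U ∧ HasUniversalCoords p U) :
    HasUniversalCoords p ⊤ := by
  choose U hxU hU using h
  have := hE.2.1
  obtain ⟨s, hs, hs'⟩ := TopologicalSpace.countable_cover_nhds fun x => (U x).isOpen.mem_nhds (hxU x)
  have hs'' : ∀ x, ∃ z ∈ s, x ∈ U z := fun x => by
    have hx : x ∈ (Set.univ : Set E.toGradedSpace) := trivial
    rw [← hs'] at hx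
    simpa using hx
  rcases s.eq_empty_or_nonempty with rfl | hne
  · refine (HasUniversalCoords.iSup (p := p) (I := Empty) (O := Empty.elim) (fun a => a.elim)
      fun a => a.elim).mono fun x _ => ?_
    obtain ⟨z, hz, -⟩ := hs'' x
    exact hz.elim
  · obtain ⟨u, rfl⟩ := hs.exists_eq_range hne
    refine HasUniversalCoords.top_of_seq hE hpQ hp (fun x => ?_) fun n => hU (u n)
    obtain ⟨_, ⟨n, rfl⟩, hn⟩ := hs'' x
    exact ⟨n, hn⟩

end QSpace

theorem IsGradedProduct.assoc {A B T X F G : GradedSpace} {p₁ : A ⟶ B} {q₁ : A ⟶ T} {p₂ : B ⟶ X}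
    {q₂ : B ⟶ F} {g₁ : G ⟶ F} {g₂ : G ⟶ T} (h₁ : IsGradedProduct p₁ q₁) (h₂ : IsGradedProduct p₂ q₂)
    (hg : IsGradedProduct g₁ g₂) {r : A ⟶ G} (hr₁ : r ≫ g₁ = p₁ ≫ q₂) (hr₂ : r ≫ g₂ = q₁) :
    IsGradedProduct (p₁ ≫ p₂) r := fun N hN f k => by
  obtain ⟨b, ⟨hb₁, hb₂⟩, hb⟩ := h₂ N hN f (k ≫ g₁)
  obtain ⟨a, ⟨ha₁, ha₂⟩, ha⟩ := h₁ N hN b (k ≫ g₂)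
  refine ⟨a, ⟨by rw [← Category.assoc, ha₁, hb₁], (hg N hN (k ≫ g₁) (k ≫ g₂)).unique ⟨?_, ?_⟩
    ⟨rfl, rfl⟩⟩, fun a' ha' => ha a' ⟨hb _ ⟨?_, ?_⟩, ?_⟩⟩
  · rw [Category.assoc, hr₁, ← Category.assoc, ha₁, hb₂]
  · rw [Category.assoc, hr₂, ha₂]
  · rw [Category.assoc, ha'.1]
  · rw [Category.assoc, ← hr₁, ← Category.assoc, ha'.2]
  · rw [← hr₂, ← Category.assoc, ha'.2]

theorem IsGradedProduct.restrict {P E T : GradedSpace} {p : P ⟶ E} {q : P ⟶ T}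
    (h : IsGradedProduct p q) (V : Opens E) :
    IsGradedProduct (GradedSpace.restrictHom p V) (GradedSpace.incl P (Opens.comap p.base V) ≫ q) :=
  fun N hN f k => by
  obtain ⟨a, ⟨ha₁, ha₂⟩, ha⟩ := h N hN (f ≫ GradedSpace.incl E V) k
  have hm : ∀ x, a.base x ∈ Opens.comap p.base V := fun x =>
    (congrArg (· ∈ V) (congrArg (fun g : N ⟶ E => g.base x) ha₁)).mpr (f.base x).2
  refine ⟨GradedSpace.lift a _ hm, ⟨GradedSpace.incl_cancel ?_, ?_⟩, fun a' ha' =>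
    GradedSpace.incl_cancel ?_⟩
  · rw [Category.assoc, GradedSpace.restrictHom_incl, ← Category.assoc, GradedSpace.lift_incl, ha₁]
  · rw [← Category.assoc, GradedSpace.lift_incl, ha₂]
  · rw [GradedSpace.lift_incl]
    refine ha _ ⟨?_, ?_⟩
    · rw [Category.assoc, ← GradedSpace.restrictHom_incl, ← Category.assoc, ha'.1]
    · rw [Category.assoc, ha'.2]

theorem IsGradedBundle.comp_product {P E X T : GradedSpace} {p : P ⟶ E} {q : P ⟶ T} {π : E ⟶ X}
    (hπ : IsGradedBundle π) (hpq : IsGradedProduct p q) (hP : IsGradedManifold P)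
    (hT : ∀ F, IsGradedManifold F → ∃ (G : GradedSpace) (g₁ : G ⟶ F) (g₂ : G ⟶ T),
      IsGradedManifold G ∧ IsGradedProduct g₁ g₂) : IsGradedBundle (p ≫ π) := fun x => by
  obtain ⟨U, hxU, F, hF, q', hq'⟩ := hπ x
  obtain ⟨G, g₁, g₂, hG, hg⟩ := hT F hF
  let V := Opens.comap π.base U
  obtain ⟨r, ⟨hr₁, hr₂⟩, -⟩ := hg (P.restrict (Opens.comap p.base V)) (hP.restrict _)
    (GradedSpace.restrictHom p V ≫ q') (GradedSpace.incl P (Opens.comap p.base V) ≫ q)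
  refine ⟨U, hxU, G, hG, r, ?_⟩
  have e' : (GradedSpace.restrictHom p V ≫ GradedSpace.restrictHom π U) ≫ GradedSpace.incl X U =
      GradedSpace.incl P (Opens.comap p.base V) ≫ p ≫ π := by
    rw [Category.assoc, GradedSpace.restrictHom_incl, ← Category.assoc,
      GradedSpace.restrictHom_incl, Category.assoc]
  have e : GradedSpace.restrictHom (p ≫ π) U =
      GradedSpace.restrictHom p V ≫ GradedSpace.restrictHom π U :=
    GradedSpace.incl_cancel ((GradedSpace.restrictHom_incl (p ≫ π) U).trans e'.symm)
  rw [e]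
  exact (hpq.restrict V).assoc hq' hg hr₁ hr₂

namespace QSpace

open GradedSpace GradedCoords

variable {P E : QSpace} {p : P.toGradedSpace ⟶ E.toGradedSpace}

theorem isContractible_tangent (D : GradedCoords) : IsContractible (tangent D) :=
  ⟨D, Iso.refl _, (isQMap_tangent_iff (N := tangent D) D.shiftedTangent.isGradedManifold (𝟙 _)).1
    (isQMap_id _)⟩

/-- A map with global fibre coordinates is a product. -/
theorem HasUniversalCoords.exists_product (h : HasUniversalCoords p ⊤)
    (hP : IsGradedManifold P.toGradedSpace) (hE : IsGradedManifold E.toGradedSpace)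
    (hp : IsQMap p) : ∃ q : P.toGradedSpace ⟶ (tangent universal).toGradedSpace, IsQMap q ∧
      IsGradedProduct p q := by
  obtain ⟨ζ, hζ⟩ := h
  obtain ⟨P₀, p₀, q₀, hP₀, hpq, hp₀, hq₀⟩ := exists_product_tangent hE universal
  obtain ⟨e, he, hep⟩ := hζ.exists_iso hP hp (isFreeOver_of_product hp₀ hq₀ hpq) hP₀ hp₀
  refine ⟨e.hom ≫ q₀, IsQMap.comp he hq₀, fun N hN f g => ?_⟩
  obtain ⟨a, ⟨h1, h2⟩, h3⟩ := hpq N hN f g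
  refine ⟨a ≫ e.inv, ⟨?_, ?_⟩, fun b hb => ?_⟩
  · rw [← hep, Category.assoc, e.inv_hom_id_assoc, h1]
  · rw [Category.assoc, e.inv_hom_id_assoc, h2]
  · rw [← h3 (b ≫ e.hom) ⟨by rw [Category.assoc, hep, hb.1], by rw [Category.assoc, hb.2]⟩,
      Category.assoc, e.hom_inv_id, Category.comp_id]

theorem isLocallyTrivialQBundle_of_product {T : QSpace} {q : P.toGradedSpace ⟶ T.toGradedSpace}
    (hp : IsQMap p) (hq : IsQMap q) (hpq : IsGradedProduct p q) : IsLocallyTrivialQBundle p T :=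
  ⟨hp, fun _ => ⟨⊤, trivial, incl P.toGradedSpace (Opens.comap p.base ⊤) ≫ q,
    IsQMap.comp (L := P.restrict (Opens.comap p.base ⊤)) (isQMap_incl P _) hq, hpq.restrict ⊤⟩⟩

/-- After adding a universal contractible factor, a bundle with contractible fibre has global
universal fibre coordinates. -/
theorem hasUniversalCoords_of_contractible {B F : QSpace}
    {p : B.toGradedSpace ⟶ E.toGradedSpace} (hE : IsGradedManifold E.toGradedSpace)
    (hF : IsContractible F) (hp : IsLocallyTrivialQBundle p F)
    {b : P.toGradedSpace ⟶ B.toGradedSpace} (hP : IsGradedManifold P.toGradedSpace) (hb : IsQMap b)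
    (h : HasUniversalCoords b ⊤) : HasUniversalCoords (P := P) (E := E) (b ≫ p) ⊤ := by
  obtain ⟨ζ, hζ⟩ := h
  refine HasUniversalCoords.top hE (IsQMap.comp hb hp.1) ?_ fun x => ?_
  · obtain ⟨P', p', q', hP', hpq', hp', hq'⟩ := exists_product_tangent hP universal.natCoords
    have hy := isFreeOver_of_product hp' hq' hpq'
    obtain ⟨θ, hθ⟩ := (hζ.cons hb hy hp').hasUniversalCoords infinite_natCoords_universal
    obtain ⟨e, he, heb⟩ := hθ.exists_iso hP' (IsQMap.comp hp' hb) hζ hP hb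
    refine ⟨P', p', _, e, hP', hp', hy, he, ?_⟩
    rw [← Category.assoc, heb, Category.assoc]
  · obtain ⟨C, hC⟩ := exists_isFreeOver_of_contractible hF hp
    obtain ⟨U, hxU, η, hη⟩ := hC x
    obtain ⟨θ, hθ⟩ := hη.comp_sum hp.1 hζ hb
    exact ⟨U, hxU, hθ.hasUniversalCoords (infinite_sum_universal C)⟩

end QSpace

namespace GaugePrePDE

open QSpace GradedSpace GradedCoords

variable {n : ℕ} {X : Type} [TopologicalSpace X] [ChartedSpace (EuclideanSpace ℝ (Fin n)) X]
  [IsManifold (𝓡 n) ∞ X]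

/-- The two gauge pre-PDEs become isomorphic after adding universal contractible factors. -/
def StablyIsomorphic (E₁ E₂ : GaugePrePDE n X) : Prop :=
  ∃ (P : QSpace) (p₁ : P.toGradedSpace ⟶ E₁.total.toGradedSpace)
    (p₂ : P.toGradedSpace ⟶ E₂.total.toGradedSpace), IsGradedManifold P.toGradedSpace ∧ IsQMap p₁ ∧
    IsQMap p₂ ∧ HasUniversalCoords p₁ ⊤ ∧ HasUniversalCoords p₂ ⊤ ∧ p₁ ≫ E₁.proj = p₂ ≫ E₂.proj

theorem exists_stabilization (E : GaugePrePDE n X) : ∃ (P : QSpace)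
    (p : P.toGradedSpace ⟶ E.total.toGradedSpace), IsGradedManifold P.toGradedSpace ∧ IsQMap p ∧
      HasUniversalCoords p ⊤ := by
  obtain ⟨P, p, q, hP, hpq, hp, hq⟩ := exists_product_tangent E.isGradedManifold universal
  exact ⟨P, p, hP, hp, _, isFreeOver_of_product hp hq hpq⟩

theorem StablyIsomorphic.refl (E : GaugePrePDE n X) : StablyIsomorphic E E := by
  obtain ⟨P, p, hP, hp, h⟩ := exists_stabilization E
  exact ⟨P, p, p, hP, hp, hp, h, h, rfl⟩

theorem StablyIsomorphic.symm {E₁ E₂ : GaugePrePDE n X} (h : StablyIsomorphic E₁ E₂) :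
    StablyIsomorphic E₂ E₁ := by
  obtain ⟨P, p₁, p₂, hP, hp₁, hp₂, h₁, h₂, h⟩ := h
  exact ⟨P, p₂, p₁, hP, hp₂, hp₁, h₂, h₁, h.symm⟩

theorem StablyIsomorphic.trans {E₁ E₂ E₃ : GaugePrePDE n X} (h : StablyIsomorphic E₁ E₂)
    (h' : StablyIsomorphic E₂ E₃) : StablyIsomorphic E₁ E₃ := by
  obtain ⟨P, p₁, p₂, hP, hp₁, hp₂, h₁, ⟨ζ, hζ⟩, h⟩ := h
  obtain ⟨P', p₂', p₃, hP', hp₂', hp₃, ⟨ζ', hζ'⟩, ⟨θ, hθ⟩, h'⟩ := h'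
  obtain ⟨e, he, hep⟩ := hζ.exists_iso hP hp₂ hζ' hP' hp₂'
  refine ⟨P, p₁, e.hom ≫ p₃, hP, hp₁, IsQMap.comp he hp₃, h₁, hθ.of_iso e he rfl, ?_⟩
  rw [h, Category.assoc, ← h', ← Category.assoc, hep]

theorem stablyIsomorphic_of_isEquivalentReduction {E E' : GaugePrePDE n X}
    (h : IsEquivalentReduction E E') : StablyIsomorphic E E' := by
  obtain ⟨p, hp, ⟨F, hF, hpF⟩, -⟩ := h
  obtain ⟨P, b, hP, hb, hu⟩ := exists_stabilization E'
  refine ⟨P, b ≫ p, b, hP, IsQMap.comp hb hpF.1, hb,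
    hasUniversalCoords_of_contractible E.isGradedManifold hF hpF hP hb hu, hu, ?_⟩
  rw [Category.assoc, hp]

theorem Equivalent.stablyIsomorphic {E₁ E₂ : GaugePrePDE n X} (h : Equivalent E₁ E₂) :
    StablyIsomorphic E₁ E₂ := by
  induction h with
  | rel _ _ h => exact stablyIsomorphic_of_isEquivalentReduction h
  | refl E => exact StablyIsomorphic.refl E
  | symm _ _ _ h => exact h.symm
  | trans _ _ _ _ _ h h' => exact h.trans h'

theorem isEquivalentReduction_of_hasUniversalCoords {E E' : GaugePrePDE n X}
    {p : E'.total.toGradedSpace ⟶ E.total.toGradedSpace} (hp : IsQMap p)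
    (h : HasUniversalCoords p ⊤) (hπ : p ≫ E.proj = E'.proj) : IsEquivalentReduction E E' := by
  obtain ⟨q, hq, hpq⟩ := h.exists_product E'.isGradedManifold E.isGradedManifold hp
  obtain ⟨ζ, hζ⟩ := h
  obtain ⟨s, hs, hsp, -⟩ := hζ.exists_hom E.isGradedManifold (isQMap_id E.total) (fun _ => trivial)
    fun _ => 0
  exact ⟨p, hπ, ⟨tangent universal, isContractible_tangent _,
    isLocallyTrivialQBundle_of_product hp hq hpq⟩, s, hs, hsp⟩

theorem StablyIsomorphic.exists_common {E₁ E₂ : GaugePrePDE n X} (h : StablyIsomorphic E₁ E₂) :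
    ∃ E : GaugePrePDE n X, IsEquivalentReduction E₁ E ∧ IsEquivalentReduction E₂ E := by
  obtain ⟨P, p₁, p₂, hP, hp₁, hp₂, h₁, h₂, h⟩ := h
  obtain ⟨q, hq, hpq⟩ := h₁.exists_product hP E₁.isGradedManifold hp₁
  let E : GaugePrePDE n X :=
    { total := P
      isGradedManifold := hP
      proj := p₁ ≫ E₁.proj
      isQMap_proj := IsQMap.comp hp₁ E₁.isQMap_proj
      isGradedBundle_proj := E₁.isGradedBundle_proj.comp_product hpq hP fun F hF =>
        hF.exists_product universal.shiftedTangent }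
  exact ⟨E, isEquivalentReduction_of_hasUniversalCoords (E' := E) hp₁ h₁ rfl,
    isEquivalentReduction_of_hasUniversalCoords (E' := E) hp₂ h₂ h.symm⟩

end GaugePrePDE

theorem mainTheorem3 {n : ℕ} {X : Type} [TopologicalSpace X] [T2Space X]
    [SecondCountableTopology X] [ChartedSpace (EuclideanSpace ℝ (Fin n)) X]
    [IsManifold (𝓡 n) ∞ X] (E₁ E₂ : GaugePrePDE n X) :
    GaugePrePDE.Equivalent E₁ E₂ ↔
      ∃ E : GaugePrePDE n X, IsEquivalentReduction E₁ E ∧ IsEquivalentReduction E₂ E :=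
  ⟨fun h => h.stablyIsomorphic.exists_common, fun ⟨_, h₁, h₂⟩ =>
    .trans _ _ _ (.rel _ _ h₁) (.symm _ _ (.rel _ _ h₂))⟩
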